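/- Let $k$ be any field of characteristic $3$. **Symmetric composition superalgebras.** A symmetric composition superalgebra over $k$ is a superspace $S=S_{\bar0}\oplus S_{\bar1}$ with an even bilinear product and a nondegenerate even supersymmetric bilinear form $b$ such that $b(xy,z)=b(x,yz)$ and $$b(xy,zt)+(-1)^{|x||y|+|x||z|+|y||z|}b(zy,xt)=(-1)^{|y||z|}b(x,z)b(y,t)$$ for homogeneous $x,y,z,t$. Its triality Lie superalgebra is $\mathfrak{tri}(S)=\mathfrak{tri}(S)_{\bar0}\oplus\mathfrak{tri}(S)_{\bar1}$, where $\mathfrak{tri}(S)_{\bar\imath}$ consists of the triples $(d_0,d_1,d_2)$ of maps of parity $i$ in the orthosymplectic Lie superalgebra of $(S,b)$ with $d_0(xy)=d_1(x)y+(-1)^{i|x|}x\,d_2(y)$, with componentwise supercommutator. Put $\theta(d_0,d_1,d_2)=(d_2,d_0,d_1)$, $$\sigma_{x,y}(z)=(-1)^{|y||z|}b(x,z)y-(-1)^{|x|(|y|+|z|)}b(y,z)x,\quad l_x(y)=xy,\quad r_x(y)=(-1)^{|x||y|}yx,$$ $$t_{x,y}=\bigl(\sigma_{x,y},\ \tfrac12b(x,y)1-r_xl_y,\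 \tfrac12b(x,y)1-l_xr_y\bigr)\in\mathfrak{tri}(S).$$ For two symmetric composition superalgebras $S,S'$, let $$\mathfrak g(S,S')=\bigl(\mathfrak{tri}(S)\oplus\mathfrak{tri}(S')\bigr)\oplus\bigoplus_{i=0}^{2}\iota_i(S\otimes S'),$$ where $\iota_0,\iota_1,\iota_2$ are copies of $S\otimes S'$ with their natural parity, with the superanticommutative bracket such that $\mathfrak{tri}(S)\oplus\mathfrak{tri}(S')$ is a direct sum of ideals of a subsuperalgebra and (indices modulo $3$) * $[(d_0,d_1,d_2),\iota_i(x\otimes x')]=\iota_i(d_i(x)\otimes x')$ and $[(d_0',d_1',d_2'),\iota_i(x\otimes x')]=(-1)^{|d_i'||x|}\iota_i(x\otimes d_i'(x'))$, * $[\iota_i(x\otimes x'),\iota_{i+1}(y\otimes y')]=(-1)^{|x'||y|}\iota_{i+2}(xy\otimes x'y')$, * $[\iota_i(x\otimes x'),\iota_i(y\otimes y')]=(-1)^{|x||x'|+|x||y'|+|y||y'|}b'(x',y')\,\theta^i(t_{x,y})+(-1)^{|y||x'|}b(x,y)\,\theta'^i(t'_{x',y'})$. Let $S_4$ be the (purely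 even) space of $2\times2$ matrices over $k$ with product $x\bullet y=\bar x\bar y$, where $\bar x=b(x,1)1-x$ and $b$ is the polar form of the determinant. Let $S_{1,2}=k1\oplus V$ with $1$ even and $V$ odd of dimension $2$ with a nonzero alternating form $\langle\cdot|\cdot\rangle$, with $b(1,1)=2$, $b(u,v)=\langle u|v\rangle$, $b(1,u)=0$, and product $x\bullet y=\bar x\bar y$, where $\bar x=b(x,1)1-x$ and the product on the right has unit $1$ and satisfies $uv=\langle u|v\rangle1$ for $u,v\in V$. **Contragredient Lie superalgebras.** Let $A=(a_{ij})$ be an $n\times n$ matrix over $k$ and $\tau\subseteq\{1,\dots,n\}$. A realization of $A$ is a vector space $\mathfrak h$ with $\dim\mathfrak h=2n-\operatorname{rank}A$ and linearly independent families $\alpha_1,\dots,\alpha_n\in\mathfrak h^*$ and $h_1,\dots,h_n\in\mathfrak h$ with $\alpha_j(h_i)=a_{ij}$. Let $\tilde{\mathfrak g}(A,\tau)$ be the Lie superalgebra generated by $\mathfrak h$ and $e_1,\dots,e_n,f_1,\dots,f_n$ ($\mathfrak h$ even; $e_i,f_i$ odd if and only if $i\in\tau$) with the relations $[e_i,f_j]=\delta_{ij}h_i$,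 $[h,h']=0$, $[h,e_i]=\alpha_i(h)e_i$, $[h,f_i]=-\alpha_i(h)f_i$, $\mathbb Z$-graded by $\deg e_i=1$, $\deg f_i=-1$, $\deg\mathfrak h=0$. Then $\mathfrak g(A,\tau)$ is the quotient of $\tilde{\mathfrak g}(A,\tau)$ by its largest homogeneous ideal that intersects $\mathfrak h$ trivially. **The module $V(\omega_2)$.** Let $W$ be the natural $6$-dimensional module of $\mathfrak{sp}_6$, with invariant alternating form $\{\cdot|\cdot\}$ and symplectic basis $a_i,b_i$ ($i=1,2,3$), and let $\varphi:\bigwedge^2W\to k$, $z_1\wedge z_2\mapsto\{z_1|z_2\}$. Put $V(\omega_2)=\ker\varphi/k\bigl(\sum_{i=1}^3a_i\wedge b_i\bigr)$. **Proposition.** Let $$A_{S_4,S_{1,2}}=\begin{pmatrix}2&-1&0&0\\-1&2&-2&-1\\0&-1&2&0\\0&1&0&0\end{pmatrix}.$$ 1. $A_{S_4,S_{1,2}}$ has a realization, and for every realization $\mathfrak g(S_4,S_{1,2})$ is isomorphic to the contragredient Lie superalgebra $\mathfrak g(A_{S_4,S_{1,2}},\{4\})$. 2. $\mathfrak g(S_4,S_{1,2})$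 is a simple Lie superalgebra. 3. There are an isomorphism of Lie algebras $\mathfrak{sp}_6\oplus\mathfrak{sl}_2\cong\mathfrak g(S_4,S_{1,2})_{\bar0}$ and, through it, an isomorphism of modules $V(\omega_2)\otimes k^2\cong\mathfrak g(S_4,S_{1,2})_{\bar1}$, where $k^2$ is the natural module of $\mathfrak{sl}_2$. 4. $\mathfrak g(S_4,S_{1,2})_{\bar1}$ is an irreducible module for $\mathfrak g(S_4,S_{1,2})_{\bar0}$. 5. $V(\omega_2)$ is an irreducible $\mathfrak{sp}_6$-module of dimension $13$, with a highest weight vector of weight $\omega_2$. -/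

import Mathlib

universe u v w

namespace SuperMagic

noncomputable section

open TensorProduct

/-- The Koszul sign `(-1) ^ (i * j)` of two parities. -/
def koszul (k : Type u) [Ring k] (i j : ZMod 2) : k := if i = 1 ∧ j = 1 then -1 else 1

theorem koszul_zero_left (k : Type u) [Ring k] (j : ZMod 2) : koszul k 0 j = 1 := by
  simp [koszul]

theorem koszul_zero_right (k : Type u) [Ring k] (i : ZMod 2) : koszul k i 0 = 1 := by
  simp [koszul]

theorem koszul_one_one (k : Type u) [Ring k] : koszul k 1 1 = -1 := by
  simp [koszul]

theorem one_add_one_parity : (1 : ZMod 2) + 1 = 0 := rfl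

theorem parity_cases (i : ZMod 2) : i = 0 ∨ i = 1 := by revert i; decide

/-- A superspace `M = M₀ ⊕ M₁`, given by the two projections onto its even and odd part
(a complete pair of orthogonal idempotents). -/
class Superspace (k : Type u) [Field k] (M : Type v) [AddCommGroup M] [Module k M] where
  proj : ZMod 2 → M →ₗ[k] M
  proj_proj : ∀ i j x, proj i (proj j x) = if i = j then proj j x else 0
  proj_add : ∀ x, proj 0 x + proj 1 x = x

section Superspace

variable (k : Type u) [Field k] {M : Type v} [AddCommGroup M] [Module k M] [Superspace k M]
  {N : Type w} [AddCommGroup N] [Module k N] [Superspace k N]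
  {P : Type*} [AddCommGroup P] [Module k P]

abbrev pr (i : ZMod 2) : M →ₗ[k] M := Superspace.proj i

variable (M) in
/-- The homogeneous component of parity `i`. -/
def part (i : ZMod 2) : Submodule k M := LinearMap.range (pr k i : M →ₗ[k] M)

variable {k} in
theorem mem_part {i : ZMod 2} {x : M} : x ∈ part k M i ↔ pr k i x = x := by
  constructor
  · rintro ⟨y, rfl⟩; simp [pr, Superspace.proj_proj]
  · intro h; exact ⟨x, h⟩

theorem pr_mem (i : ZMod 2) (x : M) : pr k i x ∈ part k M i := ⟨x, rfl⟩

variable {k} in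
theorem pr_of_mem {i j : ZMod 2} {x : M} (h : x ∈ part k M j) :
    pr k i x = if i = j then x else 0 := by
  rw [← mem_part.1 h]; simp [pr, Superspace.proj_proj]

variable {k} in
/-- For a bilinear map `f`, the map `(y, x) ↦ (-1) ^ (|x| |y|) f x y`. -/
def sflip (f : M →ₗ[k] N →ₗ[k] P) : N →ₗ[k] M →ₗ[k] P :=
  ∑ j : ZMod 2, ∑ i : ZMod 2, koszul k i j • f.flip.compl₁₂ (pr k j) (pr k i)

variable {k} in
theorem sflip_apply (f : M →ₗ[k] N →ₗ[k] P) {i j : ZMod 2} {x : M} {y : N}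
    (hx : x ∈ part k M i) (hy : y ∈ part k N j) : sflip f y x = koszul k i j • f x y := by
  simp only [sflip, LinearMap.sum_apply, LinearMap.smul_apply, LinearMap.compl₁₂_apply,
    LinearMap.flip_apply, pr_of_mem hx, pr_of_mem hy]
  rw [Finset.sum_eq_single j, Finset.sum_eq_single i] <;> simp +contextual

instance superspacePi (ι : Type w) : Superspace k (ι → M) where
  proj i := LinearMap.pi fun m => pr k i ∘ₗ LinearMap.proj m
  proj_proj i j x := by ext m; by_cases h : i = j <;> simp [Superspace.proj_proj, h]
  proj_add x := by ext m; simp [Superspace.proj_add]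

instance superspaceProd : Superspace k (M × N) where
  proj i := (pr k i).prodMap (pr k i)
  proj_proj i j x := by ext <;> by_cases h : i = j <;> simp [Superspace.proj_proj, h]
  proj_add x := by ext <;> simp [Superspace.proj_add]

theorem sum_parity {V : Type*} [AddCommMonoid V] (f : ZMod 2 → V) : ∑ i, f i = f 0 + f 1 :=
  Fin.sum_univ_two f

/-- `(M ⊗ N)ᵢ` is the sum of the `Mⱼ ⊗ Nᵢ₋ⱼ`. -/
instance superspaceTensor : Superspace k (M ⊗[k] N) where
  proj i := ∑ j : ZMod 2, TensorProduct.map (pr k j) (pr k (i - j))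
  proj_proj i j x := by
    induction x with
    | zero => simp
    | add x y hx hy => simp only [map_add, hx, hy]; split_ifs <;> simp
    | tmul x y =>
      have h : (0 : ZMod 2) - 1 = 1 := rfl
      simp only [sum_parity, LinearMap.add_apply, map_add, TensorProduct.map_tmul,
        Superspace.proj_proj, pr]
      obtain rfl | rfl : i = 0 ∨ i = 1 := by revert i; decide
      all_goals obtain rfl | rfl : j = 0 ∨ j = 1 := by revert j; decide
      all_goals simp [h]
  proj_add x := by
    induction x with
    | zero => simp
    | add x y hx hy => rw [map_add, map_add, add_add_add_comm, hx, hy]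
    | tmul x y =>
      have h : (0 : ZMod 2) - 1 = 1 := rfl
      conv_rhs => rw [← Superspace.proj_add (k := k) x, ← Superspace.proj_add (k := k) y]
      simp only [sum_parity, LinearMap.add_apply, TensorProduct.map_tmul, add_tmul, tmul_add, pr,
        sub_self, sub_zero, h]
      abel

/-- `End(M)ᵢ` consists of the maps that send every `Mⱼ` to `Mᵢ₊ⱼ`. -/
instance superspaceEnd : Superspace k (Module.End k M) where
  proj i := ∑ j : ZMod 2, LinearMap.mulLeft k (pr k (i + j) : Module.End k M) ∘ₗ
    LinearMap.mulRight k (pr k j : Module.End k M)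
  proj_proj i j d := by
    ext x
    have h : (1 : ZMod 2) + 1 = 0 := rfl
    simp only [sum_parity, LinearMap.add_apply, map_add, LinearMap.comp_apply,
      LinearMap.mulLeft_apply, LinearMap.mulRight_apply, Module.End.mul_apply,
      Superspace.proj_proj, pr]
    obtain rfl | rfl : i = 0 ∨ i = 1 := by revert i; decide
    all_goals obtain rfl | rfl : j = 0 ∨ j = 1 := by revert j; decide
    all_goals simp [h]
  proj_add d := by
    ext x
    have h : (1 : ZMod 2) + 1 = 0 := rfl
    conv_rhs => rw [← Superspace.proj_add (k := k) (d x), ← Superspace.proj_add (k := k) x]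
    simp only [sum_parity, LinearMap.add_apply, map_add, LinearMap.comp_apply,
      LinearMap.mulLeft_apply, LinearMap.mulRight_apply, Module.End.mul_apply, h, pr, add_zero,
      zero_add]
    abel

variable {k} in
theorem mem_part_end {i : ZMod 2} {d : Module.End k M} :
    d ∈ part k (Module.End k M) i ↔ ∀ j, ∀ x ∈ part k M j, d x ∈ part k M (i + j) := by
  have key (x : M) : (pr k i d) x = pr k i (d (pr k 0 x)) + pr k (i + 1) (d (pr k 1 x)) := by
    simp [pr, Superspace.proj, sum_parity]
  constructor
  · intro hd j x hx
    rw [← mem_part.1 hd, key, pr_of_mem hx, pr_of_mem hx]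
    obtain rfl | rfl := parity_cases j
    · simpa using pr_mem k _ _
    · simpa using pr_mem k _ _
  · intro h
    rw [mem_part]
    ext x
    rw [key]
    conv_rhs => rw [← Superspace.proj_add (k := k) x, map_add]
    have h0 := mem_part.1 (h 0 _ (pr_mem k 0 x))
    have h1 := mem_part.1 (h 1 _ (pr_mem k 1 x))
    rw [add_zero] at h0
    rw [h0, h1]

end Superspace

/-! ### Lie superalgebras -/

/-- A bilinear product (written as a bracket) on a superspace. -/
class SuperBracket (k : Type u) [Field k] (L : Type v) [AddCommGroup L] [Module k L]
    [Superspace k L] where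
  bracket : L →ₗ[k] L →ₗ[k] L

section Lie

variable (k : Type u) [Field k] (L : Type v) [AddCommGroup L] [Module k L] [Superspace k L]
  [SuperBracket k L] (L' : Type w) [AddCommGroup L'] [Module k L'] [Superspace k L']
  [SuperBracket k L']

variable {L} in
abbrev sbr (x y : L) : L := SuperBracket.bracket (k := k) x y

/-- The Lie superalgebra axioms, in the form valid in every characteristic different from `2`
(the last one is only needed in characteristic `3`). -/
structure IsLieSuperalgebra : Prop where
  bracket_mem : ∀ i j, ∀ x ∈ part k L i, ∀ y ∈ part k L j, sbr k x y ∈ part k L (i + j)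
  skew : ∀ i j, ∀ x ∈ part k L i, ∀ y ∈ part k L j, sbr k x y = -(koszul k i j • sbr k y x)
  jacobi : ∀ i j, ∀ x ∈ part k L i, ∀ y ∈ part k L j, ∀ z : L,
    sbr k x (sbr k y z) = sbr k (sbr k x y) z + koszul k i j • sbr k y (sbr k x z)
  cube : ∀ x ∈ part k L 1, sbr k x (sbr k x x) = 0

variable {L} in
/-- Graded two-sided ideals. -/
structure IsGradedIdeal (I : Submodule k L) : Prop where
  proj_mem : ∀ i, ∀ x ∈ I, pr k i x ∈ I
  left_mem : ∀ x, ∀ y ∈ I, sbr k x y ∈ I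
  right_mem : ∀ x ∈ I, ∀ y, sbr k x y ∈ I

/-- A simple superalgebra: the product is not zero and the only graded ideals are the trivial
ones. -/
structure IsSimpleSuperalgebra : Prop where
  bracket_ne_zero : ∃ x y : L, sbr k x y ≠ 0
  eq_bot_or_eq_top : ∀ I : Submodule k L, IsGradedIdeal k I → I = ⊥ ∨ I = ⊤

/-- Isomorphisms of superalgebras: even linear bijections that preserve the product. -/
structure SuperEquiv extends L ≃ₗ[k] L' where
  map_proj : ∀ i x, toFun (pr k i x) = pr k i (toFun x)
  map_bracket : ∀ x y, toFun (sbr k x y) = sbr k (toFun x) (toFun y)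

end Lie

/-! ### Symmetric composition superalgebras and their triality Lie superalgebras -/

/-- A symmetric composition superalgebra over a field of characteristic different from `2`,
with product `mul` and norm `(q₀, b)`, where `b = form`. As `2` is invertible, `b` determines the
quadratic form, `q₀(x) = b(x, x) / 2`, and the composition laws `q₀(xy) = q₀(x) q₀(y)` and
`b(xy, xz) = q₀(x) b(y, z) = b(yx, zx)` with `x` even are special cases of `composition`. -/
class SymmetricCompositionSuperalgebra (k : Type u) [Field k] (S : Type v) [AddCommGroup S]
    [Module k S] [Superspace k S] where
  mul : S →ₗ[k] S →ₗ[k] S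
  form : S →ₗ[k] S →ₗ[k] k
  two_ne_zero : (2 : k) ≠ 0
  mul_mem : ∀ i j, ∀ x ∈ part k S i, ∀ y ∈ part k S j, mul x y ∈ part k S (i + j)
  form_even : ∀ i j, i ≠ j → ∀ x ∈ part k S i, ∀ y ∈ part k S j, form x y = 0
  form_symm : ∀ i j, ∀ x ∈ part k S i, ∀ y ∈ part k S j, form x y = koszul k i j * form y x
  nondegenerate : ∀ x, (∀ y, form x y = 0) → x = 0
  composition : ∀ i j l m, ∀ x ∈ part k S i, ∀ y ∈ part k S j, ∀ z ∈ part k S l,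
    ∀ t ∈ part k S m, form (mul x y) (mul z t) +
      koszul k i j * koszul k i l * koszul k j l * form (mul z y) (mul x t) =
        koszul k j l * (form x z * form y t)
  form_assoc : ∀ x y z, form (mul x y) z = form x (mul y z)

section Triality

variable (k : Type u) [Field k] (S : Type v) [AddCommGroup S] [Module k S] [Superspace k S]
  [SymmetricCompositionSuperalgebra k S]

variable {S} in
abbrev smul₂ (x y : S) : S := SymmetricCompositionSuperalgebra.mul (k := k) x y

variable {S} in
abbrev form (x y : S) : k := SymmetricCompositionSuperalgebra.form (k := k) x y

/-- The component of parity `i` of the orthosymplectic Lie superalgebra of `S`. -/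
def ospPart (i : ZMod 2) : Submodule k (Module.End k S) where
  carrier := {d | d ∈ part k (Module.End k S) i ∧
    ∀ j, ∀ x ∈ part k S j, ∀ y, form k (d x) y + koszul k i j * form k x (d y) = 0}
  zero_mem' := ⟨zero_mem _, by simp [form]⟩
  add_mem' := by
    rintro d e ⟨hd, hd'⟩ ⟨he, he'⟩
    refine ⟨add_mem hd he, fun j x hx y => ?_⟩
    have h1 := hd' j x hx y
    have h2 := he' j x hx y
    simp only [form, LinearMap.add_apply, map_add] at *
    linear_combination h1 + h2
  smul_mem' := by
    rintro c d ⟨hd, hd'⟩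
    refine ⟨Submodule.smul_mem _ c hd, fun j x hx y => ?_⟩
    have h1 := hd' j x hx y
    simp only [form, LinearMap.smul_apply, map_smul, smul_eq_mul] at *
    linear_combination c * h1

/-- The component of parity `i` of the triality Lie superalgebra of `S`. -/
def triPart (i : ZMod 2) : Submodule k (Fin 3 → Module.End k S) where
  carrier := {d | (∀ m, d m ∈ ospPart k S i) ∧ ∀ j, ∀ x ∈ part k S j, ∀ y,
    d 0 (smul₂ k x y) = smul₂ k (d 1 x) y + koszul k i j • smul₂ k x (d 2 y)}
  zero_mem' := ⟨fun _ => zero_mem _, by simp [smul₂]⟩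
  add_mem' := by
    rintro d e ⟨hd, hd'⟩ ⟨he, he'⟩
    refine ⟨fun m => add_mem (hd m) (he m), fun j x hx y => ?_⟩
    have h1 := hd' j x hx y
    have h2 := he' j x hx y
    simp only [smul₂, LinearMap.add_apply, map_add, Pi.add_apply, h1, h2] at *
    module
  smul_mem' := by
    rintro c d ⟨hd, hd'⟩
    refine ⟨fun m => Submodule.smul_mem _ c (hd m), fun j x hx y => ?_⟩
    have h1 := hd' j x hx y
    simp only [smul₂, LinearMap.smul_apply, map_smul, Pi.smul_apply, h1] at *
    module

/-- The triality Lie superalgebra of `S`. -/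
def tri : Submodule k (Fin 3 → Module.End k S) := triPart k S 0 ⊔ triPart k S 1

variable {S}

theorem triPart_le_tri (i : ZMod 2) : triPart k S i ≤ tri k S := by
  obtain rfl | rfl := parity_cases i
  exacts [le_sup_left, le_sup_right]

theorem triPart_le_part (i : ZMod 2) :
    triPart k S i ≤ part k (Fin 3 → Module.End k S) i := by
  intro d hd
  rw [mem_part]
  ext1 m
  exact mem_part.1 (hd.1 m).1

theorem pr_mem_triPart (i : ZMod 2) {d : Fin 3 → Module.End k S} (hd : d ∈ tri k S) :
    pr k i d ∈ triPart k S i := by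
  obtain ⟨d0, h0, d1, h1, rfl⟩ := Submodule.mem_sup.1 hd
  rw [map_add, pr_of_mem (triPart_le_part k 0 h0), pr_of_mem (triPart_le_part k 1 h1)]
  obtain rfl | rfl := parity_cases i <;> simpa

theorem pr_mem_tri (i : ZMod 2) {d : Fin 3 → Module.End k S} (hd : d ∈ tri k S) :
    pr k i d ∈ tri k S := triPart_le_tri k i (pr_mem_triPart k i hd)

instance superspaceTri : Superspace k (tri k S) where
  proj i := (pr k i).restrict fun _ hd => pr_mem_tri k i hd
  proj_proj i j d := by
    apply Subtype.ext
    by_cases h : i = j <;> simp [Superspace.proj_proj, h, pr]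
  proj_add d := Subtype.ext (Superspace.proj_add (k := k) (d : Fin 3 → Module.End k S))

/-- The super commutator `d e - (-1) ^ (|d| |e|) e d`. -/
def superComm : Module.End k S →ₗ[k] Module.End k S →ₗ[k] Module.End k S :=
  let mul : Module.End k S →ₗ[k] Module.End k S →ₗ[k] Module.End k S := LinearMap.mul k _
  mul - sflip mul

theorem superComm_apply {i j : ZMod 2} {d e : Module.End k S}
    (hd : d ∈ part k (Module.End k S) i) (he : e ∈ part k (Module.End k S) j) :
    superComm k d e = d * e - koszul k i j • (e * d) := by
  rw [superComm, LinearMap.sub_apply, LinearMap.sub_apply, sflip_apply _ he hd]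
  simp [koszul, and_comm]

theorem superComm_mem_triPart {i j : ZMod 2} {d e : Fin 3 → Module.End k S}
    (hd : d ∈ triPart k S i) (he : e ∈ triPart k S j) :
    (fun m => superComm k (d m) (e m)) ∈ triPart k S (i + j) := by
  have hdm (m) {l x} (hx : x ∈ part k S l) : d m x ∈ part k S (i + l) :=
    mem_part_end.1 (hd.1 m).1 l x hx
  have hem (m) {l x} (hx : x ∈ part k S l) : e m x ∈ part k S (j + l) :=
    mem_part_end.1 (he.1 m).1 l x hx
  have hc (m) : superComm k (d m) (e m) = d m * e m - koszul k i j • (e m * d m) :=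
    superComm_apply k (hd.1 m).1 (he.1 m).1
  simp only [hc]
  refine ⟨fun m => ⟨?_, fun l x hx y => ?_⟩, fun l x hx y => ?_⟩
  · rw [mem_part_end]
    intro l x hx
    refine sub_mem ?_ (Submodule.smul_mem _ _ ?_)
    · rw [add_assoc]; exact hdm m (hem m hx)
    · rw [add_comm i, add_assoc]; exact hem m (hdm m hx)
  · have h1 := (hd.1 m).2 _ _ (hem m hx) y
    have h2 := (he.1 m).2 _ _ hx (d m y)
    have h3 := (he.1 m).2 _ _ (hdm m hx) y
    have h4 := (hd.1 m).2 _ _ hx (e m y)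
    simp only [form, LinearMap.sub_apply, LinearMap.smul_apply, map_sub, map_smul,
      Module.End.mul_apply, smul_eq_mul] at *
    linear_combination (norm := skip) h1 - koszul k i (j + l) * h2 -
      koszul k i j * (h3 - koszul k j (i + l) * h4)
    obtain rfl | rfl := parity_cases i <;> obtain rfl | rfl := parity_cases j <;>
      obtain rfl | rfl := parity_cases l <;>
      simp only [koszul_zero_left, koszul_zero_right, koszul_one_one, one_add_one_parity,
        add_zero, zero_add] <;> ring
  · have h1 := he.2 _ _ hx y
    have h2 := hd.2 _ _ (hem 1 hx) y
    have h3 := hd.2 _ _ hx (e 2 y)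
    have h4 := hd.2 _ _ hx y
    have h5 := he.2 _ _ (hdm 1 hx) y
    have h6 := he.2 _ _ hx (d 2 y)
    simp only [smul₂, LinearMap.sub_apply, LinearMap.smul_apply, map_sub, map_smul, map_add,
      Module.End.mul_apply] at *
    rw [h1, h4]
    simp only [map_add, map_smul]
    rw [h2, h3, h5, h6]
    obtain rfl | rfl := parity_cases i <;> obtain rfl | rfl := parity_cases j <;>
      obtain rfl | rfl := parity_cases l <;>
      simp only [koszul_zero_left, koszul_zero_right, koszul_one_one, one_add_one_parity,
        add_zero, zero_add] <;> module

theorem superComm_mem_tri {d e : Fin 3 → Module.End k S} (hd : d ∈ tri k S) (he : e ∈ tri k S) :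
    (fun m => superComm k (d m) (e m)) ∈ tri k S := by
  obtain ⟨d0, h0, d1, h1, rfl⟩ := Submodule.mem_sup.1 hd
  obtain ⟨e0, g0, e1, g1, rfl⟩ := Submodule.mem_sup.1 he
  have : (fun m => superComm k ((d0 + d1) m) ((e0 + e1) m)) =
      (fun m => superComm k (d0 m) (e0 m)) + (fun m => superComm k (d0 m) (e1 m)) +
      ((fun m => superComm k (d1 m) (e0 m)) + (fun m => superComm k (d1 m) (e1 m))) := by
    ext1 m
    simp only [Pi.add_apply, map_add, LinearMap.add_apply]
    abel
  rw [this]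
  exact add_mem
    (add_mem (triPart_le_tri k _ (superComm_mem_triPart k h0 g0))
      (triPart_le_tri k _ (superComm_mem_triPart k h0 g1)))
    (add_mem (triPart_le_tri k _ (superComm_mem_triPart k h1 g0))
      (triPart_le_tri k _ (superComm_mem_triPart k h1 g1)))

/-- The componentwise super commutator. -/
instance superBracketTri : SuperBracket k (tri k S) where
  bracket := LinearMap.mk₂ k
    (fun d e => ⟨fun m => superComm k (d.1 m) (e.1 m), superComm_mem_tri k d.2 e.2⟩)
    (fun _ _ _ => Subtype.ext (funext fun _ => by simp))
    (fun _ _ _ => Subtype.ext (funext fun _ => by simp))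
    (fun _ _ _ => Subtype.ext (funext fun _ => by simp))
    (fun _ _ _ => Subtype.ext (funext fun _ => by simp))

/-! The automorphism `θ : (d₀, d₁, d₂) ↦ (d₂, d₀, d₁)`. -/

theorem form_ext {x y : S} (h : ∀ j, ∀ z ∈ part k S j, form k x z = form k y z) : x = y := by
  rw [← sub_eq_zero]
  refine SymmetricCompositionSuperalgebra.nondegenerate (k := k) _ fun z => ?_
  rw [← Superspace.proj_add (k := k) z]
  have h0 := h 0 _ (pr_mem k 0 z)
  have h1 := h 1 _ (pr_mem k 1 z)
  simp only [form, pr, map_add, map_sub, LinearMap.sub_apply] at *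
  rw [h0, h1]; simp

theorem part_ext {V : Type*} [AddCommGroup V] [Module k V] {f g : S →ₗ[k] V}
    (h : ∀ j, ∀ z ∈ part k S j, f z = g z) : f = g := by
  ext z
  rw [← Superspace.proj_add (k := k) z, map_add, map_add]
  exact congr_arg₂ _ (h 0 _ (pr_mem k 0 z)) (h 1 _ (pr_mem k 1 z))

theorem smul₂_mem {i j : ZMod 2} {x y : S} (hx : x ∈ part k S i) (hy : y ∈ part k S j) :
    smul₂ k x y ∈ part k S (i + j) :=
  SymmetricCompositionSuperalgebra.mul_mem i j x hx y hy

theorem form_assoc (x y z : S) : form k (smul₂ k x y) z = form k x (smul₂ k y z) :=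
  SymmetricCompositionSuperalgebra.form_assoc x y z

theorem form_symm {i j : ZMod 2} {x y : S} (hx : x ∈ part k S i) (hy : y ∈ part k S j) :
    form k x y = koszul k i j * form k y x :=
  SymmetricCompositionSuperalgebra.form_symm i j x hx y hy

theorem form_even {i j : ZMod 2} {x y : S} (hx : x ∈ part k S i) (hy : y ∈ part k S j)
    (h : i ≠ j) : form k x y = 0 :=
  SymmetricCompositionSuperalgebra.form_even i j h x hx y hy

theorem composition {i j l m : ZMod 2} {x y z t : S} (hx : x ∈ part k S i) (hy : y ∈ part k S j)
    (hz : z ∈ part k S l) (ht : t ∈ part k S m) :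
    form k (smul₂ k x y) (smul₂ k z t) +
      koszul k i j * koszul k i l * koszul k j l * form k (smul₂ k z y) (smul₂ k x t) =
        koszul k j l * (form k x z * form k y t) :=
  SymmetricCompositionSuperalgebra.composition i j l m x hx y hy z hz t ht

theorem rotate_mem_triPart {i : ZMod 2} {d : Fin 3 → Module.End k S} (hd : d ∈ triPart k S i) :
    (fun m => d (m + 1)) ∈ triPart k S i := by
  refine ⟨fun m => hd.1 _, fun l y hy z => ?_⟩
  have e1 : (0 : Fin 3) + 1 = 1 := rfl
  have e2 : (1 : Fin 3) + 1 = 2 := rfl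
  have e3 : (2 : Fin 3) + 1 = 0 := rfl
  simp only [e1, e2, e3]
  have hdm (m) {l x} (hx : x ∈ part k S l) : d m x ∈ part k S (i + l) :=
    mem_part_end.1 (hd.1 m).1 l x hx
  suffices H : ∀ m, ∀ z ∈ part k S m, d 1 (smul₂ k y z) =
      smul₂ k (d 2 y) z + koszul k i l • smul₂ k y (d 0 z) from by
    have := part_ext k (f := d 1 ∘ₗ SymmetricCompositionSuperalgebra.mul (k := k) y)
      (g := SymmetricCompositionSuperalgebra.mul (k := k) (d 2 y) +
        koszul k i l • SymmetricCompositionSuperalgebra.mul (k := k) y ∘ₗ d 0)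
      (fun m z hz => by simpa using H m z hz)
    simpa using LinearMap.congr_fun this z
  intro m z hz
  refine form_ext k fun n x hx => ?_
  have hyz := smul₂_mem k hy hz
  have h1 := (hd.1 0).2 _ _ (smul₂_mem k hx hy) z
  rw [hd.2 _ x hx y] at h1
  have h2 := (hd.1 1).2 _ _ hx (smul₂ k y z)
  have s1 := form_symm k (hdm 1 hyz) hx
  have s2 := form_symm k (smul₂_mem k (hdm 2 hy) hz) hx
  have s3 := form_symm k (smul₂_mem k hy (hdm 0 hz)) hx
  have a1 := form_assoc k (d 1 x) y z
  have a2 := form_assoc k x (d 2 y) z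
  have a3 := form_assoc k x y (d 0 z)
  simp only [form, smul₂, map_add, LinearMap.add_apply, map_smul, LinearMap.smul_apply,
    smul_eq_mul] at *
  rw [s1, s2, s3]
  rw [a1, a2, a3] at h1
  obtain rfl | rfl := parity_cases i <;> obtain rfl | rfl := parity_cases l <;>
    obtain rfl | rfl := parity_cases n <;> obtain rfl | rfl := parity_cases m <;>
    simp only [koszul_zero_left, koszul_zero_right, koszul_one_one, one_add_one_parity,
        add_zero, zero_add] at * <;>
    first
    | linear_combination h1 - h2
    | linear_combination h2 - h1

theorem theta_mem {d : Fin 3 → Module.End k S} (hd : d ∈ tri k S) :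
    (fun m => d (m - 1)) ∈ tri k S := by
  obtain ⟨d0, h0, d1, h1, rfl⟩ := Submodule.mem_sup.1 hd
  have e (m : Fin 3) : m - 1 = m + 1 + 1 := by revert m; decide
  have h0' := rotate_mem_triPart k (rotate_mem_triPart k h0)
  have h1' := rotate_mem_triPart k (rotate_mem_triPart k h1)
  simp only [e]
  exact add_mem (triPart_le_tri k _ h0') (triPart_le_tri k _ h1')

/-- The automorphism `θ : (d₀, d₁, d₂) ↦ (d₂, d₀, d₁)`. -/
def theta : Module.End k (tri k S) where
  toFun d := ⟨fun m => d.1 (m - 1), theta_mem k d.2⟩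
  map_add' _ _ := rfl
  map_smul' _ _ := rfl

/-- The operators
`σ x y : z ↦ (-1) ^ (|y| |z|) b(x, z) y - (-1) ^ (|x| (|y| + |z|)) b(y, z) x`. -/
def sigma : S →ₗ[k] S →ₗ[k] Module.End k S :=
  LinearMap.mk₂ k (fun x y =>
    ∑ j, ∑ l, koszul k j l •
      ((SymmetricCompositionSuperalgebra.form (k := k) x).smulRight (pr k j y) ∘ₗ pr k l) -
    ∑ i, ∑ j, ∑ l, koszul k i (j + l) •
      ((SymmetricCompositionSuperalgebra.form (k := k) (pr k j y)).smulRight (pr k i x) ∘ₗ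
        pr k l))
    (fun x x' y => by
      ext z
      simp only [sum_parity, map_add, LinearMap.add_apply, LinearMap.sub_apply,
        LinearMap.smul_apply, LinearMap.comp_apply, LinearMap.smulRight_apply]
      module)
    (fun c x y => by
      ext z
      simp only [sum_parity, map_smul, LinearMap.add_apply, LinearMap.sub_apply,
        LinearMap.smul_apply, LinearMap.comp_apply, LinearMap.smulRight_apply, smul_eq_mul]
      module)
    (fun x y y' => by
      ext z
      simp only [sum_parity, map_add, LinearMap.add_apply, LinearMap.sub_apply,
        LinearMap.smul_apply, LinearMap.comp_apply, LinearMap.smulRight_apply]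
      module)
    (fun c x y => by
      ext z
      simp only [sum_parity, map_smul, LinearMap.add_apply, LinearMap.sub_apply,
        LinearMap.smul_apply, LinearMap.comp_apply, LinearMap.smulRight_apply, smul_eq_mul]
      module)

theorem sigma_apply {i j l : ZMod 2} {x y z : S} (hx : x ∈ part k S i) (hy : y ∈ part k S j)
    (hz : z ∈ part k S l) : sigma k x y z =
      (koszul k j l * form k x z) • y - (koszul k i (j + l) * form k y z) • x := by
  simp only [sigma, LinearMap.mk₂_apply, sum_parity, LinearMap.sub_apply, LinearMap.add_apply,
    LinearMap.smul_apply, LinearMap.comp_apply, LinearMap.smulRight_apply, pr_of_mem hx,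
    pr_of_mem hy, pr_of_mem hz]
  obtain rfl | rfl := parity_cases i <;> obtain rfl | rfl := parity_cases j <;>
    obtain rfl | rfl := parity_cases l <;> simp [smul_smul]

/-- Left multiplications `l x : y ↦ x y`. -/
def lmul : S →ₗ[k] Module.End k S := SymmetricCompositionSuperalgebra.mul (k := k)

/-- Right multiplications `r x : y ↦ (-1) ^ (|x| |y|) y x`. -/
def rmul : S →ₗ[k] Module.End k S := sflip (SymmetricCompositionSuperalgebra.mul (k := k))

theorem rmul_apply {i j : ZMod 2} {x y : S} (hx : x ∈ part k S i) (hy : y ∈ part k S j) :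
    rmul k x y = koszul k j i • smul₂ k y x := sflip_apply _ hy hx

/-- The triple `t x y = (σ x y, b(x, y)/2 - r x ∘ l y, b(x, y)/2 - l x ∘ r y)`. -/
def tripleFun (x y : S) : Fin 3 → Module.End k S :=
  ![sigma k x y, ((2 : k)⁻¹ * form k x y) • 1 - rmul k x * lmul k y,
    ((2 : k)⁻¹ * form k x y) • 1 - lmul k x * rmul k y]

theorem form_even' {i j : ZMod 2} {x y : S} (hx : x ∈ part k S i) (hy : y ∈ part k S j) :
    i = j ∨ form k x y = 0 := or_iff_not_imp_left.2 (form_even k hx hy)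

theorem parity_add_add (i j : ZMod 2) : i + j + i = j := by revert i j; decide

theorem parity_add_add' (i j : ZMod 2) : i + j + j = i := by revert i j; decide

theorem comp_left {i j l : ZMod 2} {x y z : S} (hx : x ∈ part k S i) (hy : y ∈ part k S j)
    (hz : z ∈ part k S l) :
    smul₂ k (smul₂ k x y) z +
      (koszul k i j * koszul k i l * koszul k j l) • smul₂ k (smul₂ k z y) x =
        (koszul k j l * form k x z) • y := by
  refine form_ext k fun m t ht => ?_
  have h := composition k hx hy hz ht
  have a1 := form_assoc k (smul₂ k x y) z t
  have a2 := form_assoc k (smul₂ k z y) x t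
  simp only [form, map_add, map_smul, LinearMap.add_apply, LinearMap.smul_apply,
    smul_eq_mul] at *
  linear_combination h + a1 + koszul k i j * koszul k i l * koszul k j l * a2

theorem comp_right {i j l : ZMod 2} {x y z : S} (hx : x ∈ part k S i) (hy : y ∈ part k S j)
    (hz : z ∈ part k S l) :
    smul₂ k x (smul₂ k y z) +
      (koszul k i j * koszul k i l * koszul k j l) • smul₂ k z (smul₂ k y x) =
        (koszul k i j * form k x z) • y := by
  refine form_ext k fun m t ht => ?_
  have h := composition k ht hx hy hz
  have s1 := form_symm k (smul₂_mem k hx (smul₂_mem k hy hz)) ht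
  have s2 := form_symm k (smul₂_mem k hz (smul₂_mem k hy hx)) ht
  have s3 := form_symm k hy ht
  have s4 := form_symm k (smul₂_mem k ht hz) (smul₂_mem k hy hx)
  have a1 := form_assoc k t x (smul₂ k y z)
  have a2 := form_assoc k t z (smul₂ k y x)
  simp only [form, map_add, map_smul, LinearMap.add_apply, LinearMap.smul_apply,
    smul_eq_mul] at *
  rw [s1, s2, s3, ← a1, ← a2, s4]
  have v := form_even' k hx hz
  simp only [form] at v
  rcases v with rfl | v
  on_goal 2 => rw [v] at h ⊢
  all_goals
   obtain rfl | rfl := parity_cases i <;> obtain rfl | rfl := parity_cases j <;>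
    (try obtain rfl | rfl := parity_cases l) <;> obtain rfl | rfl := parity_cases m <;>
    simp only [koszul_zero_left, koszul_zero_right, koszul_one_one, one_add_one_parity,
      add_zero, zero_add] at h ⊢ <;>
    first
    | linear_combination h
    | linear_combination -h

theorem mem_part_of_form {i : ZMod 2} {d : Module.End k S}
    (h : ∀ j, ∀ x ∈ part k S j, d x ∈ part k S (i + j)) (h' : ∀ j l, ∀ x ∈ part k S j,
      ∀ y ∈ part k S l, form k (d x) y + koszul k i j * form k x (d y) = 0) :
    d ∈ ospPart k S i := by
  refine ⟨mem_part_end.2 h, fun j x hx y => ?_⟩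
  have h0 := h' j 0 x hx _ (pr_mem k 0 y)
  have h1 := h' j 1 x hx _ (pr_mem k 1 y)
  rw [← Superspace.proj_add (k := k) y]
  simp only [form, pr, map_add] at *
  linear_combination h0 + h1

theorem sigma_mem_ospPart {i j : ZMod 2} {x y : S} (hx : x ∈ part k S i) (hy : y ∈ part k S j) :
    sigma k x y ∈ ospPart k S (i + j) := by
  refine mem_part_of_form k (fun l z hz => ?_) (fun l m z hz w hw => ?_)
  · rw [sigma_apply k hx hy hz]
    by_cases h1 : i = l
    · subst h1
      rw [parity_add_add]
      by_cases h2 : j = i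
      · subst h2
        exact sub_mem (Submodule.smul_mem _ _ hy) (Submodule.smul_mem _ _ hx)
      · rw [form_even k hy hz h2]
        simpa using Submodule.smul_mem _ _ hy
    · rw [form_even k hx hz h1]
      by_cases h2 : j = l
      · subst h2
        rw [parity_add_add']
        simpa using Submodule.smul_mem _ _ hx
      · rw [form_even k hy hz h2]
        simp
  · have s1 := form_symm k hz hx
    have s2 := form_symm k hz hy
    rw [sigma_apply k hx hy hz, sigma_apply k hx hy hw]
    simp only [form, map_sub, map_smul, LinearMap.sub_apply, LinearMap.smul_apply,
      smul_eq_mul] at *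
    rw [s1, s2]
    have v1 := form_even' k hx hz
    have v2 := form_even' k hx hw
    have v3 := form_even' k hy hz
    have v4 := form_even' k hy hw
    simp only [form] at v1 v2 v3 v4
    obtain rfl | rfl := parity_cases i <;> obtain rfl | rfl := parity_cases j <;>
      obtain rfl | rfl := parity_cases l <;> obtain rfl | rfl := parity_cases m <;>
      simp only [zero_ne_one, one_ne_zero, false_or, true_or] at v1 v2 v3 v4 <;>
      simp only [koszul_zero_left, koszul_zero_right, koszul_one_one, one_add_one_parity,
        add_zero, zero_add, *] <;> ring

theorem half_mem {i j : ZMod 2} {x y z : S} (hx : x ∈ part k S i) (hy : y ∈ part k S j)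
    {l m : ZMod 2} (hz : z ∈ part k S l) (h : m = i + j + l) :
    ((2 : k)⁻¹ * form k x y) • z ∈ part k S m := by
  rcases form_even' k hx hy with rfl | v
  · have e : i + i + l = l := by rw [add_assoc, add_comm, add_assoc, add_comm, parity_add_add']
    rw [h, e]
    exact Submodule.smul_mem _ _ hz
  · simp [v]

theorem triple_one_mem_ospPart {i j : ZMod 2} {x y : S} (hx : x ∈ part k S i)
    (hy : y ∈ part k S j) :
    ((2 : k)⁻¹ * form k x y) • 1 - rmul k x * lmul k y ∈ ospPart k S (i + j) := by
  have hv {l z} (hz : z ∈ part k S l) :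
      (((2 : k)⁻¹ * form k x y) • 1 - rmul k x * lmul k y : Module.End k S) z =
      ((2 : k)⁻¹ * form k x y) • z - koszul k (j + l) i • smul₂ k (smul₂ k y z) x := by
    have := rmul_apply k hx (smul₂_mem k hy hz)
    simp only [LinearMap.sub_apply, LinearMap.smul_apply, Module.End.one_apply,
      Module.End.mul_apply, ← this]
    rfl
  refine mem_part_of_form k (fun l z hz => ?_) (fun l m z hz w hw => ?_)
  · rw [hv hz]
    refine sub_mem (half_mem k hx hy hz rfl) (Submodule.smul_mem _ _ ?_)
    have := smul₂_mem k (smul₂_mem k hy hz) hx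
    rwa [show j + l + i = i + j + l by ring] at this
  · rw [hv hz, hv hw]
    have h := composition k hy hz hx hw
    have a1 := form_assoc k (smul₂ k y z) x w
    have a2 := form_assoc k z (smul₂ k y w) x
    have s1 := form_symm k hz (smul₂_mem k (smul₂_mem k hy hw) hx)
    have a3 := form_assoc k (smul₂ k y w) x z
    have s2 := form_symm k (smul₂_mem k hy hw) (smul₂_mem k hx hz)
    have s3 := form_symm k hy hx
    have v1 := form_even' k hx hy
    have v2 := form_even' k hz hw
    have h2 := mul_inv_cancel₀ (SymmetricCompositionSuperalgebra.two_ne_zero (k := k) (S := S))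
    simp only [form, map_sub, map_smul, LinearMap.sub_apply, LinearMap.smul_apply,
      smul_eq_mul] at *
    rw [s1, a3, s2, a1]
    rw [s3] at h
    obtain rfl | rfl := parity_cases i <;> obtain rfl | rfl := parity_cases j <;>
      obtain rfl | rfl := parity_cases l <;> obtain rfl | rfl := parity_cases m <;>
      simp only [zero_ne_one, one_ne_zero, false_or, true_or] at v1 v2 <;>
      simp only [koszul_zero_left, koszul_zero_right, koszul_one_one, one_add_one_parity,
        add_zero, zero_add, mul_zero, zero_mul, *] at h ⊢ <;>
      first
      | linear_combination -h + SymmetricCompositionSuperalgebra.form x y *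
          SymmetricCompositionSuperalgebra.form z w * h2
      | linear_combination h + SymmetricCompositionSuperalgebra.form x y *
          SymmetricCompositionSuperalgebra.form z w * h2
      | linear_combination -h
      | linear_combination h

theorem triple_two_mem_ospPart {i j : ZMod 2} {x y : S} (hx : x ∈ part k S i)
    (hy : y ∈ part k S j) :
    ((2 : k)⁻¹ * form k x y) • 1 - lmul k x * rmul k y ∈ ospPart k S (i + j) := by
  have hv {l z} (hz : z ∈ part k S l) :
      (((2 : k)⁻¹ * form k x y) • 1 - lmul k x * rmul k y : Module.End k S) z =
      ((2 : k)⁻¹ * form k x y) • z - koszul k l j • smul₂ k x (smul₂ k z y) := by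
    have := rmul_apply k hy hz
    simp only [LinearMap.sub_apply, LinearMap.smul_apply, Module.End.one_apply,
      Module.End.mul_apply, this, map_smul]
    rfl
  refine mem_part_of_form k (fun l z hz => ?_) (fun l m z hz w hw => ?_)
  · rw [hv hz]
    refine sub_mem (half_mem k hx hy hz rfl) (Submodule.smul_mem _ _ ?_)
    have := smul₂_mem k hx (smul₂_mem k hz hy)
    rwa [show i + (l + j) = i + j + l by ring] at this
  · rw [hv hz, hv hw]
    have h := composition k hz hx hw hy
    have a1 := form_assoc k z x (smul₂ k w y)
    have s1 := form_symm k (smul₂_mem k hx (smul₂_mem k hz hy)) hw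
    have a3 := form_assoc k w x (smul₂ k z y)
    have v1 := form_even' k hx hy
    have v2 := form_even' k hz hw
    have h2 := mul_inv_cancel₀ (SymmetricCompositionSuperalgebra.two_ne_zero (k := k) (S := S))
    simp only [form, map_sub, map_smul, LinearMap.sub_apply, LinearMap.smul_apply,
      smul_eq_mul] at *
    rw [s1, ← a3, ← a1]
    obtain rfl | rfl := parity_cases i <;> obtain rfl | rfl := parity_cases j <;>
      obtain rfl | rfl := parity_cases l <;> obtain rfl | rfl := parity_cases m <;>
      simp only [zero_ne_one, one_ne_zero, false_or, true_or] at v1 v2 <;>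
      simp only [koszul_zero_left, koszul_zero_right, koszul_one_one, one_add_one_parity,
        add_zero, zero_add, mul_zero, zero_mul, *] at h ⊢ <;>
      first
      | linear_combination -h + SymmetricCompositionSuperalgebra.form x y *
          SymmetricCompositionSuperalgebra.form z w * h2
      | linear_combination h + SymmetricCompositionSuperalgebra.form x y *
          SymmetricCompositionSuperalgebra.form z w * h2
      | linear_combination -h
      | linear_combination h

theorem tripleFun_mem_triPart {i j : ZMod 2} {x y : S} (hx : x ∈ part k S i)
    (hy : y ∈ part k S j) : tripleFun k x y ∈ triPart k S (i + j) := by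
  refine ⟨fun m => ?_, fun l z hz w => ?_⟩
  · fin_cases m
    exacts [sigma_mem_ospPart k hx hy, triple_one_mem_ospPart k hx hy,
      triple_two_mem_ospPart k hx hy]
  have d0 : tripleFun k x y 0 = sigma k x y := rfl
  have d1 : tripleFun k x y 1 =
    ((2 : k)⁻¹ * form k x y) • 1 - rmul k x * lmul k y := rfl
  have d2 : tripleFun k x y 2 =
    ((2 : k)⁻¹ * form k x y) • 1 - lmul k x * rmul k y := rfl
  suffices H : ∀ m, ∀ w ∈ part k S m, tripleFun k x y 0 (smul₂ k z w) =
      smul₂ k (tripleFun k x y 1 z) w +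
        koszul k (i + j) l • smul₂ k z (tripleFun k x y 2 w) from by
    have := part_ext k
      (f := tripleFun k x y 0 ∘ₗ SymmetricCompositionSuperalgebra.mul (k := k) z)
      (g := SymmetricCompositionSuperalgebra.mul (k := k) (tripleFun k x y 1 z) +
        koszul k (i + j) l • SymmetricCompositionSuperalgebra.mul (k := k) z ∘ₗ
          tripleFun k x y 2)
      (fun m w hw => by simpa using H m w hw)
    simpa using LinearMap.congr_fun this w
  intro m w hw
  have r1 := rmul_apply k hx (smul₂_mem k hy hz)
  have r2 := rmul_apply k hy hw
  have e1 := comp_left k (smul₂_mem k hy hz) hx hw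
  have e2 := comp_right k (smul₂_mem k hw hx) hy hz
  have e3 := congr_arg (SymmetricCompositionSuperalgebra.mul (k := k) z) (comp_right k hy hw hx)
  have f1 := form_assoc k y z w
  have f2 := form_symm k (smul₂_mem k hw hx) hz
  have f3 := form_assoc k z w x
  have f4 := form_symm k (smul₂_mem k hz hw) hx
  have f5 := form_symm k hy hx
  have v1 := form_even' k hx hy
  have v2 := form_even' k hx (smul₂_mem k hz hw)
  have v3 := form_even' k hy (smul₂_mem k hz hw)
  have h2 := mul_inv_cancel₀ (SymmetricCompositionSuperalgebra.two_ne_zero (k := k) (S := S))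
  rw [d0, d1, d2, sigma_apply k hx hy (smul₂_mem k hz hw)]
  have g1 : smul₂ k ((((2 : k)⁻¹ * form k x y) • 1 - rmul k x * lmul k y : Module.End k S) z) w =
      ((2 : k)⁻¹ * form k x y) • smul₂ k z w -
        koszul k (j + l) i • smul₂ k (smul₂ k (smul₂ k y z) x) w := by
    have : rmul k x (lmul k y z) = koszul k (j + l) i • smul₂ k (smul₂ k y z) x := r1
    simp only [LinearMap.sub_apply, LinearMap.smul_apply, Module.End.one_apply,
      Module.End.mul_apply, this, map_sub, map_smul, smul₂]
  have g2 : smul₂ k z ((((2 : k)⁻¹ * form k x y) • 1 - lmul k x * rmul k y : Module.End k S) w) =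
      ((2 : k)⁻¹ * form k x y) • smul₂ k z w -
        koszul k m j • smul₂ k z (smul₂ k x (smul₂ k w y)) := by
    simp only [LinearMap.sub_apply, LinearMap.smul_apply, Module.End.one_apply,
      Module.End.mul_apply, r2, map_sub, map_smul, smul₂, lmul]
  rw [g1, g2]
  rw [f1] at e1
  rw [f2, ← f3, f4] at e2
  rw [f5] at e3
  simp only [map_add, map_smul] at e3
  have hh (a : k) : (2 : k) * ((2 : k)⁻¹ * a) = a := by rw [← mul_assoc, h2, one_mul]
  generalize form k x y = a at *
  generalize form k x (smul₂ k z w) = b at *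
  generalize form k y (smul₂ k z w) = c at *
  obtain ⟨a, rfl⟩ : ∃ a', a = 2 * a' := ⟨_, (hh a).symm⟩
  have hh' : (2 : k)⁻¹ * (2 * a) = a := by rw [← mul_assoc, mul_comm _ (2 : k), h2, one_mul]
  replace v1 : i = j ∨ a = 0 := v1.imp_right fun h => by rw [← hh', h, mul_zero]
  rw [hh']
  rw [← eq_sub_iff_add_eq] at e1
  rw [e1]
  have e2' := eq_sub_of_add_eq e2
  have e3' := eq_sub_of_add_eq e3
  simp only [smul₂] at *
  rw [e2', e3']
  obtain rfl | rfl := parity_cases i <;> obtain rfl | rfl := parity_cases j <;>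
    obtain rfl | rfl := parity_cases l <;> obtain rfl | rfl := parity_cases m <;>
    simp only [zero_ne_one, one_ne_zero, false_or, true_or, one_add_one_parity, zero_add,
      add_zero] at v1 v2 v3 <;>
    simp only [koszul_zero_left, koszul_zero_right, koszul_one_one, one_add_one_parity,
        add_zero, zero_add, mul_zero, v1, v2, v3] <;> module

theorem tripleFun_add_left (x x' y : S) :
    tripleFun k (x + x') y = tripleFun k x y + tripleFun k x' y := by
  ext1 m
  fin_cases m <;> simp [tripleFun, form] <;> simp only [mul_add, add_mul, add_smul] <;> abel

theorem tripleFun_add_right (x y y' : S) :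
    tripleFun k x (y + y') = tripleFun k x y + tripleFun k x y' := by
  ext1 m
  fin_cases m <;> simp [tripleFun, form] <;> simp only [mul_add, add_smul] <;> abel

theorem tripleFun_smul_left (c : k) (x y : S) :
    tripleFun k (c • x) y = c • tripleFun k x y := by
  ext1 m
  fin_cases m <;> simp [tripleFun, form, smul_sub, smul_smul, mul_left_comm]

theorem tripleFun_smul_right (c : k) (x y : S) :
    tripleFun k x (c • y) = c • tripleFun k x y := by
  ext1 m
  fin_cases m <;> simp [tripleFun, form, smul_sub, smul_smul, mul_left_comm]

theorem tripleFun_mem_tri (x y : S) : tripleFun k x y ∈ tri k S := by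
  have key (i j) : tripleFun k (pr k i x) (pr k j y) ∈ tri k S :=
    triPart_le_tri k _ (tripleFun_mem_triPart k (pr_mem k i x) (pr_mem k j y))
  rw [← Superspace.proj_add (k := k) x, ← Superspace.proj_add (k := k) y]
  simp only [tripleFun_add_left, tripleFun_add_right]
  exact add_mem (add_mem (key 0 0) (key 1 0)) (add_mem (key 0 1) (key 1 1))

/-- The elements `t x y` of the triality Lie superalgebra. -/
def triple : S →ₗ[k] S →ₗ[k] tri k S :=
  LinearMap.mk₂ k (fun x y => ⟨tripleFun k x y, tripleFun_mem_tri k x y⟩)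
    (fun x x' y => Subtype.ext (tripleFun_add_left k x x' y))
    (fun c x y => Subtype.ext (tripleFun_smul_left k c x y))
    (fun x y y' => Subtype.ext (tripleFun_add_right k x y y'))
    (fun c x y => Subtype.ext (tripleFun_smul_right k c x y))

end Triality

/-! ### The superalgebra `𝔤(S, S')` -/

section Magic

variable (k : Type u) [Field k]
  (S : Type v) [AddCommGroup S] [Module k S] [Superspace k S]
  [SymmetricCompositionSuperalgebra k S]
  (S' : Type w) [AddCommGroup S'] [Module k S'] [Superspace k S']
  [SymmetricCompositionSuperalgebra k S']

/-- The superspace `(tri(S) ⊕ tri(S')) ⊕ (ι₀(S ⊗ S') ⊕ ι₁(S ⊗ S') ⊕ ι₂(S ⊗ S'))`. -/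
def Magic : Type max v w := (tri k S × tri k S') × (Fin 3 → S ⊗[k] S')

instance : AddCommGroup (Magic k S S') :=
  inferInstanceAs (AddCommGroup ((tri k S × tri k S') × (Fin 3 → S ⊗[k] S')))

instance : Module k (Magic k S S') :=
  inferInstanceAs (Module k ((tri k S × tri k S') × (Fin 3 → S ⊗[k] S')))

instance : Superspace k (Magic k S S') :=
  inferInstanceAs (Superspace k ((tri k S × tri k S') × (Fin 3 → S ⊗[k] S')))

/-- The action `(d₀, d₁, d₂) · ιᵢ(x ⊗ x') = ιᵢ(dᵢ(x) ⊗ x')`. -/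
def actLeft : tri k S →ₗ[k] (Fin 3 → S ⊗[k] S') →ₗ[k] (Fin 3 → S ⊗[k] S') :=
  LinearMap.mk₂ k (fun d z i => TensorProduct.map (d.1 i) LinearMap.id (z i))
    (fun _ _ _ => by ext1 i; simp [TensorProduct.map_add_left])
    (fun _ _ _ => by ext1 i; simp [TensorProduct.map_smul_left])
    (fun _ _ _ => by ext1 i; simp)
    (fun _ _ _ => by ext1 i; simp)

/-- The action `(d'₀, d'₁, d'₂) · ιᵢ(x ⊗ x') = (-1) ^ (|d'ᵢ| |x|) ιᵢ(x ⊗ d'ᵢ(x'))`. -/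
def actRight : tri k S' →ₗ[k] (Fin 3 → S ⊗[k] S') →ₗ[k] (Fin 3 → S ⊗[k] S') :=
  LinearMap.mk₂ k (fun d z i => ∑ a : ZMod 2, ∑ b : ZMod 2,
      koszul k a b • TensorProduct.map (pr k b) (pr k a (d.1 i)) (z i))
    (fun _ _ _ => by
      ext1 i; simp [TensorProduct.map_add_right, Finset.sum_add_distrib, smul_add])
    (fun _ _ _ => by
      ext1 i
      simp only [sum_parity, SetLike.val_smul, Pi.smul_apply, map_smul,
        TensorProduct.map_smul_right, LinearMap.smul_apply]
      module)
    (fun _ _ _ => by ext1 i; simp [Finset.sum_add_distrib, smul_add])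
    (fun _ _ _ => by ext1 i; simp only [sum_parity, Pi.smul_apply, map_smul]; module)

/-- The product `(x ⊗ x') (y ⊗ y') = (-1) ^ (|x'| |y|) (x y) ⊗ (x' y')` on `S ⊗ S'`. -/
def tensorMul : S ⊗[k] S' →ₗ[k] S ⊗[k] S' →ₗ[k] S ⊗[k] S' :=
  ∑ a' : ZMod 2, ∑ b : ZMod 2, koszul k a' b • TensorProduct.map₂
    ((SymmetricCompositionSuperalgebra.mul (k := k) (S := S)).compl₁₂ LinearMap.id (pr k b))
    ((SymmetricCompositionSuperalgebra.mul (k := k) (S := S')).compl₁₂ (pr k a') LinearMap.id)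

/-- The map
`(x ⊗ x', y ⊗ y') ↦ (-1) ^ (|x| |x'| + |x| |y'| + |y| |y'|) b'(x', y') t_{x, y}`. -/
def tensorTriple : S ⊗[k] S' →ₗ[k] S ⊗[k] S' →ₗ[k] tri k S :=
  ∑ a : ZMod 2, ∑ b : ZMod 2, ∑ a' : ZMod 2, ∑ b' : ZMod 2,
    (koszul k a a' * koszul k a b' * koszul k b b') •
      (TensorProduct.map₂ ((triple k (S := S)).compl₁₂ (pr k a) (pr k b))
        ((SymmetricCompositionSuperalgebra.form (k := k) (S := S')).compl₁₂
          (pr k a') (pr k b'))).compr₂ (TensorProduct.rid k (tri k S)).toLinearMap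

/-- The map `(x ⊗ x', y ⊗ y') ↦ (-1) ^ (|y| |x'|) b(x, y) t'_{x', y'}`. -/
def tensorTriple' : S ⊗[k] S' →ₗ[k] S ⊗[k] S' →ₗ[k] tri k S' :=
  ∑ b : ZMod 2, ∑ a' : ZMod 2, koszul k b a' •
    (TensorProduct.map₂
      ((SymmetricCompositionSuperalgebra.form (k := k) (S := S)).compl₁₂ LinearMap.id (pr k b))
      ((triple k (S := S')).compl₁₂ (pr k a') LinearMap.id)).compr₂
        (TensorProduct.lid k (tri k S')).toLinearMap

/-- The product of `𝔤(S, S')`: `tri(S) ⊕ tri(S')` is a subsuperalgebra that acts on the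
`ιᵢ(S ⊗ S')` by `actLeft` and `actRight`, the product of `ιᵢ(z)` and `ιᵢ₊₁(w)` is
`ιᵢ₊₂(tensorMul z w)`, the product of `ιᵢ(z)` and `ιᵢ(w)` is
`θⁱ(tensorTriple z w) + θ'ⁱ(tensorTriple' z w)`, and the remaining products are determined by
super anticommutativity. Indices are taken modulo `3`. -/
def magicMul (X Y : (tri k S × tri k S') × (Fin 3 → S ⊗[k] S')) :
    (tri k S × tri k S') × (Fin 3 → S ⊗[k] S') :=
  ((sbr k X.1.1 Y.1.1 + ∑ i : Fin 3, (theta k ^ (i : ℕ)) (tensorTriple k S S' (X.2 i) (Y.2 i)),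
    sbr k X.1.2 Y.1.2 + ∑ i : Fin 3, (theta k ^ (i : ℕ)) (tensorTriple' k S S' (X.2 i) (Y.2 i))),
   actLeft k S S' X.1.1 Y.2 + actRight k S S' X.1.2 Y.2
    - sflip (actLeft k S S') X.2 Y.1.1 - sflip (actRight k S S') X.2 Y.1.2
    + fun i => tensorMul k S S' (X.2 (i + 1)) (Y.2 (i + 2))
      - sflip (tensorMul k S S') (X.2 (i + 2)) (Y.2 (i + 1)))

theorem magicMul_add_left (X X' Y : (tri k S × tri k S') × (Fin 3 → S ⊗[k] S')) :
    magicMul k S S' (X + X') Y = magicMul k S S' X Y + magicMul k S S' X' Y := by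
  refine Prod.ext (Prod.ext ?_ ?_) ?_
  · simp only [magicMul, sbr, Prod.fst_add, Prod.snd_add, Pi.add_apply, map_add,
      LinearMap.add_apply, Finset.sum_add_distrib]
    abel
  · simp only [magicMul, sbr, Prod.fst_add, Prod.snd_add, Pi.add_apply, map_add,
      LinearMap.add_apply, Finset.sum_add_distrib]
    abel
  · ext1 i
    simp only [magicMul, Prod.fst_add, Prod.snd_add, Pi.add_apply, Pi.sub_apply, map_add,
      LinearMap.add_apply]
    abel

theorem magicMul_add_right (X Y Y' : (tri k S × tri k S') × (Fin 3 → S ⊗[k] S')) :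
    magicMul k S S' X (Y + Y') = magicMul k S S' X Y + magicMul k S S' X Y' := by
  refine Prod.ext (Prod.ext ?_ ?_) ?_
  · simp only [magicMul, sbr, Prod.fst_add, Prod.snd_add, Pi.add_apply, map_add,
      Finset.sum_add_distrib]
    abel
  · simp only [magicMul, sbr, Prod.fst_add, Prod.snd_add, Pi.add_apply, map_add,
      Finset.sum_add_distrib]
    abel
  · ext1 i
    simp only [magicMul, Prod.fst_add, Prod.snd_add, Pi.add_apply, Pi.sub_apply, map_add]
    abel

theorem magicMul_smul_left (c : k) (X Y : (tri k S × tri k S') × (Fin 3 → S ⊗[k] S')) :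
    magicMul k S S' (c • X) Y = c • magicMul k S S' X Y := by
  refine Prod.ext (Prod.ext ?_ ?_) ?_
  · simp only [magicMul, sbr, Prod.smul_fst, Prod.smul_snd, Pi.smul_apply, map_smul,
      LinearMap.smul_apply, Finset.smul_sum, smul_add]
  · simp only [magicMul, sbr, Prod.smul_fst, Prod.smul_snd, Pi.smul_apply, map_smul,
      LinearMap.smul_apply, Finset.smul_sum, smul_add]
  · ext1 i
    simp only [magicMul, Prod.smul_fst, Prod.smul_snd, Pi.smul_apply, Pi.add_apply, Pi.sub_apply,
      map_smul, LinearMap.smul_apply]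
    module

theorem magicMul_smul_right (c : k) (X Y : (tri k S × tri k S') × (Fin 3 → S ⊗[k] S')) :
    magicMul k S S' X (c • Y) = c • magicMul k S S' X Y := by
  refine Prod.ext (Prod.ext ?_ ?_) ?_
  · simp only [magicMul, sbr, Prod.smul_fst, Prod.smul_snd, Pi.smul_apply, map_smul,
      Finset.smul_sum, smul_add]
  · simp only [magicMul, sbr, Prod.smul_fst, Prod.smul_snd, Pi.smul_apply, map_smul,
      Finset.smul_sum, smul_add]
  · ext1 i
    simp only [magicMul, Prod.smul_fst, Prod.smul_snd, Pi.smul_apply, Pi.add_apply, Pi.sub_apply,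
      map_smul]
    module

instance : SuperBracket k (Magic k S S') where
  bracket := LinearMap.mk₂ k (magicMul k S S') (magicMul_add_left k S S')
    (magicMul_smul_left k S S') (magicMul_add_right k S S') (magicMul_smul_right k S S')

end Magic

/-! ### The symmetric composition superalgebras `S₄` and `S₁₂` -/

section Para

variable {k : Type u} [Field k] {C : Type v} [AddCommGroup C] [Module k C]

/-- The conjugation `x ↦ b(x, 1) 1 - x` of a unital (super)algebra with a bilinear form. -/
def conj (form : C →ₗ[k] C →ₗ[k] k) (one : C) : C →ₗ[k] C :=
  (form.flip one).smulRight one - LinearMap.id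

/-- The para-Hurwitz product `x • y = x̄ ȳ`. -/
def paraMul (mul : C →ₗ[k] C →ₗ[k] C) (form : C →ₗ[k] C →ₗ[k] k) (one : C) :
    C →ₗ[k] C →ₗ[k] C :=
  mul.compl₁₂ (conj form one) (conj form one)

end Para

variable (k : Type u) [Field k]

/-- The superspace underlying `S₄`: the `2 × 2` matrices, all of them even. -/
abbrev S4 : Type u := Matrix (Fin 2) (Fin 2) k

instance : Superspace k (S4 k) where
  proj i := if i = 0 then LinearMap.id else 0
  proj_proj i j x := by
    obtain rfl | rfl := parity_cases i <;> obtain rfl | rfl := parity_cases j <;> simp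
  proj_add x := by simp

/-- The product of `2 × 2` matrices. -/
def matMul : S4 k →ₗ[k] S4 k →ₗ[k] S4 k :=
  LinearMap.mk₂ k (fun x y => x * y)
    add_mul smul_mul_assoc mul_add (fun c x y => mul_smul_comm c x y)

/-- The polar form of the determinant of `2 × 2` matrices. -/
def detForm : S4 k →ₗ[k] S4 k →ₗ[k] k :=
  LinearMap.mk₂ k
    (fun x y => Matrix.det (x + y) - Matrix.det x - Matrix.det y)
    (fun x x' y => by simp [Matrix.det_fin_two]; ring)
    (fun c x y => by simp [Matrix.det_fin_two]; ring)
    (fun x y y' => by simp [Matrix.det_fin_two]; ring)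
    (fun c x y => by simp [Matrix.det_fin_two]; ring)

theorem detForm_apply (x y : S4 k) :
    detForm k x y = x 0 0 * y 1 1 + y 0 0 * x 1 1 - x 0 1 * y 1 0 - y 0 1 * x 1 0 := by
  change Matrix.det (x + y) - Matrix.det x - Matrix.det y = _
  simp [Matrix.det_fin_two]; ring

theorem paraMul_S4 (x y : S4 k) :
    paraMul (matMul k) (detForm k) 1 x y =
      x.adjugate * y.adjugate := by
  have h (x : S4 k) :
      conj (detForm k) 1 x = x.adjugate := by
    have : conj (detForm k) 1 x =
      (detForm k x 1) • 1 - x := rfl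
    rw [this, detForm_apply]
    ext i j
    fin_cases i <;> fin_cases j <;> simp [Matrix.adjugate_fin_two]
  have : paraMul (matMul k) (detForm k) 1 x y =
    (conj (detForm k) 1 x : S4 k) *
      (conj (detForm k) 1 y : S4 k) := rfl
  rw [this, h, h]

theorem two_ne_zero_of_charP_three [CharP k 3] : (2 : k) ≠ 0 := by
  have h := CharP.cast_eq_zero_iff k 3 2
  simp only [Nat.cast_ofNat] at h
  rw [Ne, h]; decide

theorem three_eq_zero [CharP k 3] : (3 : k) = 0 := by
  exact_mod_cast CharP.cast_eq_zero k 3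

theorem S4_part_zero (x : S4 k) : x ∈ part k (S4 k) 0 := mem_part.2 rfl

theorem S4_part_one {x : S4 k} (hx : x ∈ part k (S4 k) 1) : x = 0 := (mem_part.1 hx).symm

/-- The split para-Hurwitz algebra `S₄` of dimension `4`. -/
instance [CharP k 3] : SymmetricCompositionSuperalgebra k (S4 k) where
  mul := paraMul (matMul k) (detForm k) 1
  form := detForm k
  two_ne_zero := two_ne_zero_of_charP_three k
  mul_mem i j x hx y hy := by
    obtain rfl | rfl := parity_cases i
    · obtain rfl | rfl := parity_cases j
      · exact S4_part_zero k _
      · rw [S4_part_one k hy, map_zero]; exact zero_mem _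
    · rw [S4_part_one k hx, map_zero]; exact zero_mem _
  form_even i j hij x hx y hy := by
    obtain rfl | rfl := parity_cases i
    · obtain rfl | rfl := parity_cases j
      · exact absurd rfl hij
      · rw [S4_part_one k hy, map_zero]
    · rw [S4_part_one k hx, map_zero]; rfl
  form_symm i j x hx y hy := by
    obtain rfl | rfl := parity_cases i
    · rw [koszul_zero_left, one_mul]
      simp only [detForm_apply, detForm_apply]
      ring
    · rw [S4_part_one k hx, map_zero, map_zero]; simp
  nondegenerate x h := by
    have h' (y : S4 k) := (detForm_apply k x y).symm.trans (h y)
    have h1 := h' !![1, 0; 0, 0]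
    have h2 := h' !![0, 1; 0, 0]
    have h3 := h' !![0, 0; 1, 0]
    have h4 := h' !![0, 0; 0, 1]
    simp at h1 h2 h3 h4
    change (x : S4 k) = 0
    ext i j
    fin_cases i <;> fin_cases j <;> assumption
  composition i j l m x hx y hy z hz t ht := by
    obtain rfl | rfl := parity_cases i
    on_goal 2 => rw [S4_part_one k hx]; simp
    obtain rfl | rfl := parity_cases j
    on_goal 2 => rw [S4_part_one k hy]; simp
    obtain rfl | rfl := parity_cases l
    on_goal 2 => rw [S4_part_one k hz]; simp
    simp only [koszul_zero_left, one_mul]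
    simp only [paraMul_S4, paraMul_S4, paraMul_S4, paraMul_S4, detForm_apply, detForm_apply,
      detForm_apply, detForm_apply]
    simp [Matrix.adjugate_fin_two, Matrix.mul_apply, Fin.sum_univ_two]
    ring
  form_assoc x y z := by
    simp only [paraMul_S4, paraMul_S4, detForm_apply, detForm_apply]
    simp [Matrix.adjugate_fin_two, Matrix.mul_apply, Fin.sum_univ_two]
    ring

/-- The superspace underlying `S₁₂` and `B(1, 2)`: `k 1 ⊕ V` with `V = k²` odd. -/
abbrev S12 : Type u := k × (Fin 2 → k)

/-- The alternating form of `V = k²`. -/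
def altForm : (Fin 2 → k) →ₗ[k] (Fin 2 → k) →ₗ[k] k :=
  LinearMap.mk₂ k (fun u v => u 0 * v 1 - u 1 * v 0)
    (fun _ _ _ => by simp; ring) (fun _ _ _ => by simp; ring)
    (fun _ _ _ => by simp; ring) (fun _ _ _ => by simp; ring)

instance : Superspace k (S12 k) where
  proj i := if i = 0 then LinearMap.inl k k (Fin 2 → k) ∘ₗ LinearMap.fst k k (Fin 2 → k)
    else LinearMap.inr k k (Fin 2 → k) ∘ₗ LinearMap.snd k k (Fin 2 → k)
  proj_proj i j x := by
    obtain rfl | rfl := parity_cases i <;> obtain rfl | rfl := parity_cases j <;>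
      refine Prod.ext ?_ ?_ <;> simp
  proj_add x := by
    refine Prod.ext ?_ ?_
    · exact add_zero x.1
    · exact zero_add x.2

/-- The product of `B(1, 2)`: `1` is a unit and `u v = ⟨u | v⟩ 1` for `u, v ∈ V`. -/
def b12Mul : S12 k →ₗ[k] S12 k →ₗ[k] S12 k :=
  LinearMap.mk₂ k (fun x y : k × (Fin 2 → k) =>
      ((x.1 * y.1 + altForm k x.2 y.2, x.1 • y.2 + y.1 • x.2) : S12 k))
    (fun _ _ _ => Prod.ext (by simp; ring) (by simp; module))
    (fun _ _ _ => Prod.ext (by simp; ring) (by simp; module))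
    (fun _ _ _ => Prod.ext (by simp; ring) (by simp; module))
    (fun _ _ _ => Prod.ext (by simp; ring) (by simp; module))

/-- The bilinear form of `B(1, 2)`: `b(1, 1) = 2`, as `q₀(1) = 1`, and `b(u, v) = ⟨u | v⟩` for
`u, v ∈ V`. -/
def b12Form : S12 k →ₗ[k] S12 k →ₗ[k] k :=
  LinearMap.mk₂ k (fun x y : k × (Fin 2 → k) => 2 * (x.1 * y.1) + altForm k x.2 y.2)
    (fun _ _ _ => by simp; ring) (fun _ _ _ => by simp; ring)
    (fun _ _ _ => by simp; ring) (fun _ _ _ => by simp; ring)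

theorem b12Form_apply (x y : S12 k) :
    b12Form k x y = 2 * (x.1 * y.1) + (x.2 0 * y.2 1 - x.2 1 * y.2 0) := rfl

theorem paraMul_S12 (x y : S12 k) :
    paraMul (b12Mul k) (b12Form k) (1, 0) x y =
      ((x.1 * y.1 + (x.2 0 * y.2 1 - x.2 1 * y.2 0), -(x.1 • y.2) - y.1 • x.2) :
        S12 k) := by
  have h (x : S12 k) :
      conj (b12Form k) (1, 0) x = ((x.1, - x.2) : S12 k) := by
    have : conj (b12Form k) (1, 0) x =
      (b12Form k x (1, 0)) • (1, 0) - x := rfl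
    rw [this, b12Form_apply]
    refine Prod.ext ?_ ?_ <;> simp
    ring
  have : paraMul (b12Mul k) (b12Form k) (1, 0) x y =
    b12Mul k (conj (b12Form k) (1, 0) x)
      (conj (b12Form k) (1, 0) y) := rfl
  rw [this, h, h]
  refine Prod.ext ?_ ?_
  · change x.1 * y.1 + ((-x.2) 0 * (-y.2) 1 - (-x.2) 1 * (-y.2) 0) = _
    simp
  · change x.1 • -y.2 + y.1 • -x.2 = _
    simp; abel

theorem S12_part_zero {x : k × (Fin 2 → k)} : x ∈ part k (S12 k) 0 ↔ x.2 = 0 := by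
  rw [mem_part]
  constructor
  · intro h; rw [← h]; rfl
  · intro h; exact Prod.ext rfl h.symm

theorem S12_part_one {x : k × (Fin 2 → k)} : x ∈ part k (S12 k) 1 ↔ x.1 = 0 := by
  rw [mem_part]
  constructor
  · intro h; rw [← h]; rfl
  · intro h; exact Prod.ext h.symm rfl

/-- The symmetric composition superalgebra `S₁₂`, the para-Hurwitz superalgebra of `B(1, 2)`. -/
instance [CharP k 3] : SymmetricCompositionSuperalgebra k (S12 k) where
  mul := paraMul (b12Mul k) (b12Form k) (1, 0)
  form := b12Form k
  two_ne_zero := two_ne_zero_of_charP_three k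
  mul_mem i j x hx y hy := by
    simp only [paraMul_S12]
    obtain rfl | rfl := parity_cases i <;> obtain rfl | rfl := parity_cases j <;>
      simp only [add_zero, zero_add, one_add_one_parity] <;>
      first
      | rw [S12_part_zero] at hx
      | rw [S12_part_one] at hx
    all_goals
      first
      | rw [S12_part_zero] at hy
      | rw [S12_part_one] at hy
    all_goals
      first
      | rw [S12_part_zero]
      | rw [S12_part_one]
    all_goals simp [hx, hy]
  form_even i j hij x hx y hy := by
    simp only [b12Form_apply]
    obtain rfl | rfl := parity_cases i <;> obtain rfl | rfl := parity_cases j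
    · exact absurd rfl hij
    · rw [S12_part_zero] at hx
      rw [S12_part_one] at hy
      simp [hx, hy]
    · rw [S12_part_one] at hx
      rw [S12_part_zero] at hy
      simp [hx, hy]
    · exact absurd rfl hij
  form_symm i j x hx y hy := by
    simp only [b12Form_apply, b12Form_apply]
    obtain rfl | rfl := parity_cases i <;> obtain rfl | rfl := parity_cases j <;>
      simp only [koszul_zero_left, koszul_zero_right, koszul_one_one] <;>
      first
      | rw [S12_part_zero] at hx
      | rw [S12_part_one] at hx
    all_goals
      first
      | rw [S12_part_zero] at hy
      | rw [S12_part_one] at hy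
    all_goals simp only [hx, hy, Pi.zero_apply]
    all_goals ring
  nondegenerate x h := by
    have h' (y : S12 k) := (b12Form_apply k x y).symm.trans (h y)
    have h1 := h' (1, 0)
    have h2 := h' (0, ![1, 0])
    have h3 := h' (0, ![0, 1])
    simp [two_ne_zero_of_charP_three k] at h1 h2 h3
    refine Prod.ext h1 (funext fun i => ?_)
    fin_cases i <;> assumption
  composition i j l m x hx y hy z hz t ht := by
    simp only [paraMul_S12, paraMul_S12, paraMul_S12, paraMul_S12, b12Form_apply, b12Form_apply,
      b12Form_apply, b12Form_apply]
    have part_iff (i : ZMod 2) (x : S12 k) : x ∈ part k (S12 k) i ↔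
        (i = 0 ∧ x.2 = 0) ∨ (i = 1 ∧ x.1 = 0) := by
      obtain rfl | rfl := parity_cases i
      · simp [S12_part_zero]
      · simp [S12_part_one]
    rw [part_iff] at hx hy hz ht
    obtain ⟨x0, x1⟩ := x
    obtain ⟨y0, y1⟩ := y
    obtain ⟨z0, z1⟩ := z
    obtain ⟨t0, t1⟩ := t
    dsimp only at hx hy hz ht
    obtain ⟨rfl, rfl⟩ | ⟨rfl, rfl⟩ := hx <;> obtain ⟨rfl, rfl⟩ | ⟨rfl, rfl⟩ := hy <;>
      obtain ⟨rfl, rfl⟩ | ⟨rfl, rfl⟩ := hz <;> obtain ⟨rfl, rfl⟩ | ⟨rfl, rfl⟩ := ht <;>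
      simp only [koszul_zero_left, koszul_zero_right, koszul_one_one, Pi.zero_apply,
        Pi.sub_apply, Pi.neg_apply, Pi.smul_apply, smul_eq_mul] <;>
      first
      | ring1
      | linear_combination (x0 * y0 * z1 0 * t1 1 - x0 * y0 * z1 1 * t1 0) * three_eq_zero k
      | linear_combination (x0 * t0 * y1 0 * z1 1 - x0 * t0 * y1 1 * z1 0) * three_eq_zero k
      | linear_combination (y0 * z0 * x1 0 * t1 1 - y0 * z0 * x1 1 * t1 0) * three_eq_zero k
      | linear_combination (z0 * t0 * x1 0 * y1 1 - z0 * t0 * x1 1 * y1 0) * three_eq_zero k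
      | linear_combination (-(x1 0 * y1 1 * z1 1 * t1 0) + x1 0 * y1 0 * t1 1 * z1 1 +
          y1 1 * x1 1 * z1 0 * t1 0 - x1 1 * y1 0 * z1 0 * t1 1) * three_eq_zero k
  form_assoc x y z := by
    simp only [paraMul_S12, paraMul_S12, b12Form_apply, b12Form_apply]
    simp
    linear_combination (x.1 * y.2 1 * z.2 0 - x.1 * y.2 0 * z.2 1 + x.2 0 * y.2 1 * z.1 -
      x.2 1 * y.2 0 * z.1) * three_eq_zero k

/-! ### Contragredient Lie superalgebras -/

section Contragredient

variable {k : Type u} [Field k] {n : ℕ}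

/-- A realization `(𝔥, Π, Π^∨)` of a square matrix `A`, that is: a vector space `𝔥` of dimension
`2 n - rank A`, linearly independent families of roots `αⱼ` in the dual of `𝔥` and of coroots `hᵢ`
in `𝔥`, such that `αⱼ(hᵢ) = aᵢⱼ`. -/
structure Realization (A : Matrix (Fin n) (Fin n) k) where
  𝔥 : Type u
  [addCommGroup : AddCommGroup 𝔥]
  [module : Module k 𝔥]
  [finite : Module.Finite k 𝔥]
  root : Fin n → Module.Dual k 𝔥
  coroot : Fin n → 𝔥
  linearIndependent_root : LinearIndependent k root
  linearIndependent_coroot : LinearIndependent k coroot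
  root_coroot : ∀ i j, root j (coroot i) = A i j
  finrank_add_rank : Module.finrank k 𝔥 + A.rank = 2 * n

attribute [instance] Realization.addCommGroup Realization.module Realization.finite

/-- The generators of the contragredient Lie superalgebra: the elements of `𝔥`, and
`e₁, …, eₙ, f₁, …, fₙ`. -/
inductive Gen (V : Type u) (n : ℕ) : Type u
  | h : V → Gen V n
  | e : Fin n → Gen V n
  | f : Fin n → Gen V n

/-- The parity of a nonassociative word in the generators: `𝔥` is even, and `eᵢ` and `fᵢ` are odd
if and only if `i ∈ τ`. -/
def wordParity {V : Type u} (τ : Finset (Fin n)) : FreeMagma (Gen V n) → ZMod 2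
  | .of (.h _) => 0
  | .of (.e i) => if i ∈ τ then 1 else 0
  | .of (.f i) => if i ∈ τ then 1 else 0
  | .mul x y => wordParity τ x + wordParity τ y

/-- The `ℤ`-degree of a word: `𝔥` has degree `0`, `eᵢ` has degree `1` and `fᵢ` degree `-1`. -/
def wordDegree {V : Type u} : FreeMagma (Gen V n) → ℤ
  | .of (.h _) => 0
  | .of (.e _) => 1
  | .of (.f _) => -1
  | .mul x y => wordDegree x + wordDegree y

variable (k) in
/-- The free nonassociative algebra on the generators. -/
abbrev FreeAlg (V : Type u) (n : ℕ) : Type u := FreeNonUnitalNonAssocAlgebra k (Gen V n)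

/-- The generator `h ∈ 𝔥`. -/
def genH {V : Type u} (h : V) : FreeAlg k V n := FreeNonUnitalNonAssocAlgebra.of k (Gen.h h)

variable (k) in
/-- The generator `eᵢ`. -/
def genE (V : Type u) (i : Fin n) : FreeAlg k V n := FreeNonUnitalNonAssocAlgebra.of k (Gen.e i)

variable (k) in
/-- The generator `fᵢ`. -/
def genF (V : Type u) (i : Fin n) : FreeAlg k V n := FreeNonUnitalNonAssocAlgebra.of k (Gen.f i)

variable (k) in
/-- The projection onto the span of the words that satisfy `p`. -/
def wordProj {V : Type u} (p : FreeMagma (Gen V n) → Prop) [DecidablePred p] :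
    FreeAlg k V n →ₗ[k] FreeAlg k V n where
  toFun x := .ofCoeff (x.coeff.filter p)
  map_add' x y := MonoidAlgebra.coeff_injective <| by
    rw [MonoidAlgebra.coeff_add, MonoidAlgebra.coeff_ofCoeff, MonoidAlgebra.coeff_add,
      Finsupp.filter_add]
  map_smul' c x := MonoidAlgebra.coeff_injective <| by
    rw [MonoidAlgebra.coeff_smul, MonoidAlgebra.coeff_ofCoeff, Finsupp.filter_smul]
    rfl

variable (k) in
theorem coeff_wordProj {V : Type u} (p : FreeMagma (Gen V n) → Prop) [DecidablePred p]
    (x : FreeAlg k V n) : (wordProj k p x).coeff = x.coeff.filter p := rfl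

variable (k) in
/-- The projection onto the component of parity `i`. -/
def parityProj (V : Type u) (τ : Finset (Fin n)) (i : ZMod 2) : FreeAlg k V n →ₗ[k] FreeAlg k V n :=
  wordProj k fun w => wordParity τ w = i

variable (k) in
/-- The projection onto the component of `ℤ`-degree `d`. -/
def degreeProj (V : Type u) (n : ℕ) (d : ℤ) : FreeAlg k V n →ₗ[k] FreeAlg k V n :=
  wordProj k fun w => wordDegree w = d

theorem parityProj_parityProj {V : Type u} (τ : Finset (Fin n)) (i j : ZMod 2)
    (x : FreeAlg k V n) :
    parityProj k V τ i (parityProj k V τ j x) = if i = j then parityProj k V τ j x else 0 := by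
  refine MonoidAlgebra.coeff_injective (Finsupp.ext fun w => ?_)
  rw [parityProj, parityProj, coeff_wordProj, Finsupp.filter_apply, coeff_wordProj]
  by_cases h1 : i = j
  · rw [if_pos h1, coeff_wordProj, Finsupp.filter_apply, h1]
    exact ite_eq_left_iff.2 fun h2 => (if_neg h2).symm
  · rw [if_neg h1, Finsupp.filter_apply]
    refine ite_eq_right_iff.2 fun h2 => if_neg fun h3 => h1 (h2.symm.trans h3)

theorem parityProj_add {V : Type u} (τ : Finset (Fin n)) (x : FreeAlg k V n) :
    parityProj k V τ 0 x + parityProj k V τ 1 x = x := by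
  refine MonoidAlgebra.coeff_injective (Finsupp.ext fun w => ?_)
  rw [MonoidAlgebra.coeff_add, Finsupp.add_apply, parityProj, parityProj, coeff_wordProj,
    coeff_wordProj, Finsupp.filter_apply, Finsupp.filter_apply]
  obtain h | h := parity_cases (wordParity τ w) <;> simp [h]

/-- Two-sided ideals of the free algebra that are homogeneous for the parity and for the
`ℤ`-grading. -/
structure IsHomogeneousIdeal {V : Type u} (τ : Finset (Fin n)) (I : Submodule k (FreeAlg k V n)) :
    Prop where
  left_mem : ∀ x, ∀ y ∈ I, x * y ∈ I
  right_mem : ∀ x ∈ I, ∀ y, x * y ∈ I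
  parity_mem : ∀ i, ∀ x ∈ I, parityProj k V τ i x ∈ I
  degree_mem : ∀ d, ∀ x ∈ I, degreeProj k V n d x ∈ I

variable {A : Matrix (Fin n) (Fin n) k} (R : Realization A) (τ : Finset (Fin n))

/-- The defining relations of the Lie superalgebra `𝔤̃(A, τ)`: linearity of `𝔥`, the relations
between the generators, and the identities of Lie superalgebras. -/
inductive IsRelation : FreeAlg k R.𝔥 n → Prop
  | h_add (h h' : R.𝔥) : IsRelation (genH (h + h') - (genH h + genH h'))
  | h_smul (c : k) (h : R.𝔥) : IsRelation (genH (c • h) - c • genH h)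
  | e_f (i j : Fin n) :
      IsRelation (genE k R.𝔥 i * genF k R.𝔥 j - if i = j then genH (R.coroot i) else 0)
  | h_h (h h' : R.𝔥) : IsRelation (genH h * genH h')
  | h_e (h : R.𝔥) (i : Fin n) :
      IsRelation (genH h * genE k R.𝔥 i - R.root i h • genE k R.𝔥 i)
  | h_f (h : R.𝔥) (i : Fin n) :
      IsRelation (genH h * genF k R.𝔥 i + R.root i h • genF k R.𝔥 i)
  | skew (i j : ZMod 2) (x y : FreeAlg k R.𝔥 n) (hx : parityProj k R.𝔥 τ i x = x)
      (hy : parityProj k R.𝔥 τ j y = y) : IsRelation (x * y + koszul k i j • (y * x))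
  | jacobi (i j : ZMod 2) (x y z : FreeAlg k R.𝔥 n) (hx : parityProj k R.𝔥 τ i x = x)
      (hy : parityProj k R.𝔥 τ j y = y) :
      IsRelation (x * (y * z) - ((x * y) * z + koszul k i j • (y * (x * z))))
  | cube (x : FreeAlg k R.𝔥 n) (hx : parityProj k R.𝔥 τ 1 x = x) : IsRelation (x * (x * x))

/-- The ideal of relations; `𝔤̃(A, τ)` is the quotient of the free algebra by this ideal. -/
def relationIdeal : Submodule k (FreeAlg k R.𝔥 n) :=
  sInf {I | IsHomogeneousIdeal τ I ∧ ∀ x, IsRelation R τ x → x ∈ I}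

/-- The preimage in the free algebra of the largest homogeneous ideal of `𝔤̃(A, τ)` that
intersects `𝔥` trivially. The homogeneous ideals of `𝔤̃(A, τ)` correspond to the homogeneous ideals
`K` that contain `relationIdeal`, and `𝔥` corresponds to the sum of `relationIdeal` and the span of
the generators `h ∈ 𝔥`. -/
def maximalIdeal : Submodule k (FreeAlg k R.𝔥 n) :=
  sSup {K | IsHomogeneousIdeal τ K ∧ relationIdeal R τ ≤ K ∧
    K ⊓ (Submodule.span k (Set.range genH) ⊔ relationIdeal R τ) ≤ relationIdeal R τ}

theorem sSup_stable {V : Type v} [AddCommGroup V] [Module k V] {s : Set (Submodule k V)}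
    (f : V →ₗ[k] V) (h : ∀ K ∈ s, ∀ x ∈ K, f x ∈ K) : ∀ x ∈ sSup s, f x ∈ sSup s := by
  have : sSup s ≤ (sSup s).comap f := sSup_le fun K hK x hx => le_sSup hK (h K hK x hx)
  exact this

theorem isHomogeneousIdeal_maximalIdeal : IsHomogeneousIdeal τ (maximalIdeal R τ) where
  left_mem x := sSup_stable (LinearMap.mulLeft k x) fun _ hK y hy => hK.1.left_mem x y hy
  right_mem x hx y := sSup_stable (LinearMap.mulRight k y)
    (fun _ hK x hx => hK.1.right_mem x hx y) x hx
  parity_mem i := sSup_stable _ fun _ hK => hK.1.parity_mem i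
  degree_mem d := sSup_stable _ fun _ hK => hK.1.degree_mem d

/-- The contragredient Lie superalgebra `𝔤(A, τ)`, over a field of characteristic different from
`2`: the quotient of `𝔤̃(A, τ)` by its largest homogeneous ideal that intersects `𝔥` trivially. -/
def Contragredient : Type u := FreeAlg k R.𝔥 n ⧸ maximalIdeal R τ

instance : AddCommGroup (Contragredient R τ) :=
  inferInstanceAs (AddCommGroup (FreeAlg k R.𝔥 n ⧸ maximalIdeal R τ))

instance : Module k (Contragredient R τ) :=
  inferInstanceAs (Module k (FreeAlg k R.𝔥 n ⧸ maximalIdeal R τ))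

/-- The quotient map. -/
def Contragredient.mk : FreeAlg k R.𝔥 n →ₗ[k] Contragredient R τ := (maximalIdeal R τ).mkQ

theorem Contragredient.mk_surjective : Function.Surjective (Contragredient.mk R τ) :=
  (maximalIdeal R τ).mkQ_surjective

theorem Contragredient.mk_eq_zero {x : FreeAlg k R.𝔥 n} :
    Contragredient.mk R τ x = 0 ↔ x ∈ maximalIdeal R τ :=
  Submodule.Quotient.mk_eq_zero _

instance : Superspace k (Contragredient R τ) where
  proj i := (maximalIdeal R τ).liftQ (Contragredient.mk R τ ∘ₗ parityProj k R.𝔥 τ i) fun x hx =>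
    (Contragredient.mk_eq_zero R τ).2 ((isHomogeneousIdeal_maximalIdeal R τ).parity_mem i x hx)
  proj_proj i j x := by
    obtain ⟨x, rfl⟩ := Contragredient.mk_surjective R τ x
    change Contragredient.mk R τ (parityProj k R.𝔥 τ i (parityProj k R.𝔥 τ j x)) =
      if i = j then Contragredient.mk R τ (parityProj k R.𝔥 τ j x) else 0
    rw [parityProj_parityProj]
    split_ifs <;> simp
  proj_add x := by
    obtain ⟨x, rfl⟩ := Contragredient.mk_surjective R τ x
    change Contragredient.mk R τ (parityProj k R.𝔥 τ 0 x) +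
      Contragredient.mk R τ (parityProj k R.𝔥 τ 1 x) = _
    rw [← map_add, parityProj_add]

instance : SuperBracket k (Contragredient R τ) where
  bracket := ((maximalIdeal R τ).liftQ
    ((maximalIdeal R τ).liftQ ((LinearMap.mul k (FreeAlg k R.𝔥 n)).compr₂ (Contragredient.mk R τ))
      fun x hx => LinearMap.ext fun y => (Contragredient.mk_eq_zero R τ).2
        ((isHomogeneousIdeal_maximalIdeal R τ).right_mem x hx y)).flip
    fun y hy => LinearMap.ext fun x => by
      obtain ⟨x, rfl⟩ := Contragredient.mk_surjective R τ x
      exact (Contragredient.mk_eq_zero R τ).2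
        ((isHomogeneousIdeal_maximalIdeal R τ).left_mem x y hy)).flip

theorem Contragredient.bracket_mk (x y : FreeAlg k R.𝔥 n) :
    sbr k (Contragredient.mk R τ x) (Contragredient.mk R τ y) = Contragredient.mk R τ (x * y) :=
  rfl

end Contragredient

/-- The matrix `A_{S₄, S₁₂}`. -/
def cartanS4S12 (k : Type u) [Field k] : Matrix (Fin 4) (Fin 4) k :=
  !![ 2, -1,  0,  0;
     -1,  2, -2, -1;
      0, -1,  2,  0;
      0,  1,  0,  0]

/-! ### The module `V(ω₂)` of `𝔰𝔭₆` -/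

section Exterior

attribute [local instance 100] LieRing.ofAssociativeRing

variable {k : Type u} [Field k] {W : Type v} [AddCommGroup W] [Module k W]
  {N : Type w} [AddCommGroup N] [Module k N]

variable (k) in
/-- The element `z₁ ∧ z₂` of the second exterior power of `W`. -/
def wedge (z₁ z₂ : W) : ⋀[k]^2 W := exteriorPower.ιMulti k 2 ![z₁, z₂]

/-- The alternating map given by an alternating bilinear map. -/
def altOfBilin (B : W →ₗ[k] W →ₗ[k] N) (h : ∀ z, B z z = 0) : W [⋀^Fin 2]→ₗ[k] N where
  toFun z := B (z 0) (z 1)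
  map_update_add' z i x y := by
    fin_cases i <;> simp
  map_update_smul' z i c x := by
    fin_cases i <;> simp
  map_eq_zero_of_eq' z i j hij hne := by
    have h0 : z 0 = z 1 := by
      fin_cases i <;> fin_cases j <;> simp_all
    rw [h0, h]

/-- The linear map `z₁ ∧ z₂ ↦ B(z₁, z₂)` given by an alternating bilinear map `B`. -/
def wedgeLift (B : W →ₗ[k] W →ₗ[k] N) (h : ∀ z, B z z = 0) : ⋀[k]^2 W →ₗ[k] N :=
  exteriorPower.alternatingMapLinearEquiv (altOfBilin B h)

theorem wedgeLift_wedge (B : W →ₗ[k] W →ₗ[k] N) (h : ∀ z, B z z = 0) (z₁ z₂ : W) :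
    wedgeLift B h (wedge k z₁ z₂) = B z₁ z₂ := by
  rw [wedgeLift, wedge, exteriorPower.alternatingMapLinearEquiv_apply_ιMulti]
  rfl

theorem wedge_ext {f g : ⋀[k]^2 W →ₗ[k] N}
    (h : ∀ z₁ z₂, f (wedge k z₁ z₂) = g (wedge k z₁ z₂)) : f = g := by
  refine exteriorPower.linearMap_ext (AlternatingMap.ext fun z => ?_)
  have hz : z = ![z 0, z 1] := by ext1 i; fin_cases i <;> rfl
  rw [hz]
  exact h _ _

theorem update_zero {W : Type v} (x y z : W) : Function.update ![x, y] 0 z = ![z, y] := by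
  ext1 i; fin_cases i <;> simp

theorem update_one {W : Type v} (x y z : W) : Function.update ![x, y] 1 z = ![x, z] := by
  ext1 i; fin_cases i <;> simp

theorem wedge_add_left (z z' y : W) : wedge k (z + z') y = wedge k z y + wedge k z' y := by
  have := (exteriorPower.ιMulti k 2 (M := W)).map_update_add ![z, y] 0 z z'
  rwa [update_zero, update_zero, update_zero] at this

theorem wedge_smul_left (c : k) (z y : W) : wedge k (c • z) y = c • wedge k z y := by
  have := (exteriorPower.ιMulti k 2 (M := W)).map_update_smul ![z, y] 0 c z
  rwa [update_zero, update_zero] at this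

theorem wedge_add_right (y z z' : W) : wedge k y (z + z') = wedge k y z + wedge k y z' := by
  have := (exteriorPower.ιMulti k 2 (M := W)).map_update_add ![y, z] 1 z z'
  rwa [update_one, update_one, update_one] at this

theorem wedge_smul_right (c : k) (y z : W) : wedge k y (c • z) = c • wedge k y z := by
  have := (exteriorPower.ιMulti k 2 (M := W)).map_update_smul ![y, z] 1 c z
  rwa [update_one, update_one] at this

theorem wedge_self (z : W) : wedge k z z = 0 :=
  (exteriorPower.ιMulti k 2 (M := W)).map_eq_zero_of_eq ![z, z] (i := 0) (j := 1) rfl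
    (by decide)

theorem wedge_swap (y z : W) : wedge k y z = -wedge k z y := by
  have h := wedge_self (k := k) (y + z)
  rw [wedge_add_left, wedge_add_right, wedge_add_right, wedge_self, wedge_self, zero_add,
    add_zero] at h
  exact eq_neg_of_add_eq_zero_left h

variable (k W) in
/-- The exterior product as a bilinear map. -/
def wedgeBilin : W →ₗ[k] W →ₗ[k] ⋀[k]^2 W :=
  LinearMap.mk₂ k (wedge k) wedge_add_left wedge_smul_left wedge_add_right wedge_smul_right

/-- The action `X · (z₁ ∧ z₂) = X z₁ ∧ z₂ + z₁ ∧ X z₂` of an endomorphism. -/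
def extAction (X : Module.End k W) : Module.End k (⋀[k]^2 W) :=
  wedgeLift ((wedgeBilin k W).compl₁₂ X LinearMap.id + (wedgeBilin k W).compl₁₂ LinearMap.id X)
    fun z => by
      change wedge k (X z) z + wedge k z (X z) = 0
      rw [wedge_swap, neg_add_cancel]

theorem extAction_wedge (X : Module.End k W) (z₁ z₂ : W) :
    extAction X (wedge k z₁ z₂) = wedge k (X z₁) z₂ + wedge k z₁ (X z₂) :=
  wedgeLift_wedge _ _ _ _

variable (k W) in
/-- The action of `𝔤𝔩(W)` on the second exterior power of `W`. -/
def extActionHom : Module.End k W →ₗ⁅k⁆ Module.End k (⋀[k]^2 W) where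
  toFun := extAction
  map_add' X Y := wedge_ext fun z₁ z₂ => by
    simp only [LinearMap.add_apply, extAction_wedge, wedge_add_left, wedge_add_right]
    abel
  map_smul' c X := wedge_ext fun z₁ z₂ => by
    simp only [LinearMap.smul_apply, extAction_wedge, wedge_smul_left, wedge_smul_right,
      RingHom.id_apply, smul_add]
  map_lie' {X Y} := wedge_ext fun z₁ z₂ => by
    have hs (a b c : W) : wedge k (a - b) c = wedge k a c - wedge k b c :=
      (wedgeBilin k W).map_sub₂ a b c
    have hs' (a b c : W) : wedge k c (a - b) = wedge k c a - wedge k c b :=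
      (wedgeBilin k W c).map_sub a b
    simp only [Ring.lie_def, LinearMap.sub_apply, Module.End.mul_apply, extAction_wedge, map_add,
      hs, hs']
    abel

end Exterior

section Omega

attribute [local instance 100] LieRing.ofAssociativeRing

open LieAlgebra.Symplectic

variable (k : Type u) [Field k]

/-- The natural module `W = k⁶` of `𝔰𝔭₆`, with symplectic basis `aᵢ`, `bᵢ`. -/
abbrev W6 : Type u := Fin 3 ⊕ Fin 3 → k

def basisA (i : Fin 3) : W6 k := Pi.single (Sum.inr i) 1

def basisB (i : Fin 3) : W6 k := Pi.single (Sum.inl i) 1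

open Matrix in
/-- The form `{z | w} = zᵗ J w`, for which `{aᵢ | bⱼ} = δᵢⱼ`. -/
def sympForm : W6 k →ₗ[k] W6 k →ₗ[k] k :=
  LinearMap.mk₂ k (fun z w => z ⬝ᵥ (Matrix.J (Fin 3) k *ᵥ w))
    (fun _ _ _ => add_dotProduct _ _ _) (fun _ _ _ => smul_dotProduct _ _ _)
    (fun _ _ _ => by rw [mulVec_add, dotProduct_add])
    (fun _ _ _ => by rw [mulVec_smul, dotProduct_smul])

theorem sympForm_apply (z w : W6 k) : sympForm k z w =
    ∑ i : Fin 3, (z (Sum.inr i) * w (Sum.inl i) - z (Sum.inl i) * w (Sum.inr i)) := by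
  simp [sympForm, Matrix.J, Matrix.fromBlocks_mulVec, dotProduct, Fintype.sum_sum_type,
    Fin.sum_univ_three, Matrix.neg_mulVec]
  ring

/-- The action of `𝔰𝔭₆` on the second exterior power of `W`. -/
def spAction : sp (Fin 3) k →ₗ⁅k⁆ Module.End k (⋀[k]^2 (W6 k)) :=
  (extActionHom k (W6 k)).comp
    ((lieEquivMatrix' (R := k) (n := Fin 3 ⊕ Fin 3)).symm.toLieHom.comp (sp (Fin 3) k).incl)

theorem spAction_wedge (X : sp (Fin 3) k) (z₁ z₂ : W6 k) : spAction k X (wedge k z₁ z₂) =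
    wedge k (X.1.mulVec z₁) z₂ + wedge k z₁ (X.1.mulVec z₂) :=
  extAction_wedge _ _ _

instance : LieRingModule (sp (Fin 3) k) (⋀[k]^2 (W6 k)) :=
  LieRingModule.compLieHom _ (spAction k)

instance : LieModule k (sp (Fin 3) k) (⋀[k]^2 (W6 k)) :=
  LieModule.compLieHom _ (spAction k)

/-- The linear map `φ : z₁ ∧ z₂ ↦ {z₁ | z₂}`. -/
def contraction : ⋀[k]^2 (W6 k) →ₗ[k] k :=
  wedgeLift (sympForm k) fun z => by
    rw [sympForm_apply]
    exact Finset.sum_eq_zero fun i _ => by ring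

theorem contraction_wedge (z w : W6 k) : contraction k (wedge k z w) = sympForm k z w :=
  wedgeLift_wedge _ _ _ _

open Matrix in
theorem contraction_spAction (X : sp (Fin 3) k) (m : ⋀[k]^2 (W6 k)) :
    contraction k (spAction k X m) = 0 := by
  suffices h : contraction k ∘ₗ spAction k X = 0 from LinearMap.congr_fun h m
  refine wedge_ext fun z w => ?_
  have hX : X.1ᵀ * Matrix.J (Fin 3) k = Matrix.J (Fin 3) k * -X.1 :=
    (mem_skewAdjointMatricesSubmodule _ _).1 X.2
  have h1 (z w : W6 k) : sympForm k z w = z ⬝ᵥ (Matrix.J (Fin 3) k *ᵥ w) := rfl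
  rw [LinearMap.comp_apply, spAction_wedge, map_add, contraction_wedge, contraction_wedge, h1, h1,
    ← vecMul_transpose, ← dotProduct_mulVec, mulVec_mulVec, mulVec_mulVec, hX, mul_neg, neg_mulVec,
    dotProduct_neg, neg_add_cancel]
  rfl

/-- The submodule `ker φ`. -/
def kerContraction : LieSubmodule k (sp (Fin 3) k) (⋀[k]^2 (W6 k)) where
  __ := LinearMap.ker (contraction k)
  lie_mem {X m} _ := contraction_spAction k X m

/-- The element `∑ aᵢ ∧ bᵢ`. -/
def omegaElt : ⋀[k]^2 (W6 k) := ∑ i, wedge k (basisA k i) (basisB k i)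

theorem mulVec_basis (X : Matrix (Fin 3 ⊕ Fin 3) (Fin 3 ⊕ Fin 3) k) (s : Fin 3 ⊕ Fin 3) :
    X.mulVec (Pi.single s 1) = ∑ j, X (Sum.inl j) s • basisB k j +
      ∑ j, X (Sum.inr j) s • basisA k j := by
  ext p
  rw [Matrix.mulVec_single_one]
  obtain p | p := p <;> fin_cases p <;> simp [basisA, basisB, Fin.sum_univ_three]

theorem spAction_omegaElt (X : sp (Fin 3) k) : spAction k X (omegaElt k) = 0 := by
  have hX : X.1.transpose * Matrix.J (Fin 3) k = Matrix.J (Fin 3) k * -X.1 :=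
    (mem_skewAdjointMatricesSubmodule _ _).1 X.2
  have e1 (i j : Fin 3) : X.1 (Sum.inr j) (Sum.inl i) = X.1 (Sum.inr i) (Sum.inl j) := by
    have := congr_fun₂ hX (Sum.inl i) (Sum.inl j)
    simpa [Matrix.mul_apply, Matrix.J, Fintype.sum_sum_type, Matrix.one_apply] using this
  have e2 (i j : Fin 3) : X.1 (Sum.inr i) (Sum.inr j) = -X.1 (Sum.inl j) (Sum.inl i) := by
    have := congr_fun₂ hX (Sum.inl i) (Sum.inr j)
    simpa [Matrix.mul_apply, Matrix.J, Fintype.sum_sum_type, Matrix.one_apply] using this.symm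
  have e3 (i j : Fin 3) : X.1 (Sum.inl j) (Sum.inr i) = X.1 (Sum.inl i) (Sum.inr j) := by
    have := congr_fun₂ hX (Sum.inr i) (Sum.inr j)
    simpa [Matrix.mul_apply, Matrix.J, Fintype.sum_sum_type, Matrix.one_apply] using this
  simp only [omegaElt, map_sum, spAction_wedge]
  have hA (i : Fin 3) : X.1.mulVec (basisA k i) = ∑ j, X.1 (Sum.inl j) (Sum.inr i) • basisB k j +
      ∑ j, X.1 (Sum.inr j) (Sum.inr i) • basisA k j := mulVec_basis k X.1 _
  have hB (i : Fin 3) : X.1.mulVec (basisB k i) = ∑ j, X.1 (Sum.inl j) (Sum.inl i) • basisB k j +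
      ∑ j, X.1 (Sum.inr j) (Sum.inl i) • basisA k j := mulVec_basis k X.1 _
  simp only [hA, hB, Fin.sum_univ_three, wedge_add_left, wedge_add_right, wedge_smul_left,
    wedge_smul_right, wedge_self, smul_zero, e2]
  rw [e1 0 1, e1 0 2, e1 1 2, e3 0 1, e3 0 2, e3 1 2, wedge_swap (basisA k 1) (basisA k 0),
    wedge_swap (basisA k 2) (basisA k 0), wedge_swap (basisA k 2) (basisA k 1),
    wedge_swap (basisB k 1) (basisB k 0), wedge_swap (basisB k 2) (basisB k 0),
    wedge_swap (basisB k 2) (basisB k 1)]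
  module

/-- The trivial submodule `k (∑ aᵢ ∧ bᵢ)`. -/
def lineOmega : LieSubmodule k (sp (Fin 3) k) (⋀[k]^2 (W6 k)) where
  __ := Submodule.span k {omegaElt k}
  lie_mem {X m} hm := by
    obtain ⟨c, rfl⟩ := Submodule.mem_span_singleton.1 hm
    have : ⁅X, c • omegaElt k⁆ = 0 := by
      change spAction k X (c • omegaElt k) = 0
      rw [map_smul, spAction_omegaElt, smul_zero]
    rw [this]
    exact Submodule.zero_mem _

/-- In characteristic `3`, the line `k (∑ aᵢ ∧ bᵢ)` is contained in `ker φ`. -/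
theorem contraction_omegaElt [CharP k 3] : contraction k (omegaElt k) = 0 := by
  simp only [omegaElt, map_sum, contraction_wedge, sympForm_apply, basisA, basisB]
  simp [Fin.sum_univ_three]
  linear_combination three_eq_zero k

/-- The module `V(ω₂) = ker φ / k (∑ aᵢ ∧ bᵢ)` of `𝔰𝔭₆`. -/
abbrev VOmega2 : Type u :=
  kerContraction k ⧸ (lineOmega k).comap (kerContraction k).incl

end Omega

end

end SuperMagic

open SuperMagic TensorProduct LieAlgebra

attribute [local instance 100] LieRing.ofAssociativeRing

/-! The proof works in explicit coordinates. A map that is skew for the determinant form of S₄ has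
the form x ↦ ax − xb with a, b traceless, and the triality condition ties the matrices of the three
components together cyclically; so 𝔱𝔯𝔦(S₄) is a sum of three copies of 𝔰𝔩₂ (`triS4_leftCoord`). For
S₁₂ the three components of a triple coincide, and 𝔱𝔯𝔦(S₁₂) is 𝔬𝔰𝔭(1,2) (`tri_S12_eq`). Hence 𝔤(S₄,
S₁₂) is spanned by five families: `magL` (the three 𝔰𝔩₂), `magQ` and `magO` (the even and odd part
of 𝔬𝔰𝔭(1,2)), `magI m s` = ιₘ(s ⊗ 1) and `magK m s v` = ιₘ(s ⊗ v). Their multiplication table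
involves only products, adjugates, traces and forms of 2×2 matrices.

Jacobi identity: the elements x for which ad x is a superderivation are closed under linear
combinations and brackets (`Jacobi.bracket`), and the families `magO` and `magI` generate
everything. So only these two need to be tested as first argument, and there the identity is a
polynomial identity modulo 3 (`jacobi_O`, `jacobi_I_tri`, `jacobi_I_I`, `jacobi_I_K_K`).

Even part: a symplectic 6×6 matrix is cut into 2×2 blocks. The diagonal blocks are traceless and
give the three 𝔰𝔩₂; the block (j, i) is minus the adjugate of the block (i, j), so three
off-diagonal blocks remain and give the three ιₘ(S₄ ⊗ 1). Block multiplication is the multiplication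
table (`evenMap_bracket`), and the even part of 𝔬𝔰𝔭(1,2) is the extra 𝔰𝔩₂.

Odd part: an element of ⋀²W is a self-adjoint operator on W, with three free off-diagonal blocks and
three scalar diagonal blocks. On ker φ the three scalars sum to zero, and ∑ aᵢ ∧ bᵢ shifts all of
them equally; in characteristic 3 this leaves one number, namely any of the equal cyclic differences
(`wedgeDiag_of_mem`). So V(ω₂) has coordinates (S₄)³ × k, of dimension 13, and tensoring with k²
matches the families `magK` and `magO` (`evenMap_bracket_oddMap`).

Irreducibility: multiplication by nilpotent matrix units on both sides isolates one nonzero entry of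
one block, and that entry generates everything (`IsActionStable.eq_top_of_ne_zero`). Simplicity: the
odd part of a graded ideal is therefore 0 or everything. In the first case the even part of the
ideal annihilates the odd part of the algebra and vanishes, since the action is faithful; in the
second case the ideal contains generators.

Contragredient form: the Cartan matrix is invertible, so 𝔥 is spanned by the coroots in every
realization. Explicit elements `chevE`, `chevF`, `chevH` satisfy the defining relations, generate,
and are homogeneous for a ℤ-grading, which gives a surjection from the free algebra. Its kernel
meets 𝔥 trivially, so it lies in the maximal ideal. Conversely an admissible ideal K has as image a
graded ideal of a simple algebra. If that image were everything, K would contain a preimage of a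
nonzero element of 𝔥; its component of degree 0 would still lie in K, and by the triangular
decomposition also in 𝔥 modulo relations, which is excluded (`maximalIdeal_le_ker`). -/

namespace SuperMagic

/-! ### The triality Lie superalgebras of `S₄` and `S₁₂` -/

section TrialityS4

variable {k : Type u} [Field k]

/-- The map `x ↦ a x - x b + (tr a - tr b) x`, which in characteristic `3` depends only on the
traceless parts of `a` and `b`. -/
def biaction (a b : S4 k) : Module.End k (S4 k) :=
  LinearMap.mulLeft k a - LinearMap.mulRight k b + (a.trace - b.trace) • LinearMap.id

theorem biaction_apply (a b x : S4 k) :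
    biaction a b x = a * x - x * b + (a.trace - b.trace) • x := rfl

theorem S4_ext {k : Type u} {x y : S4 k} (h00 : x 0 0 = y 0 0) (h01 : x 0 1 = y 0 1) (h10 : x 1 0 = y 1 0)
    (h11 : x 1 1 = y 1 1) : x = y := by
  ext i j
  fin_cases i <;> fin_cases j <;> assumption

theorem biaction_apply_apply (a b x : S4 k) (i j : Fin 2) : biaction a b x i j =
    a i 0 * x 0 j + a i 1 * x 1 j - (x i 0 * b 0 j + x i 1 * b 1 j) +
      (a 0 0 + a 1 1 - (b 0 0 + b 1 1)) * x i j := by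
  simp [biaction_apply, Matrix.mul_apply, Fin.sum_univ_two, Matrix.trace_fin_two]

theorem adjugate_mul_adjugate_apply (x y : S4 k) :
    (x.adjugate * y.adjugate) 0 0 = x 1 1 * y 1 1 + x 0 1 * y 1 0 ∧
    (x.adjugate * y.adjugate) 0 1 = -(x 1 1 * y 0 1) - x 0 1 * y 0 0 ∧
    (x.adjugate * y.adjugate) 1 0 = -(x 1 0 * y 1 1) - x 0 0 * y 1 0 ∧
    (x.adjugate * y.adjugate) 1 1 = x 1 0 * y 0 1 + x 0 0 * y 0 0 := by
  simp [Matrix.adjugate_fin_two, Matrix.mul_apply, Fin.sum_univ_two, sub_eq_add_neg]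

theorem part_end_S4 (d : Module.End k (S4 k)) : d ∈ part k (Module.End k (S4 k)) 0 := by
  rw [mem_part_end]
  intro j x hx
  obtain rfl | rfl := parity_cases j
  · exact S4_part_zero k _
  · rw [S4_part_one k hx, map_zero]; exact zero_mem _

theorem part_end_S4_one {d : Module.End k (S4 k)} (hd : d ∈ part k (Module.End k (S4 k)) 1) :
    d = 0 := by
  ext1 x
  simpa using S4_part_one k (mem_part_end.1 hd 0 x (S4_part_zero k x))

variable [CharP k 3]

theorem smul₂_S4 (x y : S4 k) : smul₂ k x y = x.adjugate * y.adjugate := paraMul_S4 k x y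

theorem form_S4 (x y : S4 k) :
    form k x y = x 0 0 * y 1 1 + y 0 0 * x 1 1 - x 0 1 * y 1 0 - y 0 1 * x 1 0 :=
  detForm_apply k x y

theorem biaction_mem_ospPart (a b : S4 k) : biaction a b ∈ ospPart k (S4 k) 0 := by
  refine ⟨part_end_S4 _, fun j x _ y => ?_⟩
  simp only [koszul_zero_left, form_S4, biaction_apply_apply]
  grind

/-- For traceless matrices the adjugate changes the sign, so the conjugate of cx − xa is a x̄ − x̄ c
and that of by − yc is c ȳ − ȳ b. In (a x̄ − x̄ c) ȳ + x̄ (c ȳ − ȳ b) the terms with c cancel. The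
trace terms of `biaction` reduce the general case to this one. -/
theorem biaction_smul₂ (a b c x y : S4 k) : biaction a b (smul₂ k x y) =
    smul₂ k (biaction c a x) y + smul₂ k x (biaction b c y) := by
  simp only [smul₂_S4]
  apply S4_ext <;>
    simp only [biaction_apply_apply, Matrix.add_apply, adjugate_mul_adjugate_apply] <;> grind

theorem biaction_mem_triPart (a : Fin 3 → S4 k) :
    (fun m => biaction (a m) (a (m + 2))) ∈ triPart k (S4 k) 0 := by
  refine ⟨fun m => biaction_mem_ospPart _ _, fun j x _ y => ?_⟩
  rw [koszul_zero_left, one_smul]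
  exact biaction_smul₂ (a 0) (a 2) (a 1) x y

/-- The element of `𝔱𝔯𝔦(S₄)` given by a triple of `2 × 2` matrices, modulo scalars. -/
def triS4 : (Fin 3 → S4 k) →ₗ[k] tri k (S4 k) where
  toFun a := ⟨_, triPart_le_tri k 0 (biaction_mem_triPart a)⟩
  map_add' a b := Subtype.ext <| funext fun m => LinearMap.ext fun x => Matrix.ext fun i j => by
    change biaction (a m + b m) (a (m + 2) + b (m + 2)) x i j =
      biaction (a m) (a (m + 2)) x i j + biaction (b m) (b (m + 2)) x i j
    simp only [biaction_apply_apply, Matrix.add_apply]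
    ring
  map_smul' c a := Subtype.ext <| funext fun m => LinearMap.ext fun x => Matrix.ext fun i j => by
    change biaction (c • a m) (c • a (m + 2)) x i j = c * biaction (a m) (a (m + 2)) x i j
    simp only [biaction_apply_apply, Matrix.smul_apply, smul_eq_mul]
    ring

theorem triS4_apply (a : Fin 3 → S4 k) (m : Fin 3) :
    (triS4 a).1 m = biaction (a m) (a (m + 2)) := rfl

theorem triS4_bracket (a b : Fin 3 → S4 k) :
    sbr k (triS4 a) (triS4 b) = triS4 fun m => ⁅a m, b m⁆ := by
  refine Subtype.ext <| funext fun m => LinearMap.ext fun x => ?_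
  change superComm k (biaction (a m) (a (m + 2))) (biaction (b m) (b (m + 2))) x =
    biaction ⁅a m, b m⁆ ⁅a (m + 2), b (m + 2)⁆ x
  rw [superComm_apply k (part_end_S4 _) (part_end_S4 _), koszul_zero_left, one_smul]
  simp only [LinearMap.sub_apply, Module.End.mul_apply]
  apply S4_ext <;> simp only [biaction_apply_apply, Matrix.sub_apply, Ring.lie_def,
    Matrix.mul_apply, Fin.sum_univ_two] <;> ring

/-- The traceless matrix `a` for which a given skew map is of the form `x ↦ a x - x b`. -/
def leftCoord : Module.End k (S4 k) →ₗ[k] S4 k where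
  toFun d := !![-(d (Matrix.single 0 0 1) 0 0 + d (Matrix.single 0 1 1) 0 1),
      d (Matrix.single 1 1 1) 0 1; d (Matrix.single 0 0 1) 1 0,
      d (Matrix.single 0 0 1) 0 0 + d (Matrix.single 0 1 1) 0 1]
  map_add' d e := by apply S4_ext <;> simp <;> ring
  map_smul' c d := by apply S4_ext <;> simp <;> ring

/-- The traceless matrix `b` for which a given skew map is of the form `x ↦ a x - x b`. -/
def rightCoord (d : Module.End k (S4 k)) : S4 k :=
  !![d (Matrix.single 0 0 1) 0 0 - d (Matrix.single 0 1 1) 0 1,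
     -d (Matrix.single 0 0 1) 0 1; -d (Matrix.single 0 1 1) 0 0,
     d (Matrix.single 0 1 1) 0 1 - d (Matrix.single 0 0 1) 0 0]

/-- This is the splitting of 𝔰𝔬₄ into two copies of 𝔰𝔩₂. The values on matrix units determine a and
b; the diagonal entries come from half-sums and half-differences, with 1/2 = −1 in characteristic 3.
-/
theorem eq_biaction_of_mem_ospPart {d : Module.End k (S4 k)} (hd : d ∈ ospPart k (S4 k) 0) :
    d = biaction (leftCoord d) (rightCoord d) := by
  have h (i j p q : Fin 2) := hd.2 0 (Matrix.single i j 1) (S4_part_zero k _) (Matrix.single p q 1)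
  simp only [koszul_zero_left, form_S4, one_mul] at h
  have h' : ∀ i j, d (Matrix.single i j 1) =
      biaction (leftCoord d) (rightCoord d) (Matrix.single i j 1) := by
    have h1 := h 0 0 0 0
    have h2 := h 0 0 0 1
    have h3 := h 0 0 1 0
    have h4 := h 0 0 1 1
    have h5 := h 0 1 0 1
    have h6 := h 0 1 1 0
    have h7 := h 0 1 1 1
    have h8 := h 1 0 1 0
    have h9 := h 1 0 1 1
    have h10 := h 1 1 1 1
    simp at h1 h2 h3 h4 h5 h6 h7 h8 h9 h10
    intro i j
    fin_cases i <;> fin_cases j <;> apply S4_ext <;>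
      simp [biaction_apply_apply, leftCoord, rightCoord] <;> grind
  refine Matrix.ext_linearMap _ fun i j => LinearMap.ext_ring ?_
  simpa using h' i j

/-- With first factor 1 the triality condition becomes zȳ = ȳw for all y, where z is traceless and w
is the difference of the two sides; this forces w = 0, and two values of y suffice to see it.
Rotating the triple gives the analogous identities for the other two components. -/
theorem rightCoord_zero {d : Fin 3 → Module.End k (S4 k)} (hd : d ∈ triPart k (S4 k) 0) :
    rightCoord (d 0) = leftCoord (d 2) := by
  have h (y : S4 k) := hd.2 0 1 (S4_part_zero k _) y
  rw [eq_biaction_of_mem_ospPart (hd.1 0), eq_biaction_of_mem_ospPart (hd.1 1),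
    eq_biaction_of_mem_ospPart (hd.1 2)] at h
  simp only [koszul_zero_left, one_smul, smul₂_S4] at h
  have h1 (i j) := congr_fun₂ (h (Matrix.single 0 1 1)) i j
  have h2 (i j) := congr_fun₂ (h (Matrix.single 1 1 1)) i j
  have e1 := h1 0 0
  have e2 := h1 0 1
  have e3 := h2 0 0
  have e4 := h2 0 1
  simp [biaction_apply_apply, Matrix.adjugate_fin_two, leftCoord, rightCoord] at e1 e2 e3 e4
  apply S4_ext <;> simp [leftCoord, rightCoord] <;> grind

theorem eq_biaction_of_mem_triPart {d : Fin 3 → Module.End k (S4 k)}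
    (hd : d ∈ triPart k (S4 k) 0) (m : Fin 3) :
    d m = biaction (leftCoord (d m)) (leftCoord (d (m + 2))) := by
  have h1 := rotate_mem_triPart k hd
  have h2 := rotate_mem_triPart k h1
  conv_lhs => rw [eq_biaction_of_mem_ospPart (hd.1 m)]
  congr 1
  fin_cases m
  exacts [rightCoord_zero hd, rightCoord_zero h1, rightCoord_zero h2]

theorem triS4_leftCoord (d : tri k (S4 k)) : triS4 (fun m => leftCoord (d.1 m)) = d := by
  obtain ⟨d0, h0, d1, h1, h⟩ := Submodule.mem_sup.1 d.2
  have h1' : d1 = 0 := funext fun m => part_end_S4_one (h1.1 m).1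
  rw [h1', add_zero] at h
  rw [h] at h0
  exact Subtype.ext (funext fun m => (eq_biaction_of_mem_triPart h0 m).symm)

/-- The traceless part of a is a − (tr a / 2) 1, and −1/2 = 1 in characteristic 3. -/
theorem leftCoord_biaction (a b : S4 k) :
    leftCoord (biaction a b) = a + a.trace • 1 := by
  apply S4_ext <;> simp [leftCoord, biaction_apply_apply, Matrix.trace_fin_two] <;> grind

theorem triS4_one (c : Fin 3 → k) : triS4 (fun m => c m • (1 : S4 k)) = 0 := by
  refine Subtype.ext <| funext fun m => LinearMap.ext fun x => ?_
  change biaction (c m • 1) (c (m + 2) • 1) x = 0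
  apply S4_ext <;> simp [biaction_apply_apply] <;> grind

end TrialityS4

end SuperMagic

/-! ### The triality Lie superalgebra of S₁₂ as 𝔬𝔰𝔭(1,2). -/

namespace SuperMagic

section TrialityS12

variable {k : Type u} [Field k]

/-- The unit of `S₁₂`. -/
def evenElt : S12 k := (1, 0)

/-- The odd part of `S₁₂`. -/
def oddElt : (Fin 2 → k) →ₗ[k] S12 k := LinearMap.inr k k (Fin 2 → k)

theorem evenElt_mem : (evenElt : S12 k) ∈ part k (S12 k) 0 := (S12_part_zero k).2 rfl

theorem oddElt_mem (u : Fin 2 → k) : oddElt u ∈ part k (S12 k) 1 := (S12_part_one k).2 rfl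

theorem S12_eq (y : S12 k) : y = y.1 • evenElt + oddElt y.2 := by
  refine Prod.ext ?_ ?_ <;> simp [evenElt, oddElt]

theorem S12_linearMap_ext {N : Type*} [AddCommGroup N] [Module k N] {f g : S12 k →ₗ[k] N}
    (h1 : f evenElt = g evenElt) (h2 : ∀ u, f (oddElt u) = g (oddElt u)) : f = g := by
  refine LinearMap.ext fun y => ?_
  rw [S12_eq y]
  simp [h1, h2]

/-- The action of a matrix, made traceless, on `V`. -/
def evenAct (q : S4 k) (u : Fin 2 → k) : Fin 2 → k := q.mulVec u + q.trace • u

theorem evenAct_apply (q : S4 k) (u : Fin 2 → k) (i : Fin 2) :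
    evenAct q u i = q i 0 * u 0 + q i 1 * u 1 + (q 0 0 + q 1 1) * u i := by
  simp only [evenAct, Pi.add_apply, Matrix.mulVec, dotProduct, Fin.sum_univ_two,
    Matrix.trace_fin_two, Pi.smul_apply, smul_eq_mul]

/-- The operator `w ⟨v | -⟩`. -/
def rankOne (w v : Fin 2 → k) : S4 k := !![-(w 0 * v 1), w 0 * v 0; -(w 1 * v 1), w 1 * v 0]

/-- The derivation of `S₁₂` given by a `2 × 2` matrix, modulo scalars. -/
def evenDer : S4 k →ₗ[k] Module.End k (S12 k) :=
  LinearMap.mk₂ k (fun q (y : k × (Fin 2 → k)) => ((0, evenAct q y.2) : S12 k))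
    (fun _ _ _ => Prod.ext (by simp) (funext fun _ => by simp [evenAct_apply]; ring))
    (fun _ _ _ => Prod.ext (by simp) (funext fun _ => by simp [evenAct_apply]; ring))
    (fun _ _ _ => Prod.ext (by simp) (funext fun _ => by simp [evenAct_apply]; ring))
    (fun _ _ _ => Prod.ext (by simp) (funext fun _ => by simp [evenAct_apply]; ring))

/-- The odd derivation of `S₁₂` that sends `1` to `v`. -/
def oddDer : (Fin 2 → k) →ₗ[k] Module.End k (S12 k) :=
  LinearMap.mk₂ k (fun v (y : k × (Fin 2 → k)) => ((altForm k v y.2, y.1 • v) : S12 k))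
    (fun _ _ _ => Prod.ext (by simp) (by simp))
    (fun _ _ _ => Prod.ext (by simp) (by simp; module))
    (fun _ _ _ => Prod.ext (by simp) (by simp; module))
    (fun _ _ _ => Prod.ext (by simp) (by simp; module))

theorem altForm_apply (u v : Fin 2 → k) : altForm k u v = u 0 * v 1 - u 1 * v 0 := rfl

theorem evenDer_even (q : S4 k) : evenDer q evenElt = 0 :=
  Prod.ext rfl (by change evenAct q 0 = 0; simp [evenAct])

theorem evenDer_odd (q : S4 k) (u : Fin 2 → k) : evenDer q (oddElt u) = oddElt (evenAct q u) := rfl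

theorem oddDer_even (v : Fin 2 → k) : oddDer v evenElt = oddElt v :=
  Prod.ext (map_zero (altForm k v)) (one_smul k v)

theorem oddDer_odd (v u : Fin 2 → k) : oddDer v (oddElt u) = altForm k v u • evenElt :=
  Prod.ext (by simp [oddDer, oddElt, evenElt]) (by simp [oddDer, oddElt, evenElt])

theorem evenDer_mem_part (q : S4 k) : evenDer q ∈ part k (Module.End k (S12 k)) 0 := by
  rw [mem_part_end]
  intro j x hx
  obtain rfl | rfl := parity_cases j
  · rw [S12_part_zero] at hx
    refine (S12_part_zero k).2 ?_
    change evenAct q x.2 = 0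
    simp [hx, evenAct]
  · exact (S12_part_one k).2 rfl

theorem oddDer_mem_part (v : Fin 2 → k) : oddDer v ∈ part k (Module.End k (S12 k)) 1 := by
  rw [mem_part_end]
  intro j x hx
  obtain rfl | rfl := parity_cases j
  · rw [S12_part_zero] at hx
    refine (S12_part_one k).2 ?_
    change altForm k v x.2 = 0
    simp [hx]
  · rw [S12_part_one] at hx
    refine (S12_part_zero k).2 ?_
    change x.1 • v = 0
    simp [hx]

theorem S12_ext {k : Type u} {x y : S12 k} (h : x.1 = y.1) (h0 : x.2 0 = y.2 0) (h1 : x.2 1 = y.2 1) :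
    x = y := by
  refine Prod.ext h (funext fun i => ?_)
  fin_cases i <;> assumption

theorem evenDer_apply_fst (q : S4 k) (y : S12 k) : (evenDer q y).1 = 0 := rfl

theorem evenDer_apply_snd (q : S4 k) (y : S12 k) (i : Fin 2) : (evenDer q y).2 i =
    q i 0 * y.2 0 + q i 1 * y.2 1 + (q 0 0 + q 1 1) * y.2 i := by
  exact evenAct_apply q y.2 i

theorem oddDer_apply_fst (v : Fin 2 → k) (y : S12 k) :
    (oddDer v y).1 = v 0 * y.2 1 - v 1 * y.2 0 := rfl

theorem oddDer_apply_snd (v : Fin 2 → k) (y : S12 k) (i : Fin 2) :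
    (oddDer v y).2 i = y.1 * v i := rfl

variable [CharP k 3]

theorem form_S12 (x y : S12 k) :
    form k x y = 2 * (x.1 * y.1) + (x.2 0 * y.2 1 - x.2 1 * y.2 0) := rfl

theorem smul₂_S12 (x y : S12 k) : smul₂ k x y =
    ((x.1 * y.1 + (x.2 0 * y.2 1 - x.2 1 * y.2 0), -(x.1 • y.2) - y.1 • x.2) : S12 k) :=
  paraMul_S12 k x y

theorem evenDer_mem_triPart (q : S4 k) : (fun _ => evenDer q) ∈ triPart k (S12 k) 0 := by
  refine ⟨fun _ => ⟨evenDer_mem_part q, fun j x _ y => ?_⟩, fun j x _ y => ?_⟩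
  · simp only [koszul_zero_left, form_S12, evenDer_apply_fst, evenDer_apply_snd]
    grind
  · apply S12_ext <;> simp [koszul_zero_left, smul₂_S12, evenDer_apply_fst, evenDer_apply_snd] <;>
      grind

theorem oddDer_mem_triPart (v : Fin 2 → k) : (fun _ => oddDer v) ∈ triPart k (S12 k) 1 := by
  refine ⟨fun _ => ⟨oddDer_mem_part v, fun j x hx y => ?_⟩, fun j x hx y => ?_⟩
  · obtain rfl | rfl := parity_cases j
    · rw [S12_part_zero] at hx
      simp [koszul_zero_right, form_S12, oddDer_apply_fst, oddDer_apply_snd, hx]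
      grind
    · rw [S12_part_one] at hx
      simp [koszul_one_one, form_S12, oddDer_apply_fst, oddDer_apply_snd, hx]
      grind
  · obtain rfl | rfl := parity_cases j
    · rw [S12_part_zero] at hx
      apply S12_ext <;> simp [koszul_zero_right, smul₂_S12, oddDer_apply_fst, oddDer_apply_snd,
        hx] <;> grind
    · rw [S12_part_one] at hx
      apply S12_ext <;> simp [koszul_one_one, smul₂_S12, oddDer_apply_fst, oddDer_apply_snd,
        hx] <;> grind

/-- The even part of `𝔱𝔯𝔦(S₁₂)`. -/
def triEven : S4 k →ₗ[k] tri k (S12 k) where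
  toFun q := ⟨fun _ => evenDer q, triPart_le_tri k 0 (evenDer_mem_triPart q)⟩
  map_add' _ _ := Subtype.ext (funext fun _ => map_add evenDer _ _)
  map_smul' _ _ := Subtype.ext (funext fun _ => map_smul evenDer _ _)

/-- The odd part of `𝔱𝔯𝔦(S₁₂)`. -/
def triOdd : (Fin 2 → k) →ₗ[k] tri k (S12 k) where
  toFun q := ⟨fun _ => oddDer q, triPart_le_tri k 1 (oddDer_mem_triPart q)⟩
  map_add' _ _ := Subtype.ext (funext fun _ => map_add oddDer _ _)
  map_smul' _ _ := Subtype.ext (funext fun _ => map_smul oddDer _ _)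

/-- The traceless matrix of a derivation of `S₁₂`. -/
def evenCoord : Module.End k (S12 k) →ₗ[k] S4 k where
  toFun d := Matrix.of fun i j => (d (oddElt (Pi.single j 1))).2 i
  map_add' _ _ := rfl
  map_smul' _ _ := rfl

theorem apply_even_of_mem_ospPart {d : Module.End k (S12 k)} (hd : d ∈ ospPart k (S12 k) 0) :
    d evenElt = 0 := by
  have h1 := (S12_part_zero k).1 (mem_part_end.1 hd.1 0 _ evenElt_mem)
  have h2 := hd.2 0 _ evenElt_mem evenElt
  simp only [koszul_zero_left, form_S12] at h2
  refine Prod.ext ?_ h1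
  simp [evenElt] at h2 ⊢
  grind

/-- An odd skew map is determined by its value at 1: the image of u is a multiple c1, and b(d(1), u)
+ b(1, d(u)) = 0 gives 2c = −⟨d(1) | u⟩, hence c = ⟨d(1) | u⟩ in characteristic 3. -/
theorem apply_odd_of_mem_ospPart {d : Module.End k (S12 k)} (hd : d ∈ ospPart k (S12 k) 1)
    (u : Fin 2 → k) : d (oddElt u) = altForm k (d evenElt).2 u • evenElt := by
  have h1 := (S12_part_zero k).1 (mem_part_end.1 hd.1 1 _ (oddElt_mem u))
  have h2 := hd.2 0 _ evenElt_mem (oddElt u)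
  simp only [koszul_zero_right, form_S12] at h2
  refine Prod.ext ?_ (by rw [h1]; simp [evenElt])
  simp [evenElt, oddElt, altForm_apply] at h2 ⊢
  grind

/-- Even skew maps kill 1, so the triality condition for 1 • u = −u compares only the components 0
and 2. Rotation then identifies all three components. -/
theorem oddPart_eq_of_mem_triPart_zero {d : Fin 3 → Module.End k (S12 k)}
    (hd : d ∈ triPart k (S12 k) 0) : d 0 = d 2 := by
  refine S12_linearMap_ext ?_ fun u => ?_
  · rw [apply_even_of_mem_ospPart (hd.1 0), apply_even_of_mem_ospPart (hd.1 2)]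
  have h := hd.2 0 evenElt evenElt_mem (oddElt u)
  have e1 := (S12_part_one k).1 (mem_part_end.1 (hd.1 0).1 1 _ (oddElt_mem u))
  have e2 := (S12_part_one k).1 (mem_part_end.1 (hd.1 2).1 1 _ (oddElt_mem u))
  have e3 : smul₂ k evenElt (oddElt u) = -oddElt u := by
    refine Prod.ext ?_ ?_ <;> simp [smul₂_S12, evenElt, oddElt]
  rw [koszul_zero_left, apply_even_of_mem_ospPart (hd.1 1), e3, smul₂_S12, smul₂_S12] at h
  refine Prod.ext (e1.trans e2.symm) ?_
  have := congr_arg Prod.snd h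
  simpa [evenElt] using this

theorem eq_of_mem_triPart_zero {d : Fin 3 → Module.End k (S12 k)}
    (hd : d ∈ triPart k (S12 k) 0) (m : Fin 3) : d m = evenDer (evenCoord (d 0)) := by
  have h0 : d m = d 0 := by
    have h1 := oddPart_eq_of_mem_triPart_zero hd
    have h2 := oddPart_eq_of_mem_triPart_zero (rotate_mem_triPart k hd)
    fin_cases m
    exacts [rfl, h2, h1.symm]
  rw [h0]
  refine S12_linearMap_ext ?_ fun u => ?_
  · rw [evenDer_even, apply_even_of_mem_ospPart (hd.1 0)]
  have e1 := (S12_part_one k).1 (mem_part_end.1 (hd.1 0).1 1 _ (oddElt_mem u))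
  -- Skewness on the two basis vectors of V says that the matrix of d on V is traceless, so the
  -- trace term in `evenAct` contributes nothing.
  have e2 := (hd.1 0).2 1 _ (oddElt_mem (Pi.single 0 1)) (oddElt (Pi.single 1 1))
  have hu : oddElt u = u 0 • oddElt (Pi.single 0 1) + u 1 • oddElt (Pi.single 1 1) := by
    rw [← map_smul, ← map_smul, ← map_add]
    congr 1
    funext i
    fin_cases i <;> simp
  have e3 : ∀ i, (d 0 (oddElt u)).2 i = u 0 * (d 0 (oddElt (Pi.single 0 1))).2 i +
      u 1 * (d 0 (oddElt (Pi.single 1 1))).2 i := by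
    intro i
    rw [hu]
    simp only [map_add, map_smul]
    rfl
  simp [koszul_zero_left, form_S12, oddElt] at e2
  apply S12_ext
  · exact e1
  all_goals
    rw [e3, evenDer_odd]
    change _ = evenAct _ u _
    simp [evenAct_apply, evenCoord, oddElt]
    grind

/-- Write 1 = e₀ • e₁ = −(e₁ • e₀) with the basis vectors of V. The first expression gives the two
coordinates of d₀(1) as one coordinate of d₂(1) and one of d₁(1); the second gives them with the
roles of d₁ and d₂ interchanged. -/
theorem apply_even_of_mem_triPart_one {d : Fin 3 → Module.End k (S12 k)}
    (hd : d ∈ triPart k (S12 k) 1) : d 1 evenElt = d 0 evenElt ∧ d 2 evenElt = d 0 evenElt := by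
  have h1 := hd.2 1 _ (oddElt_mem (Pi.single 0 1)) (oddElt (Pi.single 1 1))
  have h2 := hd.2 1 _ (oddElt_mem (Pi.single 1 1)) (oddElt (Pi.single 0 1))
  have e0 (m) := (S12_part_one k).1 (mem_part_end.1 (hd.1 m).1 0 _ evenElt_mem)
  have e1 : smul₂ k (oddElt (Pi.single 0 1)) (oddElt (Pi.single 1 1)) = (evenElt : S12 k) := by
    apply S12_ext <;> simp [smul₂_S12, evenElt, oddElt]
  have e2 : smul₂ k (oddElt (Pi.single 1 1)) (oddElt (Pi.single 0 1)) = -(evenElt : S12 k) := by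
    apply S12_ext <;> simp [smul₂_S12, evenElt, oddElt]
  rw [e1, apply_odd_of_mem_ospPart (hd.1 1), apply_odd_of_mem_ospPart (hd.1 2), koszul_one_one,
    smul₂_S12, smul₂_S12] at h1
  rw [e2, apply_odd_of_mem_ospPart (hd.1 1), apply_odd_of_mem_ospPart (hd.1 2), koszul_one_one,
    smul₂_S12, smul₂_S12, map_neg] at h2
  have f (i) := congr_fun (congr_arg Prod.snd h1) i
  have g (i) := congr_fun (congr_arg Prod.snd h2) i
  have f0 := f 0
  have f1 := f 1
  have g0 := g 0
  have g1 := g 1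
  simp [evenElt, oddElt, altForm_apply] at f0 f1 g0 g1
  refine ⟨S12_ext ((e0 1).trans (e0 0).symm) ?_ ?_, S12_ext ((e0 2).trans (e0 0).symm) ?_ ?_⟩ <;>
    simp only [evenElt] <;> grind

theorem eq_of_mem_triPart_one {d : Fin 3 → Module.End k (S12 k)}
    (hd : d ∈ triPart k (S12 k) 1) (m : Fin 3) : d m = oddDer (d 0 evenElt).2 := by
  have h0 : d m evenElt = d 0 evenElt := by
    fin_cases m
    exacts [rfl, (apply_even_of_mem_triPart_one hd).1, (apply_even_of_mem_triPart_one hd).2]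
  refine S12_linearMap_ext ?_ fun u => ?_
  · rw [h0, oddDer_even]
    exact Prod.ext ((S12_part_one k).1 (mem_part_end.1 (hd.1 0).1 0 _ evenElt_mem)) rfl
  · rw [apply_odd_of_mem_ospPart (hd.1 m), oddDer_odd, h0]

theorem tri_S12_eq (d : tri k (S12 k)) :
    triEven (evenCoord ((pr k 0 d : tri k (S12 k)).1 0)) +
      triOdd ((pr k 1 d : tri k (S12 k)).1 0 (evenElt : S12 k)).2 = d := by
  have h : pr k 0 d + pr k 1 d = d := Superspace.proj_add d
  refine Eq.trans ?_ h
  congr 1 <;> refine Subtype.ext (funext fun m => ?_)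
  · exact (eq_of_mem_triPart_zero (pr_mem_triPart k 0 d.2) m).symm
  · exact (eq_of_mem_triPart_one (pr_mem_triPart k 1 d.2) m).symm

theorem triEven_bracket (p q : S4 k) : sbr k (triEven p) (triEven q) = triEven ⁅p, q⁆ := by
  refine Subtype.ext <| funext fun m => ?_
  change superComm k (evenDer p) (evenDer q) = evenDer ⁅p, q⁆
  rw [superComm_apply k (evenDer_mem_part p) (evenDer_mem_part q), koszul_zero_left, one_smul]
  refine LinearMap.ext fun x => ?_
  apply S12_ext <;> simp [Module.End.mul_apply, Ring.lie_def, Matrix.mul_apply, Fin.sum_univ_two,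
    evenDer_apply_fst, evenDer_apply_snd] <;> grind

theorem triEven_bracket_triOdd (q : S4 k) (v : Fin 2 → k) :
    sbr k (triEven q) (triOdd v) = triOdd (evenAct q v) := by
  refine Subtype.ext <| funext fun m => ?_
  change superComm k (evenDer q) (oddDer v) = oddDer (evenAct q v)
  rw [superComm_apply k (evenDer_mem_part q) (oddDer_mem_part v), koszul_zero_left, one_smul]
  refine LinearMap.ext fun x => ?_
  apply S12_ext <;> simp [Module.End.mul_apply, evenAct_apply, evenDer_apply_fst, evenDer_apply_snd, oddDer_apply_fst,
    oddDer_apply_snd] <;> grind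

theorem triOdd_bracket_triEven (q : S4 k) (v : Fin 2 → k) :
    sbr k (triOdd v) (triEven q) = -triOdd (evenAct q v) := by
  refine Subtype.ext <| funext fun m => ?_
  change superComm k (oddDer v) (evenDer q) = -oddDer (evenAct q v)
  rw [superComm_apply k (oddDer_mem_part v) (evenDer_mem_part q), koszul_zero_right, one_smul]
  refine LinearMap.ext fun x => ?_
  apply S12_ext <;> simp [Module.End.mul_apply, evenAct_apply, evenDer_apply_fst, evenDer_apply_snd, oddDer_apply_fst,
    oddDer_apply_snd] <;> grind

theorem triOdd_bracket (v w : Fin 2 → k) :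
    sbr k (triOdd v) (triOdd w) = triEven (rankOne v w + rankOne w v) := by
  refine Subtype.ext <| funext fun m => ?_
  change superComm k (oddDer v) (oddDer w) = evenDer (rankOne v w + rankOne w v)
  rw [superComm_apply k (oddDer_mem_part v) (oddDer_mem_part w), koszul_one_one]
  refine LinearMap.ext fun x => ?_
  apply S12_ext <;> simp [Module.End.mul_apply, rankOne, evenDer_apply_fst, evenDer_apply_snd,
    oddDer_apply_fst, oddDer_apply_snd] <;> grind

end TrialityS12

end SuperMagic

namespace SuperMagic

/-! ### The product of `𝔤(S₄, S₁₂)` -/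

section Product

variable {k : Type u} [Field k] [CharP k 3]

theorem inv_two : (2 : k)⁻¹ = 2 := by
  have := two_ne_zero_of_charP_three k
  grind

omit [CharP k 3] in
theorem adjugate_apply (x : S4 k) : x.adjugate 0 0 = x 1 1 ∧ x.adjugate 0 1 = -x 0 1 ∧
    x.adjugate 1 0 = -x 1 0 ∧ x.adjugate 1 1 = x 0 0 := by
  simp [Matrix.adjugate_fin_two]

omit [CharP k 3] in
theorem S4_mul_apply (x y : S4 k) (i j : Fin 2) : (x * y) i j = x i 0 * y 0 j + x i 1 * y 1 j := by
  rw [Matrix.mul_apply, Fin.sum_univ_two]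

/-- From x s̄ + s x̄ = b(s, x) 1 and x̄ t + t̄ x = b(t, x) 1 the terms s x̄ t cancel in σ, which
leaves x ↦ x s̄ t − s t̄ x. The traces of s t̄ and s̄ t agree. The other two components are
one-sided multiplications, where the coefficient 1/2 = 2 appears as the trace correction of
`biaction`. -/
theorem triple_S4 (s t : S4 k) : triple k s t =
    triS4 ![-(s * t.adjugate), 0, -(s.adjugate * t)] := by
  refine Subtype.ext <| funext fun m => LinearMap.ext fun x => ?_
  have e (y z : S4 k) := rmul_apply k (S4_part_zero k y) (S4_part_zero k z)
  simp only [koszul_zero_left, one_smul] at e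
  rw [triS4_apply]
  change tripleFun k s t m x = _
  fin_cases m
  · change sigma k s t x = biaction (-(s * t.adjugate)) (-(s.adjugate * t)) x
    rw [sigma_apply k (S4_part_zero k s) (S4_part_zero k t) (S4_part_zero k x), koszul_zero_left,
      koszul_zero_left, form_S4, form_S4]
    apply S4_ext <;> simp [biaction_apply_apply, S4_mul_apply, adjugate_apply] <;> grind
  · change (2⁻¹ * form k s t) • x - rmul k s (smul₂ k t x) = biaction 0 (-(s * t.adjugate)) x
    rw [e, inv_two, form_S4, smul₂_S4, smul₂_S4]
    apply S4_ext <;> simp [biaction_apply_apply, S4_mul_apply, adjugate_apply] <;> grind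
  · change (2⁻¹ * form k s t) • x - smul₂ k s (rmul k t x) = biaction (-(s.adjugate * t)) 0 x
    rw [e, inv_two, form_S4, smul₂_S4, smul₂_S4]
    apply S4_ext <;> simp [biaction_apply_apply, S4_mul_apply, adjugate_apply] <;> grind

/-- A homogeneous element of 𝔱𝔯𝔦(S₁₂) is determined by its zeroth component, so only σ has to be
evaluated, here and for the three other combinations of parities. -/
theorem triple_even_even : triple k (evenElt : S12 k) evenElt = 0 := by
  refine Subtype.ext <| funext fun m => ?_
  have h : tripleFun k evenElt evenElt ∈ triPart k (S12 k) 0 := by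
    simpa [one_add_one_parity] using tripleFun_mem_triPart k evenElt_mem evenElt_mem
  change tripleFun k evenElt evenElt m = 0
  rw [eq_of_mem_triPart_zero h]
  refine (congr_arg evenDer (?_ : _ = (0 : S4 k))).trans (map_zero evenDer)
  ext i j
  change (sigma k evenElt evenElt (oddElt (Pi.single j 1))).2 i = 0
  rw [sigma_apply k evenElt_mem evenElt_mem (oddElt_mem _), ← sub_smul]
  simp [koszul_zero_left]

theorem triple_even_odd (v : Fin 2 → k) : triple k evenElt (oddElt v) = -triOdd v := by
  refine Subtype.ext <| funext fun m => ?_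
  have h : tripleFun k evenElt (oddElt v) ∈ triPart k (S12 k) 1 := by
    simpa [one_add_one_parity] using tripleFun_mem_triPart k evenElt_mem (oddElt_mem v)
  change tripleFun k evenElt (oddElt v) m = -oddDer v
  rw [eq_of_mem_triPart_one h,
    ← map_neg]
  congr 1
  change (sigma k evenElt (oddElt v) evenElt).2 = _
  rw [sigma_apply k evenElt_mem (oddElt_mem v) evenElt_mem]
  ext i
  simp [form_S12, evenElt, oddElt, koszul_zero_right]
  grind

theorem triple_odd_even (v : Fin 2 → k) : triple k (oddElt v) evenElt = triOdd v := by
  refine Subtype.ext <| funext fun m => ?_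
  have h : tripleFun k (oddElt v) evenElt ∈ triPart k (S12 k) 1 := by
    simpa [one_add_one_parity] using tripleFun_mem_triPart k (oddElt_mem v) evenElt_mem
  change tripleFun k (oddElt v) evenElt m = oddDer v
  rw [eq_of_mem_triPart_one h]
  congr 1
  change (sigma k (oddElt v) evenElt evenElt).2 = _
  rw [sigma_apply k (oddElt_mem v) evenElt_mem evenElt_mem]
  ext i
  simp [form_S12, evenElt, oddElt, koszul_zero_right]
  grind

theorem triple_odd_odd (u v : Fin 2 → k) :
    triple k (oddElt u) (oddElt v) = -triEven (rankOne u v + rankOne v u) := by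
  refine Subtype.ext <| funext fun m => ?_
  have h : tripleFun k (oddElt u) (oddElt v) ∈ triPart k (S12 k) 0 := by
    simpa [one_add_one_parity] using tripleFun_mem_triPart k (oddElt_mem u) (oddElt_mem v)
  change tripleFun k (oddElt u) (oddElt v) m = -evenDer (rankOne u v + rankOne v u)
  rw [eq_of_mem_triPart_zero h, ← map_neg]
  congr 1
  have h (w i) : (sigma k (oddElt u) (oddElt v) (oddElt w)).2 i =
      -(altForm k u w * v i) - altForm k v w * u i := by
    rw [sigma_apply k (oddElt_mem u) (oddElt_mem v) (oddElt_mem _), one_add_one_parity,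
      koszul_one_one, koszul_zero_right]
    simp [form_S12, oddElt, altForm_apply]
    ring
  apply S4_ext <;> refine (h _ _).trans ?_ <;> simp [altForm_apply, rankOne] <;> ring

/-- The inclusion of `𝔱𝔯𝔦(S₄)` into `𝔤(S₄, S₁₂)`. -/
def magT : tri k (S4 k) →ₗ[k] Magic k (S4 k) (S12 k) :=
  LinearMap.inl k (tri k (S4 k) × tri k (S12 k)) (Fin 3 → S4 k ⊗[k] S12 k) ∘ₗ
    LinearMap.inl k (tri k (S4 k)) (tri k (S12 k))

/-- The inclusion of `𝔱𝔯𝔦(S₁₂)` into `𝔤(S₄, S₁₂)`. -/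
def magR : tri k (S12 k) →ₗ[k] Magic k (S4 k) (S12 k) :=
  LinearMap.inl k (tri k (S4 k) × tri k (S12 k)) (Fin 3 → S4 k ⊗[k] S12 k) ∘ₗ
    LinearMap.inr k (tri k (S4 k)) (tri k (S12 k))

/-- The inclusion `ιₘ` of `S₄ ⊗ S₁₂` into `𝔤(S₄, S₁₂)`. -/
def iota (m : Fin 3) : S4 k ⊗[k] S12 k →ₗ[k] Magic k (S4 k) (S12 k) :=
  LinearMap.inr k (tri k (S4 k) × tri k (S12 k)) (Fin 3 → S4 k ⊗[k] S12 k) ∘ₗ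
    LinearMap.single k (fun _ => S4 k ⊗[k] S12 k) m

/-- The elements of `𝔱𝔯𝔦(S₄)`, given by triples of matrices. -/
def magL : (Fin 3 → S4 k) →ₗ[k] Magic k (S4 k) (S12 k) := magT ∘ₗ triS4

/-- The even elements of `𝔱𝔯𝔦(S₁₂)`. -/
def magQ : S4 k →ₗ[k] Magic k (S4 k) (S12 k) := magR ∘ₗ triEven

/-- The odd elements of `𝔱𝔯𝔦(S₁₂)`. -/
def magO : (Fin 2 → k) →ₗ[k] Magic k (S4 k) (S12 k) := magR ∘ₗ triOdd

/-- The elements `ιₘ(s ⊗ 1)`. -/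
def magI (m : Fin 3) : S4 k →ₗ[k] Magic k (S4 k) (S12 k) :=
  iota m ∘ₗ (TensorProduct.mk k (S4 k) (S12 k)).flip evenElt

/-- The elements `ιₘ(s ⊗ v)`, with `v` odd. -/
def magK (m : Fin 3) : S4 k →ₗ[k] (Fin 2 → k) →ₗ[k] Magic k (S4 k) (S12 k) :=
  ((TensorProduct.mk k (S4 k) (S12 k)).compr₂ (iota m)).compl₂ oddElt

theorem pr_S4 (s : S4 k) : pr k 0 s = s ∧ pr k 1 s = 0 := ⟨rfl, rfl⟩

/-- S₄ is purely even, and every Koszul sign in this action and in the three tensor operations below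
involves a parity of S₄; all these signs are therefore 1. -/
theorem actRight_apply (d : tri k (S12 k)) (z : Fin 3 → S4 k ⊗[k] S12 k) (m : Fin 3) :
    actRight k (S4 k) (S12 k) d z m = TensorProduct.map LinearMap.id (d.1 m) (z m) := by
  change ∑ a : ZMod 2, ∑ b : ZMod 2,
      koszul k a b • TensorProduct.map (pr k b) (pr k a (d.1 m)) (z m) = _
  induction z m with
  | zero => simp
  | add x y hx hy => simp only [map_add, smul_add, Finset.sum_add_distrib, hx, hy]
  | tmul s y =>
    have h : pr k 0 (d.1 m) + pr k 1 (d.1 m) = d.1 m := Superspace.proj_add _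
    simp only [sum_parity, TensorProduct.map_tmul, (pr_S4 s).1, (pr_S4 s).2, koszul_zero_right,
      one_smul, zero_tmul, smul_zero, add_zero]
    rw [← tmul_add, ← LinearMap.add_apply, h]
    rfl

theorem tensorMul_tmul (s t : S4 k) (x y : S12 k) : tensorMul k (S4 k) (S12 k) (s ⊗ₜ x) (t ⊗ₜ y) =
    smul₂ k s t ⊗ₜ smul₂ k x y := by
  have hx : pr k 0 x + pr k 1 x = x := Superspace.proj_add _
  simp only [tensorMul, sum_parity, LinearMap.add_apply, LinearMap.smul_apply,
    TensorProduct.map₂_apply_tmul, TensorProduct.map_tmul, LinearMap.compl₁₂_apply, (pr_S4 t).1, (pr_S4 t).2,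
    koszul_zero_right, one_smul, map_zero, zero_tmul, smul_zero, add_zero, LinearMap.id_apply]
  rw [← tmul_add, ← LinearMap.add_apply, ← map_add, hx]

theorem tensorTriple_tmul (s t : S4 k) (x y : S12 k) :
    tensorTriple k (S4 k) (S12 k) (s ⊗ₜ x) (t ⊗ₜ y) = form k x y • triple k s t := by
  have hx : pr k 0 x + pr k 1 x = x := Superspace.proj_add _
  have hy : pr k 0 y + pr k 1 y = y := Superspace.proj_add _
  simp only [tensorTriple, sum_parity, LinearMap.add_apply, LinearMap.smul_apply,
    TensorProduct.map₂_apply_tmul, TensorProduct.map_tmul, LinearMap.compl₁₂_apply, (pr_S4 t).1, (pr_S4 t).2, (pr_S4 s).1,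
    (pr_S4 s).2, LinearMap.compr₂_apply, LinearMap.zero_apply,
    koszul_zero_left, one_smul, map_zero, zero_tmul, smul_zero, add_zero, mul_one,
    LinearEquiv.coe_coe, TensorProduct.rid_tmul]
  have e : form k x y = form k (pr k 0 x) (pr k 0 y) + form k (pr k 0 x) (pr k 1 y) +
      (form k (pr k 1 x) (pr k 0 y) + form k (pr k 1 x) (pr k 1 y)) := by
    rw [form, form, form, form, form, ← map_add, ← map_add, ← LinearMap.add_apply, ← map_add, hx,
      hy]
  rw [e]
  module

theorem tensorTriple'_tmul (s t : S4 k) (x y : S12 k) :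
    tensorTriple' k (S4 k) (S12 k) (s ⊗ₜ x) (t ⊗ₜ y) = form k s t • triple k x y := by
  have hx : pr k 0 x + pr k 1 x = x := Superspace.proj_add _
  simp only [tensorTriple', sum_parity, LinearMap.add_apply, LinearMap.smul_apply,
    TensorProduct.map₂_apply_tmul, TensorProduct.map_tmul, LinearMap.compl₁₂_apply, (pr_S4 t).1, (pr_S4 t).2,
    LinearMap.compr₂_apply,
    koszul_zero_left, one_smul, map_zero, zero_tmul, smul_zero, add_zero, LinearMap.id_apply,
    LinearEquiv.coe_coe, TensorProduct.lid_tmul]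
  rw [← smul_add, ← LinearMap.add_apply, ← map_add, hx]

theorem theta_pow_apply {S : Type v} [AddCommGroup S] [Module k S] [Superspace k S]
    [SymmetricCompositionSuperalgebra k S] (m : Fin 3) (d : tri k S) (n : Fin 3) :
    ((theta k ^ (m : ℕ)) d).1 n = d.1 (n - m) := by
  fin_cases m
  · simp
  · rfl
  · change d.1 (n - 1 - 1) = d.1 (n - 2)
    rw [sub_sub]
    rfl

theorem theta_pow_triS4 (m : Fin 3) (a : Fin 3 → S4 k) :
    (theta k ^ (m : ℕ)) (triS4 a) = triS4 fun n => a (n - m) := by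
  refine Subtype.ext <| funext fun n => ?_
  rw [theta_pow_apply, triS4_apply, triS4_apply]
  rw [sub_add_eq_add_sub]

theorem theta_pow_triEven (m : Fin 3) (q : S4 k) :
    (theta k ^ (m : ℕ)) (triEven q) = triEven q :=
  Subtype.ext <| funext fun n => theta_pow_apply m _ n

theorem theta_pow_triOdd (m : Fin 3) (v : Fin 2 → k) :
    (theta k ^ (m : ℕ)) (triOdd v) = triOdd v :=
  Subtype.ext <| funext fun n => theta_pow_apply m _ n

theorem magicMul_tri_tri (d e : tri k (S4 k)) (d' e' : tri k (S12 k)) :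
    magicMul k (S4 k) (S12 k) ((d, d'), 0) ((e, e'), 0) = ((sbr k d e, sbr k d' e'), 0) := by
  refine Prod.ext (Prod.ext ?_ ?_) ?_
  · simp [magicMul]
  · simp [magicMul]
  · ext1 m
    simp [magicMul]

theorem magicMul_tri_iota (d : tri k (S4 k)) (d' : tri k (S12 k)) (z : Fin 3 → S4 k ⊗[k] S12 k) :
    magicMul k (S4 k) (S12 k) ((d, d'), 0) (0, z) =
      (0, actLeft k (S4 k) (S12 k) d z + actRight k (S4 k) (S12 k) d' z) := by
  refine Prod.ext (Prod.ext ?_ ?_) ?_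
  · simp [magicMul, sbr]
  · simp [magicMul, sbr]
  · ext1 m
    simp [magicMul]

theorem magicMul_iota_tri (d : tri k (S4 k)) (d' : tri k (S12 k)) (z : Fin 3 → S4 k ⊗[k] S12 k) :
    magicMul k (S4 k) (S12 k) (0, z) ((d, d'), 0) =
      (0, -(sflip (actLeft k (S4 k) (S12 k)) z d + sflip (actRight k (S4 k) (S12 k)) z d')) := by
  refine Prod.ext (Prod.ext ?_ ?_) ?_
  · simp [magicMul, sbr]
  · simp [magicMul, sbr]
  · ext1 m
    simp [magicMul]
    abel

theorem triS4_mem (a : Fin 3 → S4 k) : triS4 a ∈ part k (tri k (S4 k)) 0 :=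
  mem_part.2 (Subtype.ext (mem_part.1 (triPart_le_part k 0 (biaction_mem_triPart a))))

theorem triEven_mem (q : S4 k) : triEven q ∈ part k (tri k (S12 k)) 0 :=
  mem_part.2 (Subtype.ext (mem_part.1 (triPart_le_part k 0 (evenDer_mem_triPart q))))

theorem triOdd_mem (v : Fin 2 → k) : triOdd v ∈ part k (tri k (S12 k)) 1 :=
  mem_part.2 (Subtype.ext (mem_part.1 (triPart_le_part k 1 (oddDer_mem_triPart v))))

theorem tmul_mem {i : ZMod 2} (s : S4 k) {y : S12 k} (hy : y ∈ part k (S12 k) i) :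
    s ⊗ₜ y ∈ part k (S4 k ⊗[k] S12 k) i := by
  have h : (0 : ZMod 2) - 1 = 1 := rfl
  rw [mem_part]
  change (∑ j : ZMod 2, TensorProduct.map (pr k j) (pr k (i - j))) (s ⊗ₜ y) = _
  simp only [sum_parity, LinearMap.add_apply, TensorProduct.map_tmul, (pr_S4 s).1, (pr_S4 s).2,
    zero_tmul, add_zero, sub_zero, mem_part.1 hy]

theorem single_mem {i : ZMod 2} {z : S4 k ⊗[k] S12 k} (hz : z ∈ part k (S4 k ⊗[k] S12 k) i)
    (m : Fin 3) : (Pi.single m z : Fin 3 → S4 k ⊗[k] S12 k) ∈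
      part k (Fin 3 → S4 k ⊗[k] S12 k) i := by
  rw [mem_part]
  ext1 n
  change pr k i ((Pi.single m z : Fin 3 → S4 k ⊗[k] S12 k) n) = _
  by_cases h : n = m
  · subst h
    simpa using mem_part.1 hz
  · simp [h]

end Product

end SuperMagic

/-! ### Brackets between 𝔱𝔯𝔦(S₄), 𝔱𝔯𝔦(S₁₂) and the three summands ιₘ(S₄ ⊗ S₁₂). -/

namespace SuperMagic

section Table

variable {k : Type u} [Field k] [CharP k 3]

variable (k) in
/-- An element of `𝔤(S₄, S₁₂)`, given by its components. -/
def magMk : ((tri k (S4 k) × tri k (S12 k)) × (Fin 3 → S4 k ⊗[k] S12 k)) →ₗ[k]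
    Magic k (S4 k) (S12 k) := LinearMap.id

theorem magMk_bracket (X Y : (tri k (S4 k) × tri k (S12 k)) × (Fin 3 → S4 k ⊗[k] S12 k)) :
    sbr k (magMk k X) (magMk k Y) = magMk k (magicMul k (S4 k) (S12 k) X Y) := rfl

theorem magT_eq (d : tri k (S4 k)) : magT d = magMk k ((d, 0), 0) := rfl

theorem magR_eq (d : tri k (S12 k)) : magR d = magMk k ((0, d), 0) := rfl

theorem iota_eq (m : Fin 3) (z : S4 k ⊗[k] S12 k) :
    iota m z = magMk k (0, Pi.single m z) := rfl

theorem magT_magT (d e : tri k (S4 k)) : sbr k (magT d) (magT e) = magT (sbr k d e) := by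
  simp only [magT_eq, magR_eq, iota_eq]
  rw [magMk_bracket, magicMul_tri_tri]
  simp only [sbr, map_zero]

theorem magR_magR (d e : tri k (S12 k)) : sbr k (magR d) (magR e) = magR (sbr k d e) := by
  simp only [magT_eq, magR_eq, iota_eq]
  rw [magMk_bracket, magicMul_tri_tri]
  simp only [sbr, map_zero]

theorem magT_magR (d : tri k (S4 k)) (e : tri k (S12 k)) : sbr k (magT d) (magR e) = 0 := by
  simp only [magT_eq, magR_eq, iota_eq]
  rw [magMk_bracket, magicMul_tri_tri]
  simp only [sbr, map_zero, LinearMap.zero_apply]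
  exact map_zero (magMk k)

theorem magR_magT (d : tri k (S4 k)) (e : tri k (S12 k)) : sbr k (magR e) (magT d) = 0 := by
  simp only [magT_eq, magR_eq, iota_eq]
  rw [magMk_bracket, magicMul_tri_tri]
  simp only [sbr, map_zero, LinearMap.zero_apply]
  exact map_zero (magMk k)

theorem actLeft_single (d : tri k (S4 k)) (m : Fin 3) (s : S4 k) (y : S12 k) :
    actLeft k (S4 k) (S12 k) d (Pi.single m (s ⊗ₜ y)) = Pi.single m (d.1 m s ⊗ₜ y) := by
  ext1 n
  change TensorProduct.map (d.1 n) LinearMap.id ((Pi.single m (s ⊗ₜ y) : Fin 3 → _) n) = _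
  by_cases h : n = m
  · subst h
    simp
  · simp [h]

theorem actRight_single (d : tri k (S12 k)) (m : Fin 3) (s : S4 k) (y : S12 k) :
    actRight k (S4 k) (S12 k) d (Pi.single m (s ⊗ₜ y)) = Pi.single m (s ⊗ₜ d.1 m y) := by
  ext1 n
  rw [actRight_apply]
  by_cases h : n = m
  · subst h
    simp
  · simp [h]

theorem magT_iota (d : tri k (S4 k)) (m : Fin 3) (s : S4 k) (y : S12 k) :
    sbr k (magT d) (iota m (s ⊗ₜ y)) = iota m (d.1 m s ⊗ₜ y) := by
  simp only [magT_eq, magR_eq, iota_eq]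
  rw [magMk_bracket, magicMul_tri_iota, map_zero, LinearMap.zero_apply, add_zero, actLeft_single]

theorem magR_iota (d : tri k (S12 k)) (m : Fin 3) (s : S4 k) (y : S12 k) :
    sbr k (magR d) (iota m (s ⊗ₜ y)) = iota m (s ⊗ₜ d.1 m y) := by
  simp only [magT_eq, magR_eq, iota_eq]
  rw [magMk_bracket, magicMul_tri_iota, map_zero, LinearMap.zero_apply, zero_add, actRight_single]

theorem iota_magT {d : tri k (S4 k)} (hd : d ∈ part k (tri k (S4 k)) 0) (m : Fin 3) (s : S4 k)
    {i : ZMod 2} {y : S12 k} (hy : y ∈ part k (S12 k) i) :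
    sbr k (iota m (s ⊗ₜ y)) (magT d) = -iota m (d.1 m s ⊗ₜ y) := by
  rw [← map_neg]
  simp only [magT_eq, magR_eq, iota_eq]
  rw [magMk_bracket, magicMul_iota_tri, map_zero, add_zero, sflip_apply _ hd (single_mem (tmul_mem s hy) m),
    koszul_zero_left, one_smul, actLeft_single, Pi.single_neg]

theorem iota_magR {i j : ZMod 2} {d : tri k (S12 k)} (hd : d ∈ part k (tri k (S12 k)) i)
    (m : Fin 3) (s : S4 k) {y : S12 k} (hy : y ∈ part k (S12 k) j) :
    sbr k (iota m (s ⊗ₜ y)) (magR d) = -(koszul k i j • iota m (s ⊗ₜ d.1 m y)) := by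
  rw [← map_smul, ← map_neg]
  simp only [magT_eq, magR_eq, iota_eq]
  rw [magMk_bracket, magicMul_iota_tri, map_zero, zero_add, sflip_apply _ hd (single_mem (tmul_mem s hy) m),
    actRight_single, Pi.single_neg, Pi.single_smul]

/-- The product of two elements of `ι₀(S ⊗ S') ⊕ ι₁(S ⊗ S') ⊕ ι₂(S ⊗ S')`. -/
theorem magicMul_iota_iota (z w : Fin 3 → S4 k ⊗[k] S12 k) :
    magicMul k (S4 k) (S12 k) (0, z) (0, w) =
      ((∑ i : Fin 3, (theta k ^ (i : ℕ)) (tensorTriple k (S4 k) (S12 k) (z i) (w i)),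
        ∑ i : Fin 3, (theta k ^ (i : ℕ)) (tensorTriple' k (S4 k) (S12 k) (z i) (w i))),
        fun i => tensorMul k (S4 k) (S12 k) (z (i + 1)) (w (i + 2)) -
          sflip (tensorMul k (S4 k) (S12 k)) (z (i + 2)) (w (i + 1))) := by
  refine Prod.ext (Prod.ext ?_ ?_) ?_
  · simp [magicMul, sbr]
  · simp [magicMul, sbr]
  · ext1 m
    simp [magicMul]

theorem bilin_single_ne {M N P : Type*} [AddCommMonoid M] [Module k M] [AddCommMonoid N] [Module k N]
    [AddCommMonoid P] [Module k P] (f : M →ₗ[k] N →ₗ[k] P) {m m' : Fin 3} (h : m ≠ m') (z : M) (w : N)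
    (n : Fin 3) : f ((Pi.single m z : Fin 3 → M) n) ((Pi.single m' w : Fin 3 → N) n) = 0 := by
  by_cases hn : n = m
  · subst hn
    simp [h]
  · simp [hn]

theorem sum_single {M N P : Type*} [AddCommMonoid M] [Module k M] [AddCommMonoid N] [Module k N]
    [AddCommMonoid P] [Module k P] (f : M →ₗ[k] N →ₗ[k] P) (g : Module.End k P) (m : Fin 3)
    (z : M) (w : N) :
    ∑ n : Fin 3, (g ^ (n : ℕ)) (f ((Pi.single m z : Fin 3 → M) n) ((Pi.single m w : Fin 3 → N) n)) =
      (g ^ (m : ℕ)) (f z w) := by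
  rw [Finset.sum_eq_single m (fun n _ hn => by simp [hn]) (by simp)]
  simp only [Pi.single_eq_same]

theorem sum_single_ne {M N P : Type*} [AddCommMonoid M] [Module k M] [AddCommMonoid N] [Module k N]
    [AddCommMonoid P] [Module k P] (f : M →ₗ[k] N →ₗ[k] P) (g : Module.End k P) {m m' : Fin 3}
    (h : m ≠ m') (z : M) (w : N) :
    ∑ n : Fin 3, (g ^ (n : ℕ)) (f ((Pi.single m z : Fin 3 → M) n)
      ((Pi.single m' w : Fin 3 → N) n)) = 0 :=
  Finset.sum_eq_zero fun n _ => by rw [bilin_single_ne f h, map_zero]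

/-- Products of the summands in the off-diagonal component. -/
theorem bilin_single_same {M N P : Type*} [AddCommGroup M] [Module k M] [AddCommGroup N]
    [Module k N] [AddCommGroup P] [Module k P] (f : M →ₗ[k] N →ₗ[k] P) (g : M →ₗ[k] N →ₗ[k] P)
    (m : Fin 3) (z : M) (w : N) :
    (fun n => f ((Pi.single m z : Fin 3 → M) (n + 1)) ((Pi.single m w : Fin 3 → N) (n + 2)) -
      g ((Pi.single m z : Fin 3 → M) (n + 2)) ((Pi.single m w : Fin 3 → N) (n + 1))) = 0 := by
  have h1 : m + 1 ≠ m ∧ m + 2 ≠ m ∧ m + 1 + 1 ≠ m ∧ m + 2 + 2 ≠ m := by revert m; decide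
  ext1 n
  have h : n = m ∨ n = m + 1 ∨ n = m + 2 := by clear h1; revert n m; decide
  obtain rfl | rfl | rfl := h <;> simp [h1]

/-- The component n of a product pairs the slots n + 1 and n + 2 in both orders. For arguments in
the slots m and m + 1 only n = m + 2 contributes, and only through f; in the opposite order, treated
next, only through g. -/
theorem bilin_single_next {M N P : Type*} [AddCommGroup M] [Module k M] [AddCommGroup N]
    [Module k N] [AddCommGroup P] [Module k P] (f : M →ₗ[k] N →ₗ[k] P) (g : M →ₗ[k] N →ₗ[k] P)
    (m : Fin 3) (z : M) (w : N) :
    (fun n => f ((Pi.single m z : Fin 3 → M) (n + 1)) ((Pi.single (m + 1) w : Fin 3 → N) (n + 2)) -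
      g ((Pi.single m z : Fin 3 → M) (n + 2)) ((Pi.single (m + 1) w : Fin 3 → N) (n + 1))) =
        Pi.single (m + 2) (f z w) := by
  have h1 : m + 1 ≠ m ∧ m + 2 ≠ m ∧ m + 1 + 1 ≠ m ∧ m + 1 + 2 = m ∧ m + 2 + 1 = m ∧
      m + 2 + 2 = m + 1 ∧ m + 1 + 1 ≠ m + 1 ∧ m ≠ m + 1 ∧ m ≠ m + 2 ∧ m + 1 ≠ m + 2 := by
    revert m; decide
  ext1 n
  have h : n = m ∨ n = m + 1 ∨ n = m + 2 := by clear h1; revert n m; decide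
  obtain rfl | rfl | rfl := h <;> simp [h1, Pi.single_apply]

theorem bilin_next_single {M N P : Type*} [AddCommGroup M] [Module k M] [AddCommGroup N]
    [Module k N] [AddCommGroup P] [Module k P] (f : M →ₗ[k] N →ₗ[k] P) (g : M →ₗ[k] N →ₗ[k] P)
    (m : Fin 3) (z : M) (w : N) :
    (fun n => f ((Pi.single (m + 1) z : Fin 3 → M) (n + 1)) ((Pi.single m w : Fin 3 → N) (n + 2)) -
      g ((Pi.single (m + 1) z : Fin 3 → M) (n + 2)) ((Pi.single m w : Fin 3 → N) (n + 1))) =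
        -Pi.single (m + 2) (g z w) := by
  have h1 : m + 1 ≠ m ∧ m + 2 ≠ m ∧ m + 1 + 1 ≠ m ∧ m + 1 + 2 = m ∧ m + 2 + 1 = m ∧
      m + 2 + 2 = m + 1 ∧ m + 1 + 1 ≠ m + 1 ∧ m ≠ m + 1 ∧ m ≠ m + 2 ∧ m + 1 ≠ m + 2 := by
    revert m; decide
  ext1 n
  have h : n = m ∨ n = m + 1 ∨ n = m + 2 := by clear h1; revert n m; decide
  obtain rfl | rfl | rfl := h <;> simp [h1, Pi.single_apply]

theorem iota_iota_same (m : Fin 3) (s t : S4 k) (x y : S12 k) :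
    sbr k (iota m (s ⊗ₜ x)) (iota m (t ⊗ₜ y)) =
      form k x y • magT ((theta k ^ (m : ℕ)) (triple k s t)) +
        form k s t • magR ((theta k ^ (m : ℕ)) (triple k x y)) := by
  simp only [magT_eq, magR_eq, iota_eq]
  rw [magMk_bracket, magicMul_iota_iota, sum_single, sum_single, bilin_single_same, ← map_smul,
    ← map_smul, ← map_add]
  simp only [tensorTriple_tmul, tensorTriple'_tmul, map_smul, smul_zero, add_zero, zero_add,
    Prod.smul_mk, Prod.mk_add_mk]

theorem add_one_ne_self (m : Fin 3) : m ≠ m + 1 ∧ m + 1 ≠ m := by revert m; decide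

theorem iota_iota_next (m : Fin 3) (s t : S4 k) (x y : S12 k) :
    sbr k (iota m (s ⊗ₜ x)) (iota (m + 1) (t ⊗ₜ y)) =
      iota (m + 2) (smul₂ k s t ⊗ₜ smul₂ k x y) := by
  simp only [magT_eq, magR_eq, iota_eq]
  rw [magMk_bracket, magicMul_iota_iota, sum_single_ne _ _ (add_one_ne_self m).1,
    sum_single_ne _ _ (add_one_ne_self m).1, bilin_single_next, tensorMul_tmul]
  rfl

theorem iota_next_iota (m : Fin 3) (s t : S4 k) {i j : ZMod 2} {x y : S12 k}
    (hx : x ∈ part k (S12 k) i) (hy : y ∈ part k (S12 k) j) :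
    sbr k (iota (m + 1) (t ⊗ₜ y)) (iota m (s ⊗ₜ x)) =
      -(koszul k i j • iota (m + 2) (smul₂ k s t ⊗ₜ smul₂ k x y)) := by
  rw [← map_smul, ← map_neg]
  simp only [magT_eq, magR_eq, iota_eq]
  rw [magMk_bracket, magicMul_iota_iota, sum_single_ne _ _ (add_one_ne_self m).2,
    sum_single_ne _ _ (add_one_ne_self m).2, bilin_next_single,
    sflip_apply _ (tmul_mem s hx) (tmul_mem t hy), tensorMul_tmul, Pi.single_neg]
  rfl

end Table

end SuperMagic

namespace SuperMagic

/-! ### The brackets of the five families of elements of `𝔤(S₄, S₁₂)` -/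

section Families

variable {k : Type u} [Field k] [CharP k 3]

/-- The triple of matrices that describes `θᵐ(t_{s, t})`. -/
def slots (m : Fin 3) (s t : S4 k) : Fin 3 → S4 k :=
  fun n => ![-(s * t.adjugate), 0, -(s.adjugate * t)] (n - m)

omit [CharP k 3] in
theorem slots_self (m : Fin 3) (s t : S4 k) : slots m s t m = -(s * t.adjugate) := by
  simp [slots]

omit [CharP k 3] in
theorem slots_next (m : Fin 3) (s t : S4 k) : slots m s t (m + 1) = 0 := by
  simp [slots]

omit [CharP k 3] in
theorem slots_prev (m : Fin 3) (s t : S4 k) : slots m s t (m + 2) = -(s.adjugate * t) := by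
  simp [slots]

theorem magI_apply (m : Fin 3) (s : S4 k) : magI m s = iota m (s ⊗ₜ evenElt) := rfl

theorem magK_apply (m : Fin 3) (s : S4 k) (v : Fin 2 → k) :
    magK m s v = iota m (s ⊗ₜ oddElt v) := rfl

theorem magL_apply (a : Fin 3 → S4 k) : magL a = magT (triS4 a) := rfl

theorem magQ_apply (q : S4 k) : magQ q = magR (triEven q) := rfl

theorem magO_apply (v : Fin 2 → k) : magO v = magR (triOdd v) := rfl

theorem iota_smul_even (m : Fin 3) (s : S4 k) (c : k) :
    iota m (s ⊗ₜ (c • evenElt)) = c • magI m s := by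
  rw [tmul_smul, map_smul, magI_apply]

theorem magR_neg (d : tri k (S12 k)) : magR (-d) = -magR d := by
  have h := (magR : tri k (S12 k) →ₗ[k] _).map_neg d
  exact h

theorem theta_pow_neg (m : Fin 3) (d : tri k (S12 k)) :
    (theta k ^ (m : ℕ)) (-d) = -(theta k ^ (m : ℕ)) d := by
  refine Subtype.ext <| funext fun n => (theta_pow_apply m (-d) n).trans ?_
  exact congr_arg Neg.neg (theta_pow_apply m d n).symm

/-- Start of the multiplication table: `X_Y` is the bracket of the family `magX` with the family
`magY`, in the same slot when both lie in the ιₘ. The suffix `next` means that the second slot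
follows the first cyclically, `prev` that it precedes it. Both orders are recorded because
skew-symmetry is deduced from the table later. -/
theorem L_L (a b : Fin 3 → S4 k) : sbr k (magL a) (magL b) = magL ⁅a, b⁆ := by
  simp only [magL_apply, magT_magT, triS4_bracket]
  rfl

theorem L_Q (a : Fin 3 → S4 k) (q : S4 k) : sbr k (magL a) (magQ q) = 0 := magT_magR _ _

theorem Q_L (q : S4 k) (a : Fin 3 → S4 k) : sbr k (magQ q) (magL a) = 0 := magR_magT _ _

theorem L_O (a : Fin 3 → S4 k) (v : Fin 2 → k) : sbr k (magL a) (magO v) = 0 := magT_magR _ _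

theorem O_L (v : Fin 2 → k) (a : Fin 3 → S4 k) : sbr k (magO v) (magL a) = 0 := magR_magT _ _

theorem L_I (a : Fin 3 → S4 k) (m : Fin 3) (s : S4 k) :
    sbr k (magL a) (magI m s) = magI m (biaction (a m) (a (m + 2)) s) := by
  simp only [magL_apply, magI_apply, magT_iota, triS4_apply]

theorem L_K (a : Fin 3 → S4 k) (m : Fin 3) (s : S4 k) (v : Fin 2 → k) :
    sbr k (magL a) (magK m s v) = magK m (biaction (a m) (a (m + 2)) s) v := by
  simp only [magL_apply, magK_apply, magT_iota, triS4_apply]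

theorem I_L (m : Fin 3) (s : S4 k) (a : Fin 3 → S4 k) :
    sbr k (magI m s) (magL a) = -magI m (biaction (a m) (a (m + 2)) s) := by
  simp only [magL_apply, magI_apply, iota_magT (triS4_mem a) m s evenElt_mem, triS4_apply]

theorem K_L (m : Fin 3) (s : S4 k) (v : Fin 2 → k) (a : Fin 3 → S4 k) :
    sbr k (magK m s v) (magL a) = -magK m (biaction (a m) (a (m + 2)) s) v := by
  simp only [magL_apply, magK_apply, iota_magT (triS4_mem a) m s (oddElt_mem v), triS4_apply]

theorem Q_Q (p q : S4 k) : sbr k (magQ p) (magQ q) = magQ ⁅p, q⁆ := by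
  simp only [magQ_apply, magR_magR, triEven_bracket]

theorem Q_O (q : S4 k) (v : Fin 2 → k) : sbr k (magQ q) (magO v) = magO (evenAct q v) := by
  simp only [magQ_apply, magO_apply, magR_magR, triEven_bracket_triOdd]

theorem O_Q (v : Fin 2 → k) (q : S4 k) : sbr k (magO v) (magQ q) = -magO (evenAct q v) := by
  simp only [magQ_apply, magO_apply, magR_magR, triOdd_bracket_triEven, magR_neg]

theorem O_O (v w : Fin 2 → k) :
    sbr k (magO v) (magO w) = magQ (rankOne v w + rankOne w v) := by
  simp only [magQ_apply, magO_apply, magR_magR, triOdd_bracket]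

theorem Q_I (q : S4 k) (m : Fin 3) (s : S4 k) : sbr k (magQ q) (magI m s) = 0 := by
  simp only [magQ_apply, magI_apply, magR_iota]
  exact (congr_arg (fun y => iota m (s ⊗ₜ y)) (evenDer_even q)).trans (by simp)

theorem I_Q (m : Fin 3) (s : S4 k) (q : S4 k) : sbr k (magI m s) (magQ q) = 0 := by
  simp only [magQ_apply, magI_apply, iota_magR (triEven_mem q) m s evenElt_mem]
  exact (congr_arg (fun y => -(koszul k 0 0 • iota m (s ⊗ₜ y))) (evenDer_even q)).trans (by simp)

theorem Q_K (q : S4 k) (m : Fin 3) (s : S4 k) (v : Fin 2 → k) :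
    sbr k (magQ q) (magK m s v) = magK m s (evenAct q v) := by
  simp only [magQ_apply, magK_apply, magR_iota]
  rfl

theorem K_Q (m : Fin 3) (s : S4 k) (v : Fin 2 → k) (q : S4 k) :
    sbr k (magK m s v) (magQ q) = -magK m s (evenAct q v) := by
  simp only [magQ_apply, magK_apply, iota_magR (triEven_mem q) m s (oddElt_mem v),
    koszul_zero_left, one_smul]
  rfl

theorem O_I (v : Fin 2 → k) (m : Fin 3) (s : S4 k) : sbr k (magO v) (magI m s) = magK m s v := by
  simp only [magO_apply, magI_apply, magK_apply, magR_iota]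
  exact congr_arg (fun y => iota m (s ⊗ₜ y)) (oddDer_even v)

theorem I_O (m : Fin 3) (s : S4 k) (v : Fin 2 → k) :
    sbr k (magI m s) (magO v) = -magK m s v := by
  simp only [magO_apply, magI_apply, magK_apply, iota_magR (triOdd_mem v) m s evenElt_mem,
    koszul_zero_right, one_smul]
  exact congr_arg (fun y => -iota m (s ⊗ₜ y)) (oddDer_even v)

theorem O_K (v : Fin 2 → k) (m : Fin 3) (s : S4 k) (u : Fin 2 → k) :
    sbr k (magO v) (magK m s u) = altForm k v u • magI m s := by
  simp only [magO_apply, magK_apply, magR_iota]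
  exact (congr_arg (fun y => iota m (s ⊗ₜ y)) (oddDer_odd v u)).trans (iota_smul_even m s _)

theorem K_O (m : Fin 3) (s : S4 k) (u v : Fin 2 → k) :
    sbr k (magK m s u) (magO v) = altForm k v u • magI m s := by
  simp only [magO_apply, magK_apply, iota_magR (triOdd_mem v) m s (oddElt_mem u), koszul_one_one,
    neg_smul, one_smul, neg_neg]
  exact (congr_arg (fun y => iota m (s ⊗ₜ y)) (oddDer_odd v u)).trans (iota_smul_even m s _)

theorem form_even_even : form k (evenElt : S12 k) evenElt = 2 := by
  simp [form_S12, evenElt]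

theorem form_even_odd (v : Fin 2 → k) : form k (evenElt : S12 k) (oddElt v) = 0 := by
  simp [form_S12, evenElt, oddElt]

theorem form_odd_even (v : Fin 2 → k) : form k (oddElt v) (evenElt : S12 k) = 0 := by
  simp [form_S12, evenElt, oddElt]

theorem form_odd_odd (u v : Fin 2 → k) : form k (oddElt u) (oddElt v) = altForm k u v := by
  simp [form_S12, oddElt, altForm_apply]

theorem smul₂_even_even : smul₂ k (evenElt : S12 k) evenElt = evenElt := by
  rw [smul₂_S12]
  apply S12_ext <;> simp [evenElt]

theorem smul₂_even_odd (v : Fin 2 → k) : smul₂ k (evenElt : S12 k) (oddElt v) = -oddElt v := by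
  rw [smul₂_S12]
  apply S12_ext <;> simp [evenElt, oddElt]

theorem smul₂_odd_even (v : Fin 2 → k) : smul₂ k (oddElt v) (evenElt : S12 k) = -oddElt v := by
  rw [smul₂_S12]
  apply S12_ext <;> simp [evenElt, oddElt]

theorem smul₂_odd_odd (u v : Fin 2 → k) :
    smul₂ k (oddElt u) (oddElt v) = altForm k u v • evenElt := by
  rw [smul₂_S12]
  apply S12_ext <;> simp [evenElt, oddElt, altForm_apply]

theorem theta_triple_S4 (m : Fin 3) (s t : S4 k) :
    (theta k ^ (m : ℕ)) (triple k s t) = triS4 (slots m s t) := by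
  rw [triple_S4, theta_pow_triS4]
  rfl

theorem I_I (m : Fin 3) (s t : S4 k) :
    sbr k (magI m s) (magI m t) = (2 : k) • magL (slots m s t) := by
  rw [magI_apply, magI_apply, iota_iota_same, form_even_even, triple_even_even, map_zero, map_zero,
    smul_zero, add_zero, theta_triple_S4, magL_apply]

theorem I_K (m : Fin 3) (s t : S4 k) (v : Fin 2 → k) :
    sbr k (magI m s) (magK m t v) = -(form k s t • magO v) := by
  rw [magI_apply, magK_apply, iota_iota_same, form_even_odd, triple_even_odd, theta_pow_neg,
    theta_pow_triOdd, zero_smul, zero_add, magR_neg, smul_neg, magO_apply]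

theorem K_I (m : Fin 3) (s t : S4 k) (v : Fin 2 → k) :
    sbr k (magK m s v) (magI m t) = form k s t • magO v := by
  rw [magI_apply, magK_apply, iota_iota_same, form_odd_even, triple_odd_even,
    theta_pow_triOdd, zero_smul, zero_add, magO_apply]

theorem K_K (m : Fin 3) (s t : S4 k) (u v : Fin 2 → k) :
    sbr k (magK m s u) (magK m t v) = altForm k u v • magL (slots m s t) -
      form k s t • magQ (rankOne u v + rankOne v u) := by
  rw [magK_apply, magK_apply, iota_iota_same, form_odd_odd, triple_odd_odd, theta_pow_neg,
    theta_pow_triEven, theta_triple_S4, magR_neg, smul_neg, ← sub_eq_add_neg, magL_apply,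
    magQ_apply]

theorem I_I_next (m : Fin 3) (s t : S4 k) :
    sbr k (magI m s) (magI (m + 1) t) = magI (m + 2) (s.adjugate * t.adjugate) := by
  rw [magI_apply, magI_apply, iota_iota_next, smul₂_even_even, smul₂_S4, magI_apply]

theorem I_K_next (m : Fin 3) (s t : S4 k) (v : Fin 2 → k) :
    sbr k (magI m s) (magK (m + 1) t v) = -magK (m + 2) (s.adjugate * t.adjugate) v := by
  rw [magI_apply, magK_apply, iota_iota_next, smul₂_even_odd, smul₂_S4, tmul_neg, map_neg,
    magK_apply]

theorem K_I_next (m : Fin 3) (s t : S4 k) (v : Fin 2 → k) :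
    sbr k (magK m s v) (magI (m + 1) t) = -magK (m + 2) (s.adjugate * t.adjugate) v := by
  rw [magI_apply, magK_apply, iota_iota_next, smul₂_odd_even, smul₂_S4, tmul_neg, map_neg,
    magK_apply]

theorem K_K_next (m : Fin 3) (s t : S4 k) (u v : Fin 2 → k) :
    sbr k (magK m s u) (magK (m + 1) t v) =
      altForm k u v • magI (m + 2) (s.adjugate * t.adjugate) := by
  rw [magK_apply, magK_apply, iota_iota_next, smul₂_odd_odd, smul₂_S4, iota_smul_even]

theorem I_I_prev (m : Fin 3) (s t : S4 k) :
    sbr k (magI (m + 1) t) (magI m s) = -magI (m + 2) (s.adjugate * t.adjugate) := by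
  rw [magI_apply, magI_apply, iota_next_iota m s t evenElt_mem evenElt_mem, smul₂_even_even,
    smul₂_S4, magI_apply, koszul_zero_left, one_smul]

theorem K_I_prev (m : Fin 3) (s t : S4 k) (v : Fin 2 → k) :
    sbr k (magK (m + 1) t v) (magI m s) = magK (m + 2) (s.adjugate * t.adjugate) v := by
  rw [magI_apply, magK_apply, iota_next_iota m s t evenElt_mem (oddElt_mem v), smul₂_even_odd,
    smul₂_S4, tmul_neg, map_neg, magK_apply, koszul_zero_left, one_smul, neg_neg]

theorem I_K_prev (m : Fin 3) (s t : S4 k) (v : Fin 2 → k) :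
    sbr k (magI (m + 1) t) (magK m s v) = magK (m + 2) (s.adjugate * t.adjugate) v := by
  rw [magI_apply, magK_apply, iota_next_iota m s t (oddElt_mem v) evenElt_mem, smul₂_odd_even,
    smul₂_S4, tmul_neg, map_neg, magK_apply, koszul_zero_right, one_smul, neg_neg]

theorem K_K_prev (m : Fin 3) (s t : S4 k) (u v : Fin 2 → k) :
    sbr k (magK (m + 1) t v) (magK m s u) =
      altForm k u v • magI (m + 2) (s.adjugate * t.adjugate) := by
  rw [magK_apply, magK_apply, iota_next_iota m s t (oddElt_mem u) (oddElt_mem v), smul₂_odd_odd,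
    smul₂_S4, iota_smul_even, koszul_one_one, neg_smul, one_smul, neg_neg]

theorem magMk_eq (X : (tri k (S4 k) × tri k (S12 k)) × (Fin 3 → S4 k ⊗[k] S12 k)) :
    magMk k X = magT X.1.1 + magR X.1.2 + ∑ m, iota m (X.2 m) := by
  simp only [magT_eq, magR_eq, iota_eq, ← map_add, ← map_sum]
  refine congr_arg (magMk k) (Prod.ext (Prod.ext ?_ ?_) (funext fun m => ?_))
  · simp [Prod.fst_sum]
  · simp [Prod.fst_sum, Prod.snd_sum]
  · simp [Prod.snd_sum, Finset.univ_sum_single]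

theorem magic_eq (X : Magic k (S4 k) (S12 k)) :
    X = magT X.1.1 + magR X.1.2 + ∑ m, iota m (X.2 m) := magMk_eq X

/-- Linear maps on `𝔤(S₄, S₁₂)` are determined by their values on the five families. -/
theorem magic_ext {N : Type*} [AddCommGroup N] [Module k N]
    {f g : Magic k (S4 k) (S12 k) →ₗ[k] N} (hL : ∀ a, f (magL a) = g (magL a))
    (hQ : ∀ q, f (magQ q) = g (magQ q)) (hO : ∀ v, f (magO v) = g (magO v))
    (hI : ∀ m s, f (magI m s) = g (magI m s)) (hK : ∀ m s v, f (magK m s v) = g (magK m s v)) :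
    f = g := by
  have hT (d) : f (magT d) = g (magT d) := by
    rw [← triS4_leftCoord d]
    exact hL _
  have hR (d) : f (magR d) = g (magR d) := by
    rw [← tri_S12_eq d, map_add, map_add, map_add]
    exact congr_arg₂ _ (hQ _) (hO _)
  have hi (m z) : f (iota m z) = g (iota m z) := by
    induction z with
    | zero => simp only [map_zero]
    | add x y hx hy => simp only [map_add, hx, hy]
    | tmul s y =>
      rw [S12_eq y, tmul_add, LinearMap.map_add, map_add, map_add, iota_smul_even, map_smul, map_smul,
        hI]
      exact congr_arg₂ _ rfl (hK m s y.2)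
  refine LinearMap.ext fun X => ?_
  rw [magic_eq X]
  simp only [map_add, map_sum, hT, hR, hi]

theorem pr_magMk (i : ZMod 2) (X : (tri k (S4 k) × tri k (S12 k)) × (Fin 3 → S4 k ⊗[k] S12 k)) :
    pr k i (magMk k X) = magMk k ((pr k i X.1.1, pr k i X.1.2), pr k i X.2) := rfl

theorem magT_mem {i : ZMod 2} {d : tri k (S4 k)} (hd : d ∈ part k (tri k (S4 k)) i) :
    magT d ∈ part k (Magic k (S4 k) (S12 k)) i := by
  rw [mem_part, magT_eq, pr_magMk]
  simp only [mem_part.1 hd, map_zero]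

theorem magR_mem {i : ZMod 2} {d : tri k (S12 k)} (hd : d ∈ part k (tri k (S12 k)) i) :
    magR d ∈ part k (Magic k (S4 k) (S12 k)) i := by
  rw [mem_part, magR_eq, pr_magMk]
  simp only [mem_part.1 hd, map_zero]

theorem iota_mem {i : ZMod 2} (m : Fin 3) (s : S4 k) {y : S12 k} (hy : y ∈ part k (S12 k) i) :
    iota m (s ⊗ₜ y) ∈ part k (Magic k (S4 k) (S12 k)) i := by
  rw [mem_part, iota_eq, pr_magMk]
  simp only [mem_part.1 (single_mem (tmul_mem s hy) m), Prod.fst_zero, Prod.snd_zero, map_zero]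
  rfl

theorem magL_mem (a : Fin 3 → S4 k) : magL a ∈ part k (Magic k (S4 k) (S12 k)) 0 :=
  magT_mem (triS4_mem a)

theorem magQ_mem (q : S4 k) : magQ q ∈ part k (Magic k (S4 k) (S12 k)) 0 :=
  magR_mem (triEven_mem q)

theorem magO_mem (v : Fin 2 → k) : magO v ∈ part k (Magic k (S4 k) (S12 k)) 1 :=
  magR_mem (triOdd_mem v)

theorem magI_mem (m : Fin 3) (s : S4 k) : magI m s ∈ part k (Magic k (S4 k) (S12 k)) 0 :=
  iota_mem m s evenElt_mem

theorem magK_mem (m : Fin 3) (s : S4 k) (v : Fin 2 → k) :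
    magK m s v ∈ part k (Magic k (S4 k) (S12 k)) 1 :=
  iota_mem m s (oddElt_mem v)

end Families

end SuperMagic

/-! ### Parity, skew-symmetry, and the Jacobi identity with first argument `magO v`. -/

namespace SuperMagic

section LieSuper

variable {k : Type u} [Field k] [CharP k 3]

variable (k) in
/-- The members of the five families of elements that span `𝔤(S₄, S₁₂)`, with their parity. -/
inductive IsBasic : ZMod 2 → Magic k (S4 k) (S12 k) → Prop
  | L (a : Fin 3 → S4 k) : IsBasic 0 (magL a)
  | Q (q : S4 k) : IsBasic 0 (magQ q)
  | O (v : Fin 2 → k) : IsBasic 1 (magO v)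
  | I (m : Fin 3) (s : S4 k) : IsBasic 0 (magI m s)
  | K (m : Fin 3) (s : S4 k) (v : Fin 2 → k) : IsBasic 1 (magK m s v)

theorem IsBasic.mem {i : ZMod 2} {x : Magic k (S4 k) (S12 k)} (h : IsBasic k i x) :
    x ∈ part k (Magic k (S4 k) (S12 k)) i := by
  cases h
  exacts [magL_mem _, magQ_mem _, magO_mem _, magI_mem _ _, magK_mem _ _ _]

/-- The projection to parity i followed by the quotient by the span vanishes on each of the five
families, since their members are homogeneous; hence it vanishes everywhere. -/
theorem part_eq_span (i : ZMod 2) :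
    part k (Magic k (S4 k) (S12 k)) i = Submodule.span k {x | IsBasic k i x} := by
  refine le_antisymm ?_ (Submodule.span_le.2 fun x hx => hx.mem)
  have h : (Submodule.span k {x | IsBasic k i x}).mkQ ∘ₗ pr k i = 0 := by
    have h0 {j x} (hx : IsBasic k j x) :
        ((Submodule.span k {x | IsBasic k i x}).mkQ ∘ₗ pr k i) x = 0 := by
      rw [LinearMap.comp_apply, pr_of_mem hx.mem]
      split_ifs with hij
      · subst hij
        exact (Submodule.Quotient.mk_eq_zero _).2 (Submodule.subset_span hx)
      · exact map_zero _
    exact magic_ext (fun a => h0 (.L a)) (fun q => h0 (.Q q)) (fun v => h0 (.O v))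
      (fun m s => h0 (.I m s)) (fun m s v => h0 (.K m s v))
  rintro _ ⟨x, rfl⟩
  exact (Submodule.Quotient.mk_eq_zero _).1 (LinearMap.congr_fun h x)

/-- Linear maps that agree on the homogeneous basic elements of one parity agree on the whole
component. -/
theorem eqOn_part {N : Type*} [AddCommGroup N] [Module k N]
    {f g : Magic k (S4 k) (S12 k) →ₗ[k] N} {i : ZMod 2}
    (h : ∀ x, IsBasic k i x → f x = g x) {x : Magic k (S4 k) (S12 k)}
    (hx : x ∈ part k (Magic k (S4 k) (S12 k)) i) : f x = g x := by
  rw [part_eq_span] at hx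
  exact LinearMap.eqOn_span (s := {x | IsBasic k i x}) h hx

theorem fin_three_cases (m n : Fin 3) : n = m ∨ n = m + 1 ∨ m = n + 1 := by
  revert m n; decide

omit [CharP k 3] in
theorem altForm_swap (u v : Fin 2 → k) : altForm k u v = -altForm k v u := by
  simp only [altForm_apply]
  ring

theorem form_comm_S4 (s t : S4 k) : form k s t = form k t s := by
  rw [form_S4, form_S4]
  ring

theorem rankOne_comm (u v : Fin 2 → k) : rankOne u v + rankOne v u = rankOne v u + rankOne u v :=
  add_comm _ _

theorem magL_eq_zero {a : Fin 3 → S4 k}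
    (h : ∀ m, a m 0 1 = 0 ∧ a m 1 0 = 0 ∧ a m 0 0 = a m 1 1) : magL a = 0 := by
  have : a = fun m => a m 0 0 • (1 : S4 k) := by
    funext m
    obtain ⟨h1, h2, h3⟩ := h m
    apply S4_ext <;> simp [h1, h2, h3]
  rw [this, magL_apply, triS4_one, map_zero]

/-- Scalar matrices act as zero, so in each slot only the off-diagonal entries and the difference of
the diagonal entries matter. -/
theorem magL_congr {a b : Fin 3 → S4 k}
    (h : ∀ m, a m 0 1 = b m 0 1 ∧ a m 1 0 = b m 1 0 ∧ a m 0 0 - a m 1 1 = b m 0 0 - b m 1 1) :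
    magL a = magL b := by
  rw [← sub_eq_zero, ← map_sub]
  refine magL_eq_zero fun m => ?_
  obtain ⟨h1, h2, h3⟩ := h m
  refine ⟨?_, ?_, ?_⟩ <;> simp only [Pi.sub_apply, Matrix.sub_apply]
  · rw [h1, sub_self]
  · rw [h2, sub_self]
  · linear_combination h3

/-- The sums s t̄ + t s̄ and s̄ t + t̄ s are both equal to b(s, t) 1, and scalars do not count. -/
theorem slots_swap (m : Fin 3) (s t : S4 k) : magL (slots m t s) = -magL (slots m s t) := by
  rw [← map_neg]
  refine magL_congr fun n => ?_
  obtain rfl | rfl | rfl : n = m ∨ n = m + 1 ∨ n = m + 2 := by revert m n; decide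
  all_goals
    simp [slots_self, slots_next, slots_prev, adjugate_apply, S4_mul_apply]
    try grind

theorem bracket_basic_mem {i j : ZMod 2} {x y : Magic k (S4 k) (S12 k)} (hx : IsBasic k i x)
    (hy : IsBasic k j y) : sbr k x y ∈ part k (Magic k (S4 k) (S12 k)) (i + j) := by
  have h2 : (2 : ZMod 2) = 0 := rfl
  have h11 : (1 : ZMod 2) + 1 = 0 := rfl
  have hL := magL_mem (k := k)
  have hQ := magQ_mem (k := k)
  have hO := magO_mem (k := k)
  have hI := magI_mem (k := k)
  have hK := magK_mem (k := k)
  cases hx <;> cases hy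
  case I.I m s n t | I.K m s n t _ | K.I m s _ n t | K.K m s _ n t _ =>
    obtain rfl | rfl | rfl := fin_three_cases m n <;>
      simp [I_I, I_K, K_I, K_K, I_I_next, I_K_next, K_I_next, K_K_next, I_I_prev, I_K_prev,
        K_I_prev, K_K_prev, hL, hQ, hO, hI, hK, h11, Submodule.smul_mem, sub_mem,
        -map_add]
  all_goals
    simp [L_L, L_Q, L_O, L_I, L_K, Q_L, Q_Q, Q_O, Q_I, Q_K, O_L, O_Q, O_O, O_I, O_K, I_L, I_Q, I_O,
      K_L, K_Q, K_O, hL, hQ, hO, hI, hK, h11, Submodule.smul_mem, -map_add]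

theorem bracket_basic_skew {i j : ZMod 2} {x y : Magic k (S4 k) (S12 k)} (hx : IsBasic k i x)
    (hy : IsBasic k j y) : sbr k x y = -(koszul k i j • sbr k y x) := by
  cases hx <;> cases hy <;>
    simp only [koszul_zero_left, koszul_zero_right, koszul_one_one, one_smul, neg_smul, neg_neg]
  case O.O => rw [O_O, O_O, rankOne_comm]
  case I.I m s n t | I.K m s n t _ | K.I m s _ n t | K.K m s u n t v =>
    obtain rfl | rfl | rfl := fin_three_cases m n
    all_goals
      simp only [I_I, I_K, K_I, K_K, I_I_next, I_K_next, K_I_next, K_K_next, I_I_prev, I_K_prev,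
        K_I_prev, K_K_prev, neg_neg]
    all_goals
      first
      | done
      | rw [slots_swap n s t, smul_neg, neg_neg]
      | rw [slots_swap n s t, altForm_swap v u, form_comm_S4 s t, rankOne_comm u v, neg_smul_neg]
      | rw [form_comm_S4]
  all_goals
    simp only [L_L, L_Q, L_O, L_I, L_K, Q_L, Q_Q, Q_O, Q_I, Q_K, O_L, O_Q, O_I, O_K, I_L, I_Q,
      I_O, K_L, K_Q, K_O, neg_neg, neg_zero, ← map_neg, lie_skew]

variable (k) in
/-- The bracket of `𝔤(S₄, S₁₂)` as a bilinear map. -/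
def magB : Magic k (S4 k) (S12 k) →ₗ[k] Magic k (S4 k) (S12 k) →ₗ[k] Magic k (S4 k) (S12 k) :=
  SuperBracket.bracket

section Linear

variable (x x' y y' : Magic k (S4 k) (S12 k)) (c : k)

theorem sbr_add_left : sbr k (x + x') y = sbr k x y + sbr k x' y := (magB k).map_add₂ x x' y

theorem sbr_add_right : sbr k x (y + y') = sbr k x y + sbr k x y' := (magB k x).map_add y y'

theorem sbr_sub_left : sbr k (x - x') y = sbr k x y - sbr k x' y := (magB k).map_sub₂ x x' y

theorem sbr_sub_right : sbr k x (y - y') = sbr k x y - sbr k x y' := (magB k x).map_sub y y'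

theorem sbr_smul_left : sbr k (c • x) y = c • sbr k x y := (magB k).map_smul₂ c x y

theorem sbr_smul_right : sbr k x (c • y) = c • sbr k x y := (magB k x).map_smul c y

theorem sbr_neg_left : sbr k (-x) y = -sbr k x y := (magB k).map_neg₂ x y

theorem sbr_neg_right : sbr k x (-y) = -sbr k x y := (magB k x).map_neg y

theorem sbr_zero_left : sbr k 0 y = 0 := (magB k).map_zero₂ y

theorem sbr_zero_right : sbr k x 0 = 0 := (magB k x).map_zero

end Linear

theorem part_induction {i : ZMod 2} {p : Magic k (S4 k) (S12 k) → Prop}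
    (add : ∀ x y, p x → p y → p (x + y)) (smul : ∀ (c : k) x, p x → p (c • x))
    (basic : ∀ x, IsBasic k i x → p x) {x : Magic k (S4 k) (S12 k)}
    (hx : x ∈ part k (Magic k (S4 k) (S12 k)) i) : p x := by
  have zero : p 0 := by
    obtain rfl | rfl := parity_cases i
    · simpa using smul 0 _ (basic _ (.Q 0))
    · simpa using smul 0 _ (basic _ (.O 0))
  rw [part_eq_span] at hx
  induction hx using Submodule.span_induction with
  | mem x hx => exact basic x hx
  | zero => exact zero
  | add x y _ _ hx hy => exact add x y hx hy
  | smul c x _ hx => exact smul c x hx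

theorem bracket_skew {i j : ZMod 2} {x y : Magic k (S4 k) (S12 k)}
    (hx : x ∈ part k (Magic k (S4 k) (S12 k)) i) (hy : y ∈ part k (Magic k (S4 k) (S12 k)) j) :
    sbr k x y = -(koszul k i j • sbr k y x) := by
  refine part_induction (p := fun x => sbr k x y = -(koszul k i j • sbr k y x))
    (fun x x' hx hx' => ?_) (fun c x hx => ?_) (fun x hx => ?_) hx
  · rw [sbr_add_left, sbr_add_right, hx, hx', smul_add, neg_add]
  · rw [sbr_smul_left, sbr_smul_right, hx, smul_comm, smul_neg]
  refine part_induction (p := fun y => sbr k x y = -(koszul k i j • sbr k y x))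
    (fun y y' hy hy' => ?_) (fun c y hy => ?_) (fun y hy => bracket_basic_skew hx hy) hy
  · rw [sbr_add_left, sbr_add_right, hy, hy', smul_add, neg_add]
  · rw [sbr_smul_left, sbr_smul_right, hy, smul_comm, smul_neg]

theorem bracket_mem_part {i j : ZMod 2} {x y : Magic k (S4 k) (S12 k)}
    (hx : x ∈ part k (Magic k (S4 k) (S12 k)) i) (hy : y ∈ part k (Magic k (S4 k) (S12 k)) j) :
    sbr k x y ∈ part k (Magic k (S4 k) (S12 k)) (i + j) := by
  refine part_induction (p := fun x => sbr k x y ∈ part k (Magic k (S4 k) (S12 k)) (i + j))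
    (fun x x' hx hx' => ?_) (fun c x hx => ?_) (fun x hx => ?_) hx
  · rw [sbr_add_left]
    exact add_mem hx hx'
  · rw [sbr_smul_left]
    exact Submodule.smul_mem _ c hx
  refine part_induction (p := fun y => sbr k x y ∈ part k (Magic k (S4 k) (S12 k)) (i + j))
    (fun y y' hy hy' => ?_) (fun c y hy => ?_) (fun y hy => bracket_basic_mem hx hy) hy
  · rw [sbr_add_right]
    exact add_mem hy hy'
  · rw [sbr_smul_right]
    exact Submodule.smul_mem _ c hy

variable (k) in
/-- A basis of the space of odd elements of `𝔱𝔯𝔦(S₁₂)`. -/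
def magOE (i : Fin 2) : Magic k (S4 k) (S12 k) := magO (Pi.single i 1)

/-- The elements `ιₘ(s ⊗ v)`, with `v` a basis vector. -/
def magKE (m : Fin 3) (s : S4 k) (i : Fin 2) : Magic k (S4 k) (S12 k) := magK m s (Pi.single i 1)

variable (k) in
/-- The elements `ιₘ(s ⊗ v)`, with `s` and `v` basis vectors. -/
def magKEE (m : Fin 3) (i j l : Fin 2) : Magic k (S4 k) (S12 k) :=
  magKE m (Matrix.single i j 1) l

variable (k) in
/-- The elements `ιₘ(s ⊗ 1)`, with `s` a basis vector. -/
def magIE (m : Fin 3) (i j : Fin 2) : Magic k (S4 k) (S12 k) := magI m (Matrix.single i j 1)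

variable (k) in
/-- A basis of the space of even elements of `𝔱𝔯𝔦(S₁₂)`. -/
def magQE (i j : Fin 2) : Magic k (S4 k) (S12 k) := magQ (Matrix.single i j 1)

variable (k) in
/-- Spanning elements of `𝔱𝔯𝔦(S₄)`. -/
def magLE (m : Fin 3) (i j : Fin 2) : Magic k (S4 k) (S12 k) :=
  magL (Pi.single m (Matrix.single i j 1))

theorem vector_expand (f : (Fin 2 → k) →ₗ[k] Magic k (S4 k) (S12 k)) (v : Fin 2 → k) :
    f v = v 0 • f (Pi.single 0 1) + v 1 • f (Pi.single 1 1) := by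
  rw [← map_smul, ← map_smul, ← map_add]
  congr 1
  ext i
  fin_cases i <;> simp

theorem S4_expand {V : Type*} [AddCommGroup V] [Module k V] (f : S4 k →ₗ[k] V) (s : S4 k) :
    f s = s 0 0 • f (Matrix.single 0 0 1) + s 0 1 • f (Matrix.single 0 1 1) +
      s 1 0 • f (Matrix.single 1 0 1) + s 1 1 • f (Matrix.single 1 1 1) := by
  simp only [← map_smul, ← map_add]
  congr 1
  apply S4_ext <;> simp [Matrix.single]

theorem magO_expand (v : Fin 2 → k) : magO v = v 0 • magOE k 0 + v 1 • magOE k 1 :=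
  vector_expand _ v

theorem magK_expand (m : Fin 3) (s : S4 k) (v : Fin 2 → k) :
    magK m s v = v 0 • magKE m s 0 + v 1 • magKE m s 1 := vector_expand _ v

theorem magI_expand (m : Fin 3) (s : S4 k) : magI m s = s 0 0 • magIE k m 0 0 +
    s 0 1 • magIE k m 0 1 + s 1 0 • magIE k m 1 0 + s 1 1 • magIE k m 1 1 := S4_expand _ s

theorem magQ_expand (q : S4 k) : magQ q = q 0 0 • magQE k 0 0 + q 0 1 • magQE k 0 1 +
    q 1 0 • magQE k 1 0 + q 1 1 • magQE k 1 1 := S4_expand _ q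

theorem magKE_expand (m : Fin 3) (s : S4 k) (l : Fin 2) : magKE m s l = s 0 0 • magKEE k m 0 0 l +
    s 0 1 • magKEE k m 0 1 l + s 1 0 • magKEE k m 1 0 l + s 1 1 • magKEE k m 1 1 l :=
  S4_expand ((magK m).flip (Pi.single l 1)) s

/-- A diagonal matrix with entries p, q differs from (p − q) E₀₀ by a scalar, so three elements per
slot suffice. The slot n from which the sum starts is free, so that expansions can be aligned with
the slot that occurs in a Jacobi identity. -/
theorem magL_expand (n : Fin 3) (a : Fin 3 → S4 k) : magL a =
    (a n 0 1 • magLE k n 0 1 + a n 1 0 • magLE k n 1 0 +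
      (a n 0 0 - a n 1 1) • magLE k n 0 0) +
    (a (n + 1) 0 1 • magLE k (n + 1) 0 1 + a (n + 1) 1 0 • magLE k (n + 1) 1 0 +
      (a (n + 1) 0 0 - a (n + 1) 1 1) • magLE k (n + 1) 0 0) +
    (a (n + 2) 0 1 • magLE k (n + 2) 0 1 + a (n + 2) 1 0 • magLE k (n + 2) 1 0 +
      (a (n + 2) 0 0 - a (n + 2) 1 1) • magLE k (n + 2) 0 0) := by
  simp only [magLE, ← map_smul, ← map_add]
  refine magL_congr fun m => ?_
  have h : m = n ∨ m = n + 1 ∨ m = n + 2 := by revert n m; decide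
  have h1 : n + 1 ≠ n ∧ n + 2 ≠ n ∧ n ≠ n + 1 ∧ n ≠ n + 2 ∧ n + 1 ≠ n + 2 ∧ n + 2 ≠ n + 1 := by
    clear h; revert n; decide
  obtain ⟨h1, h2, h3, h4, h5, h6⟩ := h1
  obtain rfl | rfl | rfl := h <;> simp [h1, h2, h3, h4, h5, h6, Matrix.single]

theorem fin_three_add (m : Fin 3) : m + 1 + 1 = m + 2 ∧ m + 1 + 2 = m ∧ m + 2 + 1 = m ∧
    m + 2 + 2 = m + 1 := by
  revert m; decide

section Conditional

variable {m n : Fin 3} (s t : S4 k) (u v : Fin 2 → k)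

/-- These forms of the table carry the relation between the slots as a side condition, which `simp`
can discharge after reducing sums of slots with `fin_three_add`; the original forms would require a
syntactic match. -/
theorem I_I_of_next (h : n = m + 1) :
    sbr k (magI m s) (magI n t) = magI (m + 2) (s.adjugate * t.adjugate) := by
  rw [h, I_I_next]

theorem I_I_of_prev (h : m = n + 1) :
    sbr k (magI m s) (magI n t) = -magI (n + 2) (t.adjugate * s.adjugate) := by
  rw [h, I_I_prev]

theorem I_K_of_next (h : n = m + 1) :
    sbr k (magI m s) (magK n t v) = -magK (m + 2) (s.adjugate * t.adjugate) v := by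
  rw [h, I_K_next]

theorem I_K_of_prev (h : m = n + 1) :
    sbr k (magI m s) (magK n t v) = magK (n + 2) (t.adjugate * s.adjugate) v := by
  rw [h, I_K_prev]

theorem K_I_of_next (h : n = m + 1) :
    sbr k (magK m s v) (magI n t) = -magK (m + 2) (s.adjugate * t.adjugate) v := by
  rw [h, K_I_next]

theorem K_I_of_prev (h : m = n + 1) :
    sbr k (magK m s v) (magI n t) = magK (n + 2) (t.adjugate * s.adjugate) v := by
  rw [h, K_I_prev]

theorem K_K_of_next (h : n = m + 1) :
    sbr k (magK m s u) (magK n t v) =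
      altForm k u v • magI (m + 2) (s.adjugate * t.adjugate) := by
  rw [h, K_K_next]

theorem K_K_of_prev (h : m = n + 1) :
    sbr k (magK m s u) (magK n t v) =
      altForm k v u • magI (n + 2) (t.adjugate * s.adjugate) := by
  rw [h, K_K_prev]

theorem slots_of_next (h : n = m + 1) : slots m s t n = 0 := by
  rw [h, slots_next]

theorem slots_of_prev (h : m = n + 1) : slots m s t n = -(s.adjugate * t) := by
  have h' : n = n + 1 + 2 := (fin_three_add n).2.1.symm
  rw [h]
  nth_rw 2 [h']
  rw [slots_prev]

end Conditional

/-- `magO` is one of the two families that generate the algebra, so the Jacobi identity is tested on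
it directly; for most other families it is deduced through brackets. -/
theorem jacobi_O {j l : ZMod 2} (v : Fin 2 → k) {y z : Magic k (S4 k) (S12 k)}
    (hy : IsBasic k j y) (hz : IsBasic k l z) : sbr k (magO v) (sbr k y z) =
      sbr k (sbr k (magO v) y) z + koszul k 1 j • sbr k y (sbr k (magO v) z) := by
  cases hy <;> cases hz <;>
    simp only [koszul_zero_left, koszul_zero_right, koszul_one_one, one_smul, neg_smul, neg_neg]
  case I.I m s n t | I.K m s n t _ | K.I m s _ n t | K.K m s u n t v =>
    obtain rfl | rfl | rfl := fin_three_cases m n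
    all_goals
      simp only [I_I, I_K, K_I, K_K, I_I_next, I_K_next, K_I_next, K_K_next, I_I_prev, I_K_prev,
        K_I_prev, K_K_prev, O_L, O_Q, O_O, O_I, O_K, sbr_smul_right, sbr_smul_left,
        sbr_neg_right, sbr_sub_right, sbr_zero_right, smul_zero, form_comm_S4 t s]
      -- Both sides become combinations of fixed spanning elements; comparing coefficients leaves
      -- polynomial identities in the entries, some of which hold only modulo 3.
      simp only [magO_expand, magK_expand, magQ_expand, altForm_apply, evenAct_apply, rankOne,
        Matrix.trace_fin_two, Matrix.add_apply, Matrix.of_apply, Matrix.cons_val_zero,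
        Matrix.cons_val_one, Matrix.cons_val']
      try match_scalars <;> grind
  all_goals
    simp only [L_L, L_Q, L_O, L_I, L_K, Q_L, Q_Q, Q_O, Q_I, Q_K, O_L, O_Q, O_O, O_I, O_K, I_L, I_Q,
      I_O, K_L, K_Q, K_O, sbr_smul_left, sbr_smul_right,
        sbr_neg_left, sbr_neg_right, sbr_sub_left, sbr_sub_right, sbr_zero_left, sbr_zero_right, smul_zero]
    try simp only [magO_expand, magK_expand, magQ_expand, altForm_apply, evenAct_apply, rankOne,
        Matrix.trace_fin_two, Matrix.add_apply, Matrix.of_apply, Matrix.cons_val_zero,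
        Matrix.cons_val_one, Matrix.cons_val', Ring.lie_def, Matrix.sub_apply, S4_mul_apply]
    try match_scalars <;> grind

end LieSuper

end SuperMagic

/-! ### The Jacobi identity with first argument ιₘ(s ⊗ 1). -/

namespace SuperMagic

section JacobiI

variable {k : Type u} [Field k] [CharP k 3]

theorem fin_three_cases' (m n : Fin 3) : m = n ∨ n = m + 1 ∨ n = m + 2 := by
  revert m n; decide

theorem fin_three_ne (m : Fin 3) : m ≠ m + 1 ∧ m ≠ m + 2 ∧ m + 1 ≠ m ∧ m + 1 ≠ m + 2 ∧
    m + 2 ≠ m ∧ m + 2 ≠ m + 1 := by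
  revert m; decide

theorem form_S4_apply (s t : S4 k) :
    form k s t = s 0 0 * t 1 1 + s 1 1 * t 0 0 - s 0 1 * t 1 0 - s 1 0 * t 0 1 := by
  rw [form_S4]
  ring

/-- The Jacobi identity for `x`, `y`, `z` follows from the one for `x`, `z`, `y`. -/
theorem jacobi_swap {i j l : ZMod 2} {x y z : Magic k (S4 k) (S12 k)}
    (hx : x ∈ part k (Magic k (S4 k) (S12 k)) i) (hy : y ∈ part k (Magic k (S4 k) (S12 k)) j)
    (hz : z ∈ part k (Magic k (S4 k) (S12 k)) l)
    (h : sbr k x (sbr k z y) = sbr k (sbr k x z) y + koszul k i l • sbr k z (sbr k x y)) :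
    sbr k x (sbr k y z) = sbr k (sbr k x y) z + koszul k i j • sbr k y (sbr k x z) := by
  rw [bracket_skew hy hz, sbr_neg_right, sbr_smul_right, h,
    bracket_skew (bracket_mem_part hx hy) hz, bracket_skew hy (bracket_mem_part hx hz)]
  obtain rfl | rfl := parity_cases i <;> obtain rfl | rfl := parity_cases j <;>
    obtain rfl | rfl := parity_cases l <;>
    simp only [koszul_zero_left, koszul_zero_right, koszul_one_one, one_add_one_parity, add_zero,
      zero_add] <;> module

-- The first argument is even, so no signs occur. Up to interchanging the last two arguments by
-- `jacobi_swap` there are three cases: the second argument lies in 𝔱𝔯𝔦(S₄) or 𝔱𝔯𝔦(S₁₂) (this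
-- lemma); it is some ιₙ(t ⊗ 1) and the third lies in some ιₚ (`jacobi_I_I`); both are odd elements
-- of the ιₙ and ιₚ (`jacobi_I_K_K`). All slots are expressed relative to m.
set_option maxHeartbeats 4000000 in
theorem jacobi_I_tri {l : ZMod 2} (m : Fin 3) (s : S4 k) {d z : Magic k (S4 k) (S12 k)}
    (hd : (∃ a, d = magL a) ∨ (∃ q, d = magQ q) ∨ ∃ v, d = magO v) (hz : IsBasic k l z) :
    sbr k (magI m s) (sbr k d z) =
      sbr k (sbr k (magI m s) d) z + sbr k d (sbr k (magI m s) z) := by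
  obtain ⟨h1, h2, h3, h4⟩ := fin_three_add m
  obtain ⟨a, rfl⟩ | ⟨q, rfl⟩ | ⟨u, rfl⟩ := hd <;> cases hz
  case' inl.I p r | inl.K p r v | inr.inl.I p r | inr.inl.K p r v | inr.inr.I p r |
      inr.inr.K p r v => obtain rfl | rfl | rfl := fin_three_cases' m p
  all_goals
    simp only [L_L, L_Q, L_O, L_I, L_K, Q_L, Q_Q, Q_O, Q_I, Q_K, O_L, O_Q, O_O, O_I, O_K, I_L,
      I_Q, I_O, K_L, K_Q, K_O, I_I, I_I_of_next, I_I_of_prev, I_K, I_K_of_next, I_K_of_prev, K_I,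
      K_I_of_next, K_I_of_prev, K_K, K_K_of_next, K_K_of_prev, sbr_neg_left, sbr_neg_right,
      sbr_smul_left, sbr_smul_right, sbr_sub_left, sbr_sub_right, sbr_zero_left, sbr_zero_right,
      smul_zero, neg_zero, add_zero, zero_add, h1, h2, h3, h4]
    try simp only [magO_expand, magK_expand, magKE_expand, magI_expand, magQ_expand, magL_expand
      m, form_S4_apply, biaction_apply_apply, S4_mul_apply, adjugate_apply, Matrix.trace_fin_two,
      altForm_apply, evenAct_apply, rankOne, slots_self, slots_of_next, slots_of_prev, h1, h2, h3,
      h4, Matrix.zero_apply, Matrix.neg_apply, Matrix.add_apply, Matrix.sub_apply, Ring.lie_def,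
      Pi.sub_apply, Pi.mul_apply, Matrix.of_apply, Matrix.cons_val_zero, Matrix.cons_val_one,
      Matrix.cons_val']
    first
    | done
    | clear h1 h2 h3 h4
      match_scalars <;> grind

set_option maxHeartbeats 4000000 in
theorem jacobi_I_I {l : ZMod 2} (m : Fin 3) (s : S4 k) (n : Fin 3) (t : S4 k)
    {z : Magic k (S4 k) (S12 k)} (hz : (∃ p r, z = magI p r) ∨ ∃ p r v, z = magK p r v) :
    sbr k (magI m s) (sbr k (magI n t) z) =
      sbr k (sbr k (magI m s) (magI n t)) z + sbr k (magI n t) (sbr k (magI m s) z) := by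
  obtain ⟨h1, h2, h3, h4⟩ := fin_three_add m
  obtain ⟨p, r, rfl⟩ | ⟨p, r, v, rfl⟩ := hz <;>
    obtain rfl | rfl | rfl := fin_three_cases' m n <;>
    obtain rfl | rfl | rfl := fin_three_cases' m p
  all_goals
    simp only [L_L, L_Q, L_O, L_I, L_K, Q_L, Q_Q, Q_O, Q_I, Q_K, O_L, O_Q, O_O, O_I, O_K, I_L,
      I_Q, I_O, K_L, K_Q, K_O, I_I, I_I_of_next, I_I_of_prev, I_K, I_K_of_next, I_K_of_prev, K_I,
      K_I_of_next, K_I_of_prev, K_K, K_K_of_next, K_K_of_prev, sbr_neg_left, sbr_neg_right,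
      sbr_smul_left, sbr_smul_right, sbr_sub_left, sbr_sub_right, sbr_zero_left, sbr_zero_right,
      smul_zero, neg_zero, add_zero, zero_add, h1, h2, h3, h4]
    try simp only [magO_expand, magK_expand, magKE_expand, magI_expand, magQ_expand, magL_expand
      m, form_S4_apply, biaction_apply_apply, S4_mul_apply, adjugate_apply, Matrix.trace_fin_two,
      altForm_apply, evenAct_apply, rankOne, slots_self, slots_of_next, slots_of_prev, h1, h2, h3,
      h4, Matrix.zero_apply, Matrix.neg_apply, Matrix.add_apply, Matrix.sub_apply, Ring.lie_def,
      Pi.sub_apply, Pi.mul_apply, Matrix.of_apply, Matrix.cons_val_zero, Matrix.cons_val_one,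
      Matrix.cons_val']
    clear h1 h2 h3 h4
    match_scalars <;> grind

set_option maxHeartbeats 4000000 in
theorem jacobi_I_K_K (m : Fin 3) (s : S4 k) (n : Fin 3) (t : S4 k) (u : Fin 2 → k)
    (p : Fin 3) (r : S4 k) (v : Fin 2 → k) :
    sbr k (magI m s) (sbr k (magK n t u) (magK p r v)) =
      sbr k (sbr k (magI m s) (magK n t u)) (magK p r v) +
        sbr k (magK n t u) (sbr k (magI m s) (magK p r v)) := by
  obtain ⟨h1, h2, h3, h4⟩ := fin_three_add m
  obtain rfl | rfl | rfl := fin_three_cases' m n <;>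
    obtain rfl | rfl | rfl := fin_three_cases' m p
  all_goals
    simp only [L_L, L_Q, L_O, L_I, L_K, Q_L, Q_Q, Q_O, Q_I, Q_K, O_L, O_Q, O_O, O_I, O_K, I_L,
      I_Q, I_O, K_L, K_Q, K_O, I_I, I_I_of_next, I_I_of_prev, I_K, I_K_of_next, I_K_of_prev, K_I,
      K_I_of_next, K_I_of_prev, K_K, K_K_of_next, K_K_of_prev, sbr_neg_left, sbr_neg_right,
      sbr_smul_left, sbr_smul_right, sbr_sub_left, sbr_sub_right, sbr_zero_left, sbr_zero_right,
      smul_zero, neg_zero, add_zero, zero_add, h1, h2, h3, h4]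
    try simp only [magO_expand, magK_expand, magKE_expand, magI_expand, magQ_expand, magL_expand
      m, form_S4_apply, biaction_apply_apply, S4_mul_apply, adjugate_apply, Matrix.trace_fin_two,
      altForm_apply, evenAct_apply, rankOne, slots_self, slots_of_next, slots_of_prev, h1, h2, h3,
      h4, Matrix.zero_apply, Matrix.neg_apply, Matrix.add_apply, Matrix.sub_apply, Ring.lie_def,
      Pi.sub_apply, Pi.mul_apply, Matrix.of_apply, Matrix.cons_val_zero, Matrix.cons_val_one,
      Matrix.cons_val']
    clear h1 h2 h3 h4
    match_scalars <;> grind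

end JacobiI

end SuperMagic

/-! ### From generators to the full Jacobi identity, and the cube condition. -/

namespace SuperMagic

section LieSuper

variable {k : Type u} [Field k] [CharP k 3]

/-- The Jacobi identity with a fixed first argument `x` of parity `i`. -/
def Jacobi (i : ZMod 2) (x : Magic k (S4 k) (S12 k)) : Prop :=
  ∀ j, ∀ y ∈ part k (Magic k (S4 k) (S12 k)) j, ∀ z,
    sbr k x (sbr k y z) = sbr k (sbr k x y) z + koszul k i j • sbr k y (sbr k x z)

theorem jacobi_of_isBasic {i : ZMod 2} {x : Magic k (S4 k) (S12 k)}
    (h : ∀ j l y z, IsBasic k j y → IsBasic k l z →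
      sbr k x (sbr k y z) = sbr k (sbr k x y) z + koszul k i j • sbr k y (sbr k x z)) :
    Jacobi i x := by
  intro j y hy z
  refine part_induction (p := fun y => sbr k x (sbr k y z) =
    sbr k (sbr k x y) z + koszul k i j • sbr k y (sbr k x z)) (fun y y' hy hy' => ?_)
    (fun c y hy => ?_) (fun y hy => ?_) hy
  · simp only [sbr_add_left, sbr_add_right, hy, hy']
    module
  · simp only [sbr_smul_left, sbr_smul_right, hy]
    module
  rw [← Superspace.proj_add (k := k) z]
  have h2 (l : ZMod 2) {z} (hz : z ∈ part k (Magic k (S4 k) (S12 k)) l) : sbr k x (sbr k y z) =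
      sbr k (sbr k x y) z + koszul k i j • sbr k y (sbr k x z) := by
    refine part_induction (p := fun z => sbr k x (sbr k y z) =
      sbr k (sbr k x y) z + koszul k i j • sbr k y (sbr k x z)) (fun z z' hz hz' => ?_)
      (fun c z hz => ?_) (fun z hz => h j l y z hy hz) hz
    · simp only [sbr_add_right, hz, hz']
      module
    · simp only [sbr_smul_right, hz]
      module
  simp only [sbr_add_right, h2 0 (pr_mem k 0 z), h2 1 (pr_mem k 1 z)]
  module

theorem jacobi_magO (v : Fin 2 → k) : Jacobi 1 (magO v) :=
  jacobi_of_isBasic fun _ _ _ _ hy hz => jacobi_O v hy hz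

theorem jacobi_magI (m : Fin 3) (s : S4 k) : Jacobi 0 (magI m s) := by
  refine jacobi_of_isBasic fun j l y z hy hz => ?_
  have tri {l : ZMod 2} {d z : Magic k (S4 k) (S12 k)}
    (hd : (∃ a, d = magL a) ∨ (∃ q, d = magQ q) ∨ ∃ v, d = magO v) (hz : IsBasic k l z) := 
    jacobi_I_tri m s hd hz
  have hI := magI_mem m s
  have hy' := hy
  have hz' := hz
  rw [koszul_zero_left, one_smul]
  have swap (h : sbr k (magI m s) (sbr k z y) =
      sbr k (sbr k (magI m s) z) y + sbr k z (sbr k (magI m s) y)) :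
      sbr k (magI m s) (sbr k y z) =
        sbr k (sbr k (magI m s) y) z + sbr k y (sbr k (magI m s) z) := by
    have := jacobi_swap hI hy.mem hz.mem (by rw [koszul_zero_left, one_smul, h])
    rwa [koszul_zero_left, one_smul] at this
  cases hy' with
  | L a => exact tri (.inl ⟨a, rfl⟩) hz
  | Q q => exact tri (.inr (.inl ⟨q, rfl⟩)) hz
  | O v => exact tri (.inr (.inr ⟨v, rfl⟩)) hz
  | I n t =>
    cases hz' with
    | L a => exact swap (tri (.inl ⟨a, rfl⟩) hy)
    | Q q => exact swap (tri (.inr (.inl ⟨q, rfl⟩)) hy)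
    | O v => exact swap (tri (.inr (.inr ⟨v, rfl⟩)) hy)
    | I p r => exact jacobi_I_I (l := 0) m s n t (.inl ⟨p, r, rfl⟩)
    | K p r v => exact jacobi_I_I (l := 1) m s n t (.inr ⟨p, r, v, rfl⟩)
  | K n t u =>
    cases hz' with
    | L a => exact swap (tri (.inl ⟨a, rfl⟩) hy)
    | Q q => exact swap (tri (.inr (.inl ⟨q, rfl⟩)) hy)
    | O v => exact swap (tri (.inr (.inr ⟨v, rfl⟩)) hy)
    | I p r => exact swap (jacobi_I_I (l := 1) m s p r (.inr ⟨n, t, u, rfl⟩))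
    | K p r v => exact jacobi_I_K_K m s n t u p r v

theorem Jacobi.add {i : ZMod 2} {x y : Magic k (S4 k) (S12 k)} (hx : Jacobi i x)
    (hy : Jacobi i y) : Jacobi i (x + y) := by
  intro j z hz w
  simp only [sbr_add_left, sbr_add_right, hx j z hz w, hy j z hz w]
  module

theorem Jacobi.smul {i : ZMod 2} {x : Magic k (S4 k) (S12 k)} (hx : Jacobi i x) (c : k) :
    Jacobi i (c • x) := by
  intro j z hz w
  simp only [sbr_smul_left, sbr_smul_right, hx j z hz w]
  module

/-- The Jacobi identity is inherited by brackets. -/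
theorem Jacobi.bracket {i j : ZMod 2} {x y : Magic k (S4 k) (S12 k)} (hx : Jacobi i x)
    (hy : Jacobi j y) (hxm : x ∈ part k (Magic k (S4 k) (S12 k)) i)
    (hym : y ∈ part k (Magic k (S4 k) (S12 k)) j) :
    Jacobi (i + j) (sbr k x y) := by
  intro l z hz w
  -- The identity for x says that ad [x, y] is the supercommutator of ad x and ad y; a
  -- supercommutator of superderivations is again a superderivation.
  have e (w) : sbr k (sbr k x y) w =
      sbr k x (sbr k y w) - koszul k i j • sbr k y (sbr k x w) := by
    rw [hx j y hym w, add_sub_cancel_right]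
  have hyz : sbr k y z ∈ part k (Magic k (S4 k) (S12 k)) (j + l) := bracket_mem_part hym hz
  have hxz : sbr k x z ∈ part k (Magic k (S4 k) (S12 k)) (i + l) := bracket_mem_part hxm hz
  rw [e, e, hy l z hz w, sbr_add_right, sbr_smul_right, hx _ _ hyz w, hx l z hz (sbr k y w),
    hx l z hz w, sbr_add_right, sbr_smul_right, hy _ _ hxz w, hy l z hz (sbr k x w), e,
    sbr_sub_left, sbr_sub_right, sbr_smul_left, sbr_smul_right]
  obtain rfl | rfl := parity_cases i <;> obtain rfl | rfl := parity_cases j <;>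
    obtain rfl | rfl := parity_cases l <;>
    simp only [koszul_zero_left, koszul_zero_right, koszul_one_one, one_add_one_parity, add_zero,
      zero_add] <;> module

/-- The adjugate of Eᵢᵢ is Eⱼⱼ and that of Eᵢⱼ is −Eᵢⱼ. So Eᵢⱼ adj(Eᵢᵢ) = Eᵢⱼ while adj(Eᵢⱼ) Eᵢᵢ =
0, and this choice of s and t isolates a single 𝔰𝔩₂. -/
theorem slots_upper (m : Fin 3) (i j : Fin 2) (hij : i ≠ j) :
    slots m (Matrix.single i j (1 : k)) (Matrix.single i i 1) =
      Pi.single m (-Matrix.single i j 1) := by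
  ext1 n
  obtain rfl | rfl | rfl := fin_three_cases' m n
  · rw [slots_self, Pi.single_eq_same]
    fin_cases i <;> fin_cases j <;> first | exact absurd rfl hij | skip
    all_goals
      apply S4_ext <;> simp [S4_mul_apply, adjugate_apply, Matrix.single]
  · rw [slots_next, Pi.single_eq_of_ne (fin_three_ne m).2.2.1]
  · rw [slots_prev, Pi.single_eq_of_ne (fin_three_ne m).2.2.2.2.1]
    fin_cases i <;> fin_cases j <;> first | exact absurd rfl hij | skip
    all_goals
      apply S4_ext <;> simp [S4_mul_apply, adjugate_apply, Matrix.single]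

/-- The off-diagonal elements of `𝔱𝔯𝔦(S₄)` are brackets. -/
theorem magLE_eq_bracket (m : Fin 3) (i j : Fin 2) (hij : i ≠ j) : magLE k m i j =
    sbr k (magI m (Matrix.single i j 1)) (magI m (Matrix.single i i 1)) := by
  rw [I_I, slots_upper m i j hij, Pi.single_neg, map_neg, magLE, smul_neg, ← neg_smul]
  have : (-2 : k) = 1 := by linear_combination -three_eq_zero k
  rw [this, one_smul]

/-- The diagonal elements of `𝔱𝔯𝔦(S₄)` are brackets. -/
theorem magLE_diag_eq_bracket (m : Fin 3) :
    magLE k m 0 0 = (2 : k) • sbr k (magLE k m 0 1) (magLE k m 1 0) := by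
  rw [magLE, magLE, magLE, L_L, ← map_smul]
  -- [E₀₁, E₁₀] = E₀₀ − E₁₁ has diagonal difference 2, and 2 · 2 = 1 is the diagonal difference of
  -- E₀₀.
  refine magL_congr fun n => ?_
  obtain rfl | h := eq_or_ne n m
  · simp [Ring.lie_def, S4_mul_apply, Matrix.single]
    linear_combination -three_eq_zero k
  · simp [Ring.lie_def, h]

theorem magQ_one (c : k) : magQ (c • (1 : S4 k)) = 0 := by
  have h : evenDer (c • (1 : S4 k)) = 0 := by
    refine LinearMap.ext fun y => ?_
    apply S12_ext <;> simp [evenDer_apply_fst, evenDer_apply_snd] <;> grind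
  have h' : triEven (c • (1 : S4 k)) = 0 := Subtype.ext <| funext fun m => h
  rw [magQ_apply, h', map_zero]

/-- In 𝔬𝔰𝔭(1,2) the brackets of odd elements span the even part. The constants, here and in the next
two lemmas, arise from reduction modulo 3 and modulo scalar matrices. -/
theorem magQE_upper : magQE k 0 1 = (2 : k) • sbr k (magOE k 0) (magOE k 0) := by
  rw [magQE, magOE, O_O, ← map_smul]
  congr 1
  apply S4_ext <;> simp [rankOne, Matrix.single] <;> grind

theorem magQE_lower : magQE k 1 0 = sbr k (magOE k 1) (magOE k 1) := by
  rw [magQE, magOE, O_O]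
  congr 1
  apply S4_ext <;> simp [rankOne, Matrix.single] <;> grind

theorem magQE_diag : magQE k 0 0 = sbr k (magOE k 0) (magOE k 1) ∧
    magQE k 1 1 = (2 : k) • sbr k (magOE k 0) (magOE k 1) := by
  constructor
  · rw [magQE, magOE, magOE, O_O, ← sub_eq_zero, ← map_sub, ← magQ_one (2 : k)]
    congr 1
    apply S4_ext <;> simp [rankOne, Matrix.single] <;> grind
  · rw [magQE, magOE, magOE, O_O, ← map_smul, ← sub_eq_zero, ← map_sub, ← magQ_one (2 : k)]
    congr 1
    apply S4_ext <;> simp [rankOne, Matrix.single] <;> grind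

/-- Every family comes from `magO` and `magI`: brackets of `magO` with itself give `magQ`, brackets
of `magO` with `magI` give `magK`, and brackets within a single ιₘ(S₄ ⊗ 1) give the off-diagonal
part of the m-th 𝔰𝔩₂, whose bracket gives the diagonal part. -/
theorem jacobi_isBasic {i : ZMod 2} {x : Magic k (S4 k) (S12 k)} (h : IsBasic k i x) :
    Jacobi i x := by
  have hOO (i j : Fin 2) : Jacobi 0 (sbr k (magOE k i) (magOE k j)) := by
    have h := (jacobi_magO (Pi.single i 1 : Fin 2 → k)).bracket (jacobi_magO (Pi.single j 1))
      (magO_mem _) (magO_mem _)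
    rwa [one_add_one_parity] at h
  have hLE (m : Fin 3) (i j : Fin 2) (hij : i ≠ j) : Jacobi 0 (magLE k m i j) := by
    rw [magLE_eq_bracket m i j hij]
    have h := (jacobi_magI m (Matrix.single i j (1 : k))).bracket
      (jacobi_magI m (Matrix.single i i 1)) (magI_mem m _) (magI_mem m _)
    rwa [add_zero] at h
  have hLD (m : Fin 3) : Jacobi 0 (magLE k m 0 0) := by
    rw [magLE_diag_eq_bracket m]
    have h := (hLE m 0 1 (by decide)).bracket (hLE m 1 0 (by decide)) (magL_mem _) (magL_mem _)
    rw [add_zero] at h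
    exact h.smul _
  cases h with
  | L a =>
    have h (m : Fin 3) : Jacobi 0 (a m 0 1 • magLE k m 0 1 + a m 1 0 • magLE k m 1 0 +
        (a m 0 0 - a m 1 1) • magLE k m 0 0) :=
      (((hLE m 0 1 (by decide)).smul (a m 0 1)).add
        ((hLE m 1 0 (by decide)).smul (a m 1 0))).add ((hLD m).smul (a m 0 0 - a m 1 1))
    rw [magL_expand 0]
    exact ((h 0).add (h (0 + 1))).add (h (0 + 2))
  | Q q =>
    rw [magQ_expand, magQE_upper, magQE_lower, magQE_diag.1, magQE_diag.2]
    exact ((((hOO 0 1).smul _).add (((hOO 0 0).smul _).smul _)).add ((hOO 1 1).smul _)).add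
      (((hOO 0 1).smul _).smul _)
  | O v => exact jacobi_magO v
  | I m s => exact jacobi_magI m s
  | K m s v =>
    rw [← O_I]
    have h := (jacobi_magO v).bracket (jacobi_magI m s) (magO_mem v) (magI_mem m s)
    rwa [add_zero] at h

theorem jacobi {i : ZMod 2} {x : Magic k (S4 k) (S12 k)}
    (hx : x ∈ part k (Magic k (S4 k) (S12 k)) i) : Jacobi i x :=
  part_induction (fun _ _ hx hy => hx.add hy) (fun c _ hx => hx.smul c)
    (fun _ hx => jacobi_isBasic hx) hx

/-- The Jacobi identity gives 2[x, [x, y]] + [y, [x, x]] = 0 for odd x and y, so the mixed terms in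
the cube of a sum vanish and the cube is additive. For the two odd families it vanishes because ⟨v |
v⟩ = 0. In characteristic 3 the Jacobi identity alone does not yield this. -/
theorem cube_eq_zero {x : Magic k (S4 k) (S12 k)}
    (hx : x ∈ part k (Magic k (S4 k) (S12 k)) 1) : sbr k x (sbr k x x) = 0 := by
  refine (part_induction (i := 1) (p := fun x => x ∈ part k (Magic k (S4 k) (S12 k)) 1 ∧
    sbr k x (sbr k x x) = 0) ?_ ?_ ?_ hx).2
  · rintro x y ⟨hx, hx'⟩ ⟨hy, hy'⟩
    refine ⟨add_mem hx hy, ?_⟩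
    have h1 : sbr k y x = sbr k x y := by
      rw [bracket_skew hy hx, koszul_one_one, neg_smul, one_smul, neg_neg]
    have h2 := jacobi hx 1 x hx y
    have h3 := jacobi hy 1 y hy x
    have hxx := bracket_mem_part hx hx
    have hyy := bracket_mem_part hy hy
    rw [one_add_one_parity] at hxx hyy
    rw [bracket_skew hxx hy, koszul_zero_left, one_smul, koszul_one_one] at h2
    rw [bracket_skew hyy hx, koszul_zero_left, one_smul, koszul_one_one, h1] at h3
    simp only [sbr_add_left, sbr_add_right, hx', hy', h1]
    linear_combination (norm := module) h2 + h3
  · rintro c x ⟨hx, hx'⟩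
    refine ⟨Submodule.smul_mem _ c hx, ?_⟩
    simp only [sbr_smul_left, sbr_smul_right, hx', smul_zero]
  · intro x hx
    refine ⟨hx.mem, ?_⟩
    cases hx with
    | O v =>
      rw [O_O, O_Q, neg_eq_zero, ← map_zero magO]
      congr 1
      ext i
      fin_cases i <;> simp [evenAct_apply, rankOne] <;> grind
    | K m s v =>
      have h : altForm k v v = 0 := by
        rw [altForm_apply]
        ring
      rw [K_K, h, zero_smul, zero_sub, sbr_neg_right, sbr_smul_right, K_Q, smul_neg, neg_neg]
      have : evenAct (rankOne v v + rankOne v v) v = 0 := by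
        ext i
        fin_cases i <;> simp [evenAct_apply, rankOne] <;> grind
      rw [this, map_zero, smul_zero]

theorem isLieSuperalgebra_magic : IsLieSuperalgebra k (Magic k (S4 k) (S12 k)) where
  bracket_mem _ _ _ hx _ hy := bracket_mem_part hx hy
  skew _ _ _ hx _ hy := bracket_skew hx hy
  jacobi _ j _ hx y hy z := jacobi hx j y hy z
  cube _ hx := cube_eq_zero hx

end LieSuper

end SuperMagic

namespace SuperMagic

/-! ### Coordinates on `𝔤(S₄, S₁₂)` -/

section Coordinates

variable {k : Type u} [Field k] [CharP k 3]

variable (k) in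
/-- The projection onto `𝔱𝔯𝔦(S₄)`. -/
def projT : Magic k (S4 k) (S12 k) →ₗ[k] tri k (S4 k) :=
  LinearMap.fst k (tri k (S4 k)) (tri k (S12 k)) ∘ₗ
    LinearMap.fst k (tri k (S4 k) × tri k (S12 k)) (Fin 3 → S4 k ⊗[k] S12 k)

variable (k) in
/-- The projection onto `𝔱𝔯𝔦(S₁₂)`. -/
def projR : Magic k (S4 k) (S12 k) →ₗ[k] tri k (S12 k) :=
  LinearMap.snd k (tri k (S4 k)) (tri k (S12 k)) ∘ₗ
    LinearMap.fst k (tri k (S4 k) × tri k (S12 k)) (Fin 3 → S4 k ⊗[k] S12 k)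

variable (k) in
/-- The projection onto `ιₘ(S₄ ⊗ S₁₂)`. -/
def projIota (m : Fin 3) : Magic k (S4 k) (S12 k) →ₗ[k] S4 k ⊗[k] S12 k :=
  LinearMap.proj m ∘ₗ
    LinearMap.snd k (tri k (S4 k) × tri k (S12 k)) (Fin 3 → S4 k ⊗[k] S12 k)

theorem magic_eq_sum (X : Magic k (S4 k) (S12 k)) :
    X = magT (projT k X) + magR (projR k X) + ∑ m, iota m (projIota k m X) := magic_eq X

/-- Contraction of `S₄ ⊗ S₁₂` with a linear form on `S₁₂`. -/
def contractRight (f : S12 k →ₗ[k] k) : S4 k ⊗[k] S12 k →ₗ[k] S4 k :=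
  (TensorProduct.rid k (S4 k)).toLinearMap ∘ₗ TensorProduct.map LinearMap.id f

omit [CharP k 3] in
theorem contractRight_tmul (f : S12 k →ₗ[k] k) (s : S4 k) (y : S12 k) :
    contractRight f (s ⊗ₜ y) = f y • s := by
  simp [contractRight]

variable (k) in
/-- The matrix coordinates of the component in `𝔱𝔯𝔦(S₄)`. -/
def coordL (m : Fin 3) : Magic k (S4 k) (S12 k) →ₗ[k] S4 k :=
  leftCoord ∘ₗ LinearMap.proj m ∘ₗ (tri k (S4 k)).subtype ∘ₗ projT k

variable (k) in
/-- The matrix coordinates of the even component in `𝔱𝔯𝔦(S₁₂)`. -/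
def coordQ : Magic k (S4 k) (S12 k) →ₗ[k] S4 k :=
  evenCoord ∘ₗ LinearMap.proj 0 ∘ₗ (tri k (S12 k)).subtype ∘ₗ projR k ∘ₗ
    (pr k 0 : Magic k (S4 k) (S12 k) →ₗ[k] Magic k (S4 k) (S12 k))

variable (k) in
/-- The coordinates of the odd component in `𝔱𝔯𝔦(S₁₂)`. -/
def coordO : Magic k (S4 k) (S12 k) →ₗ[k] (Fin 2 → k) :=
  LinearMap.snd k k (Fin 2 → k) ∘ₗ LinearMap.applyₗ evenElt ∘ₗ LinearMap.proj 0 ∘ₗ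
    (tri k (S12 k)).subtype ∘ₗ projR k ∘ₗ
    (pr k 1 : Magic k (S4 k) (S12 k) →ₗ[k] Magic k (S4 k) (S12 k))

variable (k) in
/-- The coordinates of the even component in `ιₘ(S₄ ⊗ S₁₂)`. -/
def coordI (m : Fin 3) : Magic k (S4 k) (S12 k) →ₗ[k] S4 k :=
  contractRight (LinearMap.fst k k (Fin 2 → k)) ∘ₗ projIota k m

variable (k) in
/-- The coordinates of the odd component in `ιₘ(S₄ ⊗ S₁₂)`. -/
def coordK (m : Fin 3) (i : Fin 2) : Magic k (S4 k) (S12 k) →ₗ[k] S4 k :=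
  contractRight (LinearMap.proj i ∘ₗ LinearMap.snd k k (Fin 2 → k)) ∘ₗ projIota k m

theorem magT_projT (X : Magic k (S4 k) (S12 k)) :
    magT (projT k X) = magL fun m => coordL k m X := by
  rw [magL_apply]
  exact congr_arg magT (triS4_leftCoord (projT k X)).symm

theorem magR_projR (X : Magic k (S4 k) (S12 k)) :
    magR (projR k X) = magQ (coordQ k X) + magO (coordO k X) := by
  rw [magQ_apply, magO_apply, ← map_add]
  exact congr_arg magR (tri_S12_eq (projR k X)).symm

theorem tensor_eq (z : S4 k ⊗[k] S12 k) :
    z = contractRight (LinearMap.fst k k (Fin 2 → k)) z ⊗ₜ evenElt +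
      ∑ i, contractRight (LinearMap.proj i ∘ₗ LinearMap.snd k k (Fin 2 → k)) z ⊗ₜ
        oddElt (Pi.single i 1) := by
  induction z with
  | zero => simp
  | add x y hx hy =>
    nth_rw 1 [hx, hy]
    simp only [map_add, add_tmul, Finset.sum_add_distrib]
    abel
  | tmul s y =>
    simp only [contractRight_tmul, Fin.sum_univ_two, smul_tmul, ← tmul_add, ← map_smul]
    congr 1
    nth_rw 1 [S12_eq y]
    rw [← map_add]
    congr 2
    ext i
    fin_cases i <;> simp

theorem iota_projIota (m : Fin 3) (X : Magic k (S4 k) (S12 k)) :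
    iota m (projIota k m X) =
      magI m (coordI k m X) + (magKE m (coordK k m 0 X) 0 + magKE m (coordK k m 1 X) 1) := by
  nth_rw 1 [tensor_eq (projIota k m X)]
  rw [map_add, map_sum, Fin.sum_univ_two]
  rfl

/-- Every element of `𝔤(S₄, S₁₂)` in terms of its coordinates. -/
theorem eq_sum_coord (X : Magic k (S4 k) (S12 k)) :
    X = magL (fun m => coordL k m X) + (magQ (coordQ k X) + magO (coordO k X)) +
      ∑ m, (magI m (coordI k m X) + (magKE m (coordK k m 0 X) 0 + magKE m (coordK k m 1 X) 1)) := by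
  simp only [← iota_projIota, ← magR_projR, ← magT_projT]
  exact magic_eq_sum X

theorem coordL_magL (m : Fin 3) (a : Fin 3 → S4 k) :
    coordL k m (magL a) = a m + (a m).trace • (1 : S4 k) := by
  change leftCoord (biaction (a m) (a (m + 2))) = _
  exact leftCoord_biaction _ _

theorem coordL_of_projT {X : Magic k (S4 k) (S12 k)} (h : projT k X = 0) (m : Fin 3) :
    coordL k m X = 0 := by
  change leftCoord ((projT k X).1 m) = 0
  rw [h]
  exact map_zero leftCoord

theorem coordQ_of_projR {X : Magic k (S4 k) (S12 k)} (h : projR k X = 0) : coordQ k X = 0 := by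
  change evenCoord ((pr k 0 (projR k X)).1 0) = 0
  rw [h, map_zero]
  exact map_zero evenCoord

theorem coordO_of_projR {X : Magic k (S4 k) (S12 k)} (h : projR k X = 0) : coordO k X = 0 := by
  change ((pr k 1 (projR k X)).1 0 evenElt).2 = 0
  rw [h, map_zero]
  rfl

theorem coordI_of_projIota {X : Magic k (S4 k) (S12 k)} {m : Fin 3} (h : projIota k m X = 0) :
    coordI k m X = 0 := by
  change contractRight _ (projIota k m X) = 0
  rw [h, map_zero]

theorem coordK_of_projIota {X : Magic k (S4 k) (S12 k)} {m : Fin 3} (h : projIota k m X = 0)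
    (i : Fin 2) : coordK k m i X = 0 := by
  change contractRight _ (projIota k m X) = 0
  rw [h, map_zero]

theorem coordQ_magQ (q : S4 k) : coordQ k (magQ q) = q + q.trace • (1 : S4 k) := by
  change evenCoord ((pr k 0 (triEven q)).1 0) = _
  rw [mem_part.1 (triEven_mem q)]
  change evenCoord (evenDer q) = _
  apply S4_ext <;> simp [evenCoord, evenDer_apply_snd, oddElt, Matrix.trace_fin_two]

theorem coordQ_magO (v : Fin 2 → k) : coordQ k (magO v) = 0 := by
  change evenCoord ((pr k 0 (triOdd v)).1 0) = _
  rw [pr_of_mem (triOdd_mem v), if_neg (by decide)]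
  exact map_zero evenCoord

theorem coordO_magQ (q : S4 k) : coordO k (magQ q) = 0 := by
  change ((pr k 1 (triEven q)).1 0 evenElt).2 = 0
  rw [pr_of_mem (triEven_mem q), if_neg (by decide)]
  rfl

theorem coordO_magO (v : Fin 2 → k) : coordO k (magO v) = v := by
  change ((pr k 1 (triOdd v)).1 0 evenElt).2 = v
  rw [mem_part.1 (triOdd_mem v)]
  exact congr_arg Prod.snd (oddDer_even v)

theorem coordI_iota (m n : Fin 3) (s : S4 k) (y : S12 k) :
    coordI k m (iota n (s ⊗ₜ y)) = if n = m then y.1 • s else 0 := by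
  change contractRight _ ((Pi.single n (s ⊗ₜ y) : Fin 3 → S4 k ⊗[k] S12 k) m) = _
  split_ifs with h
  · subst h
    rw [Pi.single_eq_same, contractRight_tmul]
    rfl
  · rw [Pi.single_eq_of_ne (Ne.symm h), map_zero]

theorem coordK_iota (m n : Fin 3) (i : Fin 2) (s : S4 k) (y : S12 k) :
    coordK k m i (iota n (s ⊗ₜ y)) = if n = m then y.2 i • s else 0 := by
  change contractRight _ ((Pi.single n (s ⊗ₜ y) : Fin 3 → S4 k ⊗[k] S12 k) m) = _
  split_ifs with h
  · subst h
    rw [Pi.single_eq_same, contractRight_tmul]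
    rfl
  · rw [Pi.single_eq_of_ne (Ne.symm h), map_zero]

theorem coordI_magI (m n : Fin 3) (s : S4 k) :
    coordI k m (magI n s) = if n = m then s else 0 := by
  rw [magI_apply, coordI_iota]
  simp [evenElt]

theorem coordI_magK (m n : Fin 3) (s : S4 k) (v : Fin 2 → k) : coordI k m (magK n s v) = 0 := by
  rw [magK_apply, coordI_iota]
  simp [oddElt]

theorem coordK_magI (m n : Fin 3) (i : Fin 2) (s : S4 k) : coordK k m i (magI n s) = 0 := by
  rw [magI_apply, coordK_iota]
  simp [evenElt]

theorem coordK_magK (m n : Fin 3) (i : Fin 2) (s : S4 k) (v : Fin 2 → k) :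
    coordK k m i (magK n s v) = if n = m then v i • s else 0 := by
  rw [magK_apply, coordK_iota]
  rfl

end Coordinates

end SuperMagic

namespace SuperMagic

/-! ### The even part -/

section Even

variable {k : Type u} [Field k] [CharP k 3]

/-- The general even element of `𝔤(S₄, S₁₂)`. -/
def evenElement (a x : Fin 3 → S4 k) (q : S4 k) : Magic k (S4 k) (S12 k) :=
  magL a + ∑ m, magI m (x m) + magQ q

/-- The general odd element of `𝔤(S₄, S₁₂)` that involves only multiples of `v`. -/
def oddElement (x : Fin 3 → S4 k) (c : k) (v : Fin 2 → k) : Magic k (S4 k) (S12 k) :=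
  ∑ m, magK m (x m) v - c • magO v

theorem sum_fin_three_shift {V : Type*} [AddCommMonoid V] (f : Fin 3 → V) (m : Fin 3) :
    ∑ n, f n = f m + f (m + 1) + f (m + 2) := by
  rw [Fin.sum_univ_three]
  fin_cases m
  · rfl
  · change f 0 + f 1 + f 2 = f 1 + f 2 + f 0
    abel
  · change f 0 + f 1 + f 2 = f 2 + f 0 + f 1
    abel

theorem biaction_of_traceless {a b : S4 k} (ha : a.trace = 0) (hb : b.trace = 0) (x : S4 k) :
    biaction a b x = a * x - x * b := by
  rw [biaction_apply, ha, hb, sub_zero, zero_smul, add_zero]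

theorem L_evenElement (a b y : Fin 3 → S4 k) (q : S4 k) :
    sbr k (magL a) (evenElement b y q) =
      magL ⁅a, b⁆ + ∑ m, magI m (biaction (a m) (a (m + 2)) (y m)) := by
  simp only [evenElement, sbr_add_right, Fin.sum_univ_three, L_L, L_I, L_Q, add_zero]

theorem I_evenElement (m : Fin 3) (x : S4 k) (b y : Fin 3 → S4 k) (q : S4 k) :
    sbr k (magI m x) (evenElement b y q) =
      -magI m (biaction (b m) (b (m + 2)) x) + ((2 : k) • magL (slots m x (y m)) +
        magI (m + 2) (x.adjugate * (y (m + 1)).adjugate) -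
        magI (m + 1) ((y (m + 2)).adjugate * x.adjugate)) := by
  obtain ⟨h1, h2, h3, h4⟩ := fin_three_add m
  simp only [evenElement, sbr_add_right, sum_fin_three_shift _ m, I_L, I_I, I_Q, I_I_next,
    I_I_of_prev x (y (m + 2)) h3.symm, h4]
  abel

theorem Q_evenElement (p : S4 k) (b y : Fin 3 → S4 k) (q : S4 k) :
    sbr k (magQ p) (evenElement b y q) = magQ ⁅p, q⁆ := by
  simp only [evenElement, sbr_add_right, Fin.sum_univ_three, Q_L, Q_I, Q_Q, add_zero, zero_add]

/-- The right side is written in the form in which commutators of symplectic matrices appear in 2×2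
blocks, where a collects diagonal and x off-diagonal blocks. -/
theorem evenElement_bracket (a x : Fin 3 → S4 k) (p : S4 k) (b y : Fin 3 → S4 k) (q : S4 k)
    (ha : ∀ m, (a m).trace = 0) (hb : ∀ m, (b m).trace = 0) :
    sbr k (evenElement a x p) (evenElement b y q) =
      evenElement (fun m => ⁅a m, b m⁆ + (y m * (x m).adjugate - x m * (y m).adjugate) +
        ((y (m + 1)).adjugate * x (m + 1) - (x (m + 1)).adjugate * y (m + 1)))
        (fun m => a m * y m - y m * a (m + 2) - (b m * x m - x m * b (m + 2)) +
          ((x (m + 1)).adjugate * (y (m + 2)).adjugate -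
            (y (m + 1)).adjugate * (x (m + 2)).adjugate)) ⁅p, q⁆ := by
  -- The table gives −2 x ȳ and −2 x̄ y. These differ from y x̄ − x ȳ and ȳ x − x̄ y by the scalar
  -- b(x, y), and the latter are the expressions that block products produce.
  have hL : magL ⁅a, b⁆ + ((2 : k) • magL (slots 0 (x 0) (y 0)) +
      (2 : k) • magL (slots 1 (x 1) (y 1)) + (2 : k) • magL (slots 2 (x 2) (y 2))) =
      magL (fun m => ⁅a m, b m⁆ + (y m * (x m).adjugate - x m * (y m).adjugate) +
        ((y (m + 1)).adjugate * x (m + 1) - (x (m + 1)).adjugate * y (m + 1))) := by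
    simp only [← map_smul, ← map_add]
    refine magL_congr fun m => ?_
    fin_cases m <;> simp [slots, Ring.lie_def, S4_mul_apply, adjugate_apply] <;> grind
  have hI (m : Fin 3) := biaction_of_traceless (ha m) (ha (m + 2)) (y m)
  have hI' (m : Fin 3) := biaction_of_traceless (hb m) (hb (m + 2)) (x m)
  conv_lhs => rw [evenElement]
  simp only [sbr_add_left, Fin.sum_univ_three, L_evenElement, I_evenElement, Q_evenElement]
  simp only [evenElement, ← hL, Fin.sum_univ_three, map_add, map_sub, hI, hI']
  simp only [Fin.isValue, Fin.reduceAdd, zero_add]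
  abel

theorem L_oddElement (a y : Fin 3 → S4 k) (c : k) (v : Fin 2 → k) :
    sbr k (magL a) (oddElement y c v) =
      ∑ m, magK m (biaction (a m) (a (m + 2)) (y m)) v := by
  simp only [oddElement, sbr_sub_right, sbr_smul_right, sbr_add_right, Fin.sum_univ_three, L_K, L_O,
    smul_zero, sub_zero]

theorem I_oddElement (m : Fin 3) (x : S4 k) (y : Fin 3 → S4 k) (c : k) (v : Fin 2 → k) :
    sbr k (magI m x) (oddElement y c v) =
      c • magK m x v - form k x (y m) • magO v -
        magK (m + 2) (x.adjugate * (y (m + 1)).adjugate) v +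
        magK (m + 1) ((y (m + 2)).adjugate * x.adjugate) v := by
  obtain ⟨h1, h2, h3, h4⟩ := fin_three_add m
  simp only [oddElement, sbr_sub_right, sbr_smul_right, sbr_add_right, sum_fin_three_shift _ m, I_K,
    I_O, I_K_next, I_K_of_prev x (y (m + 2)) v h3.symm, h4, smul_neg]
  abel

theorem Q_oddElement {q : S4 k} (hq : q.trace = 0) (y : Fin 3 → S4 k) (c : k) (v : Fin 2 → k) :
    sbr k (magQ q) (oddElement y c v) = oddElement y c (q.mulVec v) := by
  have : evenAct q v = q.mulVec v := by rw [evenAct, hq, zero_smul, add_zero]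
  simp only [oddElement, sbr_sub_right, sbr_smul_right, sbr_add_right, Fin.sum_univ_three, Q_K, Q_O,
    this]

theorem evenElement_bracket_oddElement (a x : Fin 3 → S4 k) (q : S4 k) (y : Fin 3 → S4 k) (c : k)
    (v : Fin 2 → k) (ha : ∀ m, (a m).trace = 0) (hq : q.trace = 0) :
    sbr k (evenElement a x q) (oddElement y c v) =
      oddElement (fun m => a m * y m - y m * a (m + 2) + c • x m -
        (x (m + 1)).adjugate * (y (m + 2)).adjugate + (y (m + 1)).adjugate * (x (m + 2)).adjugate)
        (∑ m, form k (x m) (y m)) v + oddElement y c (q.mulVec v) := by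
  have hI (m : Fin 3) := biaction_of_traceless (ha m) (ha (m + 2)) (y m)
  conv_lhs => rw [evenElement]
  simp only [sbr_add_left, Fin.sum_univ_three, L_oddElement, I_oddElement, Q_oddElement hq, hI]
  simp only [oddElement, Fin.sum_univ_three, map_add, map_sub, map_smul, LinearMap.add_apply,
    LinearMap.sub_apply, LinearMap.smul_apply]
  simp only [Fin.isValue, Fin.reduceAdd, zero_add]
  module

/-- The `2 × 2` blocks of a `6 × 6` matrix. -/
def block (i j : Fin 3) : Matrix (Fin 3 ⊕ Fin 3) (Fin 3 ⊕ Fin 3) k →ₗ[k] S4 k where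
  toFun X := !![X (Sum.inl i) (Sum.inl j), X (Sum.inl i) (Sum.inr j);
    X (Sum.inr i) (Sum.inl j), X (Sum.inr i) (Sum.inr j)]
  map_add' X Y := by apply S4_ext <;> simp
  map_smul' c X := by apply S4_ext <;> simp

omit [CharP k 3] in
theorem block_mul (i j : Fin 3) (X Y : Matrix (Fin 3 ⊕ Fin 3) (Fin 3 ⊕ Fin 3) k) :
    block i j (X * Y) = ∑ l, block i l X * block l j Y := by
  apply S4_ext <;>
    simp [block, Matrix.mul_apply, Fintype.sum_sum_type, Fin.sum_univ_three, Matrix.add_apply] <;>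
    ring

omit [CharP k 3] in
-- If the basis is grouped into the pairs (bᵢ, aᵢ), the form is block diagonal, and for the
-- alternating form on k² the adjoint of a 2×2 matrix is its adjugate. So skew-adjointness can be
-- read block by block.
theorem mem_sp_iff (X : Matrix (Fin 3 ⊕ Fin 3) (Fin 3 ⊕ Fin 3) k) :
    X ∈ Symplectic.sp (Fin 3) k ↔ ∀ i j, block j i X = -(block i j X).adjugate := by
  have h : X ∈ Symplectic.sp (Fin 3) k ↔
      X.transpose * Matrix.J (Fin 3) k = Matrix.J (Fin 3) k * -X :=
    mem_skewAdjointMatricesSubmodule _ _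
  rw [h]
  constructor
  · intro h i j
    have h1 := congr_fun₂ h (Sum.inl i) (Sum.inl j)
    have h2 := congr_fun₂ h (Sum.inl i) (Sum.inr j)
    have h3 := congr_fun₂ h (Sum.inr i) (Sum.inl j)
    have h4 := congr_fun₂ h (Sum.inr i) (Sum.inr j)
    simp [Matrix.mul_apply, Matrix.J, Fintype.sum_sum_type, Matrix.one_apply] at h1 h2 h3 h4
    apply S4_ext <;> simp [block, adjugate_apply] <;> grind
  · intro h
    ext p q
    obtain i | i := p <;> obtain j | j := q
    all_goals
      have h1 := congr_fun₂ (h i j) 0 0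
      have h2 := congr_fun₂ (h i j) 0 1
      have h3 := congr_fun₂ (h i j) 1 0
      have h4 := congr_fun₂ (h i j) 1 1
      simp [block, adjugate_apply] at h1 h2 h3 h4
      simp [Matrix.mul_apply, Matrix.J, Fintype.sum_sum_type, Matrix.one_apply, h1, h2, h3, h4]

/-- The map `φ` from `𝔰𝔭₆ ⊕ 𝔰𝔩₂` to `𝔤(S₄, S₁₂)`. -/
def evenMap : (Symplectic.sp (Fin 3) k × SpecialLinear.sl (Fin 2) k) →ₗ[k]
    Magic k (S4 k) (S12 k) where
  -- The action on ιₘ is by a_m on the left and by a_{m+2} on the right. So if the slots 0, 1, 2 of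
  -- a are the diagonal blocks 0, 2, 1, then ι₀, ι₁, ι₂ must be the blocks (0, 1), (2, 0), (1, 2).
  toFun X := evenElement ![block 0 0 X.1.1, block 2 2 X.1.1, block 1 1 X.1.1]
    ![block 0 1 X.1.1, block 2 0 X.1.1, block 1 2 X.1.1] X.2.1
  map_add' X Y := by
    have h (a b c a' b' c' : S4 k) : ![a + a', b + b', c + c'] = ![a, b, c] + ![a', b', c'] := by
      simp
    change evenElement ![block 0 0 (X.1.1 + Y.1.1), block 2 2 (X.1.1 + Y.1.1),
      block 1 1 (X.1.1 + Y.1.1)] ![block 0 1 (X.1.1 + Y.1.1), block 2 0 (X.1.1 + Y.1.1),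
      block 1 2 (X.1.1 + Y.1.1)] (X.2.1 + Y.2.1) = _
    simp only [map_add, h, evenElement, Fin.sum_univ_three, Pi.add_apply]
    abel
  map_smul' c X := by
    have h (a b d : S4 k) : ![c • a, c • b, c • d] = c • ![a, b, d] := by simp
    change evenElement ![block 0 0 (c • X.1.1), block 2 2 (c • X.1.1), block 1 1 (c • X.1.1)]
      ![block 0 1 (c • X.1.1), block 2 0 (c • X.1.1), block 1 2 (c • X.1.1)] (c • X.2.1) = _
    simp only [map_smul, h, evenElement, Fin.sum_univ_three, Pi.smul_apply, smul_add,
      RingHom.id_apply]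

theorem evenMap_apply (X : Symplectic.sp (Fin 3) k × SpecialLinear.sl (Fin 2) k) :
    evenMap X = evenElement ![block 0 0 X.1.1, block 2 2 X.1.1, block 1 1 X.1.1]
      ![block 0 1 X.1.1, block 2 0 X.1.1, block 1 2 X.1.1] X.2.1 := rfl

theorem block_diag_trace (X : Symplectic.sp (Fin 3) k) (i : Fin 3) :
    (block i i X.1).trace = 0 := by
  have h := congr_fun₂ ((mem_sp_iff X.1).1 X.2 i i) 0 0
  simp [adjugate_apply] at h
  rw [Matrix.trace_fin_two, h, neg_add_cancel]

theorem block_traces (X : Symplectic.sp (Fin 3) k) (m : Fin 3) :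
    ((![block 0 0 X.1, block 2 2 X.1, block 1 1 X.1] : Fin 3 → S4 k) m).trace = 0 := by
  fin_cases m <;> exact block_diag_trace X _

theorem sl_trace (Y : SpecialLinear.sl (Fin 2) k) : Matrix.trace Y.1 = 0 := by
  exact LinearMap.mem_ker.1 Y.2

/-- The remaining off-diagonal blocks are minus the adjugates of the chosen ones; after this
substitution the block products of the commutator are the terms of `evenElement_bracket`. -/
theorem evenMap_bracket (X Y : Symplectic.sp (Fin 3) k × SpecialLinear.sl (Fin 2) k) :
    evenMap (⁅X.1, Y.1⁆, ⁅X.2, Y.2⁆) = sbr k (evenMap X) (evenMap Y) := by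
  have hX := (mem_sp_iff X.1.1).1 X.1.2
  have hY := (mem_sp_iff Y.1.1).1 Y.1.2
  rw [evenMap_apply, evenMap_apply, evenMap_apply,
    evenElement_bracket _ _ _ _ _ _ (block_traces X.1) (block_traces Y.1)]
  have h1 : (⁅X.1, Y.1⁆ : Symplectic.sp (Fin 3) k).1 = X.1.1 * Y.1.1 - Y.1.1 * X.1.1 := rfl
  have h2 : (⁅X.2, Y.2⁆ : SpecialLinear.sl (Fin 2) k).1 = ⁅X.2.1, Y.2.1⁆ := rfl
  have hadj (x : S4 k) : x.adjugate.adjugate = x := by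
    apply S4_ext <;> simp [adjugate_apply]
  congr 1
  · funext m
    fin_cases m <;>
      simp [h1, map_sub, block_mul, Fin.sum_univ_three, Ring.lie_def, hX 0 1, hX 2 0, hX 1 2,
        hY 0 1, hY 2 0, hY 1 2] <;> abel
  · funext m
    fin_cases m <;>
      simp [h1, map_sub, block_mul, Fin.sum_univ_three, hX 0 1, hX 2 0, hX 1 2,
        hY 0 1, hY 2 0, hY 1 2] <;> abel

/-- The `6 × 6` matrix with given blocks. -/
def ofBlocks (B : Fin 3 → Fin 3 → S4 k) : Matrix (Fin 3 ⊕ Fin 3) (Fin 3 ⊕ Fin 3) k :=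
  Matrix.fromBlocks (Matrix.of fun i j => B i j 0 0) (Matrix.of fun i j => B i j 0 1)
    (Matrix.of fun i j => B i j 1 0) (Matrix.of fun i j => B i j 1 1)

omit [CharP k 3] in
theorem block_ofBlocks (B : Fin 3 → Fin 3 → S4 k) (i j : Fin 3) :
    block i j (ofBlocks B) = B i j := by
  apply S4_ext <;> simp [block, ofBlocks]

theorem coordL_traceless (m : Fin 3) (X : Magic k (S4 k) (S12 k)) :
    (coordL k m X).trace = 0 := by
  change (leftCoord _).trace = 0
  simp [leftCoord, Matrix.trace_fin_two]

theorem evenElement_mem (a x : Fin 3 → S4 k) (q : S4 k) :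
    evenElement a x q ∈ part k (Magic k (S4 k) (S12 k)) 0 :=
  add_mem (add_mem (magL_mem a) (sum_mem fun m _ => magI_mem m (x m))) (magQ_mem q)

theorem coord_of_mem_zero {X : Magic k (S4 k) (S12 k)}
    (hX : X ∈ part k (Magic k (S4 k) (S12 k)) 0) :
    coordO k X = 0 ∧ ∀ m i, coordK k m i X = 0 := by
  refine ⟨eqOn_part (g := 0) (fun x hx => ?_) hX, fun m i => eqOn_part (g := 0) (fun x hx => ?_) hX⟩
  · cases hx with
    | L a => exact coordO_of_projR rfl
    | Q q => exact coordO_magQ q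
    | I m s => exact coordO_of_projR rfl
  · cases hx with
    | L a => exact coordK_of_projIota rfl i
    | Q q => exact coordK_of_projIota rfl i
    | I n s => exact coordK_magI m n i s

theorem coord_of_mem_one {X : Magic k (S4 k) (S12 k)}
    (hX : X ∈ part k (Magic k (S4 k) (S12 k)) 1) :
    coordQ k X = 0 ∧ ∀ m, coordL k m X = 0 ∧ coordI k m X = 0 := by
  refine ⟨eqOn_part (g := 0) (fun x hx => ?_) hX, fun m =>
    ⟨eqOn_part (g := 0) (fun x hx => ?_) hX, eqOn_part (g := 0) (fun x hx => ?_) hX⟩⟩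
  · cases hx with
    | O v => exact coordQ_magO v
    | K m s v => exact coordQ_of_projR rfl
  · cases hx with
    | O v => exact coordL_of_projT rfl m
    | K n s v => exact coordL_of_projT rfl m
  · cases hx with
    | O v => exact coordI_of_projIota rfl
    | K n s v => exact coordI_magK m n s v

theorem coord_evenElement (a x : Fin 3 → S4 k) (q : S4 k) (ha : ∀ m, (a m).trace = 0)
    (hq : q.trace = 0) : (∀ m, coordL k m (evenElement a x q) = a m) ∧
      (∀ m, coordI k m (evenElement a x q) = x m) ∧ coordQ k (evenElement a x q) = q := by
  refine ⟨fun m => ?_, fun m => ?_, ?_⟩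
  · rw [evenElement, map_add, map_add, map_sum, coordL_magL, ha,
      coordL_of_projT (X := magQ q) rfl]
    simp [coordL_of_projT (X := magI _ _) rfl]
  · rw [evenElement, map_add, map_add, map_sum, coordI_of_projIota (X := magL a) rfl,
      coordI_of_projIota (X := magQ q) rfl]
    simp [coordI_magI]
  · rw [evenElement, map_add, map_add, map_sum, coordQ_of_projR (X := magL a) rfl, coordQ_magQ, hq]
    simp [coordQ_of_projR (X := magI _ _) rfl]

theorem evenMap_injective : Function.Injective (evenMap (k := k)) := by
  rw [← LinearMap.ker_eq_bot, LinearMap.ker_eq_bot']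
  intro X hX
  have h := coord_evenElement _ ![block 0 1 X.1.1, block 2 0 X.1.1, block 1 2 X.1.1] _
    (block_traces X.1) (sl_trace X.2)
  rw [← evenMap_apply, hX] at h
  simp only [map_zero] at h
  obtain ⟨h1, h2, h3⟩ := h
  have hB := (mem_sp_iff X.1.1).1 X.1.2
  have hb (i j : Fin 3) : block i j X.1.1 = 0 := by
    have z0 := (h1 0).symm
    have z1 := (h1 1).symm
    have z2 := (h1 2).symm
    have x0 := (h2 0).symm
    have x1 := (h2 1).symm
    have x2 := (h2 2).symm
    simp at z0 z1 z2 x0 x1 x2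
    fin_cases i <;> fin_cases j <;> simp [z0, z1, z2, x0, x1, x2, hB 0 1, hB 2 0, hB 1 2]
  refine Prod.ext (Subtype.ext ?_) (Subtype.ext h3.symm)
  ext p q
  obtain i | i := p <;> obtain j | j := q
  exacts [congr_fun₂ (hb i j) 0 0, congr_fun₂ (hb i j) 0 1, congr_fun₂ (hb i j) 1 0,
    congr_fun₂ (hb i j) 1 1]

theorem range_evenMap :
    LinearMap.range (evenMap (k := k)) = part k (Magic k (S4 k) (S12 k)) 0 := by
  refine le_antisymm ?_ fun X hX => ?_
  · rintro _ ⟨X, rfl⟩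
    exact evenElement_mem _ _ _
  obtain ⟨hO, hK⟩ := coord_of_mem_zero hX
  let a m := coordL k m X
  let x m := coordI k m X
  have ha m : (a m).trace = 0 := coordL_traceless m X
  -- The added scalar makes the trace 3 tr = 0 and does not change the image under `magQ`.
  let q := coordQ k X + (coordQ k X).trace • (1 : S4 k)
  have hq : q.trace = 0 := by
    simp [q, Matrix.trace_fin_two]
    grind
  -- The symplectic condition forces the other three off-diagonal blocks to be minus the adjugates
  -- of the given ones.
  let B : Fin 3 → Fin 3 → S4 k := ![![a 0, x 0, -(x 1).adjugate], ![-(x 0).adjugate, a 2, x 2],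
    ![x 1, -(x 2).adjugate, a 1]]
  have hadj (x : S4 k) : x.adjugate.adjugate = x := by
    apply S4_ext <;> simp [adjugate_apply]
  have hneg (x : S4 k) : (-x).adjugate = -x.adjugate := by
    apply S4_ext <;> simp [adjugate_apply]
  have hdiag (m) : a m = -(a m).adjugate := by
    have := ha m
    rw [Matrix.trace_fin_two] at this
    apply S4_ext <;> simp [adjugate_apply] <;> grind
  have hB : ofBlocks B ∈ Symplectic.sp (Fin 3) k := by
    rw [mem_sp_iff]
    intro i j
    rw [block_ofBlocks, block_ofBlocks]
    fin_cases i <;> fin_cases j <;> simp [B, hadj, hneg] <;> exact hdiag _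
  refine ⟨(⟨ofBlocks B, hB⟩, ⟨q, LinearMap.mem_ker.2 hq⟩), ?_⟩
  rw [evenMap_apply]
  conv_rhs => rw [eq_sum_coord X, hO, map_zero, add_zero]
  have hQ : magQ q = magQ (coordQ k X) := by rw [map_add, magQ_one, add_zero]
  simp only [block_ofBlocks, evenElement, hQ, hK]
  have h1 : ![B 0 0, B 2 2, B 1 1] = a := by
    funext m
    fin_cases m <;> rfl
  have h2 : ![B 0 1, B 2 0, B 1 2] = x := by
    funext m
    fin_cases m <;> rfl
  have hKE (m : Fin 3) (i : Fin 2) : magKE m (0 : S4 k) i = 0 := by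
    rw [magKE, map_zero, LinearMap.zero_apply]
  simp only [h1, h2, hKE, add_zero]
  abel

end Even

end SuperMagic

namespace SuperMagic

/-! ### Coordinates on `V(ω₂)` -/

section Omega

variable {k : Type u} [Field k]

/-- The index pairs of the three off-diagonal blocks. -/
def pairIdx (m : Fin 3) : Fin 3 × Fin 3 := ![(0, 1), (2, 0), (1, 2)] m

variable (k) in
/-- The components `z₁ᵃ ⟨z₂ᵇ|·⟩ - z₂ᵃ ⟨z₁ᵇ|·⟩` of `z₁ ∧ z₂`, as a linear map. -/
noncomputable def wedgeBlock (m : Fin 3) : ⋀[k]^2 (W6 k) →ₗ[k] S4 k :=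
  wedgeLift (LinearMap.mk₂ k (fun z w =>
    !![w (.inl (pairIdx m).1) * z (.inr (pairIdx m).2) - z (.inl (pairIdx m).1) * w (.inr (pairIdx m).2),
      z (.inl (pairIdx m).1) * w (.inl (pairIdx m).2) - w (.inl (pairIdx m).1) * z (.inl (pairIdx m).2);
      w (.inr (pairIdx m).1) * z (.inr (pairIdx m).2) - z (.inr (pairIdx m).1) * w (.inr (pairIdx m).2),
      z (.inr (pairIdx m).1) * w (.inl (pairIdx m).2) - w (.inr (pairIdx m).1) * z (.inl (pairIdx m).2)])
    (fun _ _ _ => by apply S4_ext <;> simp <;> ring) (fun _ _ _ => by apply S4_ext <;> simp <;> ring)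
    (fun _ _ _ => by apply S4_ext <;> simp <;> ring) (fun _ _ _ => by apply S4_ext <;> simp <;> ring))
    fun _ => by apply S4_ext <;> simp <;> ring

theorem wedgeBlock_wedge (m : Fin 3) (z w : W6 k) : wedgeBlock k m (wedge k z w) =
    !![w (.inl (pairIdx m).1) * z (.inr (pairIdx m).2) - z (.inl (pairIdx m).1) * w (.inr (pairIdx m).2),
      z (.inl (pairIdx m).1) * w (.inl (pairIdx m).2) - w (.inl (pairIdx m).1) * z (.inl (pairIdx m).2);
      w (.inr (pairIdx m).1) * z (.inr (pairIdx m).2) - z (.inr (pairIdx m).1) * w (.inr (pairIdx m).2),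
      z (.inr (pairIdx m).1) * w (.inl (pairIdx m).2) - w (.inr (pairIdx m).1) * z (.inl (pairIdx m).2)] :=
  wedgeLift_wedge _ _ _ _

variable (k) in
/-- The coefficient of `bᵢ ∧ aᵢ`, as a linear map. -/
noncomputable def wedgeDiag (i : Fin 3) : ⋀[k]^2 (W6 k) →ₗ[k] k :=
  wedgeLift (LinearMap.mk₂ k (fun z w => z (.inl i) * w (.inr i) - z (.inr i) * w (.inl i))
    (fun _ _ _ => by simp; ring) (fun _ _ _ => by simp; ring)
    (fun _ _ _ => by simp; ring) (fun _ _ _ => by simp; ring)) fun _ => by simp; ring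

theorem wedgeDiag_wedge (i : Fin 3) (z w : W6 k) : wedgeDiag k i (wedge k z w) =
    z (.inl i) * w (.inr i) - z (.inr i) * w (.inl i) :=
  wedgeLift_wedge _ _ _ _

theorem contraction_eq (ξ : ⋀[k]^2 (W6 k)) :
    contraction k ξ = -(wedgeDiag k 0 ξ + wedgeDiag k 1 ξ + wedgeDiag k 2 ξ) := by
  suffices h : contraction k = -(wedgeDiag k 0 + wedgeDiag k 1 + wedgeDiag k 2) by
    rw [h]
    rfl
  refine wedge_ext fun z w => ?_
  simp only [LinearMap.neg_apply, LinearMap.add_apply, wedgeDiag_wedge, contraction_wedge,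
    sympForm_apply, Fin.sum_univ_three]
  ring

variable (k) in
/-- The element with given coefficients. -/
def ofWedgeCoords (M : Fin 3 → S4 k) (c : Fin 3 → k) : ⋀[k]^2 (W6 k) :=
  ∑ m, (-(M m 0 0) • wedge k (basisB k (pairIdx m).1) (basisA k (pairIdx m).2) +
    M m 0 1 • wedge k (basisB k (pairIdx m).1) (basisB k (pairIdx m).2) -
    M m 1 0 • wedge k (basisA k (pairIdx m).1) (basisA k (pairIdx m).2) +
    M m 1 1 • wedge k (basisA k (pairIdx m).1) (basisB k (pairIdx m).2)) +
  ∑ i, c i • wedge k (basisB k i) (basisA k i)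

/-- The cyclic order, with the pair (2, 0) in place of (0, 2), agrees with `pairIdx`. -/
theorem wedge_expand {k : Type u} [Field k] {W : Type v} [AddCommGroup W] [Module k W] 
    (a b : Fin 3 → W) (x y z w : Fin 3 → k) :
    wedge k (∑ i, x i • b i + ∑ i, y i • a i) (∑ i, z i • b i + ∑ i, w i • a i) =
     (x 0 * z 1 - x 1 * z 0) • wedge k (b 0) (b 1) + (x 2 * z 0 - x 0 * z 2) • wedge k (b 2) (b 0) + 
     (x 1 * z 2 - x 2 * z 1) • wedge k (b 1) (b 2) + 
     ((y 0 * w 1 - y 1 * w 0) • wedge k (a 0) (a 1) + (y 2 * w 0 - y 0 * w 2) • wedge k (a 2) (a 0) + 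
     (y 1 * w 2 - y 2 * w 1) • wedge k (a 1) (a 2)) + 
     ∑ i, ∑ j, (x i * w j - y j * z i) • wedge k (b i) (a j) := by
  have h (i j) : wedge k (a j) (b i) = - wedge k (b i) (a j) := wedge_swap _ _
  simp only [Fin.sum_univ_three, wedge_add_left,
    wedge_add_right, wedge_smul_left, wedge_smul_right, wedge_self, h]
  rw [wedge_swap (a 1) (a 0), wedge_swap (a 0) (a 2),
    wedge_swap (a 2) (a 1),
    wedge_swap (b 1) (b 0), wedge_swap (b 0) (b 2),
    wedge_swap (b 2) (b 1)]
  module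
theorem W6_eq (z : W6 k) :
    z = ∑ i, z (.inl i) • basisB k i + ∑ i, z (.inr i) • basisA k i := by
  ext p
  obtain p | p := p <;> fin_cases p <;> simp [basisA, basisB, Fin.sum_univ_three]

theorem ofWedgeCoords_eq (ξ : ⋀[k]^2 (W6 k)) :
    ofWedgeCoords k (fun m => wedgeBlock k m ξ) (fun i => wedgeDiag k i ξ) = ξ := by
  let f : ⋀[k]^2 (W6 k) →ₗ[k] ⋀[k]^2 (W6 k) :=
    { toFun := fun ξ => ofWedgeCoords k (fun m => wedgeBlock k m ξ) (fun i => wedgeDiag k i ξ)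
      map_add' := fun ξ η => by
        simp only [ofWedgeCoords, Fin.sum_univ_three, map_add, Matrix.add_apply]
        module
      map_smul' := fun c ξ => by
        simp only [ofWedgeCoords, Fin.sum_univ_three, map_smul, Matrix.smul_apply, smul_eq_mul,
          RingHom.id_apply]
        module }
  suffices h : f = LinearMap.id from LinearMap.congr_fun h ξ
  refine wedge_ext fun z w => ?_
  change ofWedgeCoords k _ _ = wedge k z w
  conv_rhs => rw [W6_eq z, W6_eq w, wedge_expand]
  simp only [wedgeBlock_wedge, wedgeDiag_wedge, ofWedgeCoords, Fin.sum_univ_three, pairIdx,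
    Matrix.cons_val_zero, Matrix.cons_val_one, Matrix.of_apply, Matrix.cons_val,
    wedge_swap (basisA k _) (basisB k _)]
  module

theorem wedgeBlock_ofWedgeCoords (M : Fin 3 → S4 k) (c : Fin 3 → k) (m : Fin 3) :
    wedgeBlock k m (ofWedgeCoords k M c) = M m := by
  apply S4_ext <;> fin_cases m <;>
    simp [ofWedgeCoords, Fin.sum_univ_three, wedgeBlock_wedge, pairIdx, basisA, basisB]

theorem wedgeDiag_ofWedgeCoords (M : Fin 3 → S4 k) (c : Fin 3 → k) (i : Fin 3) :
    wedgeDiag k i (ofWedgeCoords k M c) = c i := by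
  fin_cases i <;>
    simp [ofWedgeCoords, Fin.sum_univ_three, wedgeDiag_wedge, pairIdx, basisA, basisB]

theorem mulVec_inl (X : Matrix (Fin 3 ⊕ Fin 3) (Fin 3 ⊕ Fin 3) k) (z : W6 k) (i : Fin 3) :
    X.mulVec z (.inl i) = ∑ j, (X (.inl i) (.inl j) * z (.inl j) + X (.inl i) (.inr j) * z (.inr j)) := by
  rw [Matrix.mulVec, dotProduct, Fintype.sum_sum_type, Finset.sum_add_distrib]

theorem mulVec_inr (X : Matrix (Fin 3 ⊕ Fin 3) (Fin 3 ⊕ Fin 3) k) (z : W6 k) (i : Fin 3) :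
    X.mulVec z (.inr i) = ∑ j, (X (.inr i) (.inl j) * z (.inl j) + X (.inr i) (.inr j) * z (.inr j)) := by
  rw [Matrix.mulVec, dotProduct, Fintype.sum_sum_type, Finset.sum_add_distrib]

variable [CharP k 3]

/-- The relations between the entries of a symplectic matrix. -/
theorem sp_entries (X : Symplectic.sp (Fin 3) k) (i j : Fin 3) :
    X.1 (.inl j) (.inl i) = -X.1 (.inr i) (.inr j) ∧ X.1 (.inl j) (.inr i) = X.1 (.inl i) (.inr j) ∧
      X.1 (.inr j) (.inl i) = X.1 (.inr i) (.inl j) ∧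
      X.1 (.inr j) (.inr i) = -X.1 (.inl i) (.inl j) := by
  have h := (mem_sp_iff X.1).1 X.2 i j
  have h1 := congr_fun₂ h 0 0
  have h2 := congr_fun₂ h 0 1
  have h3 := congr_fun₂ h 1 0
  have h4 := congr_fun₂ h 1 1
  simp [block, adjugate_apply] at h1 h2 h3 h4
  exact ⟨h1, h2, h3, h4⟩

/-- The diagonal blocks of a symplectic matrix. -/
def diagBlock (X : Symplectic.sp (Fin 3) k) : Fin 3 → S4 k :=
  ![block 0 0 X.1, block 2 2 X.1, block 1 1 X.1]

/-- The off-diagonal blocks of a symplectic matrix. -/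
def offBlock (X : Symplectic.sp (Fin 3) k) : Fin 3 → S4 k :=
  ![block 0 1 X.1, block 2 0 X.1, block 1 2 X.1]

/-- The adjugate as a linear map. -/
def adjugateLin : S4 k →ₗ[k] S4 k where
  toFun x := x.adjugate
  map_add' x y := by apply S4_ext <;> simp [adjugate_apply] <;> ring
  map_smul' c x := by apply S4_ext <;> simp [adjugate_apply]

-- The form identifies z₁ ∧ z₂ with the operator z₁{z₂ | ·} − z₂{z₁ | ·}, up to a sign. It is
-- self-adjoint, so its block (j, i) is the adjugate of the block (i, j) and its diagonal blocks are
-- scalar, and 𝔰𝔭₆ acts by commutators. The formula is the off-diagonal block of such a commutator;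
-- it has the shape of the first component in `evenElement_bracket_oddElement`.
set_option maxHeartbeats 2000000 in
theorem wedgeBlock_spAction (X : Symplectic.sp (Fin 3) k) (m : Fin 3) (ξ : ⋀[k]^2 (W6 k)) :
    wedgeBlock k m (spAction k X ξ) =
      diagBlock X m * wedgeBlock k m ξ - wedgeBlock k m ξ * diagBlock X (m + 2) +
        (wedgeDiag k (pairIdx m).1 ξ - wedgeDiag k (pairIdx m).2 ξ) • offBlock X m -
        (offBlock X (m + 1)).adjugate * (wedgeBlock k (m + 2) ξ).adjugate +
        (wedgeBlock k (m + 1) ξ).adjugate * (offBlock X (m + 2)).adjugate := by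
  let f : ⋀[k]^2 (W6 k) →ₗ[k] S4 k :=
    LinearMap.mulLeft k (diagBlock X m) ∘ₗ wedgeBlock k m -
      LinearMap.mulRight k (diagBlock X (m + 2)) ∘ₗ wedgeBlock k m +
      (wedgeDiag k (pairIdx m).1 - wedgeDiag k (pairIdx m).2).smulRight (offBlock X m) -
      LinearMap.mulLeft k (offBlock X (m + 1)).adjugate ∘ₗ adjugateLin ∘ₗ wedgeBlock k (m + 2) +
      LinearMap.mulRight k (offBlock X (m + 2)).adjugate ∘ₗ adjugateLin ∘ₗ wedgeBlock k (m + 1)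
  suffices h : wedgeBlock k m ∘ₗ spAction k X = f from LinearMap.congr_fun h ξ
  refine wedge_ext fun z w => ?_
  change wedgeBlock k m (spAction k X (wedge k z w)) =
      diagBlock X m * wedgeBlock k m (wedge k z w) - wedgeBlock k m (wedge k z w) * diagBlock X (m + 2) +
        (wedgeDiag k (pairIdx m).1 (wedge k z w) - wedgeDiag k (pairIdx m).2 (wedge k z w)) • offBlock X m -
        (offBlock X (m + 1)).adjugate * (wedgeBlock k (m + 2) (wedge k z w)).adjugate +
        (wedgeBlock k (m + 1) (wedge k z w)).adjugate * (offBlock X (m + 2)).adjugate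
  rw [spAction_wedge, map_add]
  simp only [wedgeBlock_wedge, wedgeDiag_wedge, mulVec_inl, mulVec_inr, Fin.sum_univ_three]
  obtain ⟨a1, a2, a3, a4⟩ := sp_entries X 0 1
  obtain ⟨b1, b2, b3, b4⟩ := sp_entries X 2 0
  obtain ⟨c1, c2, c3, c4⟩ := sp_entries X 1 2
  have d0 := (sp_entries X 0 0).2.2.2
  have d1 := (sp_entries X 1 1).2.2.2
  have d2 := (sp_entries X 2 2).2.2.2
  obtain rfl | rfl | rfl : m = 0 ∨ m = 1 ∨ m = 2 := by revert m; decide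
  all_goals simp only [pairIdx, diagBlock, offBlock, Matrix.cons_val, Fin.reduceAdd, Fin.isValue, zero_add]
  all_goals apply S4_ext
  all_goals simp only [block, LinearMap.coe_mk, AddHom.coe_mk, adjugate_apply, S4_mul_apply, Matrix.add_apply,
    Matrix.sub_apply, Matrix.smul_apply, smul_eq_mul, Matrix.of_apply, Matrix.cons_val', Matrix.cons_val]
  all_goals simp only [a1, a2, a3, a4, b1, b2, b3, b4, c1, c2, c3, c4, d0, d1, d2]
  all_goals ring

end Omega

end SuperMagic

/-! ### V(ω₂) in coordinates, and its identification with the odd part. -/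

namespace SuperMagic

section Omega

variable {k : Type u} [Field k] [CharP k 3]

set_option maxHeartbeats 1000000 in
theorem wedgeDiag_spAction (X : Symplectic.sp (Fin 3) k) (ξ : ⋀[k]^2 (W6 k)) :
    wedgeDiag k 0 (spAction k X ξ) - wedgeDiag k 1 (spAction k X ξ) =
      ∑ m, form k (offBlock X m) (wedgeBlock k m ξ) := by
  let f : ⋀[k]^2 (W6 k) →ₗ[k] k :=
    ∑ m, SymmetricCompositionSuperalgebra.form (k := k) (offBlock X m) ∘ₗ wedgeBlock k m
  suffices h : (wedgeDiag k 0 - wedgeDiag k 1) ∘ₗ spAction k X = f by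
    have := LinearMap.congr_fun h ξ
    simpa [f] using this
  refine wedge_ext fun z w => ?_
  -- With bₘ denoting the m-th summand on the right, the left side is −2b₀ + b₁ + b₂ without any
  -- assumption on the characteristic; the correction is 3b₀ = 0.
  have h3 : 3 * form k (offBlock X 0) (wedgeBlock k 0 (wedge k z w)) = 0 := by
    rw [three_eq_zero, zero_mul]
  simp only [f, LinearMap.comp_apply, LinearMap.sub_apply, LinearMap.sum_apply, spAction_wedge,
    map_add, wedgeBlock_wedge, wedgeDiag_wedge, mulVec_inl, mulVec_inr, Fin.sum_univ_three] at h3 ⊢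
  change _ = form k (_ : S4 k) _ + form k (_ : S4 k) _ + form k (_ : S4 k) _
  obtain ⟨a1, a2, a3, a4⟩ := sp_entries X 0 1
  obtain ⟨b1, b2, b3, b4⟩ := sp_entries X 2 0
  obtain ⟨c1, c2, c3, c4⟩ := sp_entries X 1 2
  have d0 := (sp_entries X 0 0).2.2.2
  have d1 := (sp_entries X 1 1).2.2.2
  simp only [wedgeBlock_wedge, pairIdx, offBlock, Matrix.cons_val, form_S4_apply, block, LinearMap.coe_mk, AddHom.coe_mk,
    Matrix.of_apply, Matrix.cons_val'] at h3 ⊢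
  simp only [a1, a2, a3, a4, b1, b2, b3, b4, c1, c2, c3, c4, d0, d1]
  linear_combination -h3

/-- If c₀ + c₁ + c₂ = 0, then c₂ − c₀ = −2c₀ − c₁ = c₀ − c₁ modulo 3, and similarly for c₁ − c₂.
This is where characteristic 3 reduces the diagonal part of V(ω₂) to one dimension. -/
theorem wedgeDiag_of_mem {ξ : ⋀[k]^2 (W6 k)} (h : contraction k ξ = 0) (m : Fin 3) :
    wedgeDiag k (pairIdx m).1 ξ - wedgeDiag k (pairIdx m).2 ξ =
      wedgeDiag k 0 ξ - wedgeDiag k 1 ξ := by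
  rw [contraction_eq] at h
  fin_cases m <;> simp [pairIdx] <;> grind

variable (k) in
/-- The coordinates on `ker φ` that are invariant under `∑ aᵢ ∧ bᵢ`. -/
noncomputable def kerCoord : kerContraction k →ₗ[k] (Fin 3 → S4 k) × k :=
  ((LinearMap.pi fun m => wedgeBlock k m).prod (wedgeDiag k 0 - wedgeDiag k 1)) ∘ₗ
    (kerContraction k).toSubmodule.subtype

theorem kerCoord_apply (ξ : kerContraction k) : kerCoord k ξ =
    (fun m => wedgeBlock k m ξ.1, wedgeDiag k 0 ξ.1 - wedgeDiag k 1 ξ.1) := rfl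

theorem omegaElt_eq : omegaElt k = ofWedgeCoords k 0 (fun _ => -1) := by
  simp only [omegaElt, ofWedgeCoords, Fin.sum_univ_three, wedge_swap (basisA k _) (basisB k _), Pi.zero_apply,
    Matrix.zero_apply]
  module

/-- Vanishing blocks and c₀ = c₁ force c₂ = c₀ by the equality of cyclic differences, so ξ is a
multiple of ∑ aᵢ ∧ bᵢ. Thus `kerCoord` induces coordinates on the quotient V(ω₂). -/
theorem kerCoord_eq_zero (ξ : kerContraction k) :
    kerCoord k ξ = 0 ↔ ξ.1 ∈ lineOmega k := by
  have hmem : ξ.1 ∈ lineOmega k ↔ ∃ c : k, c • omegaElt k = ξ.1 := Submodule.mem_span_singleton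
  rw [hmem, kerCoord_apply]
  constructor
  · intro h
    obtain ⟨h1, h2⟩ := Prod.ext_iff.1 h
    have h3 := wedgeDiag_of_mem (ξ := ξ.1) ξ.2 2
    refine ⟨-wedgeDiag k 0 ξ.1, ?_⟩
    rw [← ofWedgeCoords_eq ξ.1]
    have e1 : (fun m => wedgeBlock k m ξ.1) = 0 := h1
    have h2 : wedgeDiag k 0 ξ.1 - wedgeDiag k 1 ξ.1 = 0 := h2
    have h3 : wedgeDiag k 1 ξ.1 - wedgeDiag k 2 ξ.1 = wedgeDiag k 0 ξ.1 - wedgeDiag k 1 ξ.1 := h3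
    have e2 : (fun i => wedgeDiag k i ξ.1) = fun _ => wedgeDiag k 0 ξ.1 := by
      funext i
      fin_cases i
      · rfl
      · exact (sub_eq_zero.1 h2).symm
      · change wedgeDiag k 2 ξ.1 = _
        grind
    rw [e1, e2, omegaElt_eq, wedgeDiag_ofWedgeCoords]
    simp [ofWedgeCoords, Finset.smul_sum, smul_smul]
  · rintro ⟨c, hc⟩
    simp only [← hc, map_smul, omegaElt_eq, wedgeBlock_ofWedgeCoords, wedgeDiag_ofWedgeCoords]
    ext <;> simp

theorem kerCoord_surjective : Function.Surjective (kerCoord k) := by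
  intro p
  -- The diagonal coefficients must sum to zero and satisfy c₀ − c₁ = p.2.
  refine ⟨⟨ofWedgeCoords k p.1 ![0, -p.2, p.2], ?_⟩, ?_⟩
  · change contraction k _ = 0
    rw [contraction_eq]
    simp [wedgeDiag_ofWedgeCoords]
  · rw [kerCoord_apply]
    simp [wedgeDiag_ofWedgeCoords, wedgeBlock_ofWedgeCoords]

variable (k) in
/-- The projection of `ker φ` onto `V(ω₂)`. -/
noncomputable def vMk : kerContraction k →ₗ[k] VOmega2 k :=
  ((lineOmega k).comap (kerContraction k).incl).toSubmodule.mkQ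

theorem vMk_surjective : Function.Surjective (vMk k) := Submodule.mkQ_surjective _

variable (k) in
/-- Coordinates on `V(ω₂)`. -/
noncomputable def vCoord : VOmega2 k ≃ₗ[k] (Fin 3 → S4 k) × k :=
  (Submodule.quotEquivOfEq ((lineOmega k).comap (kerContraction k).incl).toSubmodule
    (LinearMap.ker (kerCoord k)) (Submodule.ext fun ξ => (kerCoord_eq_zero ξ).symm)).trans
    ((kerCoord k).quotKerEquivOfSurjective kerCoord_surjective)

theorem kerCoord_lie (X : Symplectic.sp (Fin 3) k) (ξ : kerContraction k) :
    kerCoord k ⁅X, ξ⁆ = (fun m => diagBlock X m * (kerCoord k ξ).1 m -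
        (kerCoord k ξ).1 m * diagBlock X (m + 2) + (kerCoord k ξ).2 • offBlock X m -
        (offBlock X (m + 1)).adjugate * ((kerCoord k ξ).1 (m + 2)).adjugate +
        ((kerCoord k ξ).1 (m + 1)).adjugate * (offBlock X (m + 2)).adjugate,
      ∑ m, form k (offBlock X m) ((kerCoord k ξ).1 m)) := by
  refine Prod.ext (funext fun m => ?_) (wedgeDiag_spAction X ξ.1)
  refine (wedgeBlock_spAction X m ξ.1).trans ?_
  rw [wedgeDiag_of_mem ξ.2]
  rfl

theorem vCoord_lie (X : Symplectic.sp (Fin 3) k) (ξ : VOmega2 k) :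
    vCoord k ⁅X, ξ⁆ = (fun m => diagBlock X m * (vCoord k ξ).1 m -
        (vCoord k ξ).1 m * diagBlock X (m + 2) + (vCoord k ξ).2 • offBlock X m -
        (offBlock X (m + 1)).adjugate * ((vCoord k ξ).1 (m + 2)).adjugate +
        ((vCoord k ξ).1 (m + 1)).adjugate * (offBlock X (m + 2)).adjugate,
      ∑ m, form k (offBlock X m) ((vCoord k ξ).1 m)) := by
  obtain ⟨ξ, rfl⟩ := vMk_surjective ξ
  exact kerCoord_lie X ξ

theorem finrank_VOmega2 : Module.finrank k (VOmega2 k) = 13 := by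
  rw [(vCoord k).finrank_eq]
  have : Module.finrank k (S4 k) = 4 := (Module.finrank_matrix k k (Fin 2) (Fin 2)).trans (by simp)
  rw [Module.finrank_prod]
  rw [Module.finrank_pi_fintype]
  simp [this]

theorem oddElement_add (x y : Fin 3 → S4 k) (c d : k) (v : Fin 2 → k) :
    oddElement (x + y) (c + d) v = oddElement x c v + oddElement y d v := by
  simp only [oddElement, map_add, Pi.add_apply, LinearMap.add_apply, Finset.sum_add_distrib]
  module

theorem oddElement_smul (a : k) (x : Fin 3 → S4 k) (c : k) (v : Fin 2 → k) :
    oddElement (a • x) (a • c) v = a • oddElement x c v := by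
  simp only [oddElement, map_smul, Pi.smul_apply, LinearMap.smul_apply, Finset.smul_sum, smul_sub,
    smul_eq_mul, mul_smul]

section OddMap

variable {V : Type v} [AddCommGroup V] [Module k V] (e : V ≃ₗ[k] (Fin 3 → S4 k) × k)

/-- The map `ξ ⊗ v ↦ oddElement ξ v`, for a space with given coordinates. -/
def oddMap : V ⊗[k] (Fin 2 → k) →ₗ[k] Magic k (S4 k) (S12 k) :=
  TensorProduct.lift (LinearMap.mk₂ k (fun ξ v => oddElement (e ξ).1 (e ξ).2 v)
    (fun ξ η v => by
      rw [map_add]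
      exact oddElement_add _ _ _ _ _)
    (fun a ξ v => by
      rw [map_smul]
      exact oddElement_smul _ _ _ _)
    (fun _ _ _ => by
      simp only [oddElement, map_add, Finset.sum_add_distrib]
      module)
    fun _ _ _ => by
      simp only [oddElement, map_smul, Finset.smul_sum, smul_sub]
      module)

theorem oddMap_tmul (ξ : V) (v : Fin 2 → k) :
    oddMap e (ξ ⊗ₜ v) = oddElement (e ξ).1 (e ξ).2 v := rfl

theorem oddElement_mem (x : Fin 3 → S4 k) (c : k) (v : Fin 2 → k) :
    oddElement x c v ∈ part k (Magic k (S4 k) (S12 k)) 1 :=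
  sub_mem (sum_mem fun m _ => magK_mem m (x m) v) (Submodule.smul_mem _ _ (magO_mem v))

theorem oddMap_mem (t : V ⊗[k] (Fin 2 → k)) : oddMap e t ∈ part k (Magic k (S4 k) (S12 k)) 1 := by
  induction t with
  | zero => rw [map_zero]; exact zero_mem _
  | add s t hs ht => rw [map_add]; exact add_mem hs ht
  | tmul ξ v => exact oddElement_mem _ _ _

omit [CharP k 3] in
theorem exists_tmul_single (t : V ⊗[k] (Fin 2 → k)) : ∃ ξ η : V,
    t = ξ ⊗ₜ Pi.single 0 1 + η ⊗ₜ Pi.single 1 1 := by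
  induction t with
  | zero => exact ⟨0, 0, by simp⟩
  | add s t hs ht =>
    obtain ⟨ξ, η, rfl⟩ := hs
    obtain ⟨ξ', η', rfl⟩ := ht
    refine ⟨ξ + ξ', η + η', ?_⟩
    rw [add_tmul, add_tmul]
    abel
  | tmul ξ v =>
    refine ⟨v 0 • ξ, v 1 • ξ, ?_⟩
    rw [smul_tmul, smul_tmul, ← tmul_add]
    congr 1
    ext i
    fin_cases i <;> simp

theorem coord_oddElement (x : Fin 3 → S4 k) (c : k) (v : Fin 2 → k) :
    (∀ m i, coordK k m i (oddElement x c v) = v i • x m) ∧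
      coordO k (oddElement x c v) = -(c • v) := by
  refine ⟨fun m i => ?_, ?_⟩
  · rw [oddElement, map_sub, map_sum, map_smul, coordK_of_projIota (X := magO v) rfl]
    simp [coordK_magK]
  · rw [oddElement, map_sub, map_sum, map_smul, coordO_magO]
    simp [coordO_of_projR (X := magK _ _ _) rfl]

theorem oddMap_injective : Function.Injective (oddMap e) := by
  rw [← LinearMap.ker_eq_bot, LinearMap.ker_eq_bot']
  intro t ht
  obtain ⟨ξ, η, rfl⟩ := exists_tmul_single t
  rw [map_add, oddMap_tmul, oddMap_tmul] at ht
  have h1 (m i) := congrArg (coordK k m i) ht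
  have h2 := congrArg (coordO k) ht
  simp only [map_add, map_zero, (coord_oddElement _ _ _).1, (coord_oddElement _ _ _).2] at h1 h2
  have hξ : e ξ = 0 := by
    refine Prod.ext (funext fun m => by simpa using h1 m 0) ?_
    simpa using congr_fun h2 0
  have hη : e η = 0 := by
    refine Prod.ext (funext fun m => by simpa using h1 m 1) ?_
    simpa using congr_fun h2 1
  rw [(e).map_eq_zero_iff.1 hξ, (e).map_eq_zero_iff.1 hη]
  simp

theorem range_oddMap : LinearMap.range (oddMap e) = part k (Magic k (S4 k) (S12 k)) 1 := by
  refine le_antisymm ?_ fun X hX => ?_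
  · rintro _ ⟨t, rfl⟩
    exact oddMap_mem e t
  obtain ⟨hQ, hLI⟩ := coord_of_mem_one hX
  have hL : (fun m => coordL k m X) = 0 := funext fun m => (hLI m).1
  refine ⟨(e).symm (fun m => coordK k m 0 X, -coordO k X 0) ⊗ₜ Pi.single 0 1 +
    (e).symm (fun m => coordK k m 1 X, -coordO k X 1) ⊗ₜ Pi.single 1 1, ?_⟩
  rw [map_add, oddMap_tmul, oddMap_tmul]
  simp only [LinearEquiv.apply_symm_apply, oddElement]
  conv_rhs => rw [eq_sum_coord X, hQ, hL]
  have hO : magO (coordO k X) = coordO k X 0 • magO (Pi.single 0 1) +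
      coordO k X 1 • magO (k := k) (Pi.single 1 1) := by
    rw [← map_smul, ← map_smul, ← map_add]
    congr 1
    ext i
    fin_cases i <;> simp
  rw [hO]
  simp only [hLI, map_zero, zero_add, Finset.sum_add_distrib, magKE]
  module

theorem oddMap_add_tmul (x ξ : V) (v w : Fin 2 → k) : oddMap e (x ⊗ₜ v + ξ ⊗ₜ w) =
    oddElement (e x).1 (e x).2 v + oddElement (e ξ).1 (e ξ).2 w :=
  map_add _ _ _

end OddMap

/-- The action of 𝔰𝔭₆ on the coordinates of V(ω₂), as computed in `vCoord_lie`, is term by term the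
first summand of `evenElement_bracket_oddElement`; the second summand is the action of 𝔰𝔩₂ on k². -/
theorem evenMap_bracket_oddMap (X : Symplectic.sp (Fin 3) k × SpecialLinear.sl (Fin 2) k)
    (ξ : VOmega2 k) (v : Fin 2 → k) : sbr k (evenMap X) (oddMap (vCoord k) (ξ ⊗ₜ v)) =
      oddMap (vCoord k) (⁅X.1, ξ⁆ ⊗ₜ v + ξ ⊗ₜ ⁅X.2, v⁆) := by
  refine Eq.trans ?_ (oddMap_add_tmul (vCoord k) ⁅X.1, ξ⁆ ξ v ⁅X.2, v⁆).symm
  have h := vCoord_lie X.1 ξ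
  rw [h]
  exact evenElement_bracket_oddElement _ _ _ _ _ _ (block_traces X.1) (sl_trace X.2)

end Omega

end SuperMagic

namespace SuperMagic

/-! ### Irreducibility and simplicity -/

section Irreducible

variable {k : Type u} [Field k] [CharP k 3]

/-- A subspace of the space of coordinates that is closed under the action of the even part. -/
def IsActionStable (N : Submodule k ((Fin 3 → S4 k) × k)) : Prop :=
  ∀ a x : Fin 3 → S4 k, (∀ m, (a m).trace = 0) → ∀ p ∈ N,
    ((fun m => a m * p.1 m - p.1 m * a (m + 2) + p.2 • x m -
        (x (m + 1)).adjugate * (p.1 (m + 2)).adjugate +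
        (p.1 (m + 1)).adjugate * (x (m + 2)).adjugate,
      ∑ m, form k (x m) (p.1 m)) : (Fin 3 → S4 k) × k) ∈ N

theorem form_S4_zero_left (s : S4 k) : form k (0 : S4 k) s = 0 := by
  rw [form_S4_apply]
  simp

theorem form_S4_zero_right (s : S4 k) : form k s (0 : S4 k) = 0 := by
  rw [form_S4_apply]
  simp

variable {N : Submodule k ((Fin 3 → S4 k) × k)}

theorem IsActionStable.diag_mem (hN : IsActionStable N) {a : Fin 3 → S4 k}
    (ha : ∀ m, (a m).trace = 0) {p : (Fin 3 → S4 k) × k} (hp : p ∈ N) :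
    ((fun m => a m * p.1 m - p.1 m * a (m + 2), 0) : (Fin 3 → S4 k) × k) ∈ N := by
  have := hN a 0 ha p hp
  simpa [form_S4_zero_left] using this

omit [CharP k 3] in
theorem trace_single_ne {i j : Fin 2} (h : i ≠ j) :
    (Matrix.single i j (1 : k) : S4 k).trace = 0 :=
  Matrix.trace_single_eq_of_ne i j 1 h

omit [CharP k 3] in
theorem trace_pi_single (m : Fin 3) {x : S4 k} (hx : x.trace = 0) (n : Fin 3) :
    ((Pi.single m x : Fin 3 → S4 k) n).trace = 0 := by
  obtain rfl | h := eq_or_ne n m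
  · simpa using hx
  · simp [h]

/-- The element with a single non-zero coordinate in slot `m`. -/
def slotElt (m : Fin 3) : S4 k →ₗ[k] (Fin 3 → S4 k) × k :=
  LinearMap.inl k _ _ ∘ₗ LinearMap.single k (fun _ => S4 k) m

theorem slotElt_apply (m : Fin 3) (x : S4 k) : slotElt m x = (Pi.single m x, 0) := rfl

/-- A matrix in slot m acts on the left of the block m and on the right of the block m + 1, so on an
element concentrated in block m only the left multiplication is visible. For right multiplications,
below, the matrix is put into slot m + 2. -/
theorem IsActionStable.left_mem (hN : IsActionStable N) {m : Fin 3} {x q : S4 k}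
    (hx : slotElt m x ∈ N) (hq : q.trace = 0) : slotElt m (q * x) ∈ N := by
  have h := hN.diag_mem (trace_pi_single m hq) hx
  convert h using 1
  refine Prod.ext (funext fun n => ?_) rfl
  obtain ⟨h1, h2, h3, h4, h5, h6⟩ := fin_three_ne m
  obtain rfl | rfl | rfl := fin_three_cases' m n <;> simp [slotElt_apply]

theorem IsActionStable.right_mem (hN : IsActionStable N) {m : Fin 3} {x q : S4 k}
    (hx : slotElt m x ∈ N) (hq : q.trace = 0) : slotElt m (x * q) ∈ N := by
  have h := hN.diag_mem (trace_pi_single (m + 2) hq) hx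
  rw [← neg_mem_iff, ← map_neg]
  convert h using 1
  refine Prod.ext (funext fun n => ?_) rfl
  obtain rfl | rfl | rfl := fin_three_cases' m n <;> simp [slotElt_apply]

/-- Traceless matrix units Eᵢ′ᵢ and Eⱼⱼ′ on the two sides move any matrix unit to any other. -/
theorem IsActionStable.slotElt_mem (hN : IsActionStable N) {m : Fin 3} {i j : Fin 2}
    (h : slotElt m (Matrix.single i j (1 : k)) ∈ N) (x : S4 k) : slotElt m x ∈ N := by
  have hl (i' : Fin 2) : slotElt m (Matrix.single i' j (1 : k)) ∈ N := by
    obtain rfl | hi := eq_or_ne i' i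
    · exact h
    · have := hN.left_mem h (trace_single_ne hi)
      rwa [Matrix.single_mul_single_same, one_mul] at this
  have hr (i' j' : Fin 2) : slotElt m (Matrix.single i' j' (1 : k)) ∈ N := by
    obtain rfl | hj := eq_or_ne j j'
    · exact hl i'
    · have := hN.right_mem (hl i') (trace_single_ne hj)
      rwa [Matrix.single_mul_single_same, one_mul] at this
  have := S4_expand (slotElt m) x
  rw [this]
  exact add_mem (add_mem (add_mem (N.smul_mem _ (hr _ _)) (N.smul_mem _ (hr _ _)))
    (N.smul_mem _ (hr _ _))) (N.smul_mem _ (hr _ _))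

/-- The off-diagonal blocks pair a full block with itself through the form: b(1, E₀₀) = 1 yields the
vector (0, 1), and from (0, 1) they produce every (x, 0). -/
theorem IsActionStable.eq_top_of_slotElt (hN : IsActionStable N) {m : Fin 3}
    (h : ∀ x, slotElt m x ∈ N) : N = ⊤ := by
  have h1 : ((0, 1) : (Fin 3 → S4 k) × k) ∈ N := by
    have := hN 0 (Pi.single m 1) (fun _ => Matrix.trace_zero _ _) _ (h (Matrix.single 0 0 1))
    convert this using 1
    refine Prod.ext (funext fun n => ?_) ?_
    · obtain rfl | rfl | rfl := fin_three_cases' m n <;> simp [slotElt_apply, fin_three_add m]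
    · rw [Finset.sum_eq_single m]
      · simp [slotElt_apply, form_S4_apply]
      · intro n _ hn
        simp [slotElt_apply, hn, form_S4_zero_left]
      · simp
  have h2 (x : Fin 3 → S4 k) : ((x, 0) : (Fin 3 → S4 k) × k) ∈ N := by
    have := hN 0 x (fun _ => Matrix.trace_zero _ _) _ h1
    simpa [form_S4_zero_right] using this
  rw [eq_top_iff]
  rintro ⟨x, c⟩ -
  have := add_mem (h2 x) (N.smul_mem c h1)
  simpa using this

omit [CharP k 3] in
theorem single_mulVec_single (i j l : Fin 2) : (Matrix.single i j (1 : k)).mulVec (Pi.single l 1) =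
    if j = l then Pi.single i 1 else 0 := by
  ext n
  fin_cases i <;> fin_cases j <;> fin_cases l <;> fin_cases n <;>
    simp [Matrix.mulVec, dotProduct, Fin.sum_univ_two, Matrix.single]

theorem fin_two_add_one_ne (i : Fin 2) : i + 1 ≠ i := by
  revert i
  decide

/-- If the entry (i, j) of block m is t ≠ 0, left multiplication by E_{i+1,i} and right
multiplication by E_{j,j+1} turn that block into t E_{i+1,j+1}. The first operation leaves only the
blocks m and m + 1, and the second, by a matrix in slot m + 2, removes the block m + 1. -/
theorem IsActionStable.eq_top_of_ne_zero (hN : IsActionStable N) {p : (Fin 3 → S4 k) × k}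
    (hp : p ∈ N) (hp0 : p.1 ≠ 0) : N = ⊤ := by
  obtain ⟨m, hm⟩ := Function.ne_iff.1 hp0
  obtain ⟨i, j, hij⟩ : ∃ i j, p.1 m i j ≠ 0 := by
    by_contra! h
    exact hm (Matrix.ext h)
  have h1 := hN.diag_mem (trace_pi_single m (trace_single_ne (fin_two_add_one_ne i))) hp
  have h2 := hN.diag_mem (trace_pi_single (m + 2) (trace_single_ne (fin_two_add_one_ne j).symm)) h1
  refine hN.eq_top_of_slotElt (m := m) (hN.slotElt_mem (i := i + 1) (j := j + 1) ?_)
  rw [← N.smul_mem_iff (neg_ne_zero.2 hij), ← map_smul]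
  convert h2 using 1
  refine Prod.ext (funext fun n => ?_) rfl
  obtain rfl | rfl | rfl := fin_three_cases' m n
  · simp [slotElt_apply, Matrix.single_mul_mul_single]
  · simp [slotElt_apply]
  · simp [slotElt_apply, fin_three_add m]

theorem IsActionStable.eq_bot_or_eq_top (hN : IsActionStable N) : N = ⊥ ∨ N = ⊤ := by
  by_cases h : ∃ p ∈ N, p.1 ≠ 0
  · obtain ⟨p, hp, hp0⟩ := h
    exact .inr (hN.eq_top_of_ne_zero hp hp0)
  push Not at h
  refine .inl ((Submodule.eq_bot_iff _).2 fun p hp => Prod.ext (h p hp) ?_)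
  have := h _ (hN 0 (Pi.single 0 1) (fun _ => Matrix.trace_zero _ _) p hp)
  have := congr_fun₂ (congr_fun this 0) 0 0
  simpa [h p hp] using this

/-- Stability is stated for arbitrary traceless a and arbitrary x; surjectivity of `evenMap` onto
the even part realizes each such pair by a symplectic matrix. -/
theorem exists_sp (a x : Fin 3 → S4 k) (ha : ∀ m, (a m).trace = 0) :
    ∃ X : Symplectic.sp (Fin 3) k, diagBlock X = a ∧ offBlock X = x := by
  obtain ⟨X, hX⟩ : evenElement a x 0 ∈ LinearMap.range (evenMap (k := k)) := by
    rw [range_evenMap]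
    exact evenElement_mem _ _ _
  have h1 := coord_evenElement (diagBlock X.1) (offBlock X.1) X.2.1 (block_traces X.1) (sl_trace X.2)
  have h2 := coord_evenElement a x 0 ha (Matrix.trace_zero _ _)
  rw [← hX] at h2
  exact ⟨X.1, funext fun m => (h1.1 m).symm.trans (h2.1 m),
    funext fun m => (h1.2.1 m).symm.trans (h2.2.1 m)⟩

theorem isIrreducible_VOmega2 : LieModule.IsIrreducible k (Symplectic.sp (Fin 3) k) (VOmega2 k) := by
  have : Nontrivial (VOmega2 k) := (vCoord k).toEquiv.nontrivial
  refine LieModule.IsIrreducible.mk fun N hN => ?_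
  have hs : IsActionStable (N.toSubmodule.map (vCoord k).toLinearMap) := by
    rintro a x ha _ ⟨ξ, hξ, rfl⟩
    obtain ⟨X, rfl, rfl⟩ := exists_sp a x ha
    exact ⟨⁅X, ξ⁆, N.lie_mem hξ, vCoord_lie X ξ⟩
  obtain h | h := hs.eq_bot_or_eq_top
  · refine absurd ?_ hN
    rw [← LieSubmodule.toSubmodule_eq_bot]
    refine (Submodule.eq_bot_iff _).2 fun ξ hξ => ?_
    have : vCoord k ξ ∈ N.toSubmodule.map (vCoord k).toLinearMap := ⟨ξ, hξ, rfl⟩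
    rw [h] at this
    exact (vCoord k).map_eq_zero_iff.1 this
  · rw [← LieSubmodule.toSubmodule_eq_top]
    refine eq_top_iff.2 fun ξ _ => ?_
    obtain ⟨η, hη, he⟩ : vCoord k ξ ∈ N.toSubmodule.map (vCoord k).toLinearMap := h ▸ trivial
    exact (vCoord k).injective he ▸ hη

/-- Subsuperalgebras that contain the `magO v` and the `magI m s` are everything. -/
theorem eq_top_of_generators {N : Submodule k (Magic k (S4 k) (S12 k))} (hO : ∀ v, magO v ∈ N)
    (hI : ∀ m s, magI m s ∈ N) (hN : ∀ x ∈ N, ∀ y ∈ N, sbr k x y ∈ N) : N = ⊤ := by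
  have hLE (m : Fin 3) (i j : Fin 2) (hij : i ≠ j) : magLE k m i j ∈ N := by
    rw [magLE_eq_bracket m i j hij]
    exact hN _ (hI _ _) _ (hI _ _)
  have hLD (m : Fin 3) : magLE k m 0 0 ∈ N := by
    rw [magLE_diag_eq_bracket m]
    exact N.smul_mem _ (hN _ (hLE m 0 1 (by decide)) _ (hLE m 1 0 (by decide)))
  have hL (a : Fin 3 → S4 k) : magL a ∈ N := by
    have h (m : Fin 3) : a m 0 1 • magLE k m 0 1 + a m 1 0 • magLE k m 1 0 +
        (a m 0 0 - a m 1 1) • magLE k m 0 0 ∈ N :=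
      add_mem (add_mem (N.smul_mem _ (hLE m 0 1 (by decide)))
        (N.smul_mem _ (hLE m 1 0 (by decide)))) (N.smul_mem _ (hLD m))
    rw [magL_expand 0]
    exact add_mem (add_mem (h 0) (h (0 + 1))) (h (0 + 2))
  have hQ (q : S4 k) : magQ q ∈ N := by
    have h (i j) : sbr k (magOE k i) (magOE k j) ∈ N := hN _ (hO _) _ (hO _)
    rw [magQ_expand, magQE_upper, magQE_lower, magQE_diag.1, magQE_diag.2]
    exact add_mem (add_mem (add_mem (N.smul_mem _ (h _ _)) (N.smul_mem _ (N.smul_mem _ (h _ _))))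
      (N.smul_mem _ (h _ _))) (N.smul_mem _ (N.smul_mem _ (h _ _)))
  have hz {x : Magic k (S4 k) (S12 k)} (hx : x ∈ N) : N.mkQ x = (0 : _ →ₗ[k] _) x :=
    (Submodule.Quotient.mk_eq_zero _).2 hx
  have h : N.mkQ = 0 := magic_ext (fun a => hz (hL a)) (fun q => hz (hQ q)) (fun v => hz (hO v))
    (fun m s => hz (hI m s)) fun m s v => by
      rw [← O_I]
      exact hz (hN _ (hO v) _ (hI m s))
  rw [← N.ker_mkQ, h, LinearMap.ker_zero]

theorem exists_oddElement {X : Magic k (S4 k) (S12 k)}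
    (hX : X ∈ part k (Magic k (S4 k) (S12 k)) 1) : ∃ p q : (Fin 3 → S4 k) × k,
      X = oddElement p.1 p.2 (Pi.single 0 1) + oddElement q.1 q.2 (Pi.single 1 1) := by
  have e : ((Fin 3 → S4 k) × k) ≃ₗ[k] (Fin 3 → S4 k) × k := LinearEquiv.refl k _
  rw [← range_oddMap e] at hX
  obtain ⟨t, rfl⟩ := hX
  obtain ⟨p, q, rfl⟩ := exists_tmul_single t
  exact ⟨e p, e q, oddMap_add_tmul e p q _ _⟩

theorem exists_evenElement {X : Magic k (S4 k) (S12 k)}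
    (hX : X ∈ part k (Magic k (S4 k) (S12 k)) 0) : ∃ (a x : Fin 3 → S4 k) (q : S4 k),
      (∀ m, (a m).trace = 0) ∧ q.trace = 0 ∧ X = evenElement a x q := by
  rw [← range_evenMap] at hX
  obtain ⟨X, rfl⟩ := hX
  exact ⟨_, _, _, block_traces X.1, sl_trace X.2, rfl⟩

theorem oddElement_zero_right (x : Fin 3 → S4 k) (c : k) : oddElement x c 0 = 0 := by
  simp [oddElement]

theorem oddElement_zero_left (v : Fin 2 → k) : oddElement (0 : Fin 3 → S4 k) 0 v = 0 := by
  simp [oddElement]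

theorem oddElement_injective {x : Fin 3 → S4 k} {c : k} {v : Fin 2 → k} {i : Fin 2} (hv : v i = 1)
    (h : oddElement x c v = 0) : x = 0 ∧ c = 0 := by
  obtain ⟨h1, h2⟩ := coord_oddElement x c v
  rw [h] at h1 h2
  constructor
  · funext m
    simpa [hv] using (h1 m i).symm
  · simpa [hv] using congr_fun h2 i

/-- The odd part is P ⊗ k², where P denotes the coordinates of V(ω₂). The p with p ⊗ e₀ in N form a
stable subspace of P, hence 0 or P. In the first case E₀₁ maps p ⊗ e₀ + q ⊗ e₁ to q ⊗ e₀, which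
gives q = 0 and then p = 0. In the second case E₁₀ maps q ⊗ e₀ to q ⊗ e₁. -/
theorem eq_part_one {N : Submodule k (Magic k (S4 k) (S12 k))}
    (hN1 : N ≤ part k (Magic k (S4 k) (S12 k)) 1)
    (hN : ∀ x ∈ part k (Magic k (S4 k) (S12 k)) 0, ∀ y ∈ N, sbr k x y ∈ N) :
    N = ⊥ ∨ N = part k (Magic k (S4 k) (S12 k)) 1 := by
  let P : Submodule k ((Fin 3 → S4 k) × k) :=
    { carrier := {p | oddElement p.1 p.2 (Pi.single 0 1) ∈ N}
      zero_mem' := by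
        change oddElement (0 : Fin 3 → S4 k) 0 _ ∈ N
        rw [oddElement_zero_left]
        exact N.zero_mem
      add_mem' := fun {p q} hp hq => by
        change oddElement (p.1 + q.1) (p.2 + q.2) _ ∈ N
        rw [oddElement_add]
        exact add_mem hp hq
      smul_mem' := fun a p hp => by
        change oddElement (a • p.1) (a • p.2) _ ∈ N
        rw [oddElement_smul]
        exact N.smul_mem a hp }
  have hbr (a x : Fin 3 → S4 k) (q : S4 k) (p : (Fin 3 → S4 k) × k) (v : Fin 2 → k) :=
    evenElement_bracket_oddElement a x q p.1 p.2 v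
  have hP : IsActionStable P := by
    intro a x ha p hp
    have := hN _ (evenElement_mem a x 0) _ hp
    rw [hbr a x 0 p _ ha (Matrix.trace_zero _ _), Matrix.zero_mulVec, oddElement_zero_right,
      add_zero] at this
    exact this
  have hq (q : S4 k) (hq : q.trace = 0) (p : (Fin 3 → S4 k) × k) (v : Fin 2 → k) :
      sbr k (evenElement 0 0 q) (oddElement p.1 p.2 v) = oddElement p.1 p.2 (q.mulVec v) := by
    rw [hbr 0 0 q p v (fun _ => Matrix.trace_zero _ _) hq]
    simp [form_S4_zero_left, oddElement]
  have h01 := trace_single_ne (k := k) (i := 0) (j := 1) (by decide)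
  have h10 := trace_single_ne (k := k) (i := 1) (j := 0) (by decide)
  obtain h | h := hP.eq_bot_or_eq_top
  · refine .inl ((Submodule.eq_bot_iff _).2 fun X hX => ?_)
    obtain ⟨p, q, rfl⟩ := exists_oddElement (hN1 hX)
    have hz (p : (Fin 3 → S4 k) × k) (hp : oddElement p.1 p.2 (Pi.single 0 1) ∈ N) : p = 0 := by
      have : p ∈ P := hp
      rwa [h] at this
    have h1 := hN _ (evenElement_mem 0 0 (Matrix.single 0 1 1)) _ hX
    rw [sbr_add_right, hq _ h01, hq _ h01, single_mulVec_single, single_mulVec_single] at h1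
    obtain rfl : q = 0 := hz q (by simpa [oddElement_zero_right] using h1)
    have h2 : oddElement (0 : (Fin 3 → S4 k) × k).1 (0 : (Fin 3 → S4 k) × k).2
      (Pi.single 1 1 : Fin 2 → k) = 0 := oddElement_zero_left _
    rw [h2, add_zero] at hX ⊢
    rw [hz p hX]
    exact oddElement_zero_left _
  · refine .inr (le_antisymm hN1 fun X hX => ?_)
    obtain ⟨p, q, rfl⟩ := exists_oddElement hX
    have hT (p : (Fin 3 → S4 k) × k) : oddElement p.1 p.2 (Pi.single 0 1) ∈ N :=
      (h ▸ trivial : p ∈ P)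
    have h1 := hN _ (evenElement_mem 0 0 (Matrix.single 1 0 1)) _ (hT q)
    rw [hq _ h10, single_mulVec_single] at h1
    exact add_mem (hT p) (by simpa using h1)

theorem part_one_ne_bot : part k (Magic k (S4 k) (S12 k)) 1 ≠ ⊥ := by
  intro h
  have h1 : oddElement 0 1 (Pi.single 0 1) ∈ part k (Magic k (S4 k) (S12 k)) 1 :=
    oddElement_mem _ _ _
  rw [h] at h1
  exact one_ne_zero (oddElement_injective (i := 0) (by simp) h1).2

/-- The even part acts faithfully on the odd part. -/
theorem eq_zero_of_bracket_part_one {X : Magic k (S4 k) (S12 k)}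
    (hX : X ∈ part k (Magic k (S4 k) (S12 k)) 0)
    (h : ∀ Y ∈ part k (Magic k (S4 k) (S12 k)) 1, sbr k X Y = 0) : X = 0 := by
  obtain ⟨a, x, q, ha, hq, rfl⟩ := exists_evenElement hX
  have h1 (y c v) := h _ (oddElement_mem y c v)
  simp only [evenElement_bracket_oddElement _ _ _ _ _ _ ha hq] at h1
  -- On (0, 1) ⊗ v the only contribution along `magO` comes from qv, so q = 0.
  have h2 (v) := congr_arg (coordO k) (h1 0 1 v)
  simp only [map_add, (coord_oddElement _ _ _).2, map_zero, Pi.zero_apply, form_S4_zero_right,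
    Finset.sum_const_zero, zero_smul, neg_zero, zero_add, one_smul, neg_eq_zero] at h2
  have hq0 : q = 0 := by
    refine Matrix.ext_of_mulVec_single fun i => ?_
    rw [h2, Matrix.zero_mulVec]
  subst hq0
  simp only [Matrix.zero_mulVec, oddElement_zero_right, add_zero] at h1
  have h3 := fun y c => (oddElement_injective (i := 0) (by simp) (h1 y c (Pi.single 0 1))).1
  -- The same vector (0, 1) is sent to (x, 0) once q is gone.
  have hx : x = 0 := by
    have := h3 0 1
    simpa [Matrix.adjugate_zero] using this
  subst hx
  have h4 (y : Fin 3 → S4 k) (m) := congr_fun (h3 y 0) m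
  simp only [Pi.zero_apply, smul_zero, add_zero, Matrix.adjugate_zero, zero_mul, mul_zero,
    sub_zero] at h4
  -- Identity matrices as test vectors give equality of the two matrices acting on a block; a
  -- traceless matrix that commutes with E₀₁ and E₁₀ is then zero.
  have h5 (m) : a m = a (m + 2) := by
    have := h4 1 m
    simpa [sub_eq_zero] using this
  have h6 (m) : a m = 0 := by
    have h01 := congr_fun₂ (h4 (fun _ => Matrix.single 0 1 1) m)
    have h10 := congr_fun₂ (h4 (fun _ => Matrix.single 1 0 1) m)
    rw [← h5] at h01 h10
    have e1 := h01 0 0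
    have e2 := h01 0 1
    have e3 := h10 0 0
    have e4 := ha m
    rw [Matrix.trace_fin_two] at e4
    simp [S4_mul_apply, Matrix.single] at e1 e2 e3
    apply S4_ext <;> simp <;> grind
  have : a = 0 := funext h6
  rw [this]
  simp [evenElement]

/-- By `eq_part_one` the odd part of a graded ideal I is 0 or everything. If it is 0, then even
elements of I map odd elements into I ∩ odd = 0 and vanish by faithfulness. If it is everything, I
contains every `magO v`, and the brackets of `magO` with `magK` provide every `magI m s`. -/
theorem isSimpleSuperalgebra_magic : IsSimpleSuperalgebra k (Magic k (S4 k) (S12 k)) where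
  bracket_ne_zero := by
    refine ⟨magO (Pi.single 0 1), magI 0 1, fun h => ?_⟩
    rw [O_I] at h
    have := congr_arg (coordK k 0 0) h
    rw [coordK_magK] at this
    simpa using this
  eq_bot_or_eq_top I hI := by
    have hmem (i) : I ⊓ part k (Magic k (S4 k) (S12 k)) i = ⊥ → ∀ x ∈ I, pr k i x = 0 := by
      intro h x hx
      have : pr k i x ∈ I ⊓ part k (Magic k (S4 k) (S12 k)) i := ⟨hI.proj_mem i x hx, pr_mem k i x⟩
      rwa [h] at this
    obtain h | h := eq_part_one (N := I ⊓ part k (Magic k (S4 k) (S12 k)) 1) inf_le_right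
      fun x hx y hy => ⟨hI.left_mem x y hy.1, by simpa using bracket_mem_part hx hy.2⟩
    · refine .inl ((Submodule.eq_bot_iff _).2 fun x hx => ?_)
      rw [← Superspace.proj_add (k := k) x]
      have h1 : Superspace.proj (k := k) 1 x = 0 := hmem 1 h x hx
      have h0 : Superspace.proj (k := k) 0 x = 0 := by
        refine eq_zero_of_bracket_part_one (pr_mem k 0 x) fun Y hY => ?_
        have : sbr k (pr k 0 x) Y ∈ I ⊓ part k (Magic k (S4 k) (S12 k)) 1 :=
          ⟨hI.right_mem _ (hI.proj_mem 0 x hx) Y, by simpa using bracket_mem_part (pr_mem k 0 x) hY⟩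
        rwa [h] at this
      rw [h0, h1, add_zero]
    · right
      have hO (v) : magO v ∈ I := (h ▸ magO_mem v : magO v ∈ I ⊓ _).1
      refine eq_top_of_generators hO (fun m s => ?_) fun x _ y hy => hI.left_mem x y hy
      have h1 : sbr k (magO (Pi.single 0 1)) (magK m s (Pi.single 1 1)) ∈ I := hI.right_mem _ (hO _) _
      rw [O_K, altForm_apply] at h1
      have h2 := I.smul_mem (1 : k) h1
      simpa using h1

/-- The vector is the class of b₀ ∧ b₁. The two conditions on X describe the Borel subalgebra that
stabilizes the flag b₀, b₁, b₂; if bᵢ has weight εᵢ, the eigenvalue is ε₀ + ε₁, which is ω₂. -/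
theorem exists_highest_weight_vector : ∃ v : VOmega2 k, v ≠ 0 ∧ ∀ X : Symplectic.sp (Fin 3) k,
    (∀ i j, X.1 (Sum.inr i) (Sum.inl j) = 0) →
    (∀ i j, j < i → X.1 (Sum.inl i) (Sum.inl j) = 0) →
      ⁅X, v⁆ = (X.1 (Sum.inl 0) (Sum.inl 0) + X.1 (Sum.inl 1) (Sum.inl 1)) • v := by
  refine ⟨(vCoord k).symm (Pi.single 0 !![0, 1; 0, 0], 0), ?_, fun X h1 h2 => ?_⟩
  · rw [Ne, LinearEquiv.map_eq_zero_iff]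
    intro h
    have := congr_fun₂ (congr_fun (Prod.ext_iff.1 h).1 0) 0 1
    simp at this
  · refine (vCoord k).injective ?_
    have hX := vCoord_lie X ((vCoord k).symm (Pi.single 0 !![0, 1; 0, 0], 0))
    have hs := (vCoord k).map_smul (X.1 (Sum.inl 0) (Sum.inl 0) + X.1 (Sum.inl 1) (Sum.inl 1))
      ((vCoord k).symm (Pi.single 0 !![0, 1; 0, 0], 0))
    rw [LinearEquiv.apply_symm_apply] at hX hs
    refine hX.trans (Eq.trans ?_ hs.symm)
    obtain ⟨c1, c2, c3, c4⟩ := sp_entries X 0 1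
    obtain ⟨b1, b2, b3, b4⟩ := sp_entries X 2 0
    have h02 := h2 2 0 (by decide)
    have h21 := h2 2 1 (by decide)
    have h10 := h2 1 0 (by decide)
    have d1 := (sp_entries X 1 1).2.2.2
    have e1 := (sp_entries X 2 1).2.2.2
    refine Prod.ext (funext fun m => ?_) ?_
    · obtain rfl | rfl | rfl : m = 0 ∨ m = 1 ∨ m = 2 := by revert m; decide
      all_goals apply S4_ext
      all_goals simp [diagBlock, offBlock, block, S4_mul_apply, adjugate_apply, Matrix.single, h1,
        h02, h21, h10, d1, e1]
    · simp [Fin.sum_univ_three, form_S4_apply, offBlock, block, h1, Matrix.single]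

end Irreducible

end SuperMagic

namespace SuperMagic

/-! ### The free algebra on the generators of a contragredient Lie superalgebra -/

section Words

variable {k : Type u} [Field k] {n : ℕ} {V : Type u}

variable (k) in
/-- A word as an element of the free algebra. -/
noncomputable def word (w : FreeMagma (Gen V n)) : FreeAlg k V n := MonoidAlgebra.single w 1

theorem word_mul (w w' : FreeMagma (Gen V n)) : word k (w * w') = word k w * word k w' := by
  rw [word, word, word, MonoidAlgebra.single_mul_single, one_mul]

theorem free_ext {N : Type*} [AddCommGroup N] [Module k N] {f g : FreeAlg k V n →ₗ[k] N}
    (h : ∀ w, f (word k w) = g (word k w)) : f = g := by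
  refine LinearMap.ext fun x => ?_
  induction x using MonoidAlgebra.induction_linear with
  | zero => rw [map_zero, map_zero]
  | add x y hx hy => rw [map_add, map_add, hx, hy]
  | single w c =>
    have : (MonoidAlgebra.single w c : FreeAlg k V n) = c • word k w := by
      rw [word, MonoidAlgebra.smul_single, smul_eq_mul, mul_one]
    rw [this, map_smul, map_smul, h]

theorem span_word : Submodule.span k (Set.range (word k : FreeMagma (Gen V n) → FreeAlg k V n)) = ⊤ := by
  rw [← Submodule.ker_mkQ (Submodule.span k (Set.range (word k : _ → FreeAlg k V n)))]
  have : (Submodule.span k (Set.range (word k : _ → FreeAlg k V n))).mkQ = 0 :=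
    free_ext fun w => (Submodule.Quotient.mk_eq_zero _).2 (Submodule.subset_span ⟨w, rfl⟩)
  rw [this, LinearMap.ker_zero]

theorem wordProj_word (p : FreeMagma (Gen V n) → Prop) [DecidablePred p] (w : FreeMagma (Gen V n)) :
    wordProj k p (word k w) = if p w then word k w else 0 := by
  refine MonoidAlgebra.coeff_injective ?_
  rw [coeff_wordProj, word, MonoidAlgebra.coeff_single]
  split_ifs with h
  · rw [Finsupp.filter_single_of_pos _ h, MonoidAlgebra.coeff_single]
  · rw [Finsupp.filter_single_of_neg _ h, MonoidAlgebra.coeff_zero]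

theorem parityProj_word (τ : Finset (Fin n)) (i : ZMod 2) (w : FreeMagma (Gen V n)) :
    parityProj k V τ i (word k w) = if wordParity τ w = i then word k w else 0 :=
  wordProj_word _ w

theorem degreeProj_word (d : ℤ) (w : FreeMagma (Gen V n)) :
    degreeProj k V n d (word k w) = if wordDegree w = d then word k w else 0 :=
  wordProj_word _ w

theorem wordDegree_mul (w w' : FreeMagma (Gen V n)) :
    wordDegree (w * w') = wordDegree w + wordDegree w' := rfl

/-- Elements of degree `d`. -/
def HasDegree (d : ℤ) (x : FreeAlg k V n) : Prop := degreeProj k V n d x = x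

/-- Elements of parity `i`. -/
def HasParity (τ : Finset (Fin n)) (i : ZMod 2) (x : FreeAlg k V n) : Prop :=
  parityProj k V τ i x = x

/-- Words are the linear basis of the free algebra, so statements about homogeneous elements reduce
to words. -/
theorem wordProj_eq_self_iff (p : FreeMagma (Gen V n) → Prop) [DecidablePred p] (x : FreeAlg k V n) :
    wordProj k p x = x ↔ x ∈ Submodule.span k (word k '' {w | p w}) := by
  constructor
  · intro h
    rw [← h]
    suffices hs : (Submodule.span k (word k '' {w | p w})).mkQ ∘ₗ wordProj k p = 0 from
      (Submodule.Quotient.mk_eq_zero _).1 (LinearMap.congr_fun hs x)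
    refine free_ext fun w => (Submodule.Quotient.mk_eq_zero _).2 ?_
    rw [wordProj_word]
    split_ifs with hw
    · exact Submodule.subset_span ⟨w, hw, rfl⟩
    · exact zero_mem _
  · intro h
    refine LinearMap.eqOn_span (f := wordProj k p) (g := LinearMap.id) ?_ h
    rintro _ ⟨w, hw, rfl⟩
    exact (wordProj_word p w).trans (if_pos hw)

theorem HasDegree.mul {c d : ℤ} {x y : FreeAlg k V n} (hx : HasDegree c x) (hy : HasDegree d y) :
    HasDegree (c + d) (x * y) := by
  have hx' := (wordProj_eq_self_iff _ x).1 hx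
  have hy' := (wordProj_eq_self_iff _ y).1 hy
  refine (wordProj_eq_self_iff _ _).2 ?_
  have := Submodule.apply_mem_map₂ (LinearMap.mul k (FreeAlg k V n)) hx' hy'
  rw [Submodule.map₂_span_span] at this
  refine Submodule.span_mono ?_ this
  rintro _ ⟨_, ⟨w, hw, rfl⟩, _, ⟨w', hw', rfl⟩, rfl⟩
  refine ⟨w * w', ?_, word_mul w w'⟩
  rw [Set.mem_setOf_eq] at hw hw' ⊢
  rw [wordDegree_mul, hw, hw']

theorem HasDegree.degreeProj_of_ne {c d : ℤ} {x : FreeAlg k V n} (hx : HasDegree c x)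
    (h : c ≠ d) : degreeProj k V n d x = 0 := by
  have hx' := (wordProj_eq_self_iff _ x).1 hx
  refine LinearMap.eqOn_span (f := degreeProj k V n d) (g := 0) ?_ hx'
  rintro _ ⟨w, hw, rfl⟩
  rw [Set.mem_setOf_eq] at hw
  rw [degreeProj_word, if_neg (hw ▸ h), LinearMap.zero_apply]

theorem hasDegree_word (w : FreeMagma (Gen V n)) : HasDegree (wordDegree w) (word k w) := by
  rw [HasDegree, degreeProj_word, if_pos rfl]

theorem hasParity_word (τ : Finset (Fin n)) (w : FreeMagma (Gen V n)) :
    HasParity τ (wordParity τ w) (word k w) := by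
  rw [HasParity, parityProj_word, if_pos rfl]

end Words

/-! ### The triangular decomposition of 𝔤̃(A, τ), formulated in the free algebra. -/

section Triangular

variable {k : Type u} [Field k] {n : ℕ} {A : Matrix (Fin n) (Fin n) k} (R : Realization A)
  (τ : Finset (Fin n))

theorem isHomogeneousIdeal_relationIdeal : IsHomogeneousIdeal τ (relationIdeal R τ) where
  left_mem x y hy := Submodule.mem_sInf.2 fun I hI =>
    hI.1.left_mem x y (Submodule.mem_sInf.1 hy I hI)
  right_mem x hx y := Submodule.mem_sInf.2 fun I hI =>
    hI.1.right_mem x (Submodule.mem_sInf.1 hx I hI) y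
  parity_mem i x hx := Submodule.mem_sInf.2 fun I hI =>
    hI.1.parity_mem i x (Submodule.mem_sInf.1 hx I hI)
  degree_mem d x hx := Submodule.mem_sInf.2 fun I hI =>
    hI.1.degree_mem d x (Submodule.mem_sInf.1 hx I hI)

variable {R τ}

theorem IsRelation.mem {x : FreeAlg k R.𝔥 n} (h : IsRelation R τ x) : x ∈ relationIdeal R τ :=
  Submodule.mem_sInf.2 fun _ hI => hI.2 x h

theorem mul_add_koszul_mem {i j : ZMod 2} {x y : FreeAlg k R.𝔥 n} (hx : HasParity τ i x)
    (hy : HasParity τ j y) : x * y + koszul k i j • (y * x) ∈ relationIdeal R τ :=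
  IsRelation.mem (.skew i j x y hx hy)

/-- Multiplication maps a subspace containing the relations to such a subspace if it does so for
swapped factors. -/
theorem mul_mem_of_swap {N : Submodule k (FreeAlg k R.𝔥 n)} (hN : relationIdeal R τ ≤ N)
    {i j : ZMod 2} {x y : FreeAlg k R.𝔥 n} (hx : HasParity τ i x) (hy : HasParity τ j y)
    (h : y * x ∈ N) : x * y ∈ N := by
  have := sub_mem (hN (mul_add_koszul_mem hx hy)) (N.smul_mem (koszul k i j) h)
  rwa [add_sub_cancel_right] at this

/-- Modulo the relations each of the three terms of the Jacobi identity is a combination of the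
other two; the value of the sign is irrelevant for membership in a subspace. -/
theorem jacobi_mem {N : Submodule k (FreeAlg k R.𝔥 n)} (hN : relationIdeal R τ ≤ N)
    {i j : ZMod 2} {x y z : FreeAlg k R.𝔥 n} (hx : HasParity τ i x) (hy : HasParity τ j y)
    (h1 : x * y * z ∈ N) (h2 : y * (x * z) ∈ N) : x * (y * z) ∈ N := by
  have := add_mem (hN (IsRelation.mem (.jacobi i j x y z hx hy)))
    (add_mem h1 (N.smul_mem (koszul k i j) h2))
  rwa [sub_add_cancel] at this

theorem jacobi_mem' {N : Submodule k (FreeAlg k R.𝔥 n)} (hN : relationIdeal R τ ≤ N)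
    {i j : ZMod 2} {x y z : FreeAlg k R.𝔥 n} (hx : HasParity τ i x) (hy : HasParity τ j y)
    (h1 : x * (y * z) ∈ N) (h2 : y * (x * z) ∈ N) : x * y * z ∈ N := by
  have := sub_mem (sub_mem h1 (N.smul_mem (koszul k i j) h2))
    (hN (IsRelation.mem (.jacobi i j x y z hx hy)))
  convert this using 1
  abel

variable (R τ) in
/-- The preimage of `𝔥`. -/
noncomputable def cartanPart : Submodule k (FreeAlg k R.𝔥 n) :=
  Submodule.span k (Set.range genH) ⊔ relationIdeal R τ

theorem relationIdeal_le_cartanPart : relationIdeal R τ ≤ cartanPart R τ := le_sup_right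

theorem genH_mem_cartanPart (h : R.𝔥) : genH h ∈ cartanPart R τ :=
  Submodule.mem_sup_left (Submodule.subset_span ⟨h, rfl⟩)

/-- Modulo the relations h ↦ `genH h` is linear, so its image is already a subspace and no linear
combinations are needed. -/
theorem exists_genH {x : FreeAlg k R.𝔥 n} (hx : x ∈ cartanPart R τ) :
    ∃ h : R.𝔥, x - genH h ∈ relationIdeal R τ := by
  let f : R.𝔥 →ₗ[k] FreeAlg k R.𝔥 n ⧸ relationIdeal R τ :=
    { toFun := fun h => (relationIdeal R τ).mkQ (genH h)
      map_add' := fun h h' => by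
        rw [← map_add]
        exact (Submodule.Quotient.eq _).2 (IsRelation.mem (.h_add h h'))
      map_smul' := fun c h => by
        rw [RingHom.id_apply, ← map_smul]
        exact (Submodule.Quotient.eq _).2 (IsRelation.mem (.h_smul c h)) }
  have h1 : cartanPart R τ ≤ (LinearMap.range f).comap (relationIdeal R τ).mkQ := by
    refine sup_le (Submodule.span_le.2 ?_) fun r hr => ?_
    · rintro _ ⟨h, rfl⟩
      exact ⟨h, rfl⟩
    · exact ⟨0, (map_zero f).trans ((Submodule.Quotient.mk_eq_zero _).2 hr).symm⟩
  obtain ⟨h, hh⟩ := h1 hx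
  exact ⟨h, (Submodule.Quotient.eq _).1 hh.symm⟩

variable (R τ) in
/-- Two families `X`, `Y` of generators that play the roles of the `eᵢ` and the `fᵢ`, or of the
`fᵢ` and the `eᵢ`. -/
structure IsGenPair (X Y : Fin n → FreeAlg k R.𝔥 n) : Prop where
  parity_left : ∀ i, HasParity τ (if i ∈ τ then 1 else 0) (X i)
  parity_right : ∀ i, HasParity τ (if i ∈ τ then 1 else 0) (Y i)
  genH_mul : ∀ h i, ∃ c : k, genH h * X i - c • X i ∈ relationIdeal R τ
  mul_mem : ∀ i j, Y j * X i ∈ cartanPart R τ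

/-- Iterated products of the `Xᵢ`. -/
inductive IsIterated (X : Fin n → FreeAlg k R.𝔥 n) : FreeAlg k R.𝔥 n → Prop
  | base (i : Fin n) : IsIterated X (X i)
  | mul (i : Fin n) (y : FreeAlg k R.𝔥 n) : IsIterated X y → IsIterated X (X i * y)

variable (τ) in
/-- The span of the iterated products and the relations. -/
noncomputable def iteratedPart (X : Fin n → FreeAlg k R.𝔥 n) : Submodule k (FreeAlg k R.𝔥 n) :=
  Submodule.span k {x | IsIterated X x} ⊔ relationIdeal R τ

variable {X Y : Fin n → FreeAlg k R.𝔥 n}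

theorem relationIdeal_le_iteratedPart : relationIdeal R τ ≤ iteratedPart τ X := le_sup_right

theorem IsIterated.mem {x : FreeAlg k R.𝔥 n} (h : IsIterated X x) : x ∈ iteratedPart τ X :=
  Submodule.mem_sup_left (Submodule.subset_span h)

/-- If `x` multiplies generators of a subspace containing the relations into another such
subspace, then it multiplies the whole subspace into it. -/
theorem mul_mem_of_generators {s : Set (FreeAlg k R.𝔥 n)} {N : Submodule k (FreeAlg k R.𝔥 n)}
    (hN : relationIdeal R τ ≤ N) {x y : FreeAlg k R.𝔥 n}
    (h : ∀ y ∈ s, x * y ∈ N) (hy : y ∈ Submodule.span k s ⊔ relationIdeal R τ) : x * y ∈ N := by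
  have : Submodule.span k s ⊔ relationIdeal R τ ≤ N.comap (LinearMap.mulLeft k x) :=
    sup_le (Submodule.span_le.2 h)
      fun y hy => hN ((isHomogeneousIdeal_relationIdeal R τ).left_mem x y hy)
  exact this hy

theorem left_mul_iteratedPart (i : Fin n) {y : FreeAlg k R.𝔥 n} (hy : y ∈ iteratedPart τ X) :
    X i * y ∈ iteratedPart τ X :=
  mul_mem_of_generators relationIdeal_le_iteratedPart (fun y hy => (IsIterated.mul i y hy).mem) hy

theorem hasParity_genH (h : R.𝔥) : HasParity τ 0 (genH h : FreeAlg k R.𝔥 n) :=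
  hasParity_word τ (.of (.h h))

theorem IsGenPair.genH_mul_iterated (hXY : IsGenPair R τ X Y) (h : R.𝔥) {y : FreeAlg k R.𝔥 n}
    (hy : IsIterated X y) : ∃ c : k, genH h * y - c • y ∈ relationIdeal R τ := by
  have hI := isHomogeneousIdeal_relationIdeal R τ
  induction hy with
  | base i => exact hXY.genH_mul h i
  | mul i y _ ih =>
    obtain ⟨c, hc⟩ := ih
    obtain ⟨d, hd⟩ := hXY.genH_mul h i
    refine ⟨d + c, ?_⟩
    have h1 := IsRelation.mem (.jacobi 0 _ (genH h) (X i) y (hasParity_genH h)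
      (hXY.parity_left i))
    rw [koszul_zero_left, one_smul] at h1
    have h2 := hI.right_mem _ hd y
    have h3 := hI.left_mem (X i) _ hc
    rw [sub_mul, smul_mul_assoc] at h2
    rw [mul_sub, mul_smul_comm] at h3
    convert add_mem h1 (add_mem h2 h3) using 1
    module

theorem IsGenPair.genH_mul_mem (hXY : IsGenPair R τ X Y) (h : R.𝔥) {y : FreeAlg k R.𝔥 n}
    (hy : y ∈ iteratedPart τ X) : genH h * y ∈ iteratedPart τ X :=
  mul_mem_of_generators relationIdeal_le_iteratedPart (fun y hy => by
    obtain ⟨c, hc⟩ := hXY.genH_mul_iterated h hy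
    have := add_mem (relationIdeal_le_iteratedPart hc)
      ((iteratedPart τ X).smul_mem c hy.mem)
    rwa [sub_add_cancel] at this) hy

theorem cartanPart_mul_mem {N : Submodule k (FreeAlg k R.𝔥 n)} (hN : relationIdeal R τ ≤ N)
    {x y : FreeAlg k R.𝔥 n} (hx : x ∈ cartanPart R τ) (h : ∀ h : R.𝔥, genH h * y ∈ N) :
    x * y ∈ N := by
  obtain ⟨g, hg⟩ := exists_genH hx
  have := add_mem (hN ((isHomogeneousIdeal_relationIdeal R τ).right_mem _ hg y)) (h g)
  rwa [sub_mul, sub_add_cancel] at this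

theorem IsGenPair.left_mul_cartanPart (hXY : IsGenPair R τ X Y) (i : Fin n)
    {y : FreeAlg k R.𝔥 n} (hy : y ∈ cartanPart R τ) : X i * y ∈ iteratedPart τ X := by
  refine mul_mem_of_generators relationIdeal_le_iteratedPart ?_ hy
  rintro _ ⟨h, rfl⟩
  exact mul_mem_of_swap relationIdeal_le_iteratedPart (hXY.parity_left i) (hasParity_genH h)
    (hXY.genH_mul_mem h (IsIterated.base i).mem)

/-- Induction on the length: Y_j (X_i y) is (Y_j X_i) y plus or minus X_i (Y_j y). In the first term
Y_j X_i lies in 𝔥, which acts by scalars on iterated products; the second is covered by the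
induction hypothesis, because X_i maps both 𝔥 and iterated products to iterated products. -/
theorem IsGenPair.opposite_mul_mem (hXY : IsGenPair R τ X Y) (j : Fin n) {y : FreeAlg k R.𝔥 n}
    (hy : y ∈ iteratedPart τ X) : Y j * y ∈ cartanPart R τ ⊔ iteratedPart τ X := by
  have hN : relationIdeal R τ ≤ cartanPart R τ ⊔ iteratedPart τ X :=
    relationIdeal_le_cartanPart.trans le_sup_left
  refine mul_mem_of_generators hN (fun y hy => ?_) hy
  induction hy with
  | base i => exact Submodule.mem_sup_left (hXY.mul_mem i j)
  | mul i y hy ih =>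
    refine jacobi_mem hN (hXY.parity_right j) (hXY.parity_left i) ?_ ?_
    · exact cartanPart_mul_mem hN (hXY.mul_mem i j) fun h =>
        Submodule.mem_sup_right (hXY.genH_mul_mem h hy.mem)
    · obtain ⟨a, ha, b, hb, hab⟩ := Submodule.mem_sup.1 ih
      rw [← hab, mul_add]
      exact Submodule.mem_sup_right (add_mem (hXY.left_mul_cartanPart i ha)
        (left_mul_iteratedPart i hb))

variable (R τ) in
theorem isGenPair_e_f : IsGenPair R τ (genE k R.𝔥) (genF k R.𝔥) where
  parity_left i := hasParity_word τ (.of (.e i))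
  parity_right i := hasParity_word τ (.of (.f i))
  genH_mul h i := ⟨R.root i h, IsRelation.mem (.h_e h i)⟩
  mul_mem i j := by
    refine mul_mem_of_swap relationIdeal_le_cartanPart (hasParity_word τ (.of (.f j)))
      (hasParity_word τ (.of (.e i))) ?_
    have h1 := relationIdeal_le_cartanPart (IsRelation.mem (τ := τ) (.e_f (R := R) i j))
    have h2 : (if i = j then genH (R.coroot i) else 0 : FreeAlg k R.𝔥 n) ∈ cartanPart R τ := by
      split_ifs
      · exact genH_mem_cartanPart _
      · exact zero_mem _
    simpa using add_mem h1 h2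

variable (R τ) in
theorem isGenPair_f_e : IsGenPair R τ (genF k R.𝔥) (genE k R.𝔥) where
  parity_left i := hasParity_word τ (.of (.f i))
  parity_right i := hasParity_word τ (.of (.e i))
  genH_mul h i := ⟨-R.root i h, by
    rw [neg_smul, sub_neg_eq_add]
    exact IsRelation.mem (.h_f h i)⟩
  mul_mem i j := by
    have h1 := relationIdeal_le_cartanPart (IsRelation.mem (τ := τ) (.e_f (R := R) j i))
    have h2 : (if j = i then genH (R.coroot j) else 0 : FreeAlg k R.𝔥 n) ∈ cartanPart R τ := by
      split_ifs
      · exact genH_mem_cartanPart _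
      · exact zero_mem _
    simpa using add_mem h1 h2

variable (R τ) in
/-- The triangular decomposition. -/
theorem triangular_eq_top :
    cartanPart R τ ⊔ iteratedPart τ (genE k R.𝔥) ⊔ iteratedPart τ (genF k R.𝔥) = ⊤ := by
  have hef := isGenPair_e_f R τ
  have hfe := isGenPair_f_e R τ
  have hHS : cartanPart R τ ≤ cartanPart R τ ⊔ iteratedPart τ (genE k R.𝔥) ⊔
    iteratedPart τ (genF k R.𝔥) := le_sup_left.trans le_sup_left
  have hES : iteratedPart τ (genE k R.𝔥) ≤ cartanPart R τ ⊔ iteratedPart τ (genE k R.𝔥) ⊔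
    iteratedPart τ (genF k R.𝔥) := le_sup_right.trans le_sup_left
  have hFS : iteratedPart τ (genF k R.𝔥) ≤ cartanPart R τ ⊔ iteratedPart τ (genE k R.𝔥) ⊔
    iteratedPart τ (genF k R.𝔥) := le_sup_right
  have hEHS := sup_le hHS hES
  have hFHS := sup_le hHS hFS
  have hN := relationIdeal_le_cartanPart.trans hHS
  generalize hS : cartanPart R τ ⊔ iteratedPart τ (genE k R.𝔥) ⊔
    iteratedPart τ (genF k R.𝔥) = S at hHS hES hFS hEHS hFHS hN ⊢
  have stable {x} (h1 : ∀ y ∈ cartanPart R τ, x * y ∈ S)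
      (h2 : ∀ y ∈ iteratedPart τ (genE k R.𝔥), x * y ∈ S)
      (h3 : ∀ y ∈ iteratedPart τ (genF k R.𝔥), x * y ∈ S) : ∀ y ∈ S, x * y ∈ S := by
    have : cartanPart R τ ⊔ iteratedPart τ (genE k R.𝔥) ⊔ iteratedPart τ (genF k R.𝔥) ≤
      S.comap (LinearMap.mulLeft k x) := sup_le (sup_le h1 h2) h3
    rw [hS] at this
    exact this
  -- By the Jacobi identity the homogeneous x with x S ⊆ S are closed under products, so it is
  -- enough to treat the generators.
  have hmul (w : FreeMagma (Gen R.𝔥 n)) : ∀ y ∈ S, word k w * y ∈ S := by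
    induction w with
    | ih1 g =>
      cases g with
      | h h =>
        refine stable (fun y hy => mul_mem_of_generators hN ?_ hy)
          (fun y hy => hES (hef.genH_mul_mem h hy)) fun y hy => hFS (hfe.genH_mul_mem h hy)
        rintro _ ⟨h', rfl⟩
        exact hN (IsRelation.mem (.h_h h h'))
      | e i =>
        exact stable (fun y hy => hES (hef.left_mul_cartanPart i hy))
          (fun y hy => hES (left_mul_iteratedPart i hy))
          fun y hy => hFHS (hfe.opposite_mul_mem i hy)
      | f i =>
        exact stable (fun y hy => hFS (hfe.left_mul_cartanPart i hy))
          (fun y hy => hEHS (hef.opposite_mul_mem i hy))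
          fun y hy => hFS (left_mul_iteratedPart i hy)
    | ih2 u v hu hv =>
      intro y hy
      rw [word_mul]
      exact jacobi_mem' hN (hasParity_word τ u) (hasParity_word τ v) (hu _ (hv y hy))
        (hv _ (hu y hy))
  rw [eq_top_iff, ← span_word, Submodule.span_le]
  rintro _ ⟨w, rfl⟩
  induction w with
  | ih1 g =>
    cases g with
    | h h => exact hHS (genH_mem_cartanPart h)
    | e i => exact hES (IsIterated.base i).mem
    | f i => exact hFS (IsIterated.base i).mem
  | ih2 u v hu hv =>
    rw [word_mul]
    exact hmul u _ hv

theorem IsIterated.exists_degree {ε : ℤ} (hε : ∀ i, HasDegree ε (X i)) {x : FreeAlg k R.𝔥 n}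
    (hx : IsIterated X x) : ∃ m : ℕ, HasDegree ((m + 1) * ε) x := by
  induction hx with
  | base i => exact ⟨0, by simpa using hε i⟩
  | mul i y _ ih =>
    obtain ⟨m, hm⟩ := ih
    refine ⟨m + 1, ?_⟩
    have := (hε i).mul hm
    convert this using 1
    push_cast
    ring

/-- An iterated product of m + 1 factors has degree (m + 1) ε ≠ 0, so only the relations contribute
in degree 0. -/
theorem degreeProj_iteratedPart {ε : ℤ} (hε0 : ε ≠ 0) (hε : ∀ i, HasDegree ε (X i))
    {x : FreeAlg k R.𝔥 n} (hx : x ∈ iteratedPart τ X) :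
    degreeProj k R.𝔥 n 0 x ∈ relationIdeal R τ := by
  have : iteratedPart τ X ≤ (relationIdeal R τ).comap (degreeProj k R.𝔥 n 0) := by
    refine sup_le (Submodule.span_le.2 fun x hx => ?_)
      fun x hx => (isHomogeneousIdeal_relationIdeal R τ).degree_mem 0 x hx
    obtain ⟨m, hm⟩ := IsIterated.exists_degree hε hx
    have h0 : ((m : ℤ) + 1) * ε ≠ 0 := mul_ne_zero (by positivity) hε0
    rw [SetLike.mem_coe, Submodule.mem_comap, hm.degreeProj_of_ne h0]
    exact zero_mem _
  exact this hx

/-- The component of degree `0` is `𝔥`. -/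
theorem mem_cartanPart_of_degree_zero {x : FreeAlg k R.𝔥 n} (hx : HasDegree 0 x) :
    x ∈ cartanPart R τ := by
  have h : x ∈ cartanPart R τ ⊔ iteratedPart τ (genE k R.𝔥) ⊔ iteratedPart τ (genF k R.𝔥) := by
    rw [triangular_eq_top]
    trivial
  obtain ⟨y, hy, f, hf, rfl⟩ := Submodule.mem_sup.1 h
  obtain ⟨a, ha, e, he, rfl⟩ := Submodule.mem_sup.1 hy
  have h1 := degreeProj_iteratedPart one_ne_zero (fun i => hasDegree_word (.of (.e i))) he
  have h2 := degreeProj_iteratedPart (ε := -1) (by decide)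
    (fun i => hasDegree_word (.of (.f i))) hf
  have h3 : degreeProj k R.𝔥 n 0 a ∈ cartanPart R τ := by
    have : cartanPart R τ ≤ (cartanPart R τ).comap (degreeProj k R.𝔥 n 0) := by
      refine sup_le (Submodule.span_le.2 ?_) fun x hx =>
        relationIdeal_le_cartanPart ((isHomogeneousIdeal_relationIdeal R τ).degree_mem 0 x hx)
      rintro _ ⟨h, rfl⟩
      have : degreeProj k R.𝔥 n 0 (genH h) = genH h := hasDegree_word (.of (.h h))
      rw [SetLike.mem_coe, Submodule.mem_comap, this]
      exact genH_mem_cartanPart h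
    exact this ha
  rw [HasDegree, map_add, map_add] at hx
  rw [← hx]
  exact add_mem (add_mem h3 (relationIdeal_le_cartanPart h1)) (relationIdeal_le_cartanPart h2)

end Triangular

end SuperMagic

namespace SuperMagic

/-! ### Recognition of contragredient Lie superalgebras -/

section Recognition

variable {k : Type u} [Field k] {n : ℕ} {A : Matrix (Fin n) (Fin n) k} (R : Realization A)
  (τ : Finset (Fin n)) {L : Type v} [AddCommGroup L] [Module k L] [Superspace k L]
  [SuperBracket k L]

/-- A `ℤ`-graded Lie superalgebra generated by elements `E i`, `F i` that satisfy the relations of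
a contragredient Lie superalgebra, in which `𝔥` is embedded by `η`. -/
structure IsContragredientModel (η : R.𝔥 →ₗ[k] L) (E F : Fin n → L) (G : ℤ → Submodule k L) :
    Prop where
  isLieSuperalgebra : IsLieSuperalgebra k L
  h_mem : ∀ h, η h ∈ part k L 0
  e_mem : ∀ i, E i ∈ part k L (if i ∈ τ then 1 else 0)
  f_mem : ∀ i, F i ∈ part k L (if i ∈ τ then 1 else 0)
  e_f : ∀ i j, sbr k (E i) (F j) = if i = j then η (R.coroot i) else 0
  h_h : ∀ h h', sbr k (η h) (η h') = 0
  h_e : ∀ h i, sbr k (η h) (E i) = R.root i h • E i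
  h_f : ∀ h i, sbr k (η h) (F i) = -(R.root i h • F i)
  injective : Function.Injective η
  generates : ∀ N : Submodule k L, (∀ i, E i ∈ N) → (∀ i, F i ∈ N) →
    (∀ x ∈ N, ∀ y ∈ N, sbr k x y ∈ N) → N = ⊤
  h_degree : ∀ h, η h ∈ G 0
  e_degree : ∀ i, E i ∈ G 1
  f_degree : ∀ i, F i ∈ G (-1)
  bracket_degree : ∀ c d, ∀ x ∈ G c, ∀ y ∈ G d, sbr k x y ∈ G (c + d)
  exists_component : ∀ d, ∃ c : L →ₗ[k] L, ∀ e, ∀ x ∈ G e, c x = if e = d then x else 0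

/-- The value of a word. -/
def evalWord {V : Type u} (η : V → L) (E F : Fin n → L) : FreeMagma (Gen V n) → L
  | .of (.h h) => η h
  | .of (.e i) => E i
  | .of (.f i) => F i
  | .mul x y => sbr k (evalWord η E F x) (evalWord η E F y)

/-- The linear map that sends every word to its value. -/
noncomputable def evalMap {V : Type u} (η : V → L) (E F : Fin n → L) : FreeAlg k V n →ₗ[k] L where
  toFun x := x.coeff.sum fun w c => c • evalWord (k := k) η E F w
  map_add' x y := Finsupp.sum_add_index' (fun _ => zero_smul _ _) fun _ _ _ => add_smul _ _ _
  map_smul' c x := by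
    refine (Finsupp.sum_smul_index' (g := x.coeff) (b := c)
      (h := fun w c => c • evalWord (k := k) η E F w) fun _ => zero_smul _ _).trans ?_
    rw [RingHom.id_apply, Finsupp.smul_sum]
    simp only [smul_eq_mul, mul_smul]

theorem evalMap_word {V : Type u} (η : V → L) (E F : Fin n → L) (w : FreeMagma (Gen V n)) :
    evalMap (k := k) η E F (word k w) = evalWord (k := k) η E F w := by
  change (word k w).coeff.sum (fun w c => c • evalWord (k := k) η E F w) = _
  rw [word, MonoidAlgebra.coeff_single]
  exact (Finsupp.sum_single_index (h := fun w c => c • evalWord (k := k) η E F w)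
    (zero_smul _ _)).trans (one_smul _ _)

theorem evalMap_mul {V : Type u} (η : V → L) (E F : Fin n → L) (x y : FreeAlg k V n) :
    evalMap η E F (x * y) = sbr k (evalMap (k := k) η E F x) (evalMap (k := k) η E F y) := by
  let f : FreeAlg k V n →ₗ[k] FreeAlg k V n →ₗ[k] L :=
    (LinearMap.mul k (FreeAlg k V n)).compr₂ (evalMap (k := k) η E F)
  let g : FreeAlg k V n →ₗ[k] FreeAlg k V n →ₗ[k] L :=
    (SuperBracket.bracket (k := k) (L := L)).compl₁₂ (evalMap (k := k) η E F)
      (evalMap (k := k) η E F)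
  suffices h : f = g from LinearMap.congr_fun₂ h x y
  refine free_ext fun w => free_ext fun w' => ?_
  change evalMap (k := k) η E F (word k w * word k w') =
    sbr k (evalMap (k := k) η E F (word k w)) (evalMap (k := k) η E F (word k w'))
  rw [← word_mul, evalMap_word, evalMap_word, evalMap_word]
  rfl

variable {R τ} {η : R.𝔥 →ₗ[k] L} {E F : Fin n → L} {G : ℤ → Submodule k L}

namespace IsContragredientModel

theorem evalMap_parityProj (hM : IsContragredientModel R τ η E F G) (i : ZMod 2)
    (x : FreeAlg k R.𝔥 n) :
    evalMap η E F (parityProj k R.𝔥 τ i x) = pr k i (evalMap (k := k) η E F x) := by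
  suffices h : evalMap (k := k) η E F ∘ₗ parityProj k R.𝔥 τ i = pr k i ∘ₗ evalMap (k := k) η E F from
    LinearMap.congr_fun h x
  have hw (w : FreeMagma (Gen R.𝔥 n)) :
      evalWord (k := k) η E F w ∈ part k L (wordParity τ w) := by
    induction w with
    | ih1 g =>
      cases g with
      | h h => exact hM.h_mem h
      | e i => exact hM.e_mem i
      | f i => exact hM.f_mem i
    | ih2 u v hu hv => exact hM.isLieSuperalgebra.bracket_mem _ _ _ hu _ hv
  refine free_ext fun w => ?_
  rw [LinearMap.comp_apply, LinearMap.comp_apply, parityProj_word, evalMap_word, pr_of_mem (hw w)]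
  by_cases h : wordParity τ w = i
  · rw [if_pos h, if_pos h.symm, evalMap_word]
  · rw [if_neg h, if_neg (Ne.symm h), map_zero]

theorem evalMap_degreeProj (hM : IsContragredientModel R τ η E F G) (d : ℤ) :
    ∃ c : L →ₗ[k] L, (∀ e, ∀ x ∈ G e, c x = if e = d then x else 0) ∧
      ∀ x, evalMap η E F (degreeProj k R.𝔥 n d x) = c (evalMap (k := k) η E F x) := by
  obtain ⟨c, hc⟩ := hM.exists_component d
  refine ⟨c, hc, fun x => ?_⟩
  suffices h : evalMap (k := k) η E F ∘ₗ degreeProj k R.𝔥 n d = c ∘ₗ evalMap (k := k) η E F from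
    LinearMap.congr_fun h x
  have hw (w : FreeMagma (Gen R.𝔥 n)) : evalWord (k := k) η E F w ∈ G (wordDegree w) := by
    induction w with
    | ih1 g =>
      cases g with
      | h h => exact hM.h_degree h
      | e i => exact hM.e_degree i
      | f i => exact hM.f_degree i
    | ih2 u v hu hv => exact hM.bracket_degree _ _ _ hu _ hv
  refine free_ext fun w => ?_
  rw [LinearMap.comp_apply, LinearMap.comp_apply, degreeProj_word, evalMap_word, hc _ _ (hw w)]
  split_ifs
  · exact evalMap_word _ _ _ _
  · exact map_zero _

theorem evalMap_mem (hM : IsContragredientModel R τ η E F G) {i : ZMod 2} {x : FreeAlg k R.𝔥 n}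
    (hx : parityProj k R.𝔥 τ i x = x) : evalMap (k := k) η E F x ∈ part k L i := by
  rw [← hx, hM.evalMap_parityProj]
  exact pr_mem k i _

theorem isHomogeneousIdeal_ker (hM : IsContragredientModel R τ η E F G) :
    IsHomogeneousIdeal τ (LinearMap.ker (evalMap (k := k) η E F)) where
  left_mem x y hy := by
    rw [LinearMap.mem_ker] at hy ⊢
    rw [evalMap_mul, hy]
    exact map_zero (SuperBracket.bracket (k := k) _)
  right_mem x hx y := by
    rw [LinearMap.mem_ker] at hx ⊢
    rw [evalMap_mul, hx]
    exact LinearMap.map_zero₂ (SuperBracket.bracket (k := k)) _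
  parity_mem i x hx := by
    rw [LinearMap.mem_ker] at hx ⊢
    rw [hM.evalMap_parityProj, hx, map_zero]
  degree_mem d x hx := by
    obtain ⟨c, -, hc⟩ := hM.evalMap_degreeProj d
    rw [LinearMap.mem_ker] at hx ⊢
    rw [hc, hx, map_zero]

theorem evalMap_genH (h : R.𝔥) : evalMap (k := k) η E F (genH h) = η h := evalMap_word _ _ _ _

theorem evalMap_genE (i : Fin n) : evalMap (k := k) η E F (genE k R.𝔥 i) = E i :=
  evalMap_word _ _ _ _

theorem evalMap_genF (i : Fin n) : evalMap (k := k) η E F (genF k R.𝔥 i) = F i :=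
  evalMap_word _ _ _ _

theorem relationIdeal_le_ker (hM : IsContragredientModel R τ η E F G) :
    relationIdeal R τ ≤ LinearMap.ker (evalMap (k := k) η E F) := by
  refine sInf_le ⟨hM.isHomogeneousIdeal_ker, fun x hx => ?_⟩
  rw [LinearMap.mem_ker]
  cases hx with
  | h_add h h' => rw [map_sub, map_add, evalMap_genH, evalMap_genH, evalMap_genH, map_add, sub_self]
  | h_smul c h => rw [map_sub, map_smul, evalMap_genH, evalMap_genH, map_smul, sub_self]
  | e_f i j =>
    rw [map_sub, evalMap_mul, evalMap_genE, evalMap_genF, hM.e_f]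
    split_ifs
    · rw [evalMap_genH, sub_self]
    · rw [map_zero, sub_zero]
  | h_h h h' => rw [evalMap_mul, evalMap_genH, evalMap_genH, hM.h_h]
  | h_e h i =>
    rw [map_sub, evalMap_mul, map_smul, evalMap_genH, evalMap_genE, hM.h_e, sub_self]
  | h_f h i =>
    rw [map_add, evalMap_mul, map_smul, evalMap_genH, evalMap_genF, hM.h_f, neg_add_cancel]
  | skew i j x y hx hy =>
    rw [map_add, map_smul, evalMap_mul, evalMap_mul,
      hM.isLieSuperalgebra.skew i j _ (hM.evalMap_mem hx) _ (hM.evalMap_mem hy), neg_add_cancel]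
  | jacobi i j x y z hx hy =>
    simp only [map_sub, map_add, map_smul, evalMap_mul]
    rw [hM.isLieSuperalgebra.jacobi i j _ (hM.evalMap_mem hx) _ (hM.evalMap_mem hy), sub_self]
  | cube x hx =>
    rw [evalMap_mul, evalMap_mul, hM.isLieSuperalgebra.cube _ (hM.evalMap_mem hx)]

theorem evalMap_surjective (hM : IsContragredientModel R τ η E F G) :
    Function.Surjective (evalMap (k := k) η E F) := by
  rw [← LinearMap.range_eq_top]
  refine hM.generates _ (fun i => ⟨_, evalMap_genE i⟩) (fun i => ⟨_, evalMap_genF i⟩) ?_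
  rintro _ ⟨x, rfl⟩ _ ⟨y, rfl⟩
  exact ⟨x * y, evalMap_mul _ _ _ _ _⟩

/-- The kernel is a homogeneous ideal containing the relations, and it meets 𝔥 trivially because η
is injective; so it is one of the ideals whose sum is the maximal ideal. -/
theorem ker_le_maximalIdeal (hM : IsContragredientModel R τ η E F G) :
    LinearMap.ker (evalMap (k := k) η E F) ≤ maximalIdeal R τ := by
  refine le_sSup ⟨hM.isHomogeneousIdeal_ker, hM.relationIdeal_le_ker, ?_⟩
  rintro x ⟨hx, hx'⟩
  obtain ⟨h, hh⟩ := exists_genH hx'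
  have h1 := hM.relationIdeal_le_ker hh
  rw [LinearMap.mem_ker, map_sub, LinearMap.mem_ker.1 hx, zero_sub, neg_eq_zero, evalMap_genH] at h1
  obtain rfl : h = 0 := hM.injective (h1.trans (map_zero η).symm)
  -- In the free algebra `genH 0` is a generator and not zero; it is a relation by linearity of 𝔥
  -- with scalar 0.
  have h0 := IsRelation.mem (τ := τ) (.h_smul (R := R) 0 0)
  rw [zero_smul, zero_smul, sub_zero] at h0
  have := add_mem hh h0
  rwa [sub_add_cancel] at this

/-- Let K be one of the ideals in the sum. Its image in L is a graded ideal. If the image is L, it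
contains some η(g) with g ≠ 0. The component of degree 0 of a preimage lies in K and, by the
triangular decomposition, in 𝔥 modulo relations, hence in the relations, so its value is zero; but
this value is η(g), which has degree 0. So the image is 0. -/
theorem maximalIdeal_le_ker (hM : IsContragredientModel R τ η E F G)
    (hs : IsSimpleSuperalgebra k L) (h0 : ∃ h : R.𝔥, h ≠ 0) :
    maximalIdeal R τ ≤ LinearMap.ker (evalMap (k := k) η E F) := by
  refine sSup_le ?_
  rintro K ⟨hK, -, hKH⟩
  have hJ : IsGradedIdeal k (K.map (evalMap (k := k) η E F)) := by
    refine ⟨?_, ?_, ?_⟩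
    · rintro i _ ⟨x, hx, rfl⟩
      exact ⟨_, hK.parity_mem i x hx, hM.evalMap_parityProj i x⟩
    · rintro x _ ⟨y, hy, rfl⟩
      obtain ⟨x, rfl⟩ := hM.evalMap_surjective x
      exact ⟨_, hK.left_mem x y hy, evalMap_mul _ _ _ _ _⟩
    · rintro _ ⟨x, hx, rfl⟩ y
      obtain ⟨y, rfl⟩ := hM.evalMap_surjective y
      exact ⟨_, hK.right_mem x hx y, evalMap_mul _ _ _ _ _⟩
  obtain h | h := hs.eq_bot_or_eq_top _ hJ
  · intro x hx
    have : evalMap (k := k) η E F x ∈ K.map (evalMap (k := k) η E F) := ⟨x, hx, rfl⟩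
    rwa [h] at this
  · obtain ⟨g, hg⟩ := h0
    obtain ⟨x, hx, hxg⟩ : η g ∈ K.map (evalMap (k := k) η E F) := h ▸ trivial
    obtain ⟨c, hc, hcx⟩ := hM.evalMap_degreeProj 0
    have hd : HasDegree 0 (degreeProj k R.𝔥 n 0 x) := by
      have hp : degreeProj k R.𝔥 n 0 ∘ₗ degreeProj k R.𝔥 n 0 = degreeProj k R.𝔥 n 0 := by
        refine free_ext fun w => ?_
        rw [LinearMap.comp_apply, degreeProj_word]
        split_ifs with hw
        · rw [degreeProj_word, if_pos hw]
        · exact map_zero _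
      exact LinearMap.congr_fun hp x
    have h1 := hKH ⟨hK.degree_mem 0 x hx, mem_cartanPart_of_degree_zero (τ := τ) hd⟩
    have h2 := hM.relationIdeal_le_ker h1
    rw [LinearMap.mem_ker, hcx, hxg, hc 0 _ (hM.h_degree g), if_pos rfl] at h2
    exact absurd (hM.injective (h2.trans (map_zero η).symm)) hg

/-- Simple models are contragredient. -/
theorem nonempty_superEquiv (hM : IsContragredientModel R τ η E F G)
    (hs : IsSimpleSuperalgebra k L) (h0 : ∃ h : R.𝔥, h ≠ 0) :
    Nonempty (SuperEquiv k L (Contragredient R τ)) := by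
  have hker : LinearMap.ker (evalMap (k := k) η E F) = maximalIdeal R τ :=
    le_antisymm hM.ker_le_maximalIdeal (hM.maximalIdeal_le_ker hs h0)
  let e : L ≃ₗ[k] Contragredient R τ :=
    ((evalMap (k := k) η E F).quotKerEquivOfSurjective hM.evalMap_surjective).symm.trans
      (Submodule.quotEquivOfEq _ _ hker)
  have he (x : FreeAlg k R.𝔥 n) : e (evalMap (k := k) η E F x) = Contragredient.mk R τ x := by
    have : ((evalMap (k := k) η E F).quotKerEquivOfSurjective hM.evalMap_surjective).symm
        (evalMap (k := k) η E F x) = Submodule.Quotient.mk x := by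
      rw [LinearEquiv.symm_apply_eq]
      rfl
    exact congr_arg (Submodule.quotEquivOfEq _ _ hker) this
  refine ⟨⟨e, fun i x => ?_, fun x y => ?_⟩⟩
  · obtain ⟨x, rfl⟩ := hM.evalMap_surjective x
    change e (pr k i (evalMap (k := k) η E F x)) = pr k i (e (evalMap (k := k) η E F x))
    rw [← hM.evalMap_parityProj, he, he]
    rfl
  · obtain ⟨x, rfl⟩ := hM.evalMap_surjective x
    obtain ⟨y, rfl⟩ := hM.evalMap_surjective y
    change e (sbr k (evalMap (k := k) η E F x) (evalMap (k := k) η E F y)) =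
      sbr k (e (evalMap (k := k) η E F x)) (e (evalMap (k := k) η E F y))
    rw [← evalMap_mul, he, he, he, Contragredient.bracket_mk]

end IsContragredientModel

end Recognition

end SuperMagic

namespace SuperMagic

/-! ### The principal grading -/

section Grading

variable {k : Type u} [Field k]

/-- The signs of the two weights of the natural module of `𝔰𝔩₂`. -/
def sgn (i : Fin 2) : ℤ := ![1, -1] i

variable (k) in
/-- Matrices of degree `d`, if the row indices have degrees `±p` and the column indices `±q`. -/
def matDeg (p q d : ℤ) : Submodule k (S4 k) where
  carrier := {x | ∀ i j, x i j ≠ 0 → sgn i * p - sgn j * q = d}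
  zero_mem' i j h := absurd rfl h
  add_mem' {x y} hx hy i j h := by
    by_cases hxy : x i j = 0
    · exact hy i j fun h' => h (by rw [Matrix.add_apply, hxy, h', add_zero])
    · exact hx i j hxy
  smul_mem' c x hx i j h := hx i j fun h' => h (by rw [Matrix.smul_apply, h', smul_zero])

variable (k) in
/-- Vectors of degree `d`, if the indices have degrees `±p`. -/
def vecDeg (p d : ℤ) : Submodule k (Fin 2 → k) where
  carrier := {v | ∀ i, v i ≠ 0 → sgn i * p = d}
  zero_mem' i h := absurd rfl h
  add_mem' {x y} hx hy i h := by
    by_cases hxy : x i = 0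
    · exact hy i fun h' => h (by rw [Pi.add_apply, hxy, h', add_zero])
    · exact hx i hxy
  smul_mem' c x hx i h := hx i fun h' => h (by rw [Pi.smul_apply, h', smul_zero])

variable {p q r c d : ℤ} {x y : S4 k} {v w : Fin 2 → k}

theorem mul_mem_matDeg (hx : x ∈ matDeg k p q c) (hy : y ∈ matDeg k q r d) :
    x * y ∈ matDeg k p r (c + d) := by
  intro i j h
  rw [Matrix.mul_apply] at h
  obtain ⟨l, -, hl⟩ := Finset.exists_ne_zero_of_sum_ne_zero h
  have h1 := hx i l (left_ne_zero_of_mul hl)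
  have h2 := hy l j (right_ne_zero_of_mul hl)
  linarith

/-- Up to sign the entry (i, j) of the adjugate is the entry (1 − j, 1 − i) of x. Passing from an
index to the other one changes the sign of its weight, so the degree is preserved while p and q are
interchanged. -/
theorem adjugate_mem_matDeg (hx : x ∈ matDeg k p q d) : x.adjugate ∈ matDeg k q p d := by
  intro i j h
  obtain ⟨h1, h2, h3, h4⟩ := adjugate_apply x
  have e1 := hx 0 0
  have e2 := hx 0 1
  have e3 := hx 1 0
  have e4 := hx 1 1
  simp only [sgn, Matrix.cons_val_zero, Matrix.cons_val_one] at e1 e2 e3 e4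
  fin_cases i <;> fin_cases j <;> simp [h1, h2, h3, h4, sgn] at h ⊢
  · linarith [e4 h]
  · linarith [e2 h]
  · linarith [e3 h]
  · linarith [e1 h]

theorem degree_eq_zero_of_trace_ne (hx : x ∈ matDeg k p p d) (h : x.trace ≠ 0) : d = 0 := by
  obtain ⟨i, -, hi⟩ := Finset.exists_ne_zero_of_sum_ne_zero h
  rw [← hx i i hi, sub_self]

/-- Traces and forms are nonzero only when the degrees of their arguments cancel. With this lemma a
term with such a coefficient may be handled under the resulting equation between degrees. -/
theorem smul_mem_of_ne_zero {N : Type*} [AddCommGroup N] [Module k N] {S : Submodule k N} {t : k}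
    {z : N} (h : t ≠ 0 → z ∈ S) : t • z ∈ S := by
  by_cases ht : t = 0
  · rw [ht, zero_smul]
    exact S.zero_mem
  · exact S.smul_mem t (h ht)

theorem biaction_mem_matDeg {a b : S4 k} (ha : a ∈ matDeg k p p c) (hb : b ∈ matDeg k q q c)
    (hx : x ∈ matDeg k p q d) : biaction a b x ∈ matDeg k p q (c + d) := by
  rw [biaction_apply, sub_smul]
  refine add_mem (sub_mem (mul_mem_matDeg ha hx) ?_) (sub_mem ?_ ?_)
  · rw [add_comm]
    exact mul_mem_matDeg hx hb
  · exact smul_mem_of_ne_zero fun h => by rwa [degree_eq_zero_of_trace_ne ha h, zero_add]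
  · exact smul_mem_of_ne_zero fun h => by rwa [degree_eq_zero_of_trace_ne hb h, zero_add]

theorem evenAct_mem_vecDeg (hx : x ∈ matDeg k p p c) (hv : v ∈ vecDeg k p d) :
    evenAct x v ∈ vecDeg k p (c + d) := by
  refine add_mem (fun i h => ?_) (smul_mem_of_ne_zero fun h => by
    rwa [degree_eq_zero_of_trace_ne hx h, zero_add])
  have h : ∑ l, x i l * v l ≠ 0 := h
  obtain ⟨l, -, hl⟩ := Finset.exists_ne_zero_of_sum_ne_zero h
  have h1 := hx i l (left_ne_zero_of_mul hl)
  have h2 := hv l (right_ne_zero_of_mul hl)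
  linarith

theorem rankOne_mem_matDeg (hv : v ∈ vecDeg k p c) (hw : w ∈ vecDeg k p d) :
    rankOne v w ∈ matDeg k p p (c + d) := by
  intro i j h
  have h1 := hv i
  have h2 := hw (1 - j)
  fin_cases i <;> fin_cases j <;> simp [rankOne, sgn] at h h1 h2 ⊢ <;>
    linarith [h1 h.1, h2 h.2]

theorem lie_mem_matDeg (hx : x ∈ matDeg k p p c) (hy : y ∈ matDeg k p p d) :
    ⁅x, y⁆ ∈ matDeg k p p (c + d) := by
  rw [Ring.lie_def]
  refine sub_mem (mul_mem_matDeg hx hy) ?_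
  rw [add_comm]
  exact mul_mem_matDeg hy hx

theorem altForm_degree (hv : v ∈ vecDeg k p c) (hw : w ∈ vecDeg k p d) (h : altForm k v w ≠ 0) :
    c + d = 0 := by
  rw [altForm_apply] at h
  have h1 := hv 0
  have h2 := hv 1
  have h3 := hw 0
  have h4 := hw 1
  simp only [sgn, Matrix.cons_val_zero, Matrix.cons_val_one] at h1 h2 h3 h4
  by_cases h0 : v 0 * w 1 = 0
  · rw [h0, zero_sub, neg_ne_zero] at h
    linarith [h2 (left_ne_zero_of_mul h), h3 (right_ne_zero_of_mul h)]
  · linarith [h1 (left_ne_zero_of_mul h0), h4 (right_ne_zero_of_mul h0)]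

theorem one_mem_matDeg : (1 : S4 k) ∈ matDeg k p p 0 := by
  intro i j h
  obtain rfl | hij := eq_or_ne i j
  · exact sub_self _
  · exact absurd (Matrix.one_apply_ne hij) h

theorem add_trace_mem_matDeg (hx : x ∈ matDeg k p p d) :
    x + x.trace • (1 : S4 k) ∈ matDeg k p p d :=
  add_mem hx <| smul_mem_of_ne_zero fun h => by
    rw [degree_eq_zero_of_trace_ne hx h]
    exact one_mem_matDeg

variable (k) in
/-- The projection onto the matrices of degree `d`. -/
def matFilter (p q d : ℤ) : S4 k →ₗ[k] S4 k where
  toFun x := Matrix.of fun i j => if sgn i * p - sgn j * q = d then x i j else 0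
  map_add' x y := by
    ext i j
    by_cases h : sgn i * p - sgn j * q = d <;> simp [h]
  map_smul' c x := by
    ext i j
    by_cases h : sgn i * p - sgn j * q = d <;> simp [h]

variable (k) in
/-- The projection onto the vectors of degree `d`. -/
def vecFilter (p d : ℤ) : (Fin 2 → k) →ₗ[k] (Fin 2 → k) where
  toFun v i := if sgn i * p = d then v i else 0
  map_add' x y := by
    ext i
    by_cases h : sgn i * p = d <;> simp [h]
  map_smul' c x := by
    ext i
    by_cases h : sgn i * p = d <;> simp [h]

theorem matFilter_of_mem (hx : x ∈ matDeg k p q c) :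
    matFilter k p q d x = if c = d then x else 0 := by
  ext i j
  change (if sgn i * p - sgn j * q = d then x i j else 0) = _
  by_cases h : x i j = 0
  · split_ifs <;> simp [h]
  · rw [hx i j h]
    split_ifs <;> rfl

theorem vecFilter_of_mem (hv : v ∈ vecDeg k p c) :
    vecFilter k p d v = if c = d then v else 0 := by
  ext i
  change (if sgn i * p = d then v i else 0) = _
  by_cases h : v i = 0
  · split_ifs <;> simp [h]
  · rw [hv i h]
    split_ifs <;> rfl

variable [CharP k 3]

/-- b(x, y) = tr(x ȳ), and a nonzero trace forces degree 0. -/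
theorem form_degree (hx : x ∈ matDeg k p q c) (hy : y ∈ matDeg k p q d) (h : form k x y ≠ 0) :
    c + d = 0 := by
  have h1 : form k x y = (x * y.adjugate).trace := by
    rw [form_S4_apply, Matrix.trace_fin_two, S4_mul_apply, S4_mul_apply, (adjugate_apply y).1,
      (adjugate_apply y).2.1, (adjugate_apply y).2.2.1, (adjugate_apply y).2.2.2]
    ring
  rw [h1] at h
  exact degree_eq_zero_of_trace_ne (mul_mem_matDeg hx (adjugate_mem_matDeg hy)) h

/-- Twice the degrees of the weights of the natural modules of the three `𝔰𝔩₂`. -/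
def slotDeg (m : Fin 3) : ℤ := ![5, 1, 3] m

variable (k) in
/-- Elements of the five families that are homogeneous for the principal grading (with all degrees
multiplied by `2`). -/
inductive IsGraded : ℤ → Magic k (S4 k) (S12 k) → Prop
  | L (d : ℤ) (a : Fin 3 → S4 k) (ha : ∀ m, a m ∈ matDeg k (slotDeg m) (slotDeg m) d) :
      IsGraded d (magL a)
  | Q (d : ℤ) (q : S4 k) (hq : q ∈ matDeg k 10 10 d) : IsGraded d (magQ q)
  | O (d : ℤ) (v : Fin 2 → k) (hv : v ∈ vecDeg k 10 d) : IsGraded d (magO v)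
  | I (d : ℤ) (m : Fin 3) (s : S4 k) (hs : s ∈ matDeg k (slotDeg m) (slotDeg (m + 2)) d) :
      IsGraded d (magI m s)
  | K (c d : ℤ) (m : Fin 3) (s : S4 k) (v : Fin 2 → k)
      (hs : s ∈ matDeg k (slotDeg m) (slotDeg (m + 2)) c) (hv : v ∈ vecDeg k 10 d) :
      IsGraded (c + d) (magK m s v)

variable (k) in
/-- The components of the principal grading. -/
def gradedPart (d : ℤ) : Submodule k (Magic k (S4 k) (S12 k)) :=
  Submodule.span k {x | IsGraded k d x}

theorem IsGraded.mem {x : Magic k (S4 k) (S12 k)} (h : IsGraded k d x) : x ∈ gradedPart k d :=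
  Submodule.subset_span h

theorem magK_mem_gradedPart {e : ℤ} {m : Fin 3} {s : S4 k}
    (hs : s ∈ matDeg k (slotDeg m) (slotDeg (m + 2)) c) (hv : v ∈ vecDeg k 10 d)
    (he : c + d = e) : magK m s v ∈ gradedPart k e :=
  he ▸ (IsGraded.K c d m s v hs hv).mem

variable {m n : Fin 3} {s t : S4 k}

theorem slots_mem_matDeg (hs : s ∈ matDeg k (slotDeg m) (slotDeg (m + 2)) c)
    (ht : t ∈ matDeg k (slotDeg m) (slotDeg (m + 2)) d) (n : Fin 3) :
    slots m s t n ∈ matDeg k (slotDeg n) (slotDeg n) (c + d) := by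
  obtain rfl | rfl | rfl := fin_three_cases' m n
  · rw [slots_self]
    exact neg_mem (mul_mem_matDeg hs (adjugate_mem_matDeg ht))
  · rw [slots_next]
    exact zero_mem _
  · rw [slots_prev]
    exact neg_mem (mul_mem_matDeg (adjugate_mem_matDeg hs) ht)

/-- Products of elements of consecutive slots. -/
theorem next_mem_matDeg (hs : s ∈ matDeg k (slotDeg m) (slotDeg (m + 2)) c)
    (ht : t ∈ matDeg k (slotDeg (m + 1)) (slotDeg (m + 1 + 2)) d) :
    s.adjugate * t.adjugate ∈ matDeg k (slotDeg (m + 2)) (slotDeg (m + 2 + 2)) (c + d) := by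
  obtain ⟨h1, h2, h3, h4⟩ := fin_three_add m
  rw [h2] at ht
  rw [h4]
  exact mul_mem_matDeg (adjugate_mem_matDeg hs) (adjugate_mem_matDeg ht)

theorem magL_lie_mem {a b : Fin 3 → S4 k} (ha : ∀ m, a m ∈ matDeg k (slotDeg m) (slotDeg m) c)
    (hb : ∀ m, b m ∈ matDeg k (slotDeg m) (slotDeg m) d) :
    magL ⁅a, b⁆ ∈ gradedPart k (c + d) :=
  (IsGraded.L _ _ fun m => lie_mem_matDeg (ha m) (hb m)).mem

theorem bracket_mem_gradedPart_of_L {a : Fin 3 → S4 k} {y : Magic k (S4 k) (S12 k)}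
    (ha : ∀ m, a m ∈ matDeg k (slotDeg m) (slotDeg m) c) (hy : IsGraded k d y) :
    sbr k (magL a) y ∈ gradedPart k (c + d) ∧ sbr k y (magL a) ∈ gradedPart k (c + d) := by
  cases hy with
  | L _ b hb =>
    rw [L_L, L_L]
    exact ⟨magL_lie_mem ha hb, add_comm c d ▸ magL_lie_mem hb ha⟩
  | Q _ q hq =>
    rw [L_Q, Q_L]
    exact ⟨zero_mem _, zero_mem _⟩
  | O _ v hv =>
    rw [L_O, O_L]
    exact ⟨zero_mem _, zero_mem _⟩
  | I _ m s hs =>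
    have h := (IsGraded.I _ m _ (biaction_mem_matDeg (ha m) (ha (m + 2)) hs)).mem
    rw [L_I, I_L]
    exact ⟨h, neg_mem h⟩
  | K d e m s v hs hv =>
    have h := magK_mem_gradedPart (biaction_mem_matDeg (ha m) (ha (m + 2)) hs) hv (add_assoc c d e)
    rw [L_K, K_L]
    exact ⟨h, neg_mem h⟩

theorem bracket_mem_gradedPart_of_Q {q : S4 k} {y : Magic k (S4 k) (S12 k)}
    (hq : q ∈ matDeg k 10 10 c) (hy : IsGraded k d y) :
    sbr k (magQ q) y ∈ gradedPart k (c + d) ∧ sbr k y (magQ q) ∈ gradedPart k (c + d) := by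
  cases hy with
  | L _ b hb =>
    rw [L_Q, Q_L]
    exact ⟨zero_mem _, zero_mem _⟩
  | Q _ p hp =>
    rw [Q_Q, Q_Q]
    exact ⟨(IsGraded.Q _ _ (lie_mem_matDeg hq hp)).mem,
      add_comm c d ▸ (IsGraded.Q _ _ (lie_mem_matDeg hp hq)).mem⟩
  | O _ v hv =>
    have h := (IsGraded.O _ _ (evenAct_mem_vecDeg hq hv)).mem
    rw [Q_O, O_Q]
    exact ⟨h, neg_mem h⟩
  | I _ m s hs =>
    rw [Q_I, I_Q]
    exact ⟨zero_mem _, zero_mem _⟩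
  | K d e m s v hs hv =>
    have h := magK_mem_gradedPart hs (evenAct_mem_vecDeg hq hv) (add_left_comm d c e)
    rw [Q_K, K_Q]
    exact ⟨h, neg_mem h⟩

theorem bracket_mem_gradedPart_of_O {y : Magic k (S4 k) (S12 k)}
    (hv : v ∈ vecDeg k 10 c) (hy : IsGraded k d y) :
    sbr k (magO v) y ∈ gradedPart k (c + d) ∧ sbr k y (magO v) ∈ gradedPart k (c + d) := by
  cases hy with
  | L _ b hb =>
    have h := bracket_mem_gradedPart_of_L hb (.O _ v hv)
    rw [add_comm d c] at h
    exact h.symm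
  | Q _ p hp =>
    have h := bracket_mem_gradedPart_of_Q hp (.O _ v hv)
    rw [add_comm d c] at h
    exact h.symm
  | O _ w hw =>
    rw [O_O, O_O]
    have h (v w : Fin 2 → k) {c d : ℤ} (hv : v ∈ vecDeg k 10 c) (hw : w ∈ vecDeg k 10 d) :
        magQ (rankOne v w + rankOne w v) ∈ gradedPart k (c + d) :=
      (IsGraded.Q _ _ (add_mem (rankOne_mem_matDeg hv hw)
        (add_comm c d ▸ rankOne_mem_matDeg hw hv))).mem
    exact ⟨h v w hv hw, add_comm c d ▸ h w v hw hv⟩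
  | I _ m s hs =>
    have h := magK_mem_gradedPart hs hv (add_comm d c)
    rw [O_I, I_O]
    exact ⟨h, neg_mem h⟩
  | K d e m s u hs hu =>
    have h : altForm k v u • magI m s ∈ gradedPart k (c + (d + e)) :=
      smul_mem_of_ne_zero fun h => by
        have h0 := altForm_degree hv hu h
        have : c + (d + e) = d := by linarith
        rw [this]
        exact (IsGraded.I _ m s hs).mem
    rw [O_K, K_O]
    exact ⟨h, h⟩

theorem form_smul_magO_mem (hs : s ∈ matDeg k (slotDeg m) (slotDeg (m + 2)) c)
    (ht : t ∈ matDeg k (slotDeg m) (slotDeg (m + 2)) d) {e f : ℤ} (hv : v ∈ vecDeg k 10 e)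
    (hf : c + d + e = f) : form k s t • magO v ∈ gradedPart k f :=
  smul_mem_of_ne_zero fun h => by
    rw [form_degree hs ht h, zero_add] at hf
    exact hf ▸ (IsGraded.O _ v hv).mem

theorem I_K_mem_gradedPart (hs : s ∈ matDeg k (slotDeg m) (slotDeg (m + 2)) c)
    (ht : t ∈ matDeg k (slotDeg n) (slotDeg (n + 2)) d) {e f : ℤ} (hv : v ∈ vecDeg k 10 e)
    (hf : c + d + e = f) :
    sbr k (magI m s) (magK n t v) ∈ gradedPart k f ∧
      sbr k (magK n t v) (magI m s) ∈ gradedPart k f := by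
  obtain rfl | rfl | rfl := fin_three_cases m n
  · rw [I_K, K_I]
    exact ⟨neg_mem (form_smul_magO_mem hs ht hv hf),
      form_smul_magO_mem ht hs hv (add_comm c d ▸ hf)⟩
  · rw [I_K_next, K_I_prev]
    have h := magK_mem_gradedPart (next_mem_matDeg hs ht) hv hf
    exact ⟨neg_mem h, h⟩
  · rw [I_K_prev, K_I_next]
    have h := magK_mem_gradedPart (next_mem_matDeg ht hs) hv (add_comm c d ▸ hf)
    exact ⟨h, neg_mem h⟩

theorem IsGraded.bracket_mem {x y : Magic k (S4 k) (S12 k)} (hx : IsGraded k c x)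
    (hy : IsGraded k d y) : sbr k x y ∈ gradedPart k (c + d) := by
  cases hx with
  | L _ a ha => exact (bracket_mem_gradedPart_of_L ha hy).1
  | Q _ q hq => exact (bracket_mem_gradedPart_of_Q hq hy).1
  | O _ v hv => exact (bracket_mem_gradedPart_of_O hv hy).1
  | I _ m s hs =>
    cases hy with
    | L _ a ha => exact add_comm d c ▸ (bracket_mem_gradedPart_of_L ha (.I _ m s hs)).2
    | Q _ q hq => exact add_comm d c ▸ (bracket_mem_gradedPart_of_Q hq (.I _ m s hs)).2
    | O _ v hv => exact add_comm d c ▸ (bracket_mem_gradedPart_of_O hv (.I _ m s hs)).2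
    | I _ n t ht =>
      obtain rfl | rfl | rfl := fin_three_cases m n
      · rw [I_I]
        exact Submodule.smul_mem _ _ (IsGraded.L _ _ (slots_mem_matDeg hs ht)).mem
      · rw [I_I_next]
        exact (IsGraded.I _ _ _ (next_mem_matDeg hs ht)).mem
      · rw [I_I_prev]
        exact neg_mem (add_comm d c ▸ (IsGraded.I _ _ _ (next_mem_matDeg ht hs)).mem)
    | K d e n t v ht hv => exact (I_K_mem_gradedPart hs ht hv (add_assoc _ _ _)).1
  | K a b m s u hs hu =>
    cases hy with
    | L _ a ha => exact add_comm d _ ▸ (bracket_mem_gradedPart_of_L ha (.K _ _ m s u hs hu)).2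
    | Q _ q hq => exact add_comm d _ ▸ (bracket_mem_gradedPart_of_Q hq (.K _ _ m s u hs hu)).2
    | O _ v hv => exact add_comm d _ ▸ (bracket_mem_gradedPart_of_O hv (.K _ _ m s u hs hu)).2
    | I _ n t ht => exact (I_K_mem_gradedPart ht hs hu (by ring)).2
    | K d e n t v ht hv =>
      have key {z : Magic k (S4 k) (S12 k)} {f : ℤ} (hf : a + d = f)
          (hz : z ∈ gradedPart k f) :
          altForm k u v • z ∈ gradedPart k (a + b + (d + e)) :=
        smul_mem_of_ne_zero fun h => by
          have h0 := altForm_degree hu hv h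
          have : a + b + (d + e) = f := by linarith
          rwa [this]
      obtain rfl | rfl | rfl := fin_three_cases m n
      · rw [K_K]
        refine sub_mem (key rfl (IsGraded.L _ _ (slots_mem_matDeg hs ht)).mem)
          (smul_mem_of_ne_zero fun h => ?_)
        have h0 := form_degree hs ht h
        have : a + b + (d + e) = b + e := by linarith
        rw [this]
        exact (IsGraded.Q _ _ (add_mem (rankOne_mem_matDeg hu hv)
          (add_comm b e ▸ rankOne_mem_matDeg hv hu))).mem
      · rw [K_K_next]
        exact key rfl (IsGraded.I _ _ _ (next_mem_matDeg hs ht)).mem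
      · rw [K_K_prev, altForm_swap, neg_smul]
        exact neg_mem (key (add_comm a d) (IsGraded.I _ _ _ (next_mem_matDeg ht hs)).mem)

theorem bracket_mem_gradedPart {x y : Magic k (S4 k) (S12 k)} (hx : x ∈ gradedPart k c)
    (hy : y ∈ gradedPart k d) : sbr k x y ∈ gradedPart k (c + d) := by
  have := Submodule.apply_mem_map₂ (SuperBracket.bracket (k := k) (L := Magic k (S4 k) (S12 k))) hx hy
  rw [gradedPart, gradedPart, Submodule.map₂_span_span] at this
  refine Submodule.span_le.2 ?_ this
  rintro _ ⟨x, hx, y, hy, rfl⟩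
  exact IsGraded.bracket_mem hx hy

variable (k) in
/-- The projection onto the component of degree `d`. -/
def gradedProj (d : ℤ) : Magic k (S4 k) (S12 k) →ₗ[k] Magic k (S4 k) (S12 k) :=
  magL ∘ₗ (LinearMap.pi fun m => matFilter k (slotDeg m) (slotDeg m) d ∘ₗ coordL k m) +
    (magQ ∘ₗ matFilter k 10 10 d ∘ₗ coordQ k + magO ∘ₗ vecFilter k 10 d ∘ₗ coordO k) +
    ∑ m, (magI m ∘ₗ matFilter k (slotDeg m) (slotDeg (m + 2)) d ∘ₗ coordI k m +
      ∑ i, (magK m).flip (Pi.single i 1) ∘ₗ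
        matFilter k (slotDeg m) (slotDeg (m + 2)) (d - sgn i * 10) ∘ₗ coordK k m i)

theorem gradedProj_apply (d : ℤ) (x : Magic k (S4 k) (S12 k)) : gradedProj k d x =
    magL (fun m => matFilter k (slotDeg m) (slotDeg m) d (coordL k m x)) +
    (magQ (matFilter k 10 10 d (coordQ k x)) + magO (vecFilter k 10 d (coordO k x))) +
    ∑ m, (magI m (matFilter k (slotDeg m) (slotDeg (m + 2)) d (coordI k m x)) +
      ∑ i, magK m (matFilter k (slotDeg m) (slotDeg (m + 2)) (d - sgn i * 10) (coordK k m i x))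
        (Pi.single i 1)) := by
  simp only [gradedProj, LinearMap.add_apply, LinearMap.sum_apply]
  rfl

/-- On a member of a family all coordinates but those of its own kind vanish. For `magK` the basis
vector of V with index i has degree 10 sgn(i), which is subtracted from d before its matrix
coordinate is filtered; for `magL` and `magQ` the coordinates return the traceless representative,
which has the same image. -/
theorem gradedProj_of_isGraded {x : Magic k (S4 k) (S12 k)} (hx : IsGraded k c x) :
    gradedProj k d x = if c = d then x else 0 := by
  have hzero : magL (fun _ => (0 : S4 k)) = 0 := map_zero magL
  rw [gradedProj_apply]
  cases hx with
  | L _ a ha =>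
    have h (m) := matFilter_of_mem (d := d) (add_trace_mem_matDeg (ha m))
    simp only [coordL_magL, h, coordQ_of_projR (X := magL a) rfl,
      coordO_of_projR (X := magL a) rfl, coordI_of_projIota (X := magL a) rfl,
      coordK_of_projIota (X := magL a) rfl, map_zero, LinearMap.zero_apply, Finset.sum_const_zero,
      add_zero]
    split_ifs
    · exact magL_congr fun m => by simp
    · exact hzero
  | Q _ q hq =>
    simp only [coordL_of_projT (X := magQ q) rfl, coordQ_magQ, coordO_magQ,
      matFilter_of_mem (d := d) (add_trace_mem_matDeg hq), coordI_of_projIota (X := magQ q) rfl,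
      coordK_of_projIota (X := magQ q) rfl, map_zero, LinearMap.zero_apply, Finset.sum_const_zero,
      add_zero, hzero, zero_add]
    split_ifs
    · rw [map_add, magQ_one, add_zero]
    · exact map_zero _
  | O _ v hv =>
    simp only [coordL_of_projT (X := magO v) rfl, coordQ_magO, coordO_magO,
      vecFilter_of_mem (d := d) hv, coordI_of_projIota (X := magO v) rfl,
      coordK_of_projIota (X := magO v) rfl, map_zero, LinearMap.zero_apply, Finset.sum_const_zero,
      add_zero, hzero, zero_add]
    split_ifs
    · rfl
    · exact map_zero _
  | I _ n s hs =>
    simp only [coordL_of_projT (X := magI n s) rfl, coordQ_of_projR (X := magI n s) rfl,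
      coordO_of_projR (X := magI n s) rfl, coordI_magI, coordK_magI, map_zero,
      LinearMap.zero_apply, Finset.sum_const_zero, add_zero, hzero, zero_add]
    rw [Finset.sum_eq_single n]
    · rw [if_pos rfl, matFilter_of_mem hs]
      split_ifs
      · rfl
      · exact map_zero _
    · intro m _ hm
      rw [if_neg hm.symm, map_zero, map_zero]
    · simp
  | K c e n s v hs hv =>
    simp only [coordL_of_projT (X := magK n s v) rfl, coordQ_of_projR (X := magK n s v) rfl,
      coordO_of_projR (X := magK n s v) rfl, coordI_magK, coordK_magK, map_zero, add_zero, hzero,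
      zero_add]
    rw [Finset.sum_eq_single n]
    · have h (i) : magK n (matFilter k (slotDeg n) (slotDeg (n + 2)) (d - sgn i * 10) (v i • s))
          (Pi.single i 1) = if c + e = d then v i • magK n s (Pi.single i 1) else 0 := by
        by_cases h0 : v i = 0
        · simp [h0]
        · rw [map_smul, matFilter_of_mem hs, hv i h0]
          have : c = d - e ↔ c + e = d := eq_sub_iff_add_eq
          simp only [this]
          split_ifs
          · rw [map_smul, LinearMap.smul_apply]
          · simp
      simp only [if_true, h]
      split_ifs
      · rw [Fin.sum_univ_two, ← map_smul, ← map_smul, ← map_add]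
        congr 1
        ext i
        fin_cases i <;> simp
      · exact Finset.sum_const_zero
    · intro m _ hm
      simp [hm.symm]
    · simp

theorem gradedProj_of_mem {x : Magic k (S4 k) (S12 k)} (hx : x ∈ gradedPart k c) :
    gradedProj k d x = if c = d then x else 0 := by
  have : gradedProj k d x = (if c = d then LinearMap.id else 0 : Magic k (S4 k) (S12 k) →ₗ[k] _) x := by
    refine LinearMap.eqOn_span (fun x hx => ?_) hx
    rw [gradedProj_of_isGraded hx]
    split_ifs <;> rfl
  rw [this]
  split_ifs <;> rfl

end Grading

end SuperMagic

namespace SuperMagic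

/-! ### The Chevalley generators -/

section Chevalley

variable (k : Type u) [Field k]

/-- The determinant is 4 = 1. Hence the rank is 4, every realization has dim 𝔥 = 8 − 4 = 4, and the
coroots form a basis of 𝔥. -/
theorem isUnit_cartanS4S12 [CharP k 3] : IsUnit (cartanS4S12 k) := by
  rw [Matrix.isUnit_iff_isUnit_det]
  have h : (cartanS4S12 k).det = 1 := by
    rw [Matrix.det_succ_row_zero]
    simp [cartanS4S12, Fin.sum_univ_succ, Matrix.det_fin_three, Fin.succAbove]
    grind
  rw [h]
  exact isUnit_one

theorem rank_cartanS4S12 [CharP k 3] : (cartanS4S12 k).rank = 4 := by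
  rw [Matrix.rank_of_isUnit _ (isUnit_cartanS4S12 k), Fintype.card_fin]

/-- For an invertible matrix take 𝔥 = k⁴ with the coordinate functions as roots and the rows of the
matrix as coroots. -/
theorem nonempty_realization [CharP k 3] : Nonempty (Realization (cartanS4S12 k)) :=
  ⟨{𝔥 := Fin 4 → k
    root := fun j => LinearMap.proj j
    coroot := fun i => cartanS4S12 k i
    linearIndependent_root := by
      rw [Fintype.linearIndependent_iff]
      intro g hg i
      have := LinearMap.congr_fun hg (Pi.single i 1)
      simpa [LinearMap.sum_apply, Pi.single_apply] using this
    linearIndependent_coroot := Matrix.linearIndependent_rows_of_isUnit (isUnit_cartanS4S12 k)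
    root_coroot := fun i j => rfl
    finrank_add_rank := by
      rw [rank_cartanS4S12, Module.finrank_fin_fun]}⟩

variable [CharP k 3]

/-- The generators `eᵢ`. -/
def chevE : Fin 4 → Magic k (S4 k) (S12 k) :=
  ![magI 0 !![1, 0; 0, 0], magI 2 !![1, 0; 0, 0], magL ![0, !![0, 1; 0, 0], 0],
    magK 0 !![0, 0; 1, 0] ![1, 0]]

/-- The generators `fᵢ`. -/
def chevF : Fin 4 → Magic k (S4 k) (S12 k) :=
  ![magI 0 !![0, 0; 0, -1], magI 2 !![0, 0; 0, -1], magL ![0, !![0, 0; 1, 0], 0],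
    magK 0 !![0, 1; 0, 0] ![0, 1]]

/-- The difference of the two eigenvalues of the coroots in each slot. -/
def corootDiag : Matrix (Fin 4) (Fin 3) k := !![1, 0, -1; 0, -1, 1; 0, 1, 0; 1, 0, 1]

/-- The matrices that give the coroots. -/
def corootMat (i : Fin 4) (m : Fin 3) : S4 k := !![0, 0; 0, corootDiag k i m]

/-- The coroots. -/
def chevH (i : Fin 4) : Magic k (S4 k) (S12 k) :=
  magL (corootMat k i) + magQ (if i = 3 then !![-1, 0; 0, 1] else 0)

theorem magI_eq_zero {m : Fin 3} {s : S4 k} (h : s = 0) : magI m s = 0 := by rw [h, map_zero]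

theorem magK_eq_zero {m : Fin 3} {s : S4 k} (h : s = 0) (v : Fin 2 → k) : magK m s v = 0 := by
  rw [h, map_zero, LinearMap.zero_apply]

theorem fin_four_cases (j : Fin 4) : j = 0 ∨ j = 1 ∨ j = 2 ∨ j = 3 := by revert j; decide

theorem chevE_zero : chevE k 0 = magI 0 !![1, 0; 0, 0] := rfl

theorem chevE_one : chevE k 1 = magI 2 !![1, 0; 0, 0] := rfl

theorem chevE_two : chevE k 2 = magL ![0, !![0, 1; 0, 0], 0] := rfl

theorem chevE_three : chevE k 3 = magK 0 !![0, 0; 1, 0] ![1, 0] := rfl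

theorem chevF_zero : chevF k 0 = magI 0 !![0, 0; 0, -1] := rfl

theorem chevF_one : chevF k 1 = magI 2 !![0, 0; 0, -1] := rfl

theorem chevF_two : chevF k 2 = magL ![0, !![0, 0; 1, 0], 0] := rfl

theorem chevF_three : chevF k 3 = magK 0 !![0, 1; 0, 0] ![0, 1] := rfl

theorem chevH_of_ne {i : Fin 4} (h : i ≠ 3) : chevH k i = magL (corootMat k i) := by
  rw [chevH, if_neg h, map_zero, add_zero]

theorem chevH_three : chevH k 3 = magL (corootMat k 3) + magQ !![-1, 0; 0, 1] := by
  rw [chevH, if_pos rfl]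

omit [CharP k 3] in
theorem pi_lie_apply (a b : Fin 3 → S4 k) (m : Fin 3) : ⁅a, b⁆ m = a m * b m - b m * a m := rfl

omit [CharP k 3] in
theorem slotOne_lie (x y : S4 k) :
    ⁅![0, x, 0], ![0, y, 0]⁆ = (![0, x * y - y * x, 0] : Fin 3 → S4 k) := by
  funext m
  rw [pi_lie_apply]
  obtain rfl | rfl | rfl : m = 0 ∨ m = 1 ∨ m = 2 := by revert m; decide
  · exact (congrArg₂ _ (zero_mul (0 : S4 k)) (zero_mul (0 : S4 k))).trans (sub_zero 0)
  · rfl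
  · exact (congrArg₂ _ (zero_mul (0 : S4 k)) (zero_mul (0 : S4 k))).trans (sub_zero 0)

omit [CharP k 3] in
theorem slotOne_apply (x : S4 k) (m : Fin 3) :
    (![0, x, 0] : Fin 3 → S4 k) m = if m = 1 then x else 0 := by
  obtain rfl | rfl | rfl : m = 0 ∨ m = 1 ∨ m = 2 := by revert m; decide
  all_goals rfl

omit [CharP k 3] in
theorem corootMat_two : corootMat k 2 = ![0, !![0, 0; 0, 1], 0] := by
  funext m
  rw [slotOne_apply, corootMat, corootDiag]
  obtain rfl | rfl | rfl : m = 0 ∨ m = 1 ∨ m = 2 := by revert m; decide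
  all_goals apply S4_ext <;> simp

theorem magL_slotOne_congr {x y : S4 k}
    (h : x 0 1 = y 0 1 ∧ x 1 0 = y 1 0 ∧ x 0 0 - x 1 1 = y 0 0 - y 1 1) :
    magL ![0, x, 0] = magL ![0, y, 0] := by
  refine magL_congr fun m => ?_
  rw [slotOne_apply, slotOne_apply]
  split_ifs
  · exact h
  · exact ⟨rfl, rfl, rfl⟩

theorem chev_e_f_zero (j : Fin 4) :
    sbr k (chevE k 0) (chevF k j) = if 0 = j then chevH k 0 else 0 := by
  obtain rfl | rfl | rfl | rfl := fin_four_cases j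
  · rw [chevE_zero, chevF_zero, if_pos rfl, chevH_of_ne k (by decide), I_I, ← map_smul]
    refine magL_congr fun m => ?_
    fin_cases m <;> simp [slots, corootMat, corootDiag, adjugate_apply, S4_mul_apply] <;> grind
  · rw [chevE_zero, chevF_one, if_neg (by decide), I_I_of_prev (m := 0) (n := 2) _ _ rfl, neg_eq_zero]
    refine magI_eq_zero k ?_
    apply S4_ext <;> simp [adjugate_apply, S4_mul_apply]
  · rw [chevE_zero, chevF_two, if_neg (by decide), I_L, neg_eq_zero]
    refine magI_eq_zero k ?_
    apply S4_ext <;> simp [biaction_apply]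
  · rw [chevE_zero, chevF_three, if_neg (by decide), I_K, form_S4_apply]
    simp

theorem chev_e_f_one (j : Fin 4) :
    sbr k (chevE k 1) (chevF k j) = if 1 = j then chevH k 1 else 0 := by
  obtain rfl | rfl | rfl | rfl := fin_four_cases j
  · rw [chevE_one, chevF_zero, if_neg (by decide), I_I_of_next (m := 2) (n := 0) _ _ rfl]
    refine magI_eq_zero k ?_
    apply S4_ext <;> simp [adjugate_apply, S4_mul_apply]
  · rw [chevE_one, chevF_one, if_pos rfl, chevH_of_ne k (by decide), I_I, ← map_smul]
    refine magL_congr fun m => ?_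
    fin_cases m <;> simp [slots, corootMat, corootDiag, adjugate_apply, S4_mul_apply] <;> grind
  · rw [chevE_one, chevF_two, if_neg (by decide), I_L, neg_eq_zero]
    refine magI_eq_zero k ?_
    apply S4_ext <;> simp [biaction_apply, S4_mul_apply, Matrix.trace_fin_two]
  · rw [chevE_one, chevF_three, if_neg (by decide), I_K_of_next (m := 2) (n := 0) _ _ _ rfl,
      neg_eq_zero]
    refine magK_eq_zero k ?_ _
    apply S4_ext <;> simp [adjugate_apply, S4_mul_apply]

theorem chev_e_f_two (j : Fin 4) :
    sbr k (chevE k 2) (chevF k j) = if 2 = j then chevH k 2 else 0 := by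
  obtain rfl | rfl | rfl | rfl := fin_four_cases j
  · rw [chevE_two, chevF_zero, if_neg (by decide), L_I]
    refine magI_eq_zero k ?_
    apply S4_ext <;> simp [biaction_apply]
  · rw [chevE_two, chevF_one, if_neg (by decide), L_I]
    refine magI_eq_zero k ?_
    apply S4_ext <;> simp [biaction_apply, S4_mul_apply, Matrix.trace_fin_two]
  · rw [chevE_two, chevF_two, if_pos rfl, chevH_of_ne k (by decide), L_L,
      slotOne_lie, corootMat_two]
    refine magL_slotOne_congr k ?_
    simp [S4_mul_apply]
    grind
  · rw [chevE_two, chevF_three, if_neg (by decide), L_K]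
    refine magK_eq_zero k ?_ _
    apply S4_ext <;> simp [biaction_apply]

theorem chev_e_f_three (j : Fin 4) :
    sbr k (chevE k 3) (chevF k j) = if 3 = j then chevH k 3 else 0 := by
  obtain rfl | rfl | rfl | rfl := fin_four_cases j
  · rw [chevE_three, chevF_zero, if_neg (by decide), K_I, form_S4_apply]
    simp
  · rw [chevE_three, chevF_one, if_neg (by decide), K_I_of_prev (m := 0) (n := 2) _ _ _ rfl]
    refine magK_eq_zero k ?_ _
    apply S4_ext <;> simp [adjugate_apply, S4_mul_apply]
  · rw [chevE_three, chevF_two, if_neg (by decide), K_L, neg_eq_zero]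
    refine magK_eq_zero k ?_ _
    apply S4_ext <;> simp [biaction_apply]
  · have h1 : altForm k ![1, 0] ![0, 1] = 1 := by simp [altForm_apply]
    rw [chevE_three, chevF_three, if_pos rfl, chevH_three, K_K, form_S4_apply, h1, one_smul, sub_eq_add_neg, ← neg_smul,
      ← map_smul]
    congr 1
    · refine magL_congr fun m => ?_
      fin_cases m <;> simp [slots, corootMat, corootDiag, adjugate_apply, S4_mul_apply]
    · congr 1
      apply S4_ext <;> simp [rankOne]

theorem chev_e_f (i j : Fin 4) :
    sbr k (chevE k i) (chevF k j) = if i = j then chevH k i else 0 := by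
  obtain rfl | rfl | rfl | rfl := fin_four_cases i
  exacts [chev_e_f_zero k j, chev_e_f_one k j, chev_e_f_two k j, chev_e_f_three k j]

theorem chev_h_h (i j : Fin 4) : sbr k (chevH k i) (chevH k j) = 0 := by
  have hQ : ∀ i j : Fin 4, ⁅(if i = 3 then !![-1, 0; 0, 1] else 0 : S4 k),
      (if j = 3 then !![-1, 0; 0, 1] else 0 : S4 k)⁆ = 0 := by
    intro i j
    split_ifs <;> simp
  have hL : ⁅corootMat k i, corootMat k j⁆ = 0 := by
    funext m
    rw [pi_lie_apply]
    apply S4_ext <;> simp [corootMat, S4_mul_apply, mul_comm]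
  rw [chevH, chevH, sbr_add_left, sbr_add_right, sbr_add_right, L_L, L_Q, Q_L, Q_Q, hQ, hL,
    map_zero, map_zero, add_zero, add_zero]

-- Each matrix entry of a block is a weight vector for the diagonal matrices; the terms beyond those
-- of left and right multiplication come from the trace correction.
omit [CharP k 3] in
theorem biaction_corootMat (i : Fin 4) (m n : Fin 3) (a b c d : k) :
    biaction (corootMat k i m) (corootMat k i n) !![a, b; c, d] =
      !![(corootDiag k i m - corootDiag k i n) * a, (corootDiag k i m - 2 * corootDiag k i n) * b;
        (2 * corootDiag k i m - corootDiag k i n) * c,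
        2 * (corootDiag k i m - corootDiag k i n) * d] := by
  apply S4_ext <;> simp [biaction_apply, corootMat, S4_mul_apply, Matrix.trace_fin_two] <;> ring

theorem chevH_I (i : Fin 4) (m : Fin 3) (s : S4 k) : sbr k (chevH k i) (magI m s) =
    magI m (biaction (corootMat k i m) (corootMat k i (m + 2)) s) := by
  rw [chevH, sbr_add_left, L_I, Q_I, add_zero]

theorem chevH_slotOne (i : Fin 4) (x : S4 k) : sbr k (chevH k i) (magL ![0, x, 0]) =
    magL ![0, corootMat k i 1 * x - x * corootMat k i 1, 0] := by
  rw [chevH, sbr_add_left, L_L, Q_L, add_zero]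
  congr 1
  funext m
  rw [pi_lie_apply, slotOne_apply, slotOne_apply]
  split_ifs with h
  · rw [h]
  · rw [mul_zero, zero_mul, sub_zero]

theorem chevH_K (i : Fin 4) (m : Fin 3) (s : S4 k) (v : Fin 2 → k) :
    sbr k (chevH k i) (magK m s v) =
      magK m (biaction (corootMat k i m) (corootMat k i (m + 2)) s) v +
        magK m s (evenAct (if i = 3 then !![-1, 0; 0, 1] else 0) v) := by
  rw [chevH, sbr_add_left, L_K, Q_K]

theorem slotOne_smul (c : k) (x : S4 k) :
    c • magL ![0, x, 0] = magL ![0, c • x, 0] := by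
  rw [← map_smul]
  congr 1
  funext m
  rw [Pi.smul_apply, slotOne_apply, slotOne_apply, smul_ite, smul_zero]

omit [CharP k 3] in
theorem evenAct_coroot (i : Fin 4) (v : Fin 2 → k) :
    evenAct (if i = 3 then !![-1, 0; 0, 1] else 0 : S4 k) v =
      ![-((if i = 3 then 1 else 0) * v 0), (if i = 3 then 1 else 0) * v 1] := by
  funext l
  rw [evenAct_apply]
  fin_cases l <;> split_ifs <;> simp

/-- The columns of the Cartan matrix are the weights of the four generators e_j, expressed through
the numbers in `corootDiag`. Here and in the next three lemmas the equalities hold modulo 3. -/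
theorem cartanS4S12_zero (i : Fin 4) :
    cartanS4S12 k i 0 = corootDiag k i 0 - corootDiag k i 2 := by
  fin_cases i <;> simp [corootDiag, cartanS4S12] <;> grind

theorem cartanS4S12_one (i : Fin 4) :
    cartanS4S12 k i 1 = corootDiag k i 2 - corootDiag k i 1 := by
  fin_cases i <;> simp [corootDiag, cartanS4S12] <;> grind

theorem cartanS4S12_two (i : Fin 4) : cartanS4S12 k i 2 = -corootDiag k i 1 := by
  fin_cases i <;> simp [corootDiag, cartanS4S12] <;> grind

theorem cartanS4S12_three (i : Fin 4) : cartanS4S12 k i 3 =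
    -corootDiag k i 0 - corootDiag k i 2 - (if i = 3 then 1 else 0) := by
  fin_cases i <;> simp [corootDiag, cartanS4S12] <;> grind

theorem chev_h_e (i j : Fin 4) :
    sbr k (chevH k i) (chevE k j) = cartanS4S12 k i j • chevE k j := by
  obtain rfl | rfl | rfl | rfl := fin_four_cases j
  · rw [chevE_zero, chevH_I, ← map_smul, zero_add, biaction_corootMat, cartanS4S12_zero]
    congr 1
    apply S4_ext <;> simp
  · rw [chevE_one, chevH_I, ← map_smul, show (2 : Fin 3) + 2 = 1 from rfl, biaction_corootMat,
      cartanS4S12_one]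
    congr 1
    apply S4_ext <;> simp
  · rw [chevE_two, chevH_slotOne, slotOne_smul, cartanS4S12_two]
    congr 3
    apply S4_ext <;> simp [corootMat, S4_mul_apply]
  · have h := cartanS4S12_three k i
    have h1 : (!![0, 0; (2 * corootDiag k i 0 - corootDiag k i 2) * 1, 0] : S4 k) =
        (2 * corootDiag k i 0 - corootDiag k i 2) • !![0, 0; 1, 0] := by
      apply S4_ext <;> simp
    have h2 : ![-((if i = 3 then 1 else 0) * (1 : k)), 0] =
        (-(if i = 3 then 1 else 0) : k) • ![1, 0] := by
      funext l
      fin_cases l <;> simp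
    rw [chevE_three, chevH_K, zero_add, biaction_corootMat, evenAct_coroot, mul_zero, mul_zero,
      mul_zero, h1, map_smul, LinearMap.smul_apply]
    change _ + magK 0 _ ![-((if i = 3 then 1 else 0) * (1 : k)), (if i = 3 then 1 else 0) * 0] = _
    rw [mul_zero, h2, map_smul, ← add_smul]
    congr 1
    grind

theorem chev_h_f (i j : Fin 4) :
    sbr k (chevH k i) (chevF k j) = -(cartanS4S12 k i j • chevF k j) := by
  rw [← neg_smul]
  obtain rfl | rfl | rfl | rfl := fin_four_cases j
  · rw [chevF_zero, chevH_I, ← map_smul, zero_add, biaction_corootMat, cartanS4S12_zero]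
    congr 1
    apply S4_ext <;> simp
    grind
  · rw [chevF_one, chevH_I, ← map_smul, show (2 : Fin 3) + 2 = 1 from rfl, biaction_corootMat,
      cartanS4S12_one]
    congr 1
    apply S4_ext <;> simp
    grind
  · rw [chevF_two, chevH_slotOne, slotOne_smul, cartanS4S12_two]
    congr 3
    apply S4_ext <;> simp [corootMat, S4_mul_apply]
  · have h := cartanS4S12_three k i
    have h1 : (!![0, (corootDiag k i 0 - 2 * corootDiag k i 2) * 1; 0, 0] : S4 k) =
        (corootDiag k i 0 - 2 * corootDiag k i 2) • !![0, 1; 0, 0] := by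
      apply S4_ext <;> simp
    have h2 : ![0, (if i = 3 then 1 else 0) * (1 : k)] =
        (if i = 3 then 1 else 0 : k) • ![0, 1] := by
      funext l
      fin_cases l <;> simp
    rw [chevF_three, chevH_K, zero_add, biaction_corootMat, evenAct_coroot, mul_zero, mul_zero,
      mul_zero, h1, map_smul, LinearMap.smul_apply]
    change _ + magK 0 _ ![-((if i = 3 then 1 else 0) * (0 : k)), (if i = 3 then 1 else 0) * 1] = _
    rw [mul_zero, neg_zero, h2, map_smul, ← add_smul]
    congr 1
    grind

end Chevalley

end SuperMagic

/-! ### Generation, principal degrees, and the isomorphism with the contragredient superalgebra. -/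

namespace SuperMagic

section Model

variable (k : Type u) [Field k] [CharP k 3]

theorem magI_mem_of_entries {N : Submodule k (Magic k (S4 k) (S12 k))} {m : Fin 3}
    (h0 : magI m !![1, 0; 0, 0] ∈ N) (h1 : magI m !![0, 1; 0, 0] ∈ N)
    (h2 : magI m !![0, 0; 1, 0] ∈ N) (h3 : magI m !![0, 0; 0, -1] ∈ N) (s : S4 k) :
    magI m s ∈ N := by
  have h : s = s 0 0 • !![1, 0; 0, 0] + s 0 1 • !![0, 1; 0, 0] + s 1 0 • !![0, 0; 1, 0] +
      (-s 1 1) • !![0, 0; 0, -1] := by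
    apply S4_ext <;> simp
  rw [h, map_add, map_add, map_add, map_smul, map_smul, map_smul, map_smul]
  exact add_mem (add_mem (add_mem (N.smul_mem _ h0) (N.smul_mem _ h1)) (N.smul_mem _ h2))
    (N.smul_mem _ h3)

/-- The action of the right factor. -/
theorem L_I_right {a : Fin 3 → S4 k} {m : Fin 3} {y : S4 k} (h0 : a m = 0) (h1 : a (m + 2) = y)
    (hy : y.trace = 0) (s : S4 k) : sbr k (magL a) (magI m s) = magI m (-(s * y)) := by
  rw [L_I, h0, h1, biaction_of_traceless (Matrix.trace_zero _ _) hy, zero_mul, zero_sub]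

/-- The generators e₃, f₃ act on the right of ι₂ and complete e₂, f₂ to ι₂(S₄ ⊗ 1). Brackets inside
it produce the 𝔰𝔩₂ of slot 2, which acts on the right of ι₀ and completes e₁, f₁ to ι₀(S₄ ⊗ 1). The
bracket of the two is ι₁(S₄ ⊗ 1), and pairing ι₀(S₄ ⊗ 1) with e₄ and f₄ yields the elements `magO
v`. -/
theorem eq_top_of_chevalley {N : Submodule k (Magic k (S4 k) (S12 k))}
    (hE : ∀ i, chevE k i ∈ N) (hF : ∀ i, chevF k i ∈ N)
    (hN : ∀ x ∈ N, ∀ y ∈ N, sbr k x y ∈ N) : N = ⊤ := by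
  have e0 := hE 0
  have e1 := hE 1
  have e2 := hE 2
  have e3 := hE 3
  have f0 := hF 0
  have f1 := hF 1
  have f2 := hF 2
  have f3 := hF 3
  rw [chevE_zero] at e0
  rw [chevE_one] at e1
  rw [chevE_two] at e2
  rw [chevE_three] at e3
  rw [chevF_zero] at f0
  rw [chevF_one] at f1
  rw [chevF_two] at f2
  rw [chevF_three] at f3
  have right {a : Fin 3 → S4 k} (ha : magL a ∈ N) {m : Fin 3} (y : S4 k) {s t : S4 k} (h0 : a m = 0)
      (h1 : a (m + 2) = y) (hy : y.trace = 0) (hs : magI m s ∈ N) (ht : s * y = t) :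
      magI m t ∈ N := by
    have h := hN _ ha _ hs
    rw [L_I_right k h0 h1 hy, map_neg, neg_mem_iff, ht] at h
    exact h
  have hI2 : ∀ s, magI 2 s ∈ N := by
    refine magI_mem_of_entries k e1 (right e2 _ rfl rfl ?_ e1 ?_) ?_ f1
    · simp [Matrix.trace_fin_two]
    · apply S4_ext <;> simp [S4_mul_apply]
    · rw [← neg_mem_iff, ← map_neg]
      refine right f2 _ rfl rfl ?_ f1 ?_
      · simp [Matrix.trace_fin_two]
      · apply S4_ext <;> simp [S4_mul_apply]
  have hL (i j : Fin 2) (hij : i ≠ j) :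
      magL (Pi.single 2 (Matrix.single i j 1) : Fin 3 → S4 k) ∈ N := by
    have h := magLE_eq_bracket (k := k) 2 i j hij
    rw [magLE] at h
    rw [h]
    exact hN _ (hI2 _) _ (hI2 _)
  have hs2 (x : S4 k) : (Pi.single 2 x : Fin 3 → S4 k) 0 = 0 := Pi.single_eq_of_ne (M := fun _ => S4 k) (by decide) x
  have hs0 (x : S4 k) : (Pi.single 2 x : Fin 3 → S4 k) (0 + 2) = x := Pi.single_eq_same (M := fun _ => S4 k) 2 x
  have hI0 : ∀ s, magI 0 s ∈ N := by
    refine magI_mem_of_entries k e0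
      (right (hL 0 1 (by decide)) _ (hs2 _) (hs0 _) ?_ e0 ?_) ?_ f0
    · simp [Matrix.trace_fin_two]
    · apply S4_ext <;> simp [S4_mul_apply]
    · rw [← neg_mem_iff, ← map_neg]
      refine right (hL 1 0 (by decide)) _ (hs2 _) (hs0 _) ?_ f0 ?_
      · simp [Matrix.trace_fin_two]
      · apply S4_ext <;> simp [S4_mul_apply]
  -- The product of s̄ in slot 2 with 1 in slot 0 is s in slot 1, since the adjugate is an
  -- involution on 2×2 matrices.
  have hI1 (s : S4 k) : magI 1 s ∈ N := by
    have h := hN _ (hI2 s.adjugate) _ (hI0 1)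
    rw [I_I_of_next (m := 2) (n := 0) _ _ rfl, show (2 : Fin 3) + 2 = 1 from rfl] at h
    convert h using 2
    apply S4_ext <;> simp [S4_mul_apply, adjugate_apply]
  have hI (m : Fin 3) (s : S4 k) : magI m s ∈ N := by
    obtain rfl | rfl | rfl : m = 0 ∨ m = 1 ∨ m = 2 := by revert m; decide
    exacts [hI0 s, hI1 s, hI2 s]
  -- b(E₀₁, E₁₀) = −1 cancels the minus sign in `I_K`.
  have hO0 : magO ![1, 0] ∈ N := by
    have h := hN _ (hI0 !![0, 1; 0, 0]) _ e3
    rw [I_K, form_S4_apply] at h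
    simpa using h
  have hO1 : magO ![0, 1] ∈ N := by
    have h := hN _ (hI0 !![0, 0; 1, 0]) _ f3
    rw [I_K, form_S4_apply] at h
    simpa using h
  refine eq_top_of_generators (fun v => ?_) hI hN
  have h : v = v 0 • ![1, 0] + v 1 • ![0, 1] := by
    funext i
    fin_cases i <;> simp
  rw [h, map_add, map_smul, map_smul]
  exact add_mem (N.smul_mem _ hO0) (N.smul_mem _ hO1)

theorem chevE_mem (i : Fin 4) :
    chevE k i ∈ part k (Magic k (S4 k) (S12 k)) (if i ∈ ({3} : Finset (Fin 4)) then 1 else 0) := by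
  obtain rfl | rfl | rfl | rfl := fin_four_cases i
  exacts [magI_mem _ _, magI_mem _ _, magL_mem _, magK_mem _ _ _]

theorem chevF_mem (i : Fin 4) :
    chevF k i ∈ part k (Magic k (S4 k) (S12 k)) (if i ∈ ({3} : Finset (Fin 4)) then 1 else 0) := by
  obtain rfl | rfl | rfl | rfl := fin_four_cases i
  exacts [magI_mem _ _, magI_mem _ _, magL_mem _, magK_mem _ _ _]

theorem chevH_mem (i : Fin 4) : chevH k i ∈ part k (Magic k (S4 k) (S12 k)) 0 :=
  add_mem (magL_mem _) (magQ_mem _)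

theorem chevE_ne_zero (i : Fin 4) : chevE k i ≠ 0 := by
  intro h
  obtain rfl | rfl | rfl | rfl := fin_four_cases i
  · rw [chevE_zero] at h
    have h1 := congrArg (coordI k 0) h
    rw [coordI_magI, if_pos rfl, map_zero] at h1
    simpa using congr_fun₂ h1 0 0
  · rw [chevE_one] at h
    have h1 := congrArg (coordI k 2) h
    rw [coordI_magI, if_pos rfl, map_zero] at h1
    simpa using congr_fun₂ h1 0 0
  · rw [chevE_two] at h
    have h1 := congrArg (coordL k 1) h
    rw [coordL_magL, slotOne_apply, if_pos rfl, map_zero] at h1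
    simpa using congr_fun₂ h1 0 1
  · rw [chevE_three] at h
    have h1 := congrArg (coordK k 0 0) h
    rw [coordK_magK, if_pos rfl, map_zero] at h1
    simpa using congr_fun₂ h1 1 0

variable {k} in
omit [CharP k 3] in
theorem mem_matDeg_of_entries {p q d : ℤ} {a b c e : k} (ha : a ≠ 0 → p - q = d)
    (hb : b ≠ 0 → p + q = d) (hc : c ≠ 0 → -p - q = d) (he : e ≠ 0 → -p + q = d) :
    !![a, b; c, e] ∈ matDeg k p q d := by
  intro i j h
  fin_cases i <;> fin_cases j
  · simpa [sgn] using ha h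
  · simpa [sgn] using hb h
  · simpa [sgn] using hc h
  · simpa [sgn] using he h

theorem slotOne_mem_gradedPart {x : S4 k} {d : ℤ} (hx : x ∈ matDeg k 1 1 d) :
    magL ![0, x, 0] ∈ gradedPart k d := by
  refine (IsGraded.L _ _ fun m => ?_).mem
  obtain rfl | rfl | rfl : m = 0 ∨ m = 1 ∨ m = 2 := by revert m; decide
  exacts [zero_mem _, hx, zero_mem _]

/-- The doubled weights p₀, p₁, p₂ = 5, 1, 3 of the slots and r = 10 of V are the solution of p₀ −
p₂ = 2, p₂ − p₁ = 2, 2p₁ = 2 and r − p₀ − p₂ = 2, which say that all four generators have doubled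
degree 2. -/
theorem chevE_mem_gradedPart (i : Fin 4) : chevE k i ∈ gradedPart k 2 := by
  obtain rfl | rfl | rfl | rfl := fin_four_cases i
  · refine (IsGraded.I _ _ _ ?_).mem
    apply mem_matDeg_of_entries <;> simp [slotDeg]
  · refine (IsGraded.I _ _ _ ?_).mem
    apply mem_matDeg_of_entries <;> simp [slotDeg]
  · refine slotOne_mem_gradedPart k ?_
    apply mem_matDeg_of_entries <;> simp
  · refine magK_mem_gradedPart (c := -8) (d := 10) ?_ ?_ rfl
    · apply mem_matDeg_of_entries <;> simp [slotDeg]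
    · intro i h
      fin_cases i <;> simp [sgn] at h ⊢

theorem chevF_mem_gradedPart (i : Fin 4) : chevF k i ∈ gradedPart k (-2) := by
  obtain rfl | rfl | rfl | rfl := fin_four_cases i
  · refine (IsGraded.I _ _ _ ?_).mem
    apply mem_matDeg_of_entries <;> simp [slotDeg]
  · refine (IsGraded.I _ _ _ ?_).mem
    apply mem_matDeg_of_entries <;> simp [slotDeg]
  · refine slotOne_mem_gradedPart k ?_
    apply mem_matDeg_of_entries <;> simp
  · refine magK_mem_gradedPart (c := 8) (d := -10) ?_ ?_ rfl
    · apply mem_matDeg_of_entries <;> simp [slotDeg]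
    · intro i h
      fin_cases i <;> simp [sgn] at h ⊢

theorem chevH_mem_gradedPart (i : Fin 4) : chevH k i ∈ gradedPart k 0 := by
  refine add_mem (IsGraded.L _ _ fun m => ?_).mem (IsGraded.Q _ _ ?_).mem
  · apply mem_matDeg_of_entries <;> simp
  · split_ifs
    · apply mem_matDeg_of_entries <;> simp
    · exact zero_mem _

variable (R : Realization (cartanS4S12 k))

/-- The coroots of a realization are a basis. -/
noncomputable def corootBasis : Module.Basis (Fin 4) k R.𝔥 :=
  basisOfLinearIndependentOfCardEqFinrank R.linearIndependent_coroot (by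
    have h := R.finrank_add_rank
    rw [rank_cartanS4S12] at h
    rw [Fintype.card_fin]
    omega)

theorem corootBasis_apply (i : Fin 4) : corootBasis k R i = R.coroot i := by
  rw [corootBasis, coe_basisOfLinearIndependentOfCardEqFinrank]

/-- The embedding of `𝔥`. -/
noncomputable def cartanMap : R.𝔥 →ₗ[k] Magic k (S4 k) (S12 k) :=
  (corootBasis k R).constr k (chevH k)

theorem cartanMap_coroot (i : Fin 4) : cartanMap k R (R.coroot i) = chevH k i := by
  rw [← corootBasis_apply, cartanMap, Module.Basis.constr_basis]

theorem coroot_induction {p : R.𝔥 → Prop} (h0 : ∀ i, p (R.coroot i))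
    (hadd : ∀ x y, p x → p y → p (x + y)) (hsmul : ∀ (c : k) x, p x → p (c • x)) (h : R.𝔥) :
    p h := by
  rw [← (corootBasis k R).sum_repr h]
  refine Finset.sum_induction_nonempty _ p hadd Finset.univ_nonempty fun i _ => hsmul _ _ ?_
  rw [corootBasis_apply]
  exact h0 i

theorem cartanMap_h_e (h : R.𝔥) (i : Fin 4) :
    sbr k (cartanMap k R h) (chevE k i) = R.root i h • chevE k i := by
  induction h using coroot_induction with
  | h0 j => rw [cartanMap_coroot, R.root_coroot, chev_h_e]
  | hadd x y hx hy => rw [map_add, sbr_add_left, hx, hy, map_add, add_smul]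
  | hsmul c x hx => rw [map_smul, sbr_smul_left, hx, map_smul, smul_assoc]

theorem cartanMap_h_f (h : R.𝔥) (i : Fin 4) :
    sbr k (cartanMap k R h) (chevF k i) = -(R.root i h • chevF k i) := by
  induction h using coroot_induction with
  | h0 j => rw [cartanMap_coroot, R.root_coroot, chev_h_f]
  | hadd x y hx hy => rw [map_add, sbr_add_left, hx, hy, map_add, add_smul, neg_add]
  | hsmul c x hx => rw [map_smul, sbr_smul_left, hx, map_smul, smul_neg, smul_assoc]

theorem cartanMap_h_h (h h' : R.𝔥) : sbr k (cartanMap k R h) (cartanMap k R h') = 0 := by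
  induction h using coroot_induction with
  | h0 j =>
    induction h' using coroot_induction with
    | h0 i => rw [cartanMap_coroot, cartanMap_coroot, chev_h_h]
    | hadd x y hx hy => rw [map_add, sbr_add_right, hx, hy, add_zero]
    | hsmul c x hx => rw [map_smul, sbr_smul_right, hx, smul_zero]
  | hadd x y hx hy => rw [map_add, sbr_add_left, hx, hy, add_zero]
  | hsmul c x hx => rw [map_smul, sbr_smul_left, hx, smul_zero]

theorem cartanMap_mem {N : Submodule k (Magic k (S4 k) (S12 k))} (hN : ∀ i, chevH k i ∈ N)
    (h : R.𝔥) : cartanMap k R h ∈ N := by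
  induction h using coroot_induction with
  | h0 j => rw [cartanMap_coroot]; exact hN j
  | hadd x y hx hy => rw [map_add]; exact add_mem hx hy
  | hsmul c x hx => rw [map_smul]; exact N.smul_mem c hx

/-- If h maps to 0, then its bracket with each e_j ≠ 0 shows that every root vanishes at h. In
coordinates with respect to the coroots this says that a row vector is annihilated by the Cartan
matrix, which is invertible. -/
theorem cartanMap_injective : Function.Injective (cartanMap k R) := by
  rw [← LinearMap.ker_eq_bot, LinearMap.ker_eq_bot']
  intro h hh
  have hroot (j : Fin 4) : R.root j h = 0 := by
    have h1 := cartanMap_h_e k R h j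
    rw [hh, sbr_zero_left] at h1
    exact (smul_eq_zero.1 h1.symm).resolve_right (chevE_ne_zero k j)
  have h2 : Matrix.vecMul ((corootBasis k R).repr h) (cartanS4S12 k) =
      Matrix.vecMul (0 : Fin 4 → k) (cartanS4S12 k) := by
    funext j
    rw [Matrix.zero_vecMul, Pi.zero_apply, ← hroot j]
    conv_rhs => rw [← (corootBasis k R).sum_repr h, map_sum]
    change ∑ i, (corootBasis k R).repr h i * cartanS4S12 k i j = _
    refine Finset.sum_congr rfl fun i _ => ?_
    rw [corootBasis_apply, (R.root j).map_smul, R.root_coroot, smul_eq_mul]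
  have h3 := Matrix.vecMul_injective_of_isUnit (isUnit_cartanS4S12 k) h2
  exact (LinearEquiv.map_eq_zero_iff (corootBasis k R).repr).1 (DFunLike.coe_injective h3)

/-- The components of `gradedPart` are indexed by doubled degrees, which explains the factor 2; the
index 4 of the odd simple root is 3 when counting starts at 0. -/
theorem isContragredientModel_magic : IsContragredientModel R {3} (cartanMap k R) (chevE k)
    (chevF k) (fun d => gradedPart k (2 * d)) where
  isLieSuperalgebra := isLieSuperalgebra_magic
  h_mem := cartanMap_mem k R (chevH_mem k)
  e_mem := chevE_mem k
  f_mem := chevF_mem k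
  e_f i j := by rw [cartanMap_coroot, chev_e_f]
  h_h := cartanMap_h_h k R
  h_e := cartanMap_h_e k R
  h_f := cartanMap_h_f k R
  injective := cartanMap_injective k R
  generates _ := eq_top_of_chevalley k
  h_degree := cartanMap_mem k R (chevH_mem_gradedPart k)
  e_degree := chevE_mem_gradedPart k
  f_degree := chevF_mem_gradedPart k
  bracket_degree c d x hx y hy := by
    rw [mul_add]
    exact bracket_mem_gradedPart hx hy
  exists_component d := by
    refine ⟨gradedProj k (2 * d), fun e x hx => ?_⟩
    rw [gradedProj_of_mem hx]
    refine if_congr ?_ rfl rfl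
    omega

theorem nonempty_superEquiv_magic :
    Nonempty (SuperEquiv k (Magic k (S4 k) (S12 k)) (Contragredient R {3})) :=
  (isContragredientModel_magic k R).nonempty_superEquiv isSimpleSuperalgebra_magic
    ⟨R.coroot 0, R.linearIndependent_coroot.ne_zero 0⟩

end Model

end SuperMagic

theorem mainTheorem10 (k : Type u) [Field k] [CharP k 3] :
    (Nonempty (Realization (cartanS4S12 k)) ∧
      ∀ R : Realization (cartanS4S12 k),
        Nonempty (SuperEquiv k (Magic k (S4 k) (S12 k)) (Contragredient R {3}))) ∧
    (IsLieSuperalgebra k (Magic k (S4 k) (S12 k)) ∧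
      IsSimpleSuperalgebra k (Magic k (S4 k) (S12 k))) ∧
    (∃ φ : (Symplectic.sp (Fin 3) k × SpecialLinear.sl (Fin 2) k) ≃ₗ[k]
          part k (Magic k (S4 k) (S12 k)) 0,
      ∃ ψ : (VOmega2 k ⊗[k] (Fin 2 → k)) ≃ₗ[k] part k (Magic k (S4 k) (S12 k)) 1,
        (∀ x y : Symplectic.sp (Fin 3) k × SpecialLinear.sl (Fin 2) k,
          (φ (⁅x.1, y.1⁆, ⁅x.2, y.2⁆) : Magic k (S4 k) (S12 k)) =
            sbr k (φ x : Magic k (S4 k) (S12 k)) (φ y : Magic k (S4 k) (S12 k))) ∧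
        ∀ (x : Symplectic.sp (Fin 3) k × SpecialLinear.sl (Fin 2) k)
          (v : VOmega2 k) (w : Fin 2 → k),
          sbr k (φ x : Magic k (S4 k) (S12 k)) (ψ (v ⊗ₜ[k] w) : Magic k (S4 k) (S12 k)) =
            (ψ (⁅x.1, v⁆ ⊗ₜ[k] w + v ⊗ₜ[k] ⁅x.2, w⁆) : Magic k (S4 k) (S12 k))) ∧
    (part k (Magic k (S4 k) (S12 k)) 1 ≠ ⊥ ∧
      ∀ N : Submodule k (Magic k (S4 k) (S12 k)), N ≤ part k (Magic k (S4 k) (S12 k)) 1 →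
        (∀ x ∈ part k (Magic k (S4 k) (S12 k)) 0, ∀ y ∈ N, sbr k x y ∈ N) →
          N = ⊥ ∨ N = part k (Magic k (S4 k) (S12 k)) 1) ∧
    (LieModule.IsIrreducible k (Symplectic.sp (Fin 3) k) (VOmega2 k) ∧
      Module.finrank k (VOmega2 k) = 13 ∧
      ∃ v : VOmega2 k, v ≠ 0 ∧ ∀ X : Symplectic.sp (Fin 3) k,
        (∀ i j, X.1 (Sum.inr i) (Sum.inl j) = 0) →
        (∀ i j, j < i → X.1 (Sum.inl i) (Sum.inl j) = 0) →
          ⁅X, v⁆ = (X.1 (Sum.inl 0) (Sum.inl 0) + X.1 (Sum.inl 1) (Sum.inl 1)) • v) :=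
  let φ := (LinearEquiv.ofInjective (evenMap (k := k)) evenMap_injective).trans
    (LinearEquiv.ofEq _ _ range_evenMap)
  let ψ := (LinearEquiv.ofInjective (oddMap (vCoord k)) (oddMap_injective _)).trans
    (LinearEquiv.ofEq _ _ (range_oddMap _))
  ⟨⟨nonempty_realization k, nonempty_superEquiv_magic k⟩,
    ⟨isLieSuperalgebra_magic, isSimpleSuperalgebra_magic⟩,
    ⟨φ, ψ, evenMap_bracket, evenMap_bracket_oddMap⟩,
    ⟨part_one_ne_bot, fun _ => eq_part_one⟩,
    isIrreducible_VOmega2, finrank_VOmega2, exists_highest_weight_vector⟩
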